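/- Let $k,\ell,m\ge 0$ be integers with $m$ even and $n=k+\ell+m\ge 2$. **Definitions.** $\operatorname{Gr}(r,n)$ is the real Grassmannian of $r$-dimensional subspaces of $\mathbb R^n$ with its usual (analytic) topology; points are represented by full rank $r\times n$ matrices, as row spans. $\operatorname{Gr}_{>0}(r,n)$ is the set of points having a representative all of whose maximal minors are positive. For $r+d=n$ let $\operatorname{Gr}^{\perp}_{>0}(d,n)=\{Z^\perp : Z\in\operatorname{Gr}_{>0}(d,n)\}\subset\operatorname{Gr}(r,n)$. For $a,b\ge0$ let $\tilde S_n(-a,b)$ be the set of bijections $f:\mathbb Z\to\mathbb Z$ with $f(i+n)=f(i)+n$ and $i-a\le f(i)\le i+b$ for all $i$, and $\sum_{i=1}^n(f(i)-i)=0$. For $f\in\tilde S_n(-k,n-k)$ and $i\in[n]$ let $I_i\subset[n]$ be the set of residues modulo $n$ of the numbers $f(j)+k$ with $j<i\le f(j)+k$. Let $\mathcal M_f$ be the set of $k$-subsets $J\subset[n]$ with $I_i\preceq_i J$ for all $i\in[n]$, where $\preceq_i$ compares $k$-subsets elementwise after sorting them in the cyclic order $i\prec i+1\prec\dots\prec i+n-1$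 (indices mod $n$). The positroid cell $\Pi^{>0}_{k,f}\subset\operatorname{Gr}(k,n)$ is the set of points having a representative whose maximal minors satisfy $\Delta_J>0$ for $J\in\mathcal M_f$ and $\Delta_J=0$ for $J\notin\mathcal M_f$. Put $\operatorname{Gr}_{\ge m}(k,n)=\bigcup_{f\in\tilde S_n(-k,\,n-k-m)}\Pi^{>0}_{k,f}$. Let $\operatorname{Fl}(\ell,k+\ell;n)$ be the variety of flags $W\subset U\subset\mathbb R^n$ with $\dim W=\ell$, $\dim U=k+\ell$, with the topology induced from $\operatorname{Gr}(\ell,n)\times\operatorname{Gr}(k+\ell,n)$. For $S\subset \operatorname{Gr}(k,n)$ let $\mathcal A(S)\subset\operatorname{Fl}(\ell,k+\ell;n)$ be the set of flags $(W,U)$ such that $W\in\operatorname{Gr}^\perp_{>0}(k+m,n)$ and $U=\operatorname{span}(V,W)$ for some $V\in S$, and put $\mathcal A_{n,k,\ge m}=\mathcal A(\operatorname{Gr}_{\ge m}(k,n))$ and $\mathcal A^{>0}_{k,f}=\mathcal A(\Pi^{>0}_{k,f})$. Exchanging $k$ and $\ell$ gives $\Pi^{>0}_{\ell,f}$, $\operatorname{Gr}_{\ge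 m}(\ell,n)$ and the subsets $\mathcal A_{n,\ell,\ge m}$ and $\mathcal A^{>0}_{\ell,f}$ of $\operatorname{Fl}(k,k+\ell;n)$. Let $V$ be a $k\times n$ and $W$ an $\ell\times n$ matrix, let $U=\begin{pmatrix}V\\W\end{pmatrix}$ have columns $U(1),\dots,U(n)$, and extend them to $j\in\mathbb Z$ by $U(j+n)=(-1)^{k-1}U(j)$. If for every $j\in\mathbb Z$ the vectors $U(j-\ell),\dots,U(j+k-1)$ form a basis of $\mathbb R^{k+\ell}$, let $\tilde U(j)$ be the vector with $\langle\tilde U(j),U(j-\ell)\rangle=(-1)^j$ and $\langle\tilde U(j),U(j-\ell+i)\rangle=0$ for $0<i<k+\ell$ (no condition if $k+\ell=0$), and define the stacked twist $\theta(V,W)=(\tilde W,\tilde V)$ by $\begin{pmatrix}\tilde W\\\tilde V\end{pmatrix}=(\tilde U(1),\dots,\tilde U(n))$, where $\tilde W$ is $k\times n$ and $\tilde V$ is $\ell\times n$. **Theorem.** The stacked twist is defined on all representatives of points of $\operatorname{Gr}_{\ge m}(k,n)\times\operatorname{Gr}^\perp_{>0}(k+m,n)$ and induces on row spans a map $$\theta:\operatorname{Gr}_{\ge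 m}(k,n)\times\operatorname{Gr}^\perp_{>0}(k+m,n)\to\operatorname{Gr}^\perp_{>0}(\ell+m,n)\times\operatorname{Gr}_{\ge m}(\ell,n).$$ The formulas $\mathcal Z(V,W)=(W,\operatorname{span}(V,W))$ and $\mathcal Z^{\mathrm{op}}(\tilde W,\tilde V)=(\tilde W,\operatorname{span}(\tilde W,\tilde V))$ define maps from the source of $\theta$ to $\mathcal A_{n,k,\ge m}$ and from the target of $\theta$ to $\mathcal A_{n,\ell,\ge m}$, and there is a homeomorphism $\tilde\theta:\mathcal A_{n,k,\ge m}\to\mathcal A_{n,\ell,\ge m}$ with $\tilde\theta\circ\mathcal Z=\mathcal Z^{\mathrm{op}}\circ\theta$. For each $f\in\tilde S_n(-k,\ell)$, $\tilde\theta$ restricts to a homeomorphism from $\mathcal A^{>0}_{k,f}\subset \mathcal A_{n,k,\ge m}$ to $\mathcal A^{>0}_{\ell,f^{-1}}\subset\mathcal A_{n,\ell,\ge m}$. -/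

import Mathlib

open Matrix

/-! Columns of an `r × n` matrix are indexed by `Fin n = {0, …, n-1}`; the column with index `j` is
the one that is usually numbered `j + 1`. Affine permutations are relabelled in the same way. -/

/-- Row span of a matrix. -/
def rowSpan {r n : ℕ} (M : Matrix (Fin r) (Fin n) ℝ) : Submodule ℝ (Fin n → ℝ) :=
  Submodule.span ℝ (Set.range M.row)

/-- Real `r × n` matrices of full rank `r`, with the subspace topology. -/
abbrev FullRankMat (r n : ℕ) : Type :=
  {M : Matrix (Fin r) (Fin n) ℝ // LinearIndependent ℝ M.row}

/-- The real Grassmannian of `r`-dimensional subspaces of `ℝⁿ`. -/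
def Gr (r n : ℕ) : Type :=
  {X : Submodule ℝ (Fin n → ℝ) // Module.finrank ℝ X = r}

/-- The point of the Grassmannian represented by a full rank matrix. -/
def FullRankMat.toGr {r n : ℕ} (M : FullRankMat r n) : Gr r n :=
  ⟨rowSpan M.1, by
    have h := finrank_span_eq_card M.2
    rwa [Fintype.card_fin] at h⟩

/-- The analytic topology: the quotient topology from full rank matrices. -/
instance Gr.instTopologicalSpace (r n : ℕ) : TopologicalSpace (Gr r n) :=
  TopologicalSpace.coinduced (FullRankMat.toGr (r := r) (n := n)) inferInstance

/-- The two-step flag variety of pairs `W ⊆ U ⊆ ℝⁿ` with `dim W = a`, `dim U = b`. -/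
def Fl (a b n : ℕ) : Type :=
  {p : Gr a n × Gr b n // p.1.1 ≤ p.2.1}

instance Fl.instTopologicalSpace (a b n : ℕ) : TopologicalSpace (Fl a b n) :=
  inferInstanceAs (TopologicalSpace {p : Gr a n × Gr b n // p.1.1 ≤ p.2.1})

/-- The smaller subspace `W` of a flag. -/
def Fl.small {a b n : ℕ} (F : Fl a b n) : Gr a n := F.1.1

/-- The larger subspace `U` of a flag. -/
def Fl.large {a b n : ℕ} (F : Fl a b n) : Gr b n := F.1.2

/-- The maximal minor of `M` with column set `J` (columns in increasing order). -/
noncomputable def maxMinor {r n : ℕ} (M : Matrix (Fin r) (Fin n) ℝ)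
    (J : Finset (Fin n)) (hJ : J.card = r) : ℝ :=
  (M.submatrix id (J.orderEmbOfFin hJ)).det

/-- The totally positive Grassmannian. -/
def grPos (r n : ℕ) : Set (Gr r n) :=
  {X | ∃ M : FullRankMat r n, M.toGr = X ∧
    ∀ (J : Finset (Fin n)) (hJ : J.card = r), 0 < maxMinor M.1 J hJ}

/-- The orthogonal complements, in `Gr r n`, of the points of the totally positive Grassmannian
`grPos d n` (to be used with `r + d = n`). -/
def grPosPerp (d r n : ℕ) : Set (Gr r n) :=
  {Y | ∃ Z ∈ grPos d n, ∀ w : Fin n → ℝ, w ∈ Y.1 ↔ ∀ z ∈ Z.1, z ⬝ᵥ w = 0}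

/-- The affine permutations `f` of period `n` with `i - a ≤ f i ≤ i + b`. -/
def affPerm (n : ℕ) (a b : ℤ) : Set (Equiv.Perm ℤ) :=
  {f | (∀ i, f (i + n) = f i + n) ∧
    (∑ i ∈ Finset.range n, (f (i : ℤ) - (i : ℤ)) = 0) ∧
    ∀ i, i - a ≤ f i ∧ f i ≤ i + b}

open Classical in
/-- The Grassmann necklace: the set of residues modulo `n` of the numbers `f j + k ≥ i` with
`j < i`. -/
noncomputable def grNecklace {n : ℕ} (k : ℕ) (f : Equiv.Perm ℤ) (i : Fin n) : Finset (Fin n) :=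
  Finset.univ.filter fun a =>
    ∃ j : ℤ, j < (i : ℤ) ∧ (i : ℤ) ≤ f j + k ∧ (a : ℤ) ≡ f j + k [ZMOD n]

/-- The positions, in the cyclic order `i, i+1, …, i+n-1`, of the elements of `S`, listed
increasingly. -/
def cyclicPositions {n : ℕ} (i : Fin n) (S : Finset (Fin n)) : List ℤ :=
  (S.image fun a : Fin n => ((a : ℤ) - (i : ℤ)) % (n : ℤ)).sort (· ≤ ·)

/-- `S = {s₁ ≺ … ≺ sₖ}` precedes `T = {t₁ ≺ … ≺ tₖ}`: `s_j ≼ t_j` for all `j`, for the cyclic order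
that starts at `i`. -/
def galeLE {n : ℕ} (i : Fin n) (S T : Finset (Fin n)) : Prop :=
  List.Forall₂ (· ≤ ·) (cyclicPositions i S) (cyclicPositions i T)

/-- The positroid of `f`: all `k`-subsets that lie weakly above every term of the necklace. -/
def positroid (k n : ℕ) (f : Equiv.Perm ℤ) : Set (Finset (Fin n)) :=
  {J | J.card = k ∧ ∀ i : Fin n, galeLE i (grNecklace k f i) J}

/-- The open positroid cell of `f`. (Its points are totally nonnegative, by the sign conditions.) -/
def posCell (k n : ℕ) (f : Equiv.Perm ℤ) : Set (Gr k n) :=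
  {X | ∃ M : FullRankMat k n, M.toGr = X ∧
    ∀ (J : Finset (Fin n)) (hJ : J.card = k),
      (J ∈ positroid k n f → 0 < maxMinor M.1 J hJ) ∧
      (J ∉ positroid k n f → maxMinor M.1 J hJ = 0)}

/-- The union of the positroid cells of `f` with `i - k ≤ f i ≤ i + (n - k - m)`. -/
def grGe (m k n : ℕ) : Set (Gr k n) :=
  ⋃ f ∈ affPerm n k ((n : ℤ) - k - m), posCell k n f

/-- The columns `U(j)`, `j ∈ ℤ`, extended by `U(j + n) = (-1)^(k-1) U(j)`. -/
noncomputable def extCol {r n : ℕ} [NeZero n] (k : ℕ) (U : Matrix (Fin r) (Fin n) ℝ) (j : ℤ) :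
    Fin r → ℝ :=
  ((-1 : ℝ) ^ (k + 1)) ^ (j / (n : ℤ)) • U.col (Fin.ofNat n (j % (n : ℤ)).toNat)

/-- The `(k+ℓ) × (k+ℓ)` matrix with columns `U(j-ℓ), …, U(j+k-1)`. -/
noncomputable def colWindow {n : ℕ} [NeZero n] (k ℓ : ℕ) (U : Matrix (Fin (k + ℓ)) (Fin n) ℝ)
    (j : ℤ) : Matrix (Fin (k + ℓ)) (Fin (k + ℓ)) ℝ :=
  Matrix.of fun a i => extCol k U (j - ℓ + (i : ℕ)) a

/-- For every `j`, the vectors `U(j-ℓ), …, U(j+k-1)` form a basis. -/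
def matCirc (k ℓ n : ℕ) [NeZero n] : Set (Matrix (Fin (k + ℓ)) (Fin n) ℝ) :=
  {U | ∀ j : ℤ, LinearIndependent ℝ (colWindow k ℓ U j).col ∧
    Submodule.span ℝ (Set.range (colWindow k ℓ U j).col) = ⊤}

/-- The twist of `U`: the column `u` with index `j` solves `⟨u, U(j-ℓ)⟩ = (-1)^(j+1)`
and `⟨u, U(j-ℓ+i)⟩ = 0` for `0 < i < k+ℓ`; see `twist_col_iff`. The sign is `(-1)^(j+1)` because
the column with index `j` is column number `j + 1`. -/
noncomputable def twist {n : ℕ} [NeZero n] (k ℓ : ℕ) (U : Matrix (Fin (k + ℓ)) (Fin n) ℝ) :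
    Matrix (Fin (k + ℓ)) (Fin n) ℝ :=
  Matrix.of fun a j =>
    (((colWindow k ℓ U (j : ℕ))ᵀ)⁻¹ *ᵥ
      fun i : Fin (k + ℓ) => if (i : ℕ) = 0 then (-1 : ℝ) ^ ((j : ℕ) + 1) else 0) a

/-- On matrices in `matCirc`, the columns of the twist are exactly the solutions of the defining
equations. -/
theorem twist_col_iff {n : ℕ} [NeZero n] (k ℓ : ℕ) (U : Matrix (Fin (k + ℓ)) (Fin n) ℝ)
    (hU : U ∈ matCirc k ℓ n) (j : Fin n) (u : Fin (k + ℓ) → ℝ) :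
    u = (twist k ℓ U).col j ↔
      ∀ i : Fin (k + ℓ), u ⬝ᵥ extCol k U ((j : ℕ) - ℓ + (i : ℕ)) =
        if (i : ℕ) = 0 then (-1 : ℝ) ^ ((j : ℕ) + 1) else 0 := by
  have hunit : IsUnit ((colWindow k ℓ U (j : ℕ))ᵀ).det := by
    rw [Matrix.det_transpose, ← Matrix.isUnit_iff_isUnit_det]
    exact Matrix.linearIndependent_cols_iff_isUnit.1 (hU _).1
  have key : ∀ i, ((colWindow k ℓ U (j : ℕ))ᵀ *ᵥ u) i =
      u ⬝ᵥ extCol k U ((j : ℕ) - ℓ + (i : ℕ)) := by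
    intro i
    simp [Matrix.mulVec, dotProduct, colWindow, mul_comm]
  have hcol : (twist k ℓ U).col j = ((colWindow k ℓ U (j : ℕ))ᵀ)⁻¹ *ᵥ
      fun i : Fin (k + ℓ) => if (i : ℕ) = 0 then (-1 : ℝ) ^ ((j : ℕ) + 1) else 0 := rfl
  rw [hcol]
  constructor
  · intro h i
    rw [← key, h, Matrix.mulVec_mulVec, Matrix.mul_nonsing_inv _ hunit, Matrix.one_mulVec]
  · intro h
    have h2 : (colWindow k ℓ U (j : ℕ))ᵀ *ᵥ u =
        fun i : Fin (k + ℓ) => if (i : ℕ) = 0 then (-1 : ℝ) ^ ((j : ℕ) + 1) else 0 := by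
      funext i
      rw [key, h]
    rw [← h2, Matrix.mulVec_mulVec, Matrix.nonsing_inv_mul _ hunit, Matrix.one_mulVec]

/-- `V` stacked on top of `W`. -/
def stackMat {k ℓ n : ℕ} (V : Matrix (Fin k) (Fin n) ℝ) (W : Matrix (Fin ℓ) (Fin n) ℝ) :
    Matrix (Fin (k + ℓ)) (Fin n) ℝ :=
  Matrix.of (Fin.append V.row W.row)

/-- The stacked twist map on matrices: the first `k` and the last `ℓ` rows of the twist of
`stackMat V W`. -/
noncomputable def stackedTwist {k ℓ n : ℕ} [NeZero n] (V : Matrix (Fin k) (Fin n) ℝ)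
    (W : Matrix (Fin ℓ) (Fin n) ℝ) : Matrix (Fin k) (Fin n) ℝ × Matrix (Fin ℓ) (Fin n) ℝ :=
  ((twist k ℓ (stackMat V W)).submatrix (Fin.castAdd ℓ) id,
    (twist k ℓ (stackMat V W)).submatrix (Fin.natAdd k) id)

/-- The flags `(W, U)` with `W = Z^⊥`, `Z` totally positive of dimension `k + m`, and
`U = span (V, W)` for some `V ∈ S`. -/
def flagImage (k ℓ m n : ℕ) (S : Set (Gr k n)) : Set (Fl ℓ (k + ℓ) n) :=
  {F | F.small ∈ grPosPerp (k + m) ℓ n ∧ ∃ V ∈ S, V.1 ⊔ F.small.1 = F.large.1}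

/-- The subset `𝒜_{n,k,≥m}` of the universal amplituhedron, where `n = k + ℓ + m`. -/
def univAmpGe (k ℓ m n : ℕ) : Set (Fl ℓ (k + ℓ) n) :=
  flagImage k ℓ m n (grGe m k n)

/-- The image `𝒜^{>0}_f` of the positroid cell of `f`. -/
def univAmpCell (k ℓ m n : ℕ) (f : Equiv.Perm ℤ) : Set (Fl ℓ (k + ℓ) n) :=
  flagImage k ℓ m n (posCell k n f)

/-! Extend the columns of `V` and `W` to sequences indexed by `ℤ`, and write the two blocks of the
stacked twist as sequences `A` and `B`. For every `j` the number `A j ⬝ᵥ V i + B j ⬝ᵥ W i` vanishes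
for `j - ℓ < i < j + k` and has a prescribed sign at `i = j - ℓ`. These equations (`IsDual`)
determine positivity, ranks and the inverse of the twist.

The first block. Let `W` span the complement of a totally positive `Z` of dimension `d = k + m`. The
covectors `det (Z (j+1), …, Z (j+d-1), ·)` evaluated on the vectors of `Z` form a cyclic band matrix
`L`, and in each row only `ℓ + 1` consecutive entries of a period survive. Its rows lie in the row
span of `Z`, so `L` annihilates `W`. Hence, for the sequence `L V` (`bandSum`), the pairing of `x`
with one of its vectors is a combination of the numbers `x ⬝ᵥ V i + y ⬝ᵥ W i` over `ℓ + 1`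
consecutive `i`, whatever `y` is. The minors of `L` of order `k` are nonnegative because `d - k = m`
is even (`bandMinor_nonneg`, by deleting columns one at a time), so by Cauchy–Binet `L V` is totally
nonnegative. Its consecutive minors do not vanish, and this makes it totally positive
(`SeqTNN.seqTP`). It follows that the windows of `(V, W)` are bases, and that `A j` is a multiple of
the covector attached to `L V` by `k - 1` consecutive vectors. Such covectors are again totally
positive, so `A` with alternating signs is totally positive up to sign, which characterizes
complements of totally positive spaces.

The second block. If `V` is totally positive, then `V` and `W` can be exchanged after alternating
signs (`TwistData.exists_swap`), and `B` is totally positive up to sign. In general `V` is a limit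
of totally positive matrices `V * posKernel n s`, so the minors of `B` have one weak sign. The cell
of a totally nonnegative point is determined by the ranks of cyclic intervals of columns
(`mem_posCell_iff`). This rests on a noncrossing property of circuits (`exists_cyc_famRank_lt`),
which also proves `SeqTNN.seqTP`. Linear algebra expresses the interval ranks of `B` through those
of `V` (`IsDual.famRank_right`), and the counting functions of `f⁻¹` and `f` satisfy the same
identity (`box_inv`). Hence `B` lies in the cell of `f⁻¹`.

Flags. Representatives of a flag differ by block triangular matrices, on which the twist acts
contragrediently (`stackedTwist_block`), so it induces a relation `TwistRel` between flags that is
single valued in both directions. Regarding the equations as conditions on `(V, W)` inverts the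
twist: the blocks of the twist are exchanged, its columns are divided by the positive numbers
`rightPairing`, and a second twist returns `(-W, -V)` (`untwist_spec`). Positive column scaling
preserves all positivity conditions, so the relation is onto. Both directions are continuous because
flags have continuous local matrix representatives. -/

/-! ### Quasi-periodic sequences and their cyclically increasing minors -/

/-- `X` is multiplied by `s` under translation by `n`. -/
def QuasiPeriodic (n : ℕ) (s : ℝ) {r : ℕ} (X : ℤ → Fin r → ℝ) : Prop :=
  ∀ j, X (j + n) = s • X j

/-- Strictly increasing tuples that fit into `n` consecutive integers. -/
def CycInc (n : ℕ) {r : ℕ} (q : Fin r → ℤ) : Prop :=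
  StrictMono q ∧ ∀ a b, q a < q b + n

/-- The determinant with rows `X (q 0), …, X (q (r - 1))`. -/
noncomputable def seqMinor {r : ℕ} (X : ℤ → Fin r → ℝ) (q : Fin r → ℤ) : ℝ :=
  Matrix.detRowAlternating fun a => X (q a)

/-- All cyclically increasing minors are nonnegative. -/
def SeqTNN (n : ℕ) {r : ℕ} (X : ℤ → Fin r → ℝ) : Prop :=
  ∀ q, CycInc n q → 0 ≤ seqMinor X q

/-- All cyclically increasing minors are positive. -/
def SeqTP (n : ℕ) {r : ℕ} (X : ℤ → Fin r → ℝ) : Prop :=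
  ∀ q, CycInc n q → 0 < seqMinor X q

theorem CycInc.of_mem_Ico {n r : ℕ} {q : Fin r → ℤ} {c : ℤ} (hq : StrictMono q)
    (h : ∀ a, c ≤ q a ∧ q a < c + n) : CycInc n q :=
  ⟨hq, fun a b => by have := h a; have := h b; omega⟩

theorem CycInc.rotUp {n r : ℕ} {q : Fin (r + 1) → ℤ} (hq : CycInc n q) :
    CycInc n (Fin.snoc (fun i : Fin r => q i.succ) (q 0 + n) : Fin (r + 1) → ℤ) := by
  constructor
  · intro a b hab
    induction a using Fin.lastCases with
    | last => exact absurd (Fin.le_last b) (not_le.2 hab)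
    | cast a =>
      induction b using Fin.lastCases with
      | last => simpa using hq.2 a.succ 0
      | cast b => simpa using hq.1 (Fin.succ_lt_succ_iff.2 (Fin.castSucc_lt_castSucc_iff.1 hab))
  · intro a b
    have hn : (0 : ℤ) < n := by have := hq.2 0 0; omega
    induction a using Fin.lastCases with
    | last =>
      induction b using Fin.lastCases with
      | last => simpa using hn
      | cast b => simpa using hq.1 (Fin.succ_pos b)
    | cast a =>
      induction b using Fin.lastCases with
      | last => have := hq.2 a.succ 0; simp; omega
      | cast b => simpa using hq.2 a.succ b.succ

/-- The cyclic rotation of `r + 1` rows has sign `(-1) ^ r`, and the translated row picks up the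
same factor. This cancellation dictates the quasi-periodicity sign attached to each vector length.
-/
theorem seqMinor_rotUp {n r : ℕ} (X : ℤ → Fin (r + 1) → ℝ)
    (hX : QuasiPeriodic n ((-1) ^ r) X) (q : Fin (r + 1) → ℤ) :
    seqMinor X (Fin.snoc (fun i : Fin r => q i.succ) (q 0 + n) : Fin (r + 1) → ℤ) =
      seqMinor X q := by
  have h1 : (fun a => X ((Fin.snoc (fun i : Fin r => q i.succ) (q 0 + n) : Fin (r + 1) → ℤ) a)) =
      fun a => (Fin.snoc (fun _ : Fin r => (1 : ℝ)) ((-1 : ℝ) ^ r) : Fin (r + 1) → ℝ) a •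
        ((fun a => X (q a)) ∘ finRotate (r + 1)) a := by
    funext a
    induction a using Fin.lastCases with
    | last => simpa using hX (q 0)
    | cast a => simp [finRotate_apply]
  unfold seqMinor
  rw [h1, AlternatingMap.map_smul_univ, AlternatingMap.map_perm, sign_finRotate,
    Fin.prod_univ_castSucc]
  rcases neg_one_pow_eq_or ℤˣ r with h | h
  · have h' : (-1 : ℝ) ^ r = 1 := by
      have := congrArg (fun u : ℤˣ => ((u : ℤ) : ℝ)) h; simpa using this
    simp [h, h']
  · have h' : (-1 : ℝ) ^ r = -1 := by
      have := congrArg (fun u : ℤˣ => ((u : ℤ) : ℝ)) h; simpa using this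
    simp [h, h']

theorem CycInc.rotDown {n r : ℕ} {q : Fin (r + 1) → ℤ} (hq : CycInc n q) :
    CycInc n (Fin.cons (q (Fin.last r) - n) (fun i : Fin r => q i.castSucc) :
      Fin (r + 1) → ℤ) := by
  constructor
  · intro a b hab
    induction b using Fin.cases with
    | zero => exact absurd hab (Fin.not_lt_zero a)
    | succ b =>
      induction a using Fin.cases with
      | zero => have := hq.2 (Fin.last r) b.castSucc; simp; omega
      | succ a => simpa using hq.1 (Fin.castSucc_lt_castSucc_iff.2 (Fin.succ_lt_succ_iff.1 hab))
  · intro a b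
    have hn : (0 : ℤ) < n := by have := hq.2 0 0; omega
    induction a using Fin.cases with
    | zero =>
      induction b using Fin.cases with
      | zero => simpa using hn
      | succ b => have := hq.2 (Fin.last r) b.castSucc; simp; omega
    | succ a =>
      induction b using Fin.cases with
      | zero => simpa using hq.1 (Fin.castSucc_lt_last a)
      | succ b => simpa using hq.2 a.castSucc b.castSucc

theorem seqMinor_rotDown {n r : ℕ} (X : ℤ → Fin (r + 1) → ℝ)
    (hX : QuasiPeriodic n ((-1) ^ r) X) (q : Fin (r + 1) → ℤ) :
    seqMinor X (Fin.cons (q (Fin.last r) - n) (fun i : Fin r => q i.castSucc) :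
      Fin (r + 1) → ℤ) = seqMinor X q := by
  rw [← seqMinor_rotUp X hX]
  congr 1
  funext a
  induction a using Fin.lastCases with
  | last => simp
  | cast a => simp

theorem seqMinor_eq_zero_of_eq {r : ℕ} (X : ℤ → Fin r → ℝ) {q : Fin r → ℤ} {a b : Fin r}
    (hab : a ≠ b) (h : q a = q b) : seqMinor X q = 0 :=
  AlternatingMap.map_eq_zero_of_eq _ _ (by simp [h]) hab

/-- Cyclically increasing tuples can be moved into any window of length `n` without changing their
residues and their minors. -/
theorem CycInc.exists_rotate {n r : ℕ} {q : Fin r → ℤ} (hq : CycInc n q) (c : ℤ) :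
    ∃ q' : Fin r → ℤ, StrictMono q' ∧ (∀ a, c ≤ q' a ∧ q' a < c + n) ∧
      (∀ a, ∃ b, q' a ≡ q b [ZMOD n]) ∧
      ∀ X : ℤ → Fin r → ℝ, QuasiPeriodic n ((-1) ^ (r + 1)) X → seqMinor X q' = seqMinor X q := by
  cases r with
  | zero =>
    exact ⟨q, hq.1, fun a => a.elim0, fun a => a.elim0, fun X _ => rfl⟩
  | succ r =>
    have hs : ((-1 : ℝ)) ^ (r + 1 + 1) = (-1) ^ r := by rw [pow_add, pow_add]; norm_num
    rw [hs]
    -- In the window that starts at the first entry the tuple fits as it is. The window is then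
    -- shifted by one step at a time, and an entry that drops out on one side is rotated to the
    -- other.
    induction c using Int.inductionOn' (b := q 0) with
    | zero =>
      exact ⟨q, hq.1, fun a => ⟨hq.1.monotone (Fin.zero_le a), hq.2 a 0⟩,
        fun a => ⟨a, rfl⟩, fun X _ => rfl⟩
    | succ c _ ih =>
      obtain ⟨q', h1, h2, h3, h4⟩ := ih
      by_cases hc : q' 0 = c
      · have hR := (CycInc.of_mem_Ico h1 h2).rotUp
        refine ⟨_, hR.1, ?_, ?_, fun X hX => (seqMinor_rotUp X hX q').trans (h4 X hX)⟩
        · intro a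
          induction a using Fin.lastCases with
          | last => simp [hc]; have := h2 0; omega
          | cast a => have := h1 (Fin.succ_pos a); have := h2 a.succ; simp; omega
        · intro a
          induction a using Fin.lastCases with
          | last => obtain ⟨b, hb⟩ := h3 0; exact ⟨b, by simpa using hb⟩
          | cast a => simpa using h3 a.succ
      · refine ⟨q', h1, fun a => ?_, h3, h4⟩
        have := h1.monotone (Fin.zero_le a); have := h2 a; have := h2 0; omega
    | pred c _ ih =>
      obtain ⟨q', h1, h2, h3, h4⟩ := ih
      by_cases hc : q' (Fin.last r) = c + n - 1
      · have hR := (CycInc.of_mem_Ico h1 h2).rotDown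
        refine ⟨_, hR.1, ?_, ?_, fun X hX => (seqMinor_rotDown X hX q').trans (h4 X hX)⟩
        · intro a
          induction a using Fin.cases with
          | zero => simp [hc]; have := h2 0; omega
          | succ a => have := h1 (Fin.castSucc_lt_last a); have := h2 a.castSucc; simp; omega
        · intro a
          induction a using Fin.cases with
          | zero =>
            obtain ⟨b, hb⟩ := h3 (Fin.last r)
            refine ⟨b, ?_⟩
            simp only [Fin.cons_zero]
            exact (Int.ModEq.symm (by simp [Int.modEq_iff_dvd])).trans hb
          | succ a => simpa using h3 a.castSucc
      · refine ⟨q', h1, fun a => ?_, h3, h4⟩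
        have := h1.monotone (Fin.le_last a); have := h2 a; have := h2 (Fin.last r); omega

/-! ### Cauchy–Binet and sums of products of minors -/

/-- Cauchy–Binet, with a sum over all tuples instead of the increasing ones. -/
theorem factorial_mul_det_sum {r N : ℕ} (A : Fin r → Fin N → ℝ) (B : Fin N → Fin r → ℝ) :
    (r.factorial : ℝ) * Matrix.detRowAlternating (fun a => ∑ p, A a p • B p) =
      ∑ f : Fin r → Fin N,
        Matrix.det (Matrix.of fun a b => A a (f b)) * Matrix.detRowAlternating (fun a => B (f a)) := by
  -- For each permutation the multilinear expansion is reindexed. Adding the results over all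
  -- permutations assembles the determinants of `A`, at the cost of the factor `r!`.
  have key : ∀ σ : Equiv.Perm (Fin r),
      Matrix.detRowAlternating (fun a => ∑ p, A a p • B p) =
        ∑ f : Fin r → Fin N, (((Equiv.Perm.sign σ : ℤ) : ℝ) * ∏ a, A (σ a) (f a)) *
          Matrix.detRowAlternating (fun a => B (f a)) := by
    intro σ
    have h1 : Matrix.detRowAlternating (fun a => ∑ p, A a p • B p) =
        ∑ g : Fin r → Fin N, (∏ a, A a (g a)) * Matrix.detRowAlternating (fun a => B (g a)) := by
      have := (Matrix.detRowAlternating (n := Fin r) (R := ℝ)).toMultilinearMap.map_sum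
        (fun a p => A a p • B p)
      refine this.trans (Finset.sum_congr rfl fun g _ => ?_)
      exact AlternatingMap.map_smul_univ _ _ _
    rw [h1, ← (Equiv.arrowCongr σ (Equiv.refl (Fin N))).sum_comp]
    refine Finset.sum_congr rfl fun f _ => ?_
    have h2 : (fun a => B ((Equiv.arrowCongr σ (Equiv.refl (Fin N))) f a)) =
        (fun a => B (f a)) ∘ σ.symm := by
      funext a; simp [Equiv.arrowCongr]
    rw [h2, AlternatingMap.map_perm, Equiv.Perm.sign_symm]
    have h3 : ∏ a, A a ((Equiv.arrowCongr σ (Equiv.refl (Fin N))) f a) = ∏ a, A (σ a) (f a) := by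
      rw [← Equiv.prod_comp σ]; simp [Equiv.arrowCongr]
    rw [h3, Units.smul_def, zsmul_eq_mul]; ring
  have hsum : ∑ σ : Equiv.Perm (Fin r), Matrix.detRowAlternating (fun a => ∑ p, A a p • B p) =
      (r.factorial : ℝ) * Matrix.detRowAlternating (fun a => ∑ p, A a p • B p) := by
    simp [Fintype.card_perm]
  rw [← hsum, Finset.sum_congr rfl fun σ _ => key σ, Finset.sum_comm]
  refine Finset.sum_congr rfl fun f _ => ?_
  rw [← Finset.sum_mul, Matrix.det_apply']
  simp

theorem exists_strictMono_comp_perm {r N : ℕ} {f : Fin r → Fin N} (hf : Function.Injective f) :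
    ∃ (q : Fin r → Fin N) (σ : Equiv.Perm (Fin r)), StrictMono q ∧ f = q ∘ σ := by
  refine ⟨f ∘ Tuple.sort f, (Tuple.sort f)⁻¹, ?_, ?_⟩
  · exact (Tuple.monotone_sort f).strictMono_of_injective (hf.comp (Tuple.sort f).injective)
  · funext a; simp

/-- Sorting a tuple multiplies both determinants by the same sign, and a repeated entry annihilates
the second one. -/
theorem det_mul_det_nonneg_of_strictMono {r N : ℕ} (A : Fin r → Fin N → ℝ) (B : Fin N → Fin r → ℝ)
    (h : ∀ q : Fin r → Fin N, StrictMono q → 0 ≤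
      Matrix.det (Matrix.of fun a b => A a (q b)) * Matrix.detRowAlternating (fun a => B (q a)))
    (f : Fin r → Fin N) : 0 ≤
      Matrix.det (Matrix.of fun a b => A a (f b)) * Matrix.detRowAlternating (fun a => B (f a)) := by
  by_cases hf : Function.Injective f
  · obtain ⟨q, σ, hq, rfl⟩ := exists_strictMono_comp_perm hf
    have h1 : Matrix.det (Matrix.of fun a b => A a ((q ∘ σ) b)) =
        ((Equiv.Perm.sign σ : ℤ) : ℝ) * Matrix.det (Matrix.of fun a b => A a (q b)) :=
      Matrix.det_permute' σ (Matrix.of fun a b => A a (q b))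
    have h2 : Matrix.detRowAlternating (fun a => B ((q ∘ σ) a)) =
        ((Equiv.Perm.sign σ : ℤ) : ℝ) * Matrix.detRowAlternating (fun a => B (q a)) := by
      have := AlternatingMap.map_perm (Matrix.detRowAlternating (n := Fin r) (R := ℝ))
        (fun a => B (q a)) σ
      rw [Units.smul_def, zsmul_eq_mul] at this
      exact this
    rw [h1, h2]
    have hs : (((Equiv.Perm.sign σ : ℤ) : ℝ)) * (((Equiv.Perm.sign σ : ℤ) : ℝ)) = 1 := by
      rw [← Int.cast_mul, ← Units.val_mul, Int.units_mul_self]; simp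
    calc _ ≤ _ := h q hq
      _ = _ := by linear_combination (-(Matrix.det (Matrix.of fun a b => A a (q b)) *
          Matrix.detRowAlternating (fun a => B (q a)))) * hs
  · have : ∃ a b, f a = f b ∧ a ≠ b := by
      simpa [Function.Injective] using hf
    obtain ⟨a, b, hab, hne⟩ := this
    rw [AlternatingMap.map_eq_zero_of_eq _ _ (by simp [hab]) hne, mul_zero]

theorem det_sum_nonneg {r N : ℕ} (A : Fin r → Fin N → ℝ) (B : Fin N → Fin r → ℝ)
    (h : ∀ q : Fin r → Fin N, StrictMono q → 0 ≤
      Matrix.det (Matrix.of fun a b => A a (q b)) * Matrix.detRowAlternating (fun a => B (q a))) :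
    0 ≤ Matrix.detRowAlternating (fun a => ∑ p, A a p • B p) := by
  have h1 := factorial_mul_det_sum A B
  have h2 : (0 : ℝ) < r.factorial := by exact_mod_cast r.factorial_pos
  have h3 := Finset.sum_nonneg fun f (_ : f ∈ Finset.univ) =>
    det_mul_det_nonneg_of_strictMono A B h f
  rw [← h1] at h3
  exact nonneg_of_mul_nonneg_right h3 h2

theorem det_sum_pos {r N : ℕ} (A : Fin r → Fin N → ℝ) (B : Fin N → Fin r → ℝ)
    (h : ∀ q : Fin r → Fin N, StrictMono q → 0 ≤
      Matrix.det (Matrix.of fun a b => A a (q b)) * Matrix.detRowAlternating (fun a => B (q a)))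
    (q : Fin r → Fin N) (hq : 0 <
      Matrix.det (Matrix.of fun a b => A a (q b)) * Matrix.detRowAlternating (fun a => B (q a))) :
    0 < Matrix.detRowAlternating (fun a => ∑ p, A a p • B p) := by
  have h1 := factorial_mul_det_sum A B
  have h2 : (0 : ℝ) < r.factorial := by exact_mod_cast r.factorial_pos
  have h3 : 0 < ∑ f : Fin r → Fin N,
        Matrix.det (Matrix.of fun a b => A a (f b)) * Matrix.detRowAlternating (fun a => B (f a)) :=
    Finset.sum_pos' (fun f _ => det_mul_det_nonneg_of_strictMono A B h f)
      ⟨q, Finset.mem_univ _, hq⟩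
  rw [← h1] at h3
  exact (mul_pos_iff_of_pos_left h2).1 h3

/-! ### The cyclic band matrix of a totally positive sequence -/

/-- The tuple `j + 1, …, j + d - 1, p`. -/
def bandIdx (d : ℕ) (j p : ℤ) : Fin d → ℤ := fun a => if (a : ℕ) + 1 = d then p else j + 1 + a

/-- The covector `x ↦ det (X (j + 1), …, X (j + d - 1), x)`. -/
noncomputable def lam {d : ℕ} (X : ℤ → Fin d → ℝ) (j : ℤ) : Fin d → ℝ := fun i =>
  Matrix.detRowAlternating fun a : Fin d => if (a : ℕ) + 1 = d then Pi.single i 1 else X (j + 1 + a)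

theorem lam_dotProduct {d : ℕ} (hd : 0 < d) (X : ℤ → Fin d → ℝ) (j : ℤ) (x : Fin d → ℝ) :
    lam X j ⬝ᵥ x =
      Matrix.detRowAlternating fun a : Fin d => if (a : ℕ) + 1 = d then x else X (j + 1 + a) := by
  have hl : d - 1 < d := by omega
  have upd : ∀ y : Fin d → ℝ, (fun a : Fin d => if (a : ℕ) + 1 = d then y else X (j + 1 + a)) =
      Function.update (fun a : Fin d => X (j + 1 + a)) ⟨d - 1, hl⟩ y := by
    intro y
    funext a
    by_cases h : (a : ℕ) + 1 = d
    · have : a = ⟨d - 1, hl⟩ := Fin.ext (by simp; omega)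
      subst this; rw [if_pos h, Function.update_self]
    · have : a ≠ ⟨d - 1, hl⟩ := fun e => h (by rw [e]; simp; omega)
      rw [if_neg h, Function.update_of_ne this]
  rw [upd]
  have hx : x = ∑ i, x i • (Pi.single i (1 : ℝ) : Fin d → ℝ) := by
    funext b; simp [Finset.sum_apply, Pi.single_apply]
  conv_rhs => rw [hx]
  have := (Matrix.detRowAlternating (n := Fin d) (R := ℝ)).map_update_sum Finset.univ
    ⟨d - 1, hl⟩ (fun i => x i • (Pi.single i (1 : ℝ) : Fin d → ℝ)) (fun a : Fin d => X (j + 1 + a))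
  rw [this]
  simp only [dotProduct, lam, upd, AlternatingMap.map_update_smul, smul_eq_mul]
  exact Finset.sum_congr rfl fun i _ => mul_comm _ _

theorem lam_dotProduct_seq {d : ℕ} (hd : 0 < d) (X : ℤ → Fin d → ℝ) (j p : ℤ) :
    lam X j ⬝ᵥ X p = seqMinor X (bandIdx d j p) := by
  rw [lam_dotProduct hd, seqMinor]
  congr 1
  funext a
  simp only [bandIdx]
  split_ifs <;> rfl

theorem CycInc.bandIdx {n d : ℕ} {j p : ℤ} (hdn : d ≤ n) (h1 : j + d ≤ p) (h2 : p ≤ j + n) :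
    CycInc n (bandIdx d j p) := by
  refine CycInc.of_mem_Ico (c := j + 1) ?_ ?_
  · intro a b hab
    have h : (a : ℕ) < b := hab
    have := b.2
    simp only [_root_.bandIdx]
    split_ifs <;> omega
  · intro a
    have := a.2
    simp only [_root_.bandIdx]
    split_ifs <;> omega

/-- Up to `p = j + n` the tuple `j + 1, …, j + d - 1, p` still fits into one period. -/
theorem band_pos {n d : ℕ} (hd : 0 < d) (hdn : d ≤ n) {X : ℤ → Fin d → ℝ} (hX : SeqTP n X)
    {j p : ℤ} (h1 : j + d ≤ p) (h2 : p ≤ j + n) : 0 < lam X j ⬝ᵥ X p := by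
  rw [lam_dotProduct_seq hd]
  exact hX _ (CycInc.bandIdx hdn h1 h2)

/-- The vector `X p` already occurs among the first `d - 1` rows. -/
theorem band_eq_zero {d : ℕ} {X : ℤ → Fin d → ℝ} {j p : ℤ} (h1 : j + 1 ≤ p) (h2 : p < j + d) :
    lam X j ⬝ᵥ X p = 0 := by
  have hd : 0 < d := by omega
  rw [lam_dotProduct_seq hd]
  obtain ⟨i, hi⟩ := Int.eq_ofNat_of_zero_le (show 0 ≤ p - j - 1 by omega)
  refine seqMinor_eq_zero_of_eq X (a := ⟨i, by omega⟩) (b := ⟨d - 1, by omega⟩) ?_ ?_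
  · intro e
    have := congrArg Fin.val e
    simp at this; omega
  · simp only [bandIdx]
    rw [if_neg (by omega), if_pos (by omega)]; omega

theorem eq_zero_of_dotProduct_seq {d : ℕ} {X : ℤ → Fin d → ℝ} {q : Fin d → ℤ}
    (hq : seqMinor X q ≠ 0) {μ : Fin d → ℝ} (h : ∀ a, μ ⬝ᵥ X (q a) = 0) : μ = 0 := by
  refine Matrix.eq_zero_of_mulVec_eq_zero (M := Matrix.of fun a => X (q a)) hq ?_
  funext a
  rw [Pi.zero_apply, ← h a, dotProduct_comm]
  rfl

theorem neg_one_pow_mul_self (a : ℕ) : ((-1 : ℝ)) ^ a * (-1) ^ a = 1 := by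
  rw [← pow_add, Even.neg_one_pow ⟨a, rfl⟩]

/-- The `d - 1` translated rows contribute the power `((-1) ^ (d + 1)) ^ (d - 1)`, which equals
`(-1) ^ (d + 1)` for either parity of `d`. -/
theorem lam_quasiPeriodic {n d : ℕ} {X : ℤ → Fin d → ℝ} (hX : QuasiPeriodic n ((-1) ^ (d + 1)) X)
    (j : ℤ) : lam X (j + n) = (-1 : ℝ) ^ (d + 1) • lam X j := by
  funext i
  cases d with
  | zero => exact i.elim0
  | succ D =>
    have h : (fun a : Fin (D + 1) => if (a : ℕ) + 1 = D + 1 then (Pi.single i 1 : Fin (D + 1) → ℝ)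
        else X (j + n + 1 + a)) = fun a : Fin (D + 1) =>
        (if (a : ℕ) + 1 = D + 1 then (1 : ℝ) else (-1) ^ (D + 1 + 1)) •
        (if (a : ℕ) + 1 = D + 1 then (Pi.single i 1 : Fin (D + 1) → ℝ) else X (j + 1 + a)) := by
      funext a
      split_ifs
      · simp
      · rw [← hX]; congr 1; ring
    simp only [lam, Pi.smul_apply]
    rw [h, AlternatingMap.map_smul_univ, Fin.prod_univ_castSucc]
    congr 1
    simp only [Fin.val_castSucc, Fin.val_last, if_true, mul_one]
    rw [Finset.prod_congr rfl (g := fun _ => (-1 : ℝ) ^ (D + 1 + 1))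
      (fun a _ => if_neg (by have := a.2; omega))]
    rw [Finset.prod_const, Finset.card_univ, Fintype.card_fin]
    rcases Nat.even_or_odd D with h | h
    · have : (-1 : ℝ) ^ (D + 1 + 1) = 1 := by rw [Even.neg_one_pow]; exact h.add_one.add_one
      rw [this, one_pow]
    · have : (-1 : ℝ) ^ (D + 1 + 1) = -1 := by rw [Odd.neg_one_pow]; exact h.add_one.add_one
      rw [this, h.neg_one_pow]

/-- The `r × r` minor with rows `j` and columns `p` of the cyclic band matrix of `X`. -/
noncomputable def bandMinor {d r : ℕ} (X : ℤ → Fin d → ℝ) (j p : Fin r → ℤ) : ℝ :=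
  Matrix.detRowAlternating fun a b : Fin r => lam X (j a) ⬝ᵥ X (p b)

/-- Multilinearity expands the determinant over the choices of `j a - 1` or `j a` in every row.
Neighbouring choices can coincide but cannot cross, so a term either vanishes or is an increasing
minor of `A` with a nonnegative coefficient. The boundary conditions on `α` and `β` keep the indices
in `[0, N)`. -/
theorem det_rowPair_nonneg {r : ℕ} {N : ℤ} {A : ℤ → Fin r → ℝ}
    (hA : ∀ s : Fin r → ℤ, StrictMono s → (∀ a, 0 ≤ s a ∧ s a < N) → 0 ≤ seqMinor A s)
    {j : Fin r → ℤ} (hj : StrictMono j) (hjN : ∀ a, 0 ≤ j a ∧ j a ≤ N) {α β : Fin r → ℝ}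
    (hα : ∀ a, 0 ≤ α a) (hβ : ∀ a, 0 ≤ β a) (hα0 : ∀ a, j a = 0 → α a = 0)
    (hβ0 : ∀ a, j a = N → β a = 0) :
    0 ≤ Matrix.detRowAlternating fun a => α a • A (j a - 1) + β a • A (j a) := by
  have h0 := (Matrix.detRowAlternating (n := Fin r) (R := ℝ)).map_add_univ
    (fun a => α a • A (j a - 1)) (fun a => β a • A (j a))
  have h1 : (Matrix.detRowAlternating fun a => α a • A (j a - 1) + β a • A (j a)) =
    ∑ s : Finset (Fin r), Matrix.detRowAlternating
      (s.piecewise (fun a => α a • A (j a - 1)) (fun a => β a • A (j a))) := h0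
  rw [h1]
  refine Finset.sum_nonneg fun T _ => ?_
  have h2 : T.piecewise (fun a => α a • A (j a - 1)) (fun a => β a • A (j a)) =
      fun a => (T.piecewise α β a) • A (T.piecewise (fun a => j a - 1) j a) := by
    funext a
    by_cases h : a ∈ T <;> simp [h]
  rw [h2, AlternatingMap.map_smul_univ, smul_eq_mul]
  set s := T.piecewise (fun a => j a - 1) j with hs
  have hs' : ∀ a, (a ∈ T ∧ s a = j a - 1) ∨ (a ∉ T ∧ s a = j a) := by
    intro a; by_cases h : a ∈ T <;> simp [hs, h]
  have hprod : 0 ≤ ∏ a, T.piecewise α β a := by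
    refine Finset.prod_nonneg fun a _ => ?_
    by_cases h : a ∈ T <;> simp [h, hα a, hβ a]
  by_cases hz : ∃ a, T.piecewise α β a = 0
  · obtain ⟨a, ha⟩ := hz
    rw [Finset.prod_eq_zero (Finset.mem_univ a) ha, zero_mul]
  push Not at hz
  refine mul_nonneg hprod ?_
  by_cases hinj : Function.Injective s
  · refine hA s ?_ ?_
    · have hmono : Monotone s := by
        intro a b hab
        rcases hab.eq_or_lt with rfl | hab
        · rfl
        · have := hj hab
          rcases hs' a with h | h <;> rcases hs' b with h' | h' <;> omega
      exact hmono.strictMono_of_injective hinj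
    · intro a
      have h3 := hjN a
      have h4 := hz a
      rcases hs' a with ⟨h, h'⟩ | ⟨h, h'⟩
      · have : j a ≠ 0 := fun e => h4 (by simp [h, hα0 a e])
        omega
      · have : j a ≠ N := fun e => h4 (by simp [h, hβ0 a e])
        omega
  · have : ∃ a b, s a = s b ∧ a ≠ b := by simpa [Function.Injective] using hinj
    obtain ⟨a, b, hab, hne⟩ := this
    exact (seqMinor_eq_zero_of_eq A hne hab).ge

/-- The increasing map `ℤ → ℤ` that skips the integers congruent to `N` modulo `N + 1`. -/
def skip (N : ℕ) (q : ℤ) : ℤ := q + q / N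

theorem skip_add {N : ℕ} (hN : 0 < N) (q : ℤ) : skip N (q + N) = skip N q + ((N + 1 : ℕ) : ℤ) := by
  have : (N : ℤ) ≠ 0 := by positivity
  simp only [skip]
  rw [Int.add_ediv_of_dvd_right (dvd_refl _), Int.ediv_self this]
  push_cast; ring

theorem skip_strictMono {N : ℕ} (hN : 0 < N) : StrictMono (skip N) := by
  intro a b hab
  have : a / (N : ℤ) ≤ b / N := Int.ediv_le_ediv (by positivity) hab.le
  simp only [skip]; omega

theorem skip_of_lt {N : ℕ} {q : ℤ} (h1 : 0 ≤ q) (h2 : q < N) : skip N q = q := by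
  simp [skip, Int.ediv_eq_zero_of_lt h1 h2]

theorem skip_of_ge {N : ℕ} {q : ℤ} (h1 : N ≤ q) (h2 : q < 2 * N) : skip N q = q + 1 := by
  have hN : 0 < N := by omega
  have h := skip_add hN (q - N)
  rw [sub_add_cancel, skip_of_lt (q := q - N) (by omega) (by omega)] at h
  push_cast at h; omega

section Skip

variable {N d : ℕ} {X : ℤ → Fin d → ℝ}

theorem QuasiPeriodic.comp_skip {s : ℝ} (hN : 0 < N) (hX : QuasiPeriodic (N + 1) s X) :
    QuasiPeriodic N s (X ∘ skip N) := by
  intro j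
  rw [Function.comp_apply, skip_add hN, hX]; rfl

theorem SeqTP.comp_skip (hN : 0 < N) (hX : SeqTP (N + 1) X) : SeqTP N (X ∘ skip N) := by
  intro q hq
  refine hX (skip N ∘ q) ⟨(skip_strictMono hN).comp hq.1, fun a b => ?_⟩
  have := skip_strictMono hN (hq.2 a b)
  rwa [skip_add hN] at this

/-- Write `Y` for the sequence without the deleted columns. If the deleted index `N` is not one of
`j + 1, …, j + d - 1`, then `lam X j` is itself a covector of `Y`. Otherwise `lam X j` vanishes on
the `d - 2` vectors `Y (j + 1), …, Y (j + d - 2)`, and the annihilator of these is the plane spanned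
by `lam Y (j - 1)` and `lam Y j`. Evaluation at `Y (j + d - 1)` and at `Y (j + N)` isolates the two
coefficients as quotients of positive band entries. -/
theorem exists_lam_eq_skip (hd : 0 < d) (hdN : d ≤ N) (hqp : QuasiPeriodic (N + 1) ((-1) ^ (d + 1)) X)
    (hX : SeqTP (N + 1) X) {j : ℤ} (hj0 : 0 ≤ j) (hjN : j ≤ N) :
    ∃ α β : ℝ, 0 ≤ α ∧ 0 ≤ β ∧ (j = 0 → α = 0) ∧ (j = N → β = 0) ∧
      lam X j = α • lam (X ∘ skip N) (j - 1) + β • lam (X ∘ skip N) j := by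
  have hN : 0 < N := by omega
  by_cases h1 : j + d ≤ N
  · refine ⟨0, 1, le_rfl, zero_le_one, fun _ => rfl, fun h => by omega, ?_⟩
    rw [zero_smul, one_smul, zero_add]
    funext i
    simp only [lam]
    congr 1
    funext a
    have := a.2
    split_ifs
    · rfl
    · rw [Function.comp_apply, skip_of_lt (by omega) (by omega)]
  by_cases h2 : j = N
  · refine ⟨1, 0, zero_le_one, le_rfl, fun h => by omega, fun _ => rfl, ?_⟩
    rw [zero_smul, one_smul, add_zero]
    funext i
    simp only [lam]
    congr 1
    funext a
    have := a.2
    split_ifs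
    · rfl
    · rw [Function.comp_apply, skip_of_ge (by omega) (by omega)]
      congr 1; omega
  set Y := X ∘ skip N with hY
  have hYp := hX.comp_skip hN
  have hYq := hqp.comp_skip hN
  have b1 : 0 < lam Y (j - 1) ⬝ᵥ Y (j + d - 1) :=
    band_pos hd hdN hYp (by omega) (by omega)
  have b2 : 0 < lam Y j ⬝ᵥ Y (j + N) := band_pos hd hdN hYp (by omega) (by omega)
  have e1 : Y (j + d - 1) = X (j + d) := by
    rw [hY, Function.comp_apply, skip_of_ge (by omega) (by omega)]; congr 1; ring
  have e2 : Y (j + N) = X (j + (N + 1 : ℕ)) := by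
    rw [hY, Function.comp_apply, skip_add hN, skip_of_lt (by omega) (by omega)]
  have c1 : 0 < lam X j ⬝ᵥ Y (j + d - 1) := by
    rw [e1]; exact band_pos hd (by omega) hX (by omega) (by omega)
  have c2 : 0 < lam X j ⬝ᵥ Y (j + N) := by
    rw [e2]; exact band_pos hd (by omega) hX (by push_cast; omega) (by push_cast; omega)
  refine ⟨(lam X j ⬝ᵥ Y (j + d - 1)) / (lam Y (j - 1) ⬝ᵥ Y (j + d - 1)),
    (lam X j ⬝ᵥ Y (j + N)) / (lam Y j ⬝ᵥ Y (j + N)), by positivity, by positivity,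
    fun h => by omega, fun h => absurd h h2, ?_⟩
  rw [← sub_eq_zero]
  have hbasis : seqMinor Y (bandIdx d j (j + N)) ≠ 0 :=
    (hYp _ (CycInc.bandIdx hdN (by omega) (by omega))).ne'
  -- The identity is tested on the basis `Y (j + 1), …, Y (j + d - 1), Y (j + N)`.
  refine eq_zero_of_dotProduct_seq hbasis fun a => ?_
  have ha := a.2
  rw [sub_dotProduct, add_dotProduct, smul_dotProduct, smul_dotProduct, smul_eq_mul, smul_eq_mul]
  simp only [bandIdx]
  split_ifs with hl
  · have z1 : lam Y (j - 1) ⬝ᵥ Y (j + N) = 0 := by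
      rw [show Y (j + N) = _ from hYq j, dotProduct_smul, band_eq_zero (by omega) (by omega), smul_zero]
    rw [z1, mul_zero, zero_add, div_mul_cancel₀ _ b2.ne', sub_self]
  · have z2 : lam Y j ⬝ᵥ Y (j + 1 + a) = 0 := band_eq_zero (by omega) (by omega)
    rw [z2, mul_zero, add_zero]
    by_cases hl2 : (a : ℕ) + 2 = d
    · have : j + 1 + (a : ℤ) = j + d - 1 := by omega
      rw [this, div_mul_cancel₀ _ b1.ne', sub_self]
    · have z1 : lam Y (j - 1) ⬝ᵥ Y (j + 1 + a) = 0 := band_eq_zero (by omega) (by omega)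
      have z0 : lam X j ⬝ᵥ Y (j + 1 + a) = 0 := by
        by_cases h3 : j + 1 + (a : ℤ) < N
        · rw [hY, Function.comp_apply, skip_of_lt (by omega) h3]
          exact band_eq_zero (by omega) (by omega)
        · rw [hY, Function.comp_apply, skip_of_ge (by omega) (by omega)]
          exact band_eq_zero (by omega) (by omega)
      rw [z0, z1, mul_zero, sub_zero]

end Skip

theorem bandMinor_transpose {d r : ℕ} (X : ℤ → Fin d → ℝ) (j p : Fin r → ℤ) :
    bandMinor X j p = seqMinor (fun q a => lam X (j a) ⬝ᵥ X q) p :=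
  (Matrix.det_transpose (Matrix.of fun a b : Fin r => lam X (j a) ⬝ᵥ X (p b))).symm

/-- Rotating an `r`-minor needs the quasi-periodicity sign for `r`, while the covectors carry the
sign for `d`. This is where the parity of `d + r` enters. -/
theorem bandMinor_eq_of_rows {n d r : ℕ} {X : ℤ → Fin d → ℝ}
    (hX : QuasiPeriodic n ((-1) ^ (d + 1)) X) (hdr : Even (d + r)) {j : Fin r → ℤ}
    (hj : CycInc n j) (c : ℤ) : ∃ j' : Fin r → ℤ, StrictMono j' ∧ (∀ a, c ≤ j' a ∧ j' a < c + n) ∧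
      (∀ a, ∃ b, j' a ≡ j b [ZMOD n]) ∧ ∀ p : Fin r → ℤ, bandMinor X j' p = bandMinor X j p := by
  obtain ⟨j', h1, h2, h3, h4⟩ := hj.exists_rotate c
  refine ⟨j', h1, h2, h3, fun p => h4 (fun i b => lam X i ⬝ᵥ X (p b)) ?_⟩
  intro i
  have hs : (-1 : ℝ) ^ (r + 1) = (-1) ^ (d + 1) := by
    rw [neg_one_pow_eq_pow_mod_two, neg_one_pow_eq_pow_mod_two (n := d + 1)]
    congr 1
    rw [Nat.even_iff] at hdr; omega
  funext b
  simp only [Pi.smul_apply, lam_quasiPeriodic hX, smul_dotProduct, hs]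

theorem bandMinor_eq_of_cols {n d r : ℕ} {X : ℤ → Fin d → ℝ}
    (hX : QuasiPeriodic n ((-1) ^ (d + 1)) X) (hdr : Even (d + r)) {p : Fin r → ℤ}
    (hp : CycInc n p) (c : ℤ) : ∃ p' : Fin r → ℤ, StrictMono p' ∧ (∀ a, c ≤ p' a ∧ p' a < c + n) ∧
      (∀ a, ∃ b, p' a ≡ p b [ZMOD n]) ∧ ∀ j : Fin r → ℤ, bandMinor X j p' = bandMinor X j p := by
  obtain ⟨p', h1, h2, h3, h4⟩ := hp.exists_rotate c
  refine ⟨p', h1, h2, h3, fun j => ?_⟩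
  rw [bandMinor_transpose, bandMinor_transpose]
  refine h4 (fun q a => lam X (j a) ⬝ᵥ X q) ?_
  intro i
  have hs : (-1 : ℝ) ^ (r + 1) = (-1) ^ (d + 1) := by
    rw [neg_one_pow_eq_pow_mod_two, neg_one_pow_eq_pow_mod_two (n := d + 1)]
    congr 1
    rw [Nat.even_iff] at hdr; omega
  funext b
  simp only [Pi.smul_apply, show X (i + n) = _ from hX i, dotProduct_smul, hs]

theorem exists_residue_notMem {n r : ℕ} (hrn : r < n) (p : Fin r → ℤ) :
    ∃ c : ℤ, ∀ b, ¬ (c ≡ p b [ZMOD n]) := by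
  have hn : (0 : ℤ) < n := by omega
  have hcard : (Finset.univ.image fun b => p b % n).card < (Finset.Ico (0 : ℤ) n).card := by
    refine lt_of_le_of_lt Finset.card_image_le ?_
    simpa using hrn
  obtain ⟨c, hc, hc'⟩ := Finset.exists_mem_notMem_of_card_lt_card hcard
  refine ⟨c, fun b hb => hc' ?_⟩
  rw [Finset.mem_Ico] at hc
  refine Finset.mem_image.2 ⟨b, Finset.mem_univ _, ?_⟩
  rw [← hb, Int.emod_eq_of_lt hc.1 hc.2]

theorem bandMinor_comp_add {d r : ℕ} (X : ℤ → Fin d → ℝ) (c : ℤ) (j p : Fin r → ℤ) :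
    bandMinor (fun q => X (q + c)) (fun a => j a - c) (fun a => p a - c) = bandMinor X j p := by
  have h : ∀ i, lam (fun q => X (q + c)) (i - c) = lam X i := by
    intro i
    funext b
    simp only [lam]
    congr 1
    funext a
    split_ifs
    · rfl
    · congr 1; ring
  simp only [bandMinor, h, sub_add_cancel]

/-- The minors of order `r ≤ d`, `r ≡ d mod 2`, of the cyclic band matrix of a totally positive
sequence are nonnegative. -/
theorem bandMinor_nonneg {d r : ℕ} (hr : r ≤ d) (hdr : Even (d + r)) (e : ℕ) :
    ∀ {X : ℤ → Fin d → ℝ}, QuasiPeriodic (d + e) ((-1) ^ (d + 1)) X → SeqTP (d + e) X →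
      ∀ {j p : Fin r → ℤ}, CycInc (d + e) j → CycInc (d + e) p → 0 ≤ bandMinor X j p := by
  rcases Nat.eq_zero_or_pos d with hd | hd
  · intro X _ _ j p _ _
    obtain rfl : r = 0 := by omega
    have : bandMinor X j p = 1 := Matrix.det_isEmpty
    rw [this]; exact zero_le_one
  induction e with
  | zero =>
    intro X hq hX j p hj hp
    obtain ⟨j', hj1, hj2, -, hj4⟩ := bandMinor_eq_of_rows hq hdr hj 0
    obtain ⟨p', hp1, hp2, -, hp4⟩ := bandMinor_eq_of_cols hq hdr hp (d : ℤ)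
    rw [← hj4, ← hp4]
    simp only [Nat.add_zero] at hj2 hp2 hX
    -- For period `d` an entry of the band matrix vanishes unless its row and column agree modulo
    -- `d`. The minor therefore belongs to a positive diagonal matrix or has a zero row.
    by_cases hall : ∀ a, ∃ b, p' b = j' a + d
    · have hsub : Set.range (fun a => j' a + (d : ℤ)) ⊆ Set.range p' := by
        rintro _ ⟨a, rfl⟩; exact hall a
      have hm : StrictMono fun a => j' a + (d : ℤ) := fun a b h => by have := hj1 h; simp; omega
      have heq : (fun a => j' a + (d : ℤ)) = p' := by
        refine (hm.range_inj hp1).1 ?_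
        refine Set.eq_of_subset_of_ncard_le hsub ?_ (Set.finite_range _)
        rw [Set.ncard_range_of_injective hp1.injective, Set.ncard_range_of_injective hm.injective]
      rw [← heq]
      have hdiag : (Matrix.of fun a b : Fin r => lam X (j' a) ⬝ᵥ X (j' b + d)) =
          Matrix.diagonal fun a => lam X (j' a) ⬝ᵥ X (j' a + d) := by
        ext a b
        by_cases hab : a = b
        · subst hab; simp
        · rw [Matrix.diagonal_apply_ne _ hab, Matrix.of_apply]
          have h1 := hj2 a; have h2 := hj2 b
          rcases lt_or_gt_of_ne hab with h | h
          · have := hj1 h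
            have e : X (j' b + d) = (-1 : ℝ) ^ (d + 1) • X (j' b) := hq (j' b)
            rw [e, dotProduct_smul, band_eq_zero (by omega) (by omega), smul_zero]
          · have := hj1 h
            exact band_eq_zero (by omega) (by omega)
      have : bandMinor X j' (fun a => j' a + (d : ℤ)) =
          ∏ a, lam X (j' a) ⬝ᵥ X (j' a + d) := by
        have h := congrArg Matrix.det hdiag
        rw [Matrix.det_diagonal] at h
        exact h
      rw [this]
      exact Finset.prod_nonneg fun a _ => (band_pos hd le_rfl hX le_rfl le_rfl).le
    · push Not at hall
      obtain ⟨a, ha⟩ := hall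
      refine (Matrix.det_eq_zero_of_row_eq_zero (A := Matrix.of fun a b : Fin r =>
        lam X (j' a) ⬝ᵥ X (p' b)) a fun b => ?_).ge
      rw [Matrix.of_apply]
      have h1 := hj2 a; have h2 := hp2 b; have h3 := ha b
      rcases lt_or_gt_of_ne h3 with h | h
      · by_cases h4 : j' a + 1 ≤ p' b
        · exact band_eq_zero h4 h
        · omega
      · have e : X (p' b) = (-1 : ℝ) ^ (d + 1) • X (p' b - d) := by
          rw [← hq (p' b - d)]; simp
        rw [e, dotProduct_smul, band_eq_zero (by omega) (by omega), smul_zero]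
  | succ e ih =>
    intro X hq hX j p hj hp
    -- The minor has `r ≤ d` columns and the period is larger than `d`, so some residue class
    -- contains none of them. After translation by `c + 1` this class sits at the last position of
    -- the period, which is the one that `skip` removes.
    obtain ⟨c, hc⟩ := exists_residue_notMem (show r < d + (e + 1) by omega) p
    obtain ⟨j', hj1, hj2, -, hj4⟩ := bandMinor_eq_of_rows hq hdr hj (c + 1)
    obtain ⟨p', hp1, hp2, hp3, hp4⟩ := bandMinor_eq_of_cols hq hdr hp (c + 1)
    rw [← hj4, ← hp4, ← bandMinor_comp_add X (c + 1)]
    have hp5 : ∀ a, p' a < c + 1 + (d + e : ℕ) := by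
      intro a
      have h1 := hp2 a
      by_contra hcon
      have h2 : p' a = c + (d + (e + 1) : ℕ) := by push_cast at *; omega
      obtain ⟨b, hb⟩ := hp3 a
      refine hc b (Int.ModEq.trans ?_ hb)
      rw [h2]; exact (by simp [Int.modEq_iff_dvd])
    set Y : ℤ → Fin d → ℝ := fun q => X (q + (c + 1)) with hY
    have hYq : QuasiPeriodic (d + e + 1) ((-1) ^ (d + 1)) Y := by
      intro q
      have := hq (q + (c + 1))
      simp only [hY]; rw [← this]; congr 1; push_cast; ring
    have hYp : SeqTP (d + e + 1) Y := by
      intro q hq'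
      refine hX (fun a => q a + (c + 1)) ⟨fun a b h => by have := hq'.1 h; simp; omega, fun a b => ?_⟩
      have := hq'.2 a b; push_cast at *; omega
    have hN : 0 < d + e := by omega
    have hex : ∀ a, ∃ α β : ℝ, 0 ≤ α ∧ 0 ≤ β ∧ (j' a - (c + 1) = 0 → α = 0) ∧
        (j' a - (c + 1) = (d + e : ℕ) → β = 0) ∧ lam Y (j' a - (c + 1)) =
          α • lam (Y ∘ skip (d + e)) (j' a - (c + 1) - 1) +
          β • lam (Y ∘ skip (d + e)) (j' a - (c + 1)) := fun a =>
      exists_lam_eq_skip hd (by omega) hYq hYp (by have := hj2 a; omega)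
        (by have := hj2 a; push_cast at *; omega)
    choose α β hα hβ hα0 hβ0 hlam using hex
    -- The columns of the minor survive the deletion, and every row is a nonnegative combination of
    -- two adjacent rows of the band matrix with the shorter period, to which the induction
    -- hypothesis applies.
    have key := det_rowPair_nonneg (N := (d + e : ℕ)) (A := fun i b =>
        lam (Y ∘ skip (d + e)) i ⬝ᵥ Y (p' b - (c + 1)))
      (j := fun a => j' a - (c + 1)) ?_ (fun a b h => by have := hj1 h; simp; omega)
      (fun a => by have := hj2 a; push_cast at *; omega) hα hβ hα0 hβ0
    · have e1 : bandMinor Y (fun a => j' a - (c + 1)) (fun a => p' a - (c + 1)) = _ :=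
        congrArg Matrix.detRowAlternating (funext fun a => funext fun b => by
          rw [hlam a, add_dotProduct, smul_dotProduct, smul_dotProduct])
      rw [e1]; exact key
    · intro s hs1 hs2
      have := ih (hYq.comp_skip hN) (hYp.comp_skip hN)
        (CycInc.of_mem_Ico (c := 0) hs1 (fun a => by have := hs2 a; push_cast at *; omega))
        (p := fun b => p' b - (c + 1))
        (CycInc.of_mem_Ico (c := 0) (fun a b h => by have := hp1 h; simp; omega)
          (fun a => by have := hp2 a; have := hp5 a; push_cast at *; omega))
      have e2 : ∀ b, (Y ∘ skip (d + e)) (p' b - (c + 1)) = Y (p' b - (c + 1)) := fun b => by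
        rw [Function.comp_apply, skip_of_lt (by have := hp2 b; omega) (by have := hp5 b; omega)]
      simp only [bandMinor, e2] at this
      exact this

/-! ### Signs of maximal minors and crossing pairs -/

/-- The cyclic interval `i, i + 1, …, i + t - 1` in `Fin n`. -/
def cyc {n : ℕ} (i : Fin n) (t : ℕ) : Finset (Fin n) :=
  Finset.univ.filter fun a => ((a : ℤ) - (i : ℤ)) % (n : ℤ) < t

theorem maxMinor_eq {r n : ℕ} (M : Matrix (Fin r) (Fin n) ℝ) (J : Finset (Fin n)) (hJ : J.card = r) :
    maxMinor M J hJ = Matrix.detRowAlternating fun a => M.col (J.orderEmbOfFin hJ a) :=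
  (Matrix.det_transpose _).symm

/-- Moving `u` from the front to its place in increasing order passes exactly the elements of `T`
below `u`. -/
theorem alternating_cons_orderEmbOfFin {n r : ℕ} {E : Type*} [AddCommGroup E] [Module ℝ E]
    (f : E [⋀^Fin (r + 1)]→ₗ[ℝ] ℝ) (v : Fin n → E) {T : Finset (Fin n)} (hT : T.card = r)
    {u : Fin n} (hT' : (insert u T).card = r + 1) :
    f (Matrix.vecCons (v u) fun a => v (T.orderEmbOfFin hT a)) =
      (-1) ^ (T.filter (· < u)).card * f fun a => v ((insert u T).orderEmbOfFin hT' a) := by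
  set q := (insert u T).orderEmbOfFin hT' with hq
  obtain ⟨i, hi⟩ : ∃ i, q i = u := by
    have : u ∈ Set.range q := by
      rw [hq, Finset.range_orderEmbOfFin]; simp
    exact this
  have hT2 : (q ∘ i.succAbove) = T.orderEmbOfFin hT := by
    refine Finset.orderEmbOfFin_unique hT (fun a => ?_)
      (q.strictMono.comp (Fin.strictMono_succAbove i))
    have h1 : q (i.succAbove a) ∈ insert u T := Finset.orderEmbOfFin_mem _ _ _
    refine (Finset.mem_insert.1 h1).resolve_left fun h => ?_
    rw [← hi] at h
    exact Fin.succAbove_ne i a (q.injective h)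
  have hcons : (Matrix.vecCons (v u) fun a => v (T.orderEmbOfFin hT a)) =
      (fun a => v (q a)) ∘ i.cycleRange.symm := by
    have := Fin.cons_removeNth_eq_comp_cycleRange_symm (fun a => v (q a)) i
    rw [← this]
    funext a
    induction a using Fin.cases with
    | zero => simp [hi]
    | succ a => simp [← hT2, Fin.removeNth]
  have hcard : (T.filter (· < u)).card = i := by
    have : T.filter (· < u) = (Finset.Iio i).map q.toEmbedding := by
      ext x
      simp only [Finset.mem_filter, Finset.mem_map, Finset.mem_Iio]
      constructor
      · rintro ⟨hx, hxu⟩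
        have : x ∈ Set.range q := by
          rw [hq, Finset.range_orderEmbOfFin]; simp [hx]
        obtain ⟨b, rfl⟩ := this
        rw [← hi] at hxu
        exact ⟨b, q.lt_iff_lt.1 hxu, rfl⟩
      · rintro ⟨b, hb, rfl⟩
        have h2 : q b < u := by rw [← hi]; exact q.lt_iff_lt.2 hb
        exact ⟨(Finset.mem_insert.1 (Finset.orderEmbOfFin_mem _ _ _)).resolve_left h2.ne, h2⟩
    rw [this, Finset.card_map, Fin.card_Iio]
  rw [hcons, AlternatingMap.map_perm, Equiv.Perm.sign_symm, Fin.sign_cycleRange, hcard,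
    Units.smul_def, zsmul_eq_mul]
  simp

/-- The sign of the order of two elements. -/
def orderSign {n : ℕ} (u w : Fin n) : ℝ := if u < w then 1 else -1

section Cross

variable {n r : ℕ} (v : Fin n → Fin (r + 2) → ℝ) {S : Finset (Fin n)} (hS : S.card = r)

/-- The determinant of `u`, `w` and the vectors indexed by `S`. -/
noncomputable def pairDet (u w : Fin (r + 2) → ℝ) : ℝ :=
  Matrix.detRowAlternating (Matrix.vecCons u (Matrix.vecCons w fun a => v (S.orderEmbOfFin hS a)))

theorem pairDet_eq_curry (u w : Fin (r + 2) → ℝ) : pairDet v hS u w =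
    ((Matrix.detRowAlternating.curryLeft u).curryLeft w) (fun a => v (S.orderEmbOfFin hS a)) := rfl

theorem pairDet_sum_left {ι : Type*} (A : Finset ι) (c : ι → ℝ) (x : ι → Fin (r + 2) → ℝ)
    (w : Fin (r + 2) → ℝ) :
    pairDet v hS (∑ i ∈ A, c i • x i) w = ∑ i ∈ A, c i * pairDet v hS (x i) w := by
  simp only [pairDet_eq_curry, map_sum, map_smul]
  induction A using Finset.cons_induction with
  | empty => simp
  | cons a s ha ih => simp [Finset.sum_cons] at ih ⊢; rw [ih]

theorem pairDet_swap (u w : Fin (r + 2) → ℝ) : pairDet v hS u w = -pairDet v hS w u := by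
  have h := AlternatingMap.map_swap (Matrix.detRowAlternating (n := Fin (r + 2)) (R := ℝ))
    (Matrix.vecCons w (Matrix.vecCons u fun a => v (S.orderEmbOfFin hS a)))
    (show (0 : Fin (r + 2)) ≠ 1 by simp)
  rw [pairDet, pairDet, ← h]
  congr 1
  funext a
  refine Fin.cases ?_ (fun a => ?_) a
  · simp
  · refine Fin.cases ?_ (fun a => ?_) a
    · simp
    · rw [Function.comp_apply, Equiv.swap_apply_of_ne_of_ne (Fin.succ_ne_zero _)
        (by rw [← Fin.succ_zero_eq_one]; exact fun h => Fin.succ_ne_zero _ (Fin.succ_injective _ h))]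
      simp

theorem pairDet_self (u : Fin (r + 2) → ℝ) : pairDet v hS u u = 0 := by
  have := pairDet_swap v hS u u; linarith

theorem pairDet_of_mem {x : Fin n} (hx : x ∈ S) (w : Fin (r + 2) → ℝ) :
    pairDet v hS (v x) w = 0 := by
  have : x ∈ Set.range (S.orderEmbOfFin hS) := by rw [Finset.range_orderEmbOfFin]; exact hx
  obtain ⟨a, rfl⟩ := this
  exact AlternatingMap.map_eq_zero_of_eq _ _ (i := 0) (j := a.succ.succ) (by simp)
    (Fin.succ_ne_zero _).symm

/-- Sorting `w` and then `u` into `S` passes the elements of `S` below each of them, and `u` passes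
`w` as well precisely when `w < u`. -/
theorem pairDet_eq_minor {u w : Fin n} (hw : w ∉ S) (huw : u ≠ w)
    (hc : (insert u (insert w S)).card = r + 2) :
    pairDet v hS (v u) (v w) =
      orderSign u w * ((-1) ^ (S.filter (· < u)).card * (-1) ^ (S.filter (· < w)).card) *
        Matrix.detRowAlternating fun a => v ((insert u (insert w S)).orderEmbOfFin hc a) := by
  have hc1 : (insert w S).card = r + 1 := by rw [Finset.card_insert_of_notMem hw, hS]
  have h1 := alternating_cons_orderEmbOfFin (Matrix.detRowAlternating.curryLeft (v u)) v hS hc1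
  have h2 := alternating_cons_orderEmbOfFin (Matrix.detRowAlternating (n := Fin (r + 2)) (R := ℝ))
    v hc1 hc
  have h3 : pairDet v hS (v u) (v w) = (-1) ^ (S.filter (· < w)).card *
    Matrix.detRowAlternating
      (Matrix.vecCons (v u) fun a => v ((insert w S).orderEmbOfFin hc1 a)) := h1
  rw [h3, h2]
  have h4 : ((-1 : ℝ)) ^ ((insert w S).filter (· < u)).card =
      orderSign u w * (-1) ^ (S.filter (· < u)).card := by
    rw [Finset.filter_insert, orderSign]
    split_ifs with h5 h6 h6
    · exact absurd h5 (not_lt.2 h6.le)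
    · rw [Finset.card_insert_of_notMem (by simp [hw]), pow_succ]; ring
    · rw [one_mul]
    · exact absurd (lt_of_le_of_ne (not_lt.1 h5) huw) h6
  rw [h4]; ring

/-- In the product of the four pair determinants of `a`, `a'` with `b`, `e`, the signs that count
elements of `S` each occur an even number of times and cancel. Nonnegativity of the minors then
makes the product at most zero when the order signs multiply to `-1`. The proportionality
assumptions make it a nonzero square, a contradiction. -/
theorem not_crossing_aux (hv : ∀ (J : Finset (Fin n)) (hJ : J.card = r + 2),
      0 ≤ Matrix.detRowAlternating fun a => v (J.orderEmbOfFin hJ a))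
    {a a' b e : Fin n} (ha : a ∉ S) (ha' : a' ∉ S) (hb : b ∉ S) (he : e ∉ S)
    (hab : a ≠ b) (ha'b : a' ≠ b) (hae : a ≠ e) (ha'e : a' ≠ e) {ρ y : ℝ} (hρ : ρ ≠ 0) (hy : y ≠ 0)
    (h0 : pairDet v hS (v a) (v b) ≠ 0)
    (h1 : ∀ w, pairDet v hS (v a') w = ρ * pairDet v hS (v a) w)
    (h2 : pairDet v hS (v a) (v e) = y * pairDet v hS (v a) (v b))
    (hs : orderSign a b * orderSign a' b * orderSign a e * orderSign a' e = -1) : False := by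
  have card2 : ∀ {u w : Fin n}, u ∉ S → w ∉ S → u ≠ w → (insert u (insert w S)).card = r + 2 := by
    intro u w hu hw huw
    rw [Finset.card_insert_of_notMem (by simp [hu, huw]), Finset.card_insert_of_notMem hw, hS]
  have e1 := pairDet_eq_minor v hS hb hab (card2 ha hb hab)
  have e2 := pairDet_eq_minor v hS hb ha'b (card2 ha' hb ha'b)
  have e3 := pairDet_eq_minor v hS he hae (card2 ha he hae)
  have e4 := pairDet_eq_minor v hS he ha'e (card2 ha' he ha'e)
  have p1 := hv _ (card2 ha hb hab)
  have p2 := hv _ (card2 ha' hb ha'b)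
  have p3 := hv _ (card2 ha he hae)
  have p4 := hv _ (card2 ha' he ha'e)
  set d1 := Matrix.detRowAlternating fun i => v ((insert a (insert b S)).orderEmbOfFin (card2 ha hb hab) i)
  set d2 := Matrix.detRowAlternating fun i => v ((insert a' (insert b S)).orderEmbOfFin (card2 ha' hb ha'b) i)
  set d3 := Matrix.detRowAlternating fun i => v ((insert a (insert e S)).orderEmbOfFin (card2 ha he hae) i)
  set d4 := Matrix.detRowAlternating fun i => v ((insert a' (insert e S)).orderEmbOfFin (card2 ha' he ha'e) i)
  have hpos : 0 < pairDet v hS (v a) (v b) * pairDet v hS (v a') (v b) *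
      (pairDet v hS (v a) (v e) * pairDet v hS (v a') (v e)) := by
    rw [h1, h1, h2]
    have : 0 < (ρ * y * (pairDet v hS (v a) (v b)) ^ 2) ^ 2 := by positivity
    calc (0 : ℝ) < _ := this
      _ = _ := by ring
  have hprod : pairDet v hS (v a) (v b) * pairDet v hS (v a') (v b) *
      (pairDet v hS (v a) (v e) * pairDet v hS (v a') (v e)) = -(d1 * d2 * d3 * d4) := by
    rw [e1, e2, e3, e4]
    have q1 := neg_one_pow_mul_self (S.filter (· < a)).card
    have q2 := neg_one_pow_mul_self (S.filter (· < a')).card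
    have q3 := neg_one_pow_mul_self (S.filter (· < b)).card
    have q4 := neg_one_pow_mul_self (S.filter (· < e)).card
    generalize ((-1 : ℝ)) ^ (S.filter (· < a)).card = s1 at *
    generalize ((-1 : ℝ)) ^ (S.filter (· < a')).card = s2 at *
    generalize ((-1 : ℝ)) ^ (S.filter (· < b)).card = s3 at *
    generalize ((-1 : ℝ)) ^ (S.filter (· < e)).card = s4 at *
    calc _ = (orderSign a b * orderSign a' b * orderSign a e * orderSign a' e) *
        ((s1 * s1) * (s2 * s2) * ((s3 * s3) * (s3 * s3)⁻¹) * (s3 * s3) * (s4 * s4)) *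
        (d1 * d2 * d3 * d4) := by rw [q3]; ring_nf; rw [show s3 ^ 2 = s3 * s3 by ring, q3]; ring
      _ = _ := by rw [hs, q1, q2, q3, q4]; ring
  rw [hprod] at hpos
  have : 0 ≤ d1 * d2 * d3 * d4 := by positivity
  linarith

end Cross

/-! ### Ranks of families, circuits and their gaps -/

/-- The rank of the vectors indexed by `I`. -/
noncomputable def famRank {ι E : Type*} [AddCommGroup E] [Module ℝ E] (v : ι → E) (I : Finset ι) : ℕ :=
  Module.finrank ℝ (Submodule.span ℝ (v '' I))

section FamRank

variable {ι E : Type*} [AddCommGroup E] [Module ℝ E] (v : ι → E)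

theorem famRank_le_card (I : Finset ι) : famRank v I ≤ I.card := by
  classical
  have h := finrank_span_finset_le_card (R := ℝ) (I.image v)
  rw [Finset.coe_image] at h
  exact h.trans Finset.card_image_le

theorem famRank_mono [Module.Finite ℝ E] {I J : Finset ι} (h : I ⊆ J) : famRank v I ≤ famRank v J :=
  Submodule.finrank_mono (Submodule.span_mono (Set.image_mono (by exact_mod_cast h)))

variable {v}

theorem famRank_eq_card {I : Finset ι} (h : LinearIndepOn ℝ v (I : Set ι)) :
    famRank v I = I.card := by
  have h1 := finrank_span_eq_card (R := ℝ) (b := fun x : (I : Set ι) => v x) h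
  rw [famRank, Set.image_eq_range, h1]; simp

theorem exists_linearIndepOn_card_eq (I : Finset ι) : ∃ K ⊆ I, LinearIndepOn ℝ v (K : Set ι) ∧
    K.card = famRank v I ∧ v '' I ⊆ Submodule.span ℝ (v '' K) := by
  classical
  obtain ⟨b, hbI, -, hspan, hli⟩ := exists_linearIndepOn_extension
    (linearIndepOn_empty ℝ v) (Set.empty_subset (I : Set ι))
  have hfin : b.Finite := I.finite_toSet.subset hbI
  refine ⟨hfin.toFinset, by simpa using hbI, by simpa using hli, ?_, by simpa using hspan⟩
  have h1 := famRank_eq_card (v := v) (I := hfin.toFinset) (by simpa using hli)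
  have h2 : Submodule.span ℝ (v '' (hfin.toFinset : Set ι)) = Submodule.span ℝ (v '' (I : Set ι)) := by
    rw [Set.Finite.coe_toFinset]
    exact le_antisymm (Submodule.span_mono (Set.image_mono hbI)) (Submodule.span_le.2 hspan)
  rw [← h1, famRank, famRank, h2]

end FamRank

theorem detRow_ne_zero_iff {k : ℕ} (w : Fin k → Fin k → ℝ) :
    Matrix.detRowAlternating w ≠ 0 ↔ LinearIndependent ℝ w := by
  rw [← isUnit_iff_ne_zero]
  have h1 : IsUnit (Matrix.of w) ↔ IsUnit (Matrix.of w).det := Matrix.isUnit_iff_isUnit_det _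
  exact h1.symm.trans Matrix.linearIndependent_rows_iff_isUnit.symm

section Fam

variable {n k : ℕ} {v : Fin n → Fin k → ℝ}

theorem detRow_orderEmb_ne_zero_iff {J : Finset (Fin n)} (hJ : J.card = k) :
    (Matrix.detRowAlternating fun a => v (J.orderEmbOfFin hJ a)) ≠ 0 ↔
      LinearIndepOn ℝ v (J : Set (Fin n)) := by
  rw [detRow_ne_zero_iff, LinearIndepOn]
  let e : Fin k ≃ (J : Set (Fin n)) := (J.orderIsoOfFin hJ).toEquiv
  rw [← linearIndependent_equiv e]
  rfl

theorem linearIndepOn_of_span_eq_top {J : Finset (Fin n)} (hJ : J.card = k)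
    (h : Submodule.span ℝ (v '' J) = ⊤) : LinearIndepOn ℝ v (J : Set (Fin n)) := by
  rw [LinearIndepOn]
  refine linearIndependent_of_top_le_span_of_card_eq_finrank ?_ (by simp [hJ])
  rw [← Set.image_eq_range, h]

/-- A dependent finite family contains a minimal one, with a relation without zero coefficients. -/
theorem exists_circuit {J : Finset (Fin n)} (hJ : ¬ LinearIndepOn ℝ v (J : Set (Fin n))) :
    ∃ A ⊆ J, ∃ c : Fin n → ℝ, (∀ x ∈ A, c x ≠ 0) ∧ ∑ x ∈ A, c x • v x = 0 ∧ A.Nonempty ∧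
      ∀ x ∈ A, LinearIndepOn ℝ v ((A.erase x : Finset (Fin n)) : Set (Fin n)) := by
  induction J using Finset.strongInduction with
  | H J ih =>
    by_cases h : ∀ x ∈ J, LinearIndepOn ℝ v ((J.erase x : Finset (Fin n)) : Set (Fin n))
    · rw [linearIndepOn_finset_iff] at hJ
      push Not at hJ
      obtain ⟨c, hc, x, hx, hcx⟩ := hJ
      refine ⟨J, subset_rfl, c, ?_, hc, ⟨x, hx⟩, h⟩
      intro y hy hcy
      have h1 := linearIndepOn_finset_iff.1 (h y hy) c (by
        rw [← hc, ← Finset.add_sum_erase J (fun i => c i • v i) hy, hcy]; simp)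
      exact hcx (h1 x (Finset.mem_erase.2 ⟨fun e => hcx (by rw [e, hcy]), hx⟩))
    · push Not at h
      obtain ⟨x, hx, hx'⟩ := h
      obtain ⟨A, hA, h1⟩ := ih _ (Finset.erase_ssubset hx) hx'
      exact ⟨A, hA.trans (Finset.erase_subset _ _), h1⟩

/-- The cyclic predecessor of `e` in `A`. -/
noncomputable def cycPred (A : Finset (Fin n)) (hA : A.Nonempty) (e : Fin n) : Fin n :=
  -- When nothing in `A` lies below `e`, the cyclic order wraps around to the maximum. On the
  -- complement of `A` the fibres of this map are the gaps of `A`.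
  if h : (A.filter (· < e)).Nonempty then (A.filter (· < e)).max' h else A.max' hA

theorem cycPred_mem (A : Finset (Fin n)) (hA : A.Nonempty) (e : Fin n) : cycPred A hA e ∈ A := by
  unfold cycPred
  split_ifs with h
  · exact (Finset.mem_filter.1 (Finset.max'_mem _ h)).1
  · exact Finset.max'_mem _ _

/-- Different predecessors force an element of `A` between `b` and `e`, and the largest such element
is the predecessor of `e`. The predecessor of `b` lies below `b`, or wraps around and then lies
above `e`. So the two predecessors separate `b` from `e` on the circle. -/
theorem cycPred_crossing_of_lt {A : Finset (Fin n)} {hA : A.Nonempty} {b e : Fin n}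
    (hb : b ∉ A) (he : e ∉ A) (hbe : b < e) (h : cycPred A hA b ≠ cycPred A hA e) :
    b < cycPred A hA e ∧ cycPred A hA e < e ∧ (cycPred A hA b < b ∨ e < cycPred A hA b) := by
  have h1 : ∃ x ∈ A, b ≤ x ∧ x < e := by
    by_contra hcon
    push Not at hcon
    have : A.filter (· < b) = A.filter (· < e) := by
      ext x
      simp only [Finset.mem_filter]
      refine and_congr_right fun hx => ⟨fun h => h.trans hbe, fun h => ?_⟩
      by_contra h'
      exact absurd h (not_lt.2 (hcon x hx (not_lt.1 h')))
    exact h (by simp only [cycPred, this])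
  obtain ⟨x, hx, hbx, hxe⟩ := h1
  have hne : (A.filter (· < e)).Nonempty := ⟨x, Finset.mem_filter.2 ⟨hx, hxe⟩⟩
  have ee : cycPred A hA e = (A.filter (· < e)).max' hne := by rw [cycPred, dif_pos hne]
  have h3 : cycPred A hA e < e := by
    rw [ee]; exact (Finset.mem_filter.1 (Finset.max'_mem _ hne)).2
  have h4 : b ≤ cycPred A hA e := by
    rw [ee]; exact hbx.trans (Finset.le_max' _ _ (Finset.mem_filter.2 ⟨hx, hxe⟩))
  have h4' : b < cycPred A hA e :=
    lt_of_le_of_ne h4 fun h' => hb (by rw [h']; exact cycPred_mem A hA e)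
  refine ⟨h4', h3, ?_⟩
  by_cases hb' : (A.filter (· < b)).Nonempty
  · left
    have eb : cycPred A hA b = (A.filter (· < b)).max' hb' := by rw [cycPred, dif_pos hb']
    rw [eb]; exact (Finset.mem_filter.1 (Finset.max'_mem _ hb')).2
  · right
    have eb : cycPred A hA b = A.max' hA := by rw [cycPred, dif_neg hb']
    have h5 : cycPred A hA e ≤ cycPred A hA b := by
      rw [eb]; exact Finset.le_max' _ _ (cycPred_mem A hA e)
    by_contra hcon
    have h6 : cycPred A hA b < e :=
      lt_of_le_of_ne (not_lt.1 hcon) fun h' => he (by rw [← h']; exact cycPred_mem A hA b)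
    have h7 : cycPred A hA b ≤ cycPred A hA e := by
      conv_rhs => rw [ee]
      exact Finset.le_max' _ _ (Finset.mem_filter.2 ⟨cycPred_mem A hA b, h6⟩)
    exact h (le_antisymm h7 h5)

/-- The chord through the two predecessors crosses the chord through `b` and `e`, and for crossing
chords the four order signs multiply to `-1`. -/
theorem orderSign_crossing {A : Finset (Fin n)} {hA : A.Nonempty} {b e : Fin n}
    (hb : b ∉ A) (he : e ∉ A) (h : cycPred A hA b ≠ cycPred A hA e) :
    orderSign (cycPred A hA e) b * orderSign (cycPred A hA b) b *
      orderSign (cycPred A hA e) e * orderSign (cycPred A hA b) e = -1 := by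
  have hne : b ≠ e := fun h' => h (by rw [h'])
  rcases lt_or_gt_of_ne hne with hlt | hlt
  · obtain ⟨h1, h2, h3⟩ := cycPred_crossing_of_lt hb he hlt h
    simp only [orderSign]
    rcases h3 with h3 | h3
    · rw [if_neg h1.not_gt, if_pos h3, if_pos h2, if_pos (h3.trans hlt)]; norm_num
    · rw [if_neg h1.not_gt, if_neg (hlt.trans h3).not_gt, if_pos h2, if_neg h3.not_gt]; norm_num
  · obtain ⟨h1, h2, h3⟩ := cycPred_crossing_of_lt he hb hlt h.symm
    simp only [orderSign]
    rcases h3 with h3 | h3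
    · rw [if_pos (h3.trans hlt), if_pos h2, if_pos h3, if_neg h1.not_gt]; norm_num
    · rw [if_neg h3.not_gt, if_pos h2, if_neg (hlt.trans h3).not_gt, if_neg h1.not_gt]; norm_num

theorem mem_cyc {i a : Fin n} {t : ℕ} : a ∈ cyc i t ↔ ((a : ℤ) - (i : ℤ)) % (n : ℤ) < t := by
  simp [cyc]

theorem cycPos_of_le {i a : Fin n} (h : i ≤ a) :
    ((a : ℤ) - (i : ℤ)) % (n : ℤ) = (a : ℤ) - i := by
  have h' : (i : ℕ) ≤ a := h
  have := a.2
  exact Int.emod_eq_of_lt (by omega) (by omega)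

theorem cycPos_of_lt {i a : Fin n} (h : a < i) :
    ((a : ℤ) - (i : ℤ)) % (n : ℤ) = (a : ℤ) - i + n := by
  have h' : (a : ℕ) < i := h
  have := i.2
  rw [← Int.add_emod_right]
  exact Int.emod_eq_of_lt (by omega) (by omega)

/-- The complement of a gap is a cyclic interval. -/
theorem exists_cyc_eq_compl_gap {A : Finset (Fin n)} (hA : A.Nonempty) {s : Fin n} (hs : s ∈ A) :
    ∃ (i : Fin n) (t : ℕ), t ≤ n ∧ ∀ e, e ∈ cyc i t ↔ ¬ (e ∉ A ∧ cycPred A hA e = s) := by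
  -- The gap after the maximum wraps around, and its complement runs from `min A` to `max A`. Any
  -- other gap lies strictly between `s` and the next element `b` of `A`, so its complement starts
  -- at `b` and has `n - (b - s - 1)` elements.
  by_cases hmax : s = A.max' hA
  · have hle : A.min' hA ≤ s := Finset.min'_le _ _ hs
    have hle' : ((A.min' hA : Fin n) : ℕ) ≤ s := hle
    refine ⟨A.min' hA, s - A.min' hA + 1, by have := s.2; omega, fun e => ?_⟩
    rw [mem_cyc]
    constructor
    · rintro h ⟨he, hg⟩
      rcases lt_or_ge e (A.min' hA) with h1 | h1
      · rw [cycPos_of_lt h1] at h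
        have := s.2
        have h1' : (e : ℕ) < A.min' hA := h1
        push_cast [hle'] at h; omega
      · rw [cycPos_of_le h1] at h
        have h2 : (e : ℕ) ≤ s := by push_cast [hle'] at h; omega
        have h3 : e < s := lt_of_le_of_ne h2 fun h' => he (h' ▸ hs)
        have hne : (A.filter (· < e)).Nonempty := ⟨A.min' hA, Finset.mem_filter.2
          ⟨Finset.min'_mem _ _, lt_of_le_of_ne h1 fun h' => he (h' ▸ Finset.min'_mem _ _)⟩⟩
        rw [cycPred, dif_pos hne] at hg
        have := (Finset.mem_filter.1 (Finset.max'_mem _ hne)).2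
        rw [hg] at this
        exact absurd this h3.not_gt
    · intro h
      by_cases h1 : A.min' hA ≤ e ∧ e ≤ s
      · rw [cycPos_of_le h1.1]
        have h2 : (e : ℕ) ≤ s := h1.2
        push_cast [hle']; omega
      · exfalso
        apply h
        have he : e ∉ A := fun he => h1 ⟨Finset.min'_le _ _ he, hmax ▸ Finset.le_max' _ _ he⟩
        refine ⟨he, ?_⟩
        by_cases h2 : A.min' hA ≤ e
        · have h3 : s < e := not_le.1 fun h3 => h1 ⟨h2, h3⟩
          have hne : (A.filter (· < e)).Nonempty := ⟨s, Finset.mem_filter.2 ⟨hs, h3⟩⟩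
          rw [cycPred, dif_pos hne]
          refine le_antisymm ?_ (Finset.le_max' _ _ (Finset.mem_filter.2 ⟨hs, h3⟩))
          rw [hmax]
          exact Finset.le_max' _ _ (Finset.mem_filter.1 (Finset.max'_mem _ hne)).1
        · have hne : ¬ (A.filter (· < e)).Nonempty := by
            rintro ⟨x, hx⟩
            rw [Finset.mem_filter] at hx
            exact h2 ((Finset.min'_le _ _ hx.1).trans hx.2.le)
          rw [cycPred, dif_neg hne, hmax]
  · have hne : (A.filter (s < ·)).Nonempty := ⟨A.max' hA, Finset.mem_filter.2
      ⟨Finset.max'_mem _ _, lt_of_le_of_ne (Finset.le_max' _ _ hs) hmax⟩⟩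
    obtain ⟨b, hbdef⟩ : ∃ b, b = (A.filter (s < ·)).min' hne := ⟨_, rfl⟩
    have hb : b ∈ A ∧ s < b := by
      rw [hbdef]; exact Finset.mem_filter.1 (Finset.min'_mem _ hne)
    have hbmin : ∀ x ∈ A, s < x → b ≤ x := fun x hx hsx => by
      rw [hbdef]; exact Finset.min'_le _ _ (Finset.mem_filter.2 ⟨hx, hsx⟩)
    have hsb : (s : ℕ) < b := hb.2
    have hbn := b.2
    have hgap : ∀ e, (e ∉ A ∧ cycPred A hA e = s) ↔ (s < e ∧ e < b) := by
      intro e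
      constructor
      · rintro ⟨he, hg⟩
        by_cases hne' : (A.filter (· < e)).Nonempty
        · rw [cycPred, dif_pos hne'] at hg
          have h1 := (Finset.mem_filter.1 (Finset.max'_mem _ hne')).2
          rw [hg] at h1
          refine ⟨h1, not_le.1 fun hbe => ?_⟩
          have h2 : b < e := lt_of_le_of_ne hbe fun h' => he (h' ▸ hb.1)
          have h3 := Finset.le_max' (A.filter (· < e)) b (Finset.mem_filter.2 ⟨hb.1, h2⟩)
          rw [hg] at h3
          exact absurd hb.2 h3.not_gt
        · rw [cycPred, dif_neg hne'] at hg
          exact absurd hg.symm hmax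
      · rintro ⟨h1, h2⟩
        have he : e ∉ A := fun he => absurd (hbmin e he h1) h2.not_ge
        have hne' : (A.filter (· < e)).Nonempty := ⟨s, Finset.mem_filter.2 ⟨hs, h1⟩⟩
        refine ⟨he, ?_⟩
        rw [cycPred, dif_pos hne']
        refine le_antisymm (Finset.max'_le _ _ _ fun x hx => ?_)
          (Finset.le_max' _ _ (Finset.mem_filter.2 ⟨hs, h1⟩))
        rw [Finset.mem_filter] at hx
        exact not_lt.1 fun hsx => absurd (hbmin x hx.1 hsx) (hx.2.trans h2).not_ge
    refine ⟨b, n - (b - s - 1), by omega, fun e => ?_⟩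
    rw [hgap, mem_cyc, not_and_or, not_lt, not_lt]
    have he := e.2
    rcases lt_or_ge e b with h | h
    · rw [cycPos_of_lt h]
      have h' : (e : ℕ) < b := h
      constructor
      · intro h1; left; change (e : ℕ) ≤ s; omega
      · rintro (h1 | h1)
        · have h1' : (e : ℕ) ≤ s := h1
          omega
        · exact absurd h h1.not_gt
    · rw [cycPos_of_le h]
      have h' : (b : ℕ) ≤ e := h
      constructor
      · intro _; exact Or.inr h
      · intro _; omega

end Fam

/-! ### Dependent sets violate a rank condition on a cyclic interval -/

section Positroid

variable {n k : ℕ} {v : Fin n → Fin k → ℝ}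

theorem eq_smul_sum_erase {A : Finset (Fin n)} {c : Fin n → ℝ} (hc : ∑ x ∈ A, c x • v x = 0)
    {a : Fin n} (ha : a ∈ A) (hca : c a ≠ 0) :
    v a = ∑ x ∈ A.erase a, (-(c x / c a)) • v x := by
  rw [← Finset.add_sum_erase A _ ha] at hc
  have h1 : c a • v a = -∑ x ∈ A.erase a, c x • v x := eq_neg_of_add_eq_zero_left hc
  have h2 : v a = (c a)⁻¹ • (c a • v a) := by rw [smul_smul, inv_mul_cancel₀ hca, one_smul]
  rw [h2, h1, smul_neg, Finset.smul_sum, ← Finset.sum_neg_distrib]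
  refine Finset.sum_congr rfl fun x _ => ?_
  rw [smul_smul, ← neg_smul]
  congr 1
  field_simp

/-- Suppose that `b` and `e` lie in different gaps, with predecessors `a'` and `a`. The set `S`
obtained from `B` with `a0` added by removing `a`, `a'` and `b` has `k - 2` elements. Modulo the
vectors of `S`, the relation on `A` makes `v a'` proportional to `v a`. Modulo `v a` and the vectors
of `S`, `v e` is `y b • v b`. These are the hypotheses of `not_crossing_aux`, whereas the chords
cross. -/
theorem cycPred_eq_of_exchange
    (hv : ∀ (J : Finset (Fin n)) (hJ : J.card = k),
      0 ≤ Matrix.detRowAlternating fun a => v (J.orderEmbOfFin hJ a))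
    {A B : Finset (Fin n)} {c : Fin n → ℝ} (hcA : ∀ x ∈ A, c x ≠ 0)
    (hc : ∑ x ∈ A, c x • v x = 0) (hA : A.Nonempty) {a0 : Fin n}
    (hB : A.erase a0 ⊆ B) (ha0B : a0 ∉ B) (hBcard : B.card = k)
    (hBspan : Submodule.span ℝ (v '' B) = ⊤) {b e : Fin n} (hb : b ∈ B) (hbA : b ∉ A) (heA : e ∉ A)
    {y : Fin n → ℝ} (hy : v e = ∑ x ∈ B, y x • v x) (hyb : y b ≠ 0) :
    cycPred A hA b = cycPred A hA e := by
  by_contra hne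
  set a := cycPred A hA e with ha
  set a' := cycPred A hA b with ha'
  have haA : a ∈ A := cycPred_mem _ _ _
  have ha'A : a' ∈ A := cycPred_mem _ _ _
  have hAB : A ⊆ insert a0 B := by
    intro x hx
    by_cases h : x = a0
    · simp [h]
    · exact Finset.mem_insert_of_mem (hB (Finset.mem_erase.2 ⟨h, hx⟩))
  set S := (((insert a0 B).erase b).erase a).erase a' with hSdef
  have hab : a ≠ b := fun h => hbA (h ▸ haA)
  have ha'b : a' ≠ b := fun h => hbA (h ▸ ha'A)
  have hae : a ≠ e := fun h => heA (h ▸ haA)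
  have ha'e : a' ≠ e := fun h => heA (h ▸ ha'A)
  have hScard : S.card + 2 = k := by
    have h1 : (insert a0 B).card = k + 1 := by rw [Finset.card_insert_of_notMem ha0B, hBcard]
    have h2 : b ∈ insert a0 B := Finset.mem_insert_of_mem hb
    have h3 : a ∈ (insert a0 B).erase b := Finset.mem_erase.2 ⟨hab, hAB haA⟩
    have h4 : a' ∈ ((insert a0 B).erase b).erase a :=
      Finset.mem_erase.2 ⟨hne, Finset.mem_erase.2 ⟨ha'b, hAB ha'A⟩⟩
    have h5 := Finset.card_erase_add_one h2
    have h6 := Finset.card_erase_add_one h3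
    have h7 : S.card + 1 = _ := Finset.card_erase_add_one h4
    omega
  obtain ⟨r, rfl⟩ : ∃ r, k = r + 2 := ⟨S.card, hScard.symm⟩
  have hS : S.card = r := by omega
  have memS : ∀ x, x ∈ S ↔ x ≠ a' ∧ x ≠ a ∧ x ≠ b ∧ (x = a0 ∨ x ∈ B) := by
    intro x; simp [hSdef]
  have haS : a ∉ S := fun h => ((memS a).1 h).2.1 rfl
  have ha'S : a' ∉ S := fun h => ((memS a').1 h).1 rfl
  have hbS : b ∉ S := fun h => ((memS b).1 h).2.2.1 rfl
  have hAS : ∀ x ∈ A, x ≠ a → x ≠ a' → x ∈ S := fun x hx h1 h2 =>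
    (memS x).2 ⟨h2, h1, fun h => hbA (h ▸ hx), Finset.mem_insert.1 (hAB hx)⟩
  have h1 : ∀ w, pairDet v hS (v a') w = -(c a / c a') * pairDet v hS (v a) w := by
    intro w
    conv_lhs => rw [eq_smul_sum_erase hc ha'A (hcA a' ha'A), pairDet_sum_left]
    rw [Finset.sum_eq_single a]
    · intro x hx hxa
      rw [Finset.mem_erase] at hx
      rw [pairDet_of_mem v hS (hAS x hx.2 hxa hx.1), mul_zero]
    · intro h
      exact absurd (Finset.mem_erase.2 ⟨fun h' => hne h'.symm, haA⟩) h
  have hρ : -(c a / c a') ≠ 0 := neg_ne_zero.2 (div_ne_zero (hcA a haA) (hcA a' ha'A))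
  have haa' : pairDet v hS (v a') (v a) = 0 := by rw [h1, pairDet_self, mul_zero]
  have h2 : pairDet v hS (v a) (v e) = y b * pairDet v hS (v a) (v b) := by
    rw [pairDet_swap v hS (v a) (v e), hy, pairDet_sum_left, Finset.sum_eq_single b,
      pairDet_swap v hS (v a) (v b)]
    · ring
    · intro x hx hxb
      by_cases hxa : x = a
      · rw [hxa, pairDet_self, mul_zero]
      by_cases hxa' : x = a'
      · rw [hxa', haa', mul_zero]
      rw [pairDet_of_mem v hS ((memS x).2 ⟨hxa', hxa, hxb, Or.inr hx⟩), mul_zero]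
    · intro h; exact absurd hb h
  have hset : insert a (insert b S) = (insert a0 B).erase a' := by
    ext x
    simp only [Finset.mem_insert, Finset.mem_erase, memS]
    constructor
    · rintro (rfl | rfl | h)
      · exact ⟨fun h => hne h.symm, Finset.mem_insert.1 (hAB haA)⟩
      · exact ⟨fun h => ha'b h.symm, Or.inr hb⟩
      · exact ⟨h.1, h.2.2.2⟩
    · rintro ⟨h3, h4⟩
      by_cases hxa : x = a
      · exact Or.inl hxa
      by_cases hxb : x = b
      · exact Or.inr (Or.inl hxb)
      exact Or.inr (Or.inr ⟨h3, hxa, hxb, h4⟩)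
  have hcard : (insert a (insert b S)).card = r + 2 := by
    rw [Finset.card_insert_of_notMem (by simp [haS, hab]), Finset.card_insert_of_notMem hbS, hS]
  -- Any element of `A` can be solved for by means of the relation, so the `k`-set obtained from `B`
  -- with `a0` added by removing `a'` still spans and has a nonzero minor.
  have h0 : pairDet v hS (v a) (v b) ≠ 0 := by
    rw [pairDet_eq_minor v hS hbS hab hcard]
    have h3 : LinearIndepOn ℝ v ((insert a (insert b S) : Finset (Fin n)) : Set (Fin n)) := by
      refine linearIndepOn_of_span_eq_top hcard ?_
      rw [hset, eq_top_iff, ← hBspan, Submodule.span_le]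
      have h4 : ∀ x ∈ (insert a0 B).erase a',
          v x ∈ Submodule.span ℝ (v '' (((insert a0 B).erase a' : Finset (Fin n)) : Set (Fin n))) :=
        fun x hx => Submodule.subset_span ⟨x, hx, rfl⟩
      rintro _ ⟨x, hx, rfl⟩
      by_cases hxa' : x = a'
      · rw [hxa', eq_smul_sum_erase hc ha'A (hcA a' ha'A)]
        refine Submodule.sum_mem _ fun z hz => Submodule.smul_mem _ _ (h4 z ?_)
        rw [Finset.mem_erase] at hz ⊢
        exact ⟨hz.1, hAB hz.2⟩
      · exact h4 x (Finset.mem_erase.2 ⟨hxa', Finset.mem_insert_of_mem hx⟩)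
    refine mul_ne_zero (mul_ne_zero ?_ (by positivity)) ((detRow_orderEmb_ne_zero_iff hcard).2 h3)
    unfold orderSign; split_ifs <;> norm_num
  have heS : e ∉ S := by
    intro h
    rw [pairDet_swap, pairDet_of_mem v hS h, neg_zero] at h2
    exact mul_ne_zero hyb h0 h2.symm
  exact not_crossing_aux v hS hv haS ha'S hbS heS hab ha'b hae ha'e hρ hyb h0 h1 h2
    (orderSign_crossing hbA heA hne)

/-- A dependent `k`-set of columns of a totally nonnegative configuration violates a rank
condition on some cyclic interval. -/
theorem exists_cyc_famRank_lt
    (hv : ∀ (J : Finset (Fin n)) (hJ : J.card = k),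
      0 ≤ Matrix.detRowAlternating fun a => v (J.orderEmbOfFin hJ a))
    (hspan : Submodule.span ℝ (Set.range v) = ⊤) {J : Finset (Fin n)} (hJ : J.card = k)
    (hdep : ¬ LinearIndepOn ℝ v (J : Set (Fin n))) :
    ∃ (i : Fin n) (t : ℕ), t ≤ n ∧ famRank v (cyc i t) < (J ∩ cyc i t).card := by
  obtain ⟨A, hAJ, c, hcA, hc, hA, hAi⟩ := exists_circuit hdep
  obtain ⟨a0, ha0⟩ := id hA
  obtain ⟨B', -, hAB', hBspan', hBli'⟩ := exists_linearIndepOn_extension (hAi a0 ha0)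
    (Set.subset_univ _)
  obtain ⟨B, rfl⟩ : ∃ B : Finset (Fin n), (B : Set (Fin n)) = B' :=
    ⟨B'.toFinite.toFinset, B'.toFinite.coe_toFinset⟩
  have hB : A.erase a0 ⊆ B := by exact_mod_cast hAB'
  have hBspan : Submodule.span ℝ (v '' B) = ⊤ := by
    rw [eq_top_iff, ← hspan, Submodule.span_le, ← Set.image_univ]; exact hBspan'
  have hBcard : B.card = k := by
    rw [← famRank_eq_card hBli', famRank, hBspan, finrank_top, Module.finrank_fin_fun]
  have ha0B : a0 ∉ B := by
    intro h
    have hAB : A ⊆ B := fun x hx => by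
      by_cases hx0 : x = a0
      · exact hx0 ▸ h
      · exact hB (Finset.mem_erase.2 ⟨hx0, hx⟩)
    have hli : LinearIndepOn ℝ v (A : Set (Fin n)) := hBli'.mono (by exact_mod_cast hAB)
    exact hcA a0 ha0 (linearIndepOn_finset_iff.1 hli c hc a0 ha0)
  -- coordinates with respect to `B`
  have hcoord : ∀ e, ∃ y : Fin n → ℝ, v e = ∑ x ∈ B, y x • v x := by
    intro e
    have h1 : v e ∈ Submodule.span ℝ (v '' B) := by rw [hBspan]; trivial
    obtain ⟨y, hy⟩ := (Submodule.mem_span_image_finset_iff_exists_fun ℝ).1 h1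
    refine ⟨fun x => if h : x ∈ B then y ⟨x, h⟩ else 0, ?_⟩
    rw [← hy, ← Finset.sum_coe_sort B]
    simp
  choose y hy using hcoord
  -- The gaps of `A`, indexed by the element of `A` that precedes them.
  set G : Fin n → Finset (Fin n) := fun s =>
    Finset.univ.filter fun e => e ∉ A ∧ cycPred A hA e = s with hG
  have hfib : ∀ K : Finset (Fin n), (K \ A).card = ∑ s ∈ A, (K ∩ G s).card := by
    intro K
    rw [Finset.card_eq_sum_card_fiberwise (f := cycPred A hA) (t := A)
      (fun e _ => cycPred_mem A hA e)]
    refine Finset.sum_congr rfl fun s _ => ?_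
    congr 1
    ext e
    simp [hG, and_assoc]
  -- The vectors outside a gap are combinations of the vectors of `B` outside that gap. For indices
  -- in `A` this is the relation on `A`, since `A` without `a0` lies in `B`. For indices in other
  -- gaps the coordinates along the given gap vanish by `cycPred_eq_of_exchange`.
  have hrank : ∀ s, famRank v (Finset.univ \ G s) ≤ k - (B ∩ G s).card := by
    intro s
    have h1 : v '' ((Finset.univ \ G s : Finset (Fin n)) : Set (Fin n)) ⊆
        Submodule.span ℝ (v '' ((B \ G s : Finset (Fin n)) : Set (Fin n))) := by
      rintro _ ⟨e, he, rfl⟩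
      have he' : e ∈ A ∨ cycPred A hA e ≠ s := by
        have : e ∉ G s := (Finset.mem_sdiff.1 he).2
        simp only [hG, Finset.mem_filter, Finset.mem_univ, true_and, not_and_or, not_not] at this
        exact this
      have hmem : ∀ x ∈ B \ G s,
          v x ∈ Submodule.span ℝ (v '' ((B \ G s : Finset (Fin n)) : Set (Fin n))) :=
        fun x hx => Submodule.subset_span ⟨x, hx, rfl⟩
      by_cases heA : e ∈ A
      · have hsub : A.erase a0 ⊆ B \ G s := fun x hx => Finset.mem_sdiff.2
          ⟨hB hx, fun h => (Finset.mem_filter.1 h).2.1 (Finset.mem_of_mem_erase hx)⟩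
        by_cases he0 : e = a0
        · rw [he0, eq_smul_sum_erase hc ha0 (hcA a0 ha0)]
          exact Submodule.sum_mem _ fun z hz => Submodule.smul_mem _ _ (hmem z (hsub hz))
        · exact hmem e (hsub (Finset.mem_erase.2 ⟨he0, heA⟩))
      · have hes := he'.resolve_left heA
        rw [hy e]
        refine Submodule.sum_mem _ fun x hx => ?_
        by_cases hxG : x ∈ G s
        · have hxG' := (Finset.mem_filter.1 hxG).2
          have : y e x = 0 := by
            by_contra hyx
            exact hes ((cycPred_eq_of_exchange hv hcA hc hA hB ha0B hBcard hBspan hx hxG'.1 heA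
              (hy e) hyx).symm.trans hxG'.2)
          rw [this, zero_smul]; exact Submodule.zero_mem _
        · exact Submodule.smul_mem _ _ (hmem x (Finset.mem_sdiff.2 ⟨hx, hxG⟩))
    have h2 : famRank v (Finset.univ \ G s) ≤ famRank v (B \ G s) :=
      Submodule.finrank_mono (Submodule.span_le.2 h1)
    have h3 := famRank_le_card v (B \ G s)
    have h4 := Finset.card_sdiff_add_card_inter B (G s)
    omega
  -- Both `J` and `B` have `k` elements, but `J` contains `A` whereas `B` misses `a0`. So `B` has
  -- one element more than `J` outside `A`, and in some gap it has more elements than `J`. The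
  -- complement of that gap is the required interval.
  obtain ⟨s, hs, hlt⟩ : ∃ s ∈ A, (J ∩ G s).card < (B ∩ G s).card := by
    apply Finset.exists_lt_of_sum_lt
    rw [← hfib, ← hfib]
    have h1 := Finset.card_sdiff_add_card_inter J A
    have h2 := Finset.card_sdiff_add_card_inter B A
    have h3 : J ∩ A = A := Finset.inter_eq_right.2 hAJ
    have h4 : B ∩ A = A.erase a0 := by
      ext x
      rw [Finset.mem_inter, Finset.mem_erase]
      exact ⟨fun h => ⟨fun h' => ha0B (h' ▸ h.1), h.2⟩,
        fun h => ⟨hB (Finset.mem_erase.2 h), h.2⟩⟩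
    rw [h3] at h1
    rw [h4] at h2
    have := Finset.card_erase_add_one ha0
    omega
  obtain ⟨i, t, ht, hit⟩ := exists_cyc_eq_compl_gap hA hs
  refine ⟨i, t, ht, ?_⟩
  have hI : cyc i t = Finset.univ \ G s := by
    ext e
    rw [hit]; simp [hG]
  rw [hI]
  have h1 := hrank s
  have h2 := Finset.card_sdiff_add_card_inter J (G s)
  have h3 : J ∩ (Finset.univ \ G s) = J \ G s := by ext; simp
  rw [h3]
  have h4 : (B ∩ G s).card ≤ k := hBcard ▸ Finset.card_le_card Finset.inter_subset_left
  omega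

end Positroid

/-! ### Passing between quasi-periodic sequences and matrices -/

theorem QuasiPeriodic.add_mul {n : ℕ} {s : ℝ} (hs : s ≠ 0) {r : ℕ} {X : ℤ → Fin r → ℝ}
    (hX : QuasiPeriodic n s X) (j t : ℤ) : X (j + n * t) = s ^ t • X j := by
  induction t using Int.induction_on with
  | zero => simp
  | succ t ih =>
    rw [zpow_add_one₀ hs, mul_comm (s ^ (t : ℤ)), mul_smul, ← ih, ← hX]
    congr 1; ring
  | pred t ih =>
    have h := hX (j + n * (-t - 1))
    rw [show j + n * (-t - 1) + n = j + (n : ℤ) * (-t) by ring, ih] at h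
    rw [zpow_sub_one₀ hs, mul_comm (s ^ (-t : ℤ)), mul_smul, h, smul_smul, inv_mul_cancel₀ hs, one_smul]

theorem QuasiPeriodic.ext {n : ℕ} (hn : 0 < n) {s : ℝ} (hs : s ≠ 0) {r : ℕ} {X Y : ℤ → Fin r → ℝ}
    (hX : QuasiPeriodic n s X) (hY : QuasiPeriodic n s Y)
    (h : ∀ j : ℤ, 0 ≤ j → j < n → X j = Y j) : X = Y := by
  funext j
  have hn' : (0 : ℤ) < n := by exact_mod_cast hn
  rw [← Int.emod_add_mul_ediv j n, hX.add_mul hs, hY.add_mul hs,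
    h _ (Int.emod_nonneg _ hn'.ne') (Int.emod_lt_of_pos _ hn')]

section ExtCol

variable {r n : ℕ} [NeZero n] (k : ℕ) (U : Matrix (Fin r) (Fin n) ℝ)

theorem extCol_quasiPeriodic : QuasiPeriodic n ((-1) ^ (k + 1)) (extCol k U) := by
  intro j
  have hn : (n : ℤ) ≠ 0 := by exact_mod_cast NeZero.ne n
  simp only [extCol]
  rw [Int.add_emod_right, Int.add_ediv_of_dvd_right (dvd_refl _), Int.ediv_self hn,
    zpow_add_one₀ (neg_one_pow_ne_zero _), smul_smul, mul_comm]

theorem extCol_coe (j : Fin n) : extCol k U (j : ℕ) = U.col j := by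
  have h1 : ((j : ℕ) : ℤ) < n := by exact_mod_cast j.2
  simp only [extCol]
  rw [Int.ediv_eq_zero_of_lt (by positivity) h1, Int.emod_eq_of_lt (by positivity) h1]
  simp

theorem extCol_eq_of_quasiPeriodic {X : ℤ → Fin r → ℝ} (hX : QuasiPeriodic n ((-1) ^ (k + 1)) X)
    (h : ∀ j : Fin n, X (j : ℕ) = U.col j) : extCol k U = X := by
  refine (extCol_quasiPeriodic k U).ext (NeZero.pos n) (neg_one_pow_ne_zero _) hX ?_
  intro j h0 hn
  obtain ⟨i, rfl⟩ := Int.eq_ofNat_of_zero_le h0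
  rw [show ((i : ℕ) : ℤ) = ((⟨i, by omega⟩ : Fin n) : ℕ) from rfl, extCol_coe, h]

end ExtCol

theorem exists_orderEmbOfFin_eq {r n : ℕ} {g : Fin r → Fin n} (hg : StrictMono g) :
    ∃ (J : Finset (Fin n)) (hJ : J.card = r), (J.orderEmbOfFin hJ : Fin r → Fin n) = g := by
  refine ⟨Finset.univ.image g, by simp [Finset.card_image_of_injective _ hg.injective], ?_⟩
  exact (Finset.orderEmbOfFin_unique _ (fun a => by simp) hg).symm

theorem exists_fin_eq_of_strictMono {r n : ℕ} {q : Fin r → ℤ} (hq : StrictMono q)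
    (h : ∀ a, 0 ≤ q a ∧ q a < (0 : ℤ) + n) :
    ∃ (J : Finset (Fin n)) (hJ : J.card = r), ∀ a, q a = ((J.orderEmbOfFin hJ a : Fin n) : ℕ) := by
  have h1 : ∀ a, ∃ b : Fin n, q a = (b : ℕ) := fun a => by
    obtain ⟨i, hi⟩ := Int.eq_ofNat_of_zero_le (h a).1
    exact ⟨⟨i, by have := (h a).2; omega⟩, hi⟩
  choose g hg using h1
  have hgm : StrictMono g := fun a b hab => by
    have := hq hab
    rw [hg, hg] at this
    exact_mod_cast this
  obtain ⟨J, hJ, hJg⟩ := exists_orderEmbOfFin_eq hgm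
  exact ⟨J, hJ, fun a => by rw [hg, hJg]⟩

/-- Every cyclically increasing minor is a minor with columns in `{0, …, n - 1}`. -/
theorem CycInc.exists_finset {r n : ℕ} {q : Fin r → ℤ} (hq : CycInc n q) :
    ∃ (J : Finset (Fin n)) (hJ : J.card = r), (∀ x ∈ J, ∃ a, ((x : ℕ) : ℤ) ≡ q a [ZMOD n]) ∧
      ∀ X : ℤ → Fin r → ℝ, QuasiPeriodic n ((-1) ^ (r + 1)) X →
      seqMinor X q =
        Matrix.detRowAlternating fun a => X ((J.orderEmbOfFin hJ a : Fin n) : ℕ) := by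
  obtain ⟨q', h1, h2, h3, h4⟩ := hq.exists_rotate 0
  obtain ⟨J, hJ, hJq⟩ := exists_fin_eq_of_strictMono h1 h2
  refine ⟨J, hJ, fun x hx => ?_, fun X hX => ?_⟩
  · have : x ∈ Set.range (J.orderEmbOfFin hJ) := by rw [Finset.range_orderEmbOfFin]; exact hx
    obtain ⟨a, rfl⟩ := this
    rw [← hJq]; exact h3 a
  · rw [← h4 X hX, seqMinor]
    simp only [hJq]

theorem cycInc_orderEmbOfFin {r n : ℕ} {J : Finset (Fin n)} (hJ : J.card = r) :
    CycInc n fun a => (((J.orderEmbOfFin hJ a : Fin n) : ℕ) : ℤ) := by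
  refine CycInc.of_mem_Ico (c := 0) (fun a b h => ?_) (fun a => ?_)
  · have : J.orderEmbOfFin hJ a < J.orderEmbOfFin hJ b := (J.orderEmbOfFin hJ).strictMono h
    exact_mod_cast this
  · have := (J.orderEmbOfFin hJ a).2
    omega

section Interval

variable {r n : ℕ} {s : ℝ} {X : ℤ → Fin r → ℝ}

theorem QuasiPeriodic.span_congr (hs : s ≠ 0) (hX : QuasiPeriodic n s X)
    {S T : Set ℤ} (h : ∀ x ∈ S, ∃ y ∈ T, x ≡ y [ZMOD n]) :
    Submodule.span ℝ (X '' S) ≤ Submodule.span ℝ (X '' T) := by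
  rw [Submodule.span_le]
  rintro _ ⟨x, hx, rfl⟩
  obtain ⟨y, hy, hxy⟩ := h x hx
  obtain ⟨t, ht⟩ := (Int.modEq_iff_dvd.1 hxy.symm)
  have : x = y + n * t := by omega
  rw [this, hX.add_mul hs]
  exact Submodule.smul_mem _ _ (Submodule.subset_span ⟨y, hy, rfl⟩)

theorem famRank_Ico_add_mul (hs : s ≠ 0) (hX : QuasiPeriodic n s X) (a b t : ℤ) :
    famRank X (Finset.Ico (a + n * t) (b + n * t)) = famRank X (Finset.Ico a b) := by
  have h : Submodule.span ℝ (X '' (Finset.Ico (a + n * t) (b + n * t) : Finset ℤ)) =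
      Submodule.span ℝ (X '' (Finset.Ico a b : Finset ℤ)) := by
    refine le_antisymm (hX.span_congr hs fun x hx => ?_) (hX.span_congr hs fun x hx => ?_)
    · rw [Finset.mem_coe, Finset.mem_Ico] at hx
      refine ⟨x - n * t, by rw [Finset.mem_coe, Finset.mem_Ico]; omega, ?_⟩
      exact Int.modEq_iff_dvd.2 ⟨-t, by ring⟩
    · rw [Finset.mem_coe, Finset.mem_Ico] at hx
      refine ⟨x + n * t, by rw [Finset.mem_coe, Finset.mem_Ico]; omega, ?_⟩
      exact Int.modEq_iff_dvd.2 ⟨t, by ring⟩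
  rw [famRank, famRank, h]

/-- Wrapping around the circle multiplies vectors by nonzero scalars only, so a cyclic interval of
columns has the rank of an interval of integers. -/
theorem famRank_cyc (hs : s ≠ 0) (hX : QuasiPeriodic n s X) (i : Fin n) (t : ℕ) :
    famRank (fun p : Fin n => X ((p : ℕ) : ℤ)) (cyc i t) =
      famRank X (Finset.Ico ((i : ℕ) : ℤ) ((i : ℕ) + t)) := by
  have hn : (0 : ℤ) < n := by have := i.2; omega
  have himg : (fun p : Fin n => X ((p : ℕ) : ℤ)) '' (cyc i t : Finset (Fin n)) =
      X '' ((fun p : Fin n => ((p : ℕ) : ℤ)) '' (cyc i t : Finset (Fin n))) := by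
    rw [Set.image_image]
  have h : Submodule.span ℝ ((fun p : Fin n => X ((p : ℕ) : ℤ)) '' (cyc i t : Finset (Fin n))) =
      Submodule.span ℝ (X '' (Finset.Ico ((i : ℕ) : ℤ) ((i : ℕ) + t) : Finset ℤ)) := by
    rw [himg]
    refine le_antisymm (hX.span_congr hs ?_) (hX.span_congr hs ?_)
    · rintro _ ⟨p, hp, rfl⟩
      rw [Finset.mem_coe, mem_cyc] at hp
      have h0 := Int.emod_nonneg ((p : ℤ) - (i : ℤ)) hn.ne'
      refine ⟨(i : ℕ) + ((p : ℤ) - (i : ℤ)) % n, ?_, ?_⟩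
      · rw [Finset.mem_coe, Finset.mem_Ico]; omega
      · refine Int.ModEq.symm ?_
        calc ((i : ℕ) : ℤ) + ((p : ℤ) - (i : ℤ)) % n ≡ (i : ℕ) + ((p : ℤ) - (i : ℤ)) [ZMOD n] :=
              Int.ModEq.add_left _ (Int.mod_modEq _ _)
          _ = _ := by ring
    · intro x hx
      rw [Finset.mem_coe, Finset.mem_Ico] at hx
      have h0 := Int.emod_nonneg x hn.ne'
      have h1 := Int.emod_lt_of_pos x hn
      obtain ⟨y, hy⟩ := Int.eq_ofNat_of_zero_le h0
      refine ⟨y, ⟨⟨y, by omega⟩, ?_, rfl⟩, ?_⟩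
      · rw [Finset.mem_coe, mem_cyc]
        have h2 : ((y : ℤ) - (i : ℕ)) % n = (x - (i : ℕ)) % n := by
          rw [← hy]; exact Int.ModEq.sub_right _ (Int.mod_modEq x n)
        change ((y : ℤ) - (i : ℕ)) % n < t
        rw [h2]
        have h3 : 0 ≤ (x - ((i : ℕ) : ℤ)) / n := Int.ediv_nonneg (by omega) hn.le
        have h4 := Int.emod_add_mul_ediv (x - ((i : ℕ) : ℤ)) n
        nlinarith
      · rw [← hy]; exact (Int.mod_modEq x n).symm
  rw [famRank, famRank, h]

end Interval

theorem linearIndepOn_Ico_of_seqMinor {r : ℕ} {X : ℤ → Fin r → ℝ} {j : ℤ}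
    (h : seqMinor X (fun a : Fin r => j + (a : ℕ)) ≠ 0) :
    LinearIndepOn ℝ X (Finset.Ico j (j + r) : Finset ℤ) := by
  have h1 : LinearIndependent ℝ fun a : Fin r => X (j + (a : ℕ)) := (detRow_ne_zero_iff _).1 h
  have hinj : Function.Injective fun a : Fin r => j + ((a : ℕ) : ℤ) := fun a b hab => by
    simp at hab; exact Fin.ext hab
  have h2 : ((Finset.Ico j (j + r) : Finset ℤ) : Set ℤ) =
      Set.range fun a : Fin r => j + ((a : ℕ) : ℤ) := by
    ext x
    simp only [Finset.coe_Ico, Set.mem_Ico, Set.mem_range]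
    constructor
    · rintro ⟨h1, h2⟩
      obtain ⟨y, hy⟩ := Int.eq_ofNat_of_zero_le (show 0 ≤ x - j by omega)
      exact ⟨⟨y, by omega⟩, by simp; omega⟩
    · rintro ⟨a, rfl⟩
      have := a.2
      omega
  rw [h2]
  exact (linearIndepOn_range_iff hinj X).2 h1

theorem card_cyc {n : ℕ} (i : Fin n) {t : ℕ} : (cyc i t).card ≤ t := by
  have hn : (0 : ℤ) < n := by have := i.2; omega
  have : (cyc i t).card ≤ (Finset.Ico (0 : ℤ) t).card := by
    refine Finset.card_le_card_of_injOn (fun a => ((a : ℤ) - (i : ℤ)) % (n : ℤ)) ?_ ?_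
    · intro a ha
      rw [Finset.mem_coe, mem_cyc] at ha
      rw [Finset.mem_coe, Finset.mem_Ico]
      exact ⟨Int.emod_nonneg _ hn.ne', ha⟩
    · intro a _ b _ hab
      have h1 : ((a : ℤ) - (i : ℤ)) ≡ ((b : ℤ) - (i : ℤ)) [ZMOD n] := hab
      have h2 : (a : ℤ) ≡ b [ZMOD n] := by simpa using h1.add_right (i : ℤ)
      have ha := a.2
      have hb := b.2
      have h3 : (a : ℤ) = b := by
        rw [Int.ModEq, Int.emod_eq_of_lt (by omega) (by omega),
          Int.emod_eq_of_lt (by omega) (by omega)] at h2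
        exact h2
      exact Fin.ext (by exact_mod_cast h3)
  simpa using this

/-- A totally nonnegative sequence with nonvanishing consecutive minors is totally positive. -/
theorem SeqTNN.seqTP {r n : ℕ} (hrn : r ≤ n) {X : ℤ → Fin r → ℝ}
    (hqp : QuasiPeriodic n ((-1) ^ (r + 1)) X) (hX : SeqTNN n X)
    (hcons : ∀ j : ℤ, seqMinor X (fun a : Fin r => j + (a : ℕ)) ≠ 0) : SeqTP n X := by
  intro q hq
  refine lt_of_le_of_ne (hX q hq) fun h0 => ?_
  obtain ⟨J, hJ, -, hJX⟩ := hq.exists_finset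
  rw [hJX X hqp] at h0
  set v : Fin n → Fin r → ℝ := fun p => X ((p : ℕ) : ℤ) with hv
  have hdep : ¬ LinearIndepOn ℝ v (J : Set (Fin n)) := by
    rw [← detRow_orderEmb_ne_zero_iff hJ, not_not]; exact h0.symm
  have hnonneg : ∀ (J : Finset (Fin n)) (hJ : J.card = r),
      0 ≤ Matrix.detRowAlternating fun a => v (J.orderEmbOfFin hJ a) := fun J hJ =>
    hX _ (cycInc_orderEmbOfFin hJ)
  have hs : ((-1 : ℝ)) ^ (r + 1) ≠ 0 := neg_one_pow_ne_zero _
  have hli := fun j => linearIndepOn_Ico_of_seqMinor (hcons j)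
  have hspan : Submodule.span ℝ (Set.range v) = ⊤ := by
    apply Submodule.eq_top_of_finrank_eq
    rw [Module.finrank_fin_fun]
    refine le_antisymm ?_ ?_
    · exact (Submodule.finrank_le _).trans_eq (Module.finrank_fin_fun ℝ)
    · have h1 := famRank_eq_card (hli 0)
      rw [Int.card_Ico] at h1
      have h2 : Submodule.span ℝ (X '' (Finset.Ico (0 : ℤ) (0 + r) : Finset ℤ)) ≤
          Submodule.span ℝ (Set.range v) := by
        refine Submodule.span_mono ?_
        rintro _ ⟨x, hx, rfl⟩
        rw [Finset.mem_coe, Finset.mem_Ico] at hx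
        obtain ⟨y, rfl⟩ := Int.eq_ofNat_of_zero_le hx.1
        exact ⟨⟨y, by omega⟩, rfl⟩
      have h3 := Submodule.finrank_mono h2
      rw [famRank] at h1
      omega
  -- A zero minor would give an interval of rank smaller than the number of its elements in an
  -- `r`-set. The nonzero consecutive minors give an interval of length `t` the rank `t` when `t ≤
  -- r`, and rank at least `r` beyond that.
  obtain ⟨i, t, -, hlt⟩ := exists_cyc_famRank_lt hnonneg hspan hJ hdep
  rw [famRank_cyc hs hqp] at hlt
  have hJi : (J ∩ cyc i t).card ≤ r := hJ ▸ Finset.card_le_card Finset.inter_subset_left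
  have hJt : (J ∩ cyc i t).card ≤ t := (Finset.card_le_card Finset.inter_subset_right).trans (card_cyc i)
  rcases le_total t r with htr | htr
  · have h1 : LinearIndepOn ℝ X (Finset.Ico ((i : ℕ) : ℤ) ((i : ℕ) + t) : Finset ℤ) :=
      (hli (i : ℕ)).mono (by
        rw [Finset.coe_subset]; exact Finset.Ico_subset_Ico_right (by omega))
    rw [famRank_eq_card h1, Int.card_Ico] at hlt
    omega
  · have h1 := famRank_mono X (I := Finset.Ico ((i : ℕ) : ℤ) ((i : ℕ) + r))
      (J := Finset.Ico ((i : ℕ) : ℤ) ((i : ℕ) + t)) (Finset.Ico_subset_Ico_right (by omega))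
    rw [famRank_eq_card (hli (i : ℕ)), Int.card_Ico] at h1
    omega

/-! ### Minors of an orthogonal complement -/

section Duality

variable {n r s : ℕ} {x : Fin n → Fin r → ℝ} {w : Fin n → Fin s → ℝ}

theorem dotProduct_sum_orth
    (horth : ∀ i c, ∑ p : Fin n, (-1 : ℝ) ^ (p : ℕ) * (x p i * w p c) = 0)
    (ζ : Fin r → ℝ) : ∑ p : Fin n, ((-1 : ℝ) ^ (p : ℕ) * (ζ ⬝ᵥ x p) : ℝ) • w p = 0 := by
  funext c
  rw [Finset.sum_apply, Pi.zero_apply]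
  have : ∀ p : Fin n, (((-1 : ℝ) ^ (p : ℕ) * (ζ ⬝ᵥ x p) : ℝ) • w p) c =
      ∑ i, ζ i * ((-1 : ℝ) ^ (p : ℕ) * (x p i * w p c)) := by
    intro p
    rw [Pi.smul_apply, smul_eq_mul, dotProduct, Finset.mul_sum, Finset.sum_mul]
    exact Finset.sum_congr rfl fun i _ => by ring
  simp only [this]
  rw [Finset.sum_comm]
  refine Finset.sum_eq_zero fun i _ => ?_
  rw [← Finset.mul_sum, horth, mul_zero]

/-- A vector `μ` orthogonal to the columns of `w` in `J` yields a linear relation among the vectors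
of `x` outside `J`. These are `r` independent vectors, so `μ` is orthogonal to all columns of `w`.
-/
theorem dual_minor_ne_zero (hrs : r + s = n)
    (hx : ∀ (J : Finset (Fin n)) (hJ : J.card = r),
      0 < Matrix.detRowAlternating fun a => x (J.orderEmbOfFin hJ a))
    (horth : ∀ i c, ∑ p : Fin n, (-1 : ℝ) ^ (p : ℕ) * (x p i * w p c) = 0)
    (hw : ∀ μ : Fin s → ℝ, (∀ p, w p ⬝ᵥ μ = 0) → μ = 0) (J : Finset (Fin n)) (hJ : J.card = s) :
    (Matrix.detRowAlternating fun a => w (J.orderEmbOfFin hJ a)) ≠ 0 := by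
  intro h0
  obtain ⟨μ, hμ, hμ0⟩ := Matrix.exists_mulVec_eq_zero_iff.2
    (show (Matrix.of fun a => w (J.orderEmbOfFin hJ a)).det = 0 from h0)
  have hJ0 : ∀ p ∈ J, w p ⬝ᵥ μ = 0 := by
    intro p hp
    have : p ∈ Set.range (J.orderEmbOfFin hJ) := by rw [Finset.range_orderEmbOfFin]; exact hp
    obtain ⟨a, rfl⟩ := this
    exact congrFun hμ0 a
  have hsum : ∑ p ∈ Jᶜ, ((-1 : ℝ) ^ (p : ℕ) * (w p ⬝ᵥ μ) : ℝ) • x p = 0 := by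
    have h1 : ∑ p : Fin n, ((-1 : ℝ) ^ (p : ℕ) * (w p ⬝ᵥ μ) : ℝ) • x p = 0 := by
      have := dotProduct_sum_orth (x := w) (w := x) (fun c i => by
        rw [← horth i c]; exact Finset.sum_congr rfl fun p _ => by ring) μ
      rw [← this]
      exact Finset.sum_congr rfl fun p _ => by rw [dotProduct_comm]
    rw [← h1]
    refine Finset.sum_subset (Finset.subset_univ _) fun p _ hp => ?_
    rw [Finset.mem_compl, not_not] at hp
    rw [hJ0 p hp, mul_zero, zero_smul]
  have hc : Jᶜ.card = r := by rw [Finset.card_compl, Fintype.card_fin, hJ]; omega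
  have hli := (detRow_orderEmb_ne_zero_iff (v := x) hc).1 (hx Jᶜ hc).ne'
  have hz := linearIndepOn_finset_iff.1 hli _ hsum
  apply hμ
  refine hw μ fun p => ?_
  by_cases hp : p ∈ J
  · exact hJ0 p hp
  · exact (mul_eq_zero.1 (hz p (Finset.mem_compl.2 hp))).resolve_left
      (pow_ne_zero _ (by norm_num))

theorem exists_vecCons_linear {t : ℕ} (rest : Fin t → Fin (t + 1) → ℝ) :
    ∃ L : (Fin (t + 1) → ℝ) →ₗ[ℝ] ℝ,
      ∀ y, Matrix.detRowAlternating (Matrix.vecCons y rest) = L y :=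
  ⟨{ toFun := fun y => Matrix.detRowAlternating (Matrix.vecCons y rest)
     map_add' := fun _ _ => AlternatingMap.map_vecCons_add _ _ _ _
     map_smul' := fun _ _ => AlternatingMap.map_vecCons_smul _ _ _ _ }, fun _ => rfl⟩

theorem exists_dotProduct_eq {d : ℕ} (L : (Fin d → ℝ) →ₗ[ℝ] ℝ) : ∃ ζ : Fin d → ℝ,
    ∀ y, L y = ζ ⬝ᵥ y := by
  refine ⟨fun i => L (fun j => if i = j then 1 else 0), fun y => ?_⟩
  rw [LinearMap.pi_apply_eq_sum_univ L y, dotProduct]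
  exact Finset.sum_congr rfl fun i _ => by rw [smul_eq_mul, mul_comm]

theorem vecCons_orderEmb_eq_zero {t : ℕ} (v : Fin n → Fin (t + 1) → ℝ) {T : Finset (Fin n)}
    (hT : T.card = t) {p : Fin n} (hp : p ∈ T) :
    Matrix.detRowAlternating (Matrix.vecCons (v p) fun a => v (T.orderEmbOfFin hT a)) = 0 := by
  have : p ∈ Set.range (T.orderEmbOfFin hT) := by rw [Finset.range_orderEmbOfFin]; exact hp
  obtain ⟨a, rfl⟩ := this
  exact AlternatingMap.map_eq_zero_of_eq _ _ (i := 0) (j := a.succ) (by simp)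
    (Fin.succ_ne_zero a).symm

/-- Let `R` be the complement of `T` together with `u` and `v`. Apply the orthogonality relation to
the linear forms `det (·, x on R)` and `det (·, w on T)`; only the terms `p = u` and `p = v`
survive. Everything below `u` belongs to `R` or `T`, so the sorting signs at `u` cancel `(-1) ^ u`.
Below `v` exactly `u` is missing from `R` and `T`, which leaves one extra sign and turns the
vanishing sum into an equality of positive multiples. -/
theorem dual_minor_exchange (hrs : r + s = n)
    (hx : ∀ (J : Finset (Fin n)) (hJ : J.card = r),
      0 < Matrix.detRowAlternating fun a => x (J.orderEmbOfFin hJ a))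
    (horth : ∀ i c, ∑ p : Fin n, (-1 : ℝ) ^ (p : ℕ) * (x p i * w p c) = 0)
    {T : Finset (Fin n)} {u v : Fin n} (hu : u ∉ T) (hv : v ∉ T) (huv : u < v)
    (hc1 : (insert u T).card = s) (hc2 : (insert v T).card = s) :
    ∃ α β : ℝ, 0 < α ∧ 0 < β ∧
      α * (Matrix.detRowAlternating fun a => w ((insert u T).orderEmbOfFin hc1 a)) =
      β * Matrix.detRowAlternating fun a => w ((insert v T).orderEmbOfFin hc2 a) := by
  obtain ⟨s', rfl⟩ : ∃ s', s = s' + 1 := ⟨T.card, by rw [← hc1, Finset.card_insert_of_notMem hu]⟩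
  have hT : T.card = s' := by rw [Finset.card_insert_of_notMem hu] at hc1; omega
  have huvT : u ∉ insert v T := by simp [hu, huv.ne]
  obtain ⟨R, hR⟩ : ∃ R, R = (insert u (insert v T))ᶜ := ⟨_, rfl⟩
  have hRc : R.card + (s' + 2) = n := by
    have := Finset.card_add_card_compl (insert u (insert v T))
    rw [← hR, Finset.card_insert_of_notMem huvT, Finset.card_insert_of_notMem hv, hT,
      Fintype.card_fin] at this
    omega
  obtain ⟨r', rfl⟩ : ∃ r', r = r' + 1 := ⟨R.card, by omega⟩
  have hRr : R.card = r' := by omega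
  have memR : ∀ p, p ∈ R ↔ p ≠ u ∧ p ≠ v ∧ p ∉ T := by intro p; simp [hR]
  have huR : u ∉ R := fun h => ((memR u).1 h).1 rfl
  have hvR : v ∉ R := fun h => ((memR v).1 h).2.1 rfl
  have hcu : (insert u R).card = r' + 1 := by rw [Finset.card_insert_of_notMem huR, hRr]
  have hcv : (insert v R).card = r' + 1 := by rw [Finset.card_insert_of_notMem hvR, hRr]
  obtain ⟨F, hF⟩ := exists_vecCons_linear fun a => x (R.orderEmbOfFin hRr a)
  obtain ⟨G, hG⟩ := exists_vecCons_linear fun a => w (T.orderEmbOfFin hT a)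
  obtain ⟨ζ, hζ⟩ := exists_dotProduct_eq F
  have h0 : ∑ p : Fin n, (-1 : ℝ) ^ (p : ℕ) * F (x p) * G (w p) = 0 := by
    have := congrArg G (dotProduct_sum_orth horth ζ)
    simpa only [map_sum, map_smul, map_zero, smul_eq_mul, ← hζ] using this
  have h1 : ∑ p ∈ {u, v}, (-1 : ℝ) ^ ((p : Fin n) : ℕ) * F (x p) * G (w p) = 0 := by
    rw [← h0]
    refine Finset.sum_subset (Finset.subset_univ _) fun p _ hp => ?_
    simp only [Finset.mem_insert, Finset.mem_singleton, not_or] at hp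
    by_cases hpT : p ∈ T
    · rw [← hG, vecCons_orderEmb_eq_zero w hT hpT, mul_zero]
    · rw [← hF, vecCons_orderEmb_eq_zero x hRr ((memR p).2 ⟨hp.1, hp.2, hpT⟩), mul_zero, zero_mul]
  have cntu : (R.filter (· < u)).card + (T.filter (· < u)).card = (u : ℕ) := by
    rw [← Finset.card_union_of_disjoint]
    · rw [← Finset.filter_union, ← Fin.card_Iio u]
      congr 1
      ext p
      simp only [Finset.mem_filter, Finset.mem_union, memR, Finset.mem_Iio]
      constructor
      · exact fun h => h.2
      · intro h
        refine ⟨?_, h⟩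
        by_cases hp : p ∈ T
        · exact Or.inr hp
        · exact Or.inl ⟨h.ne, (h.trans huv).ne, hp⟩
    · exact (Finset.disjoint_left.2 fun p hp => ((memR p).1 hp).2.2).mono
        (Finset.filter_subset _ _) (Finset.filter_subset _ _)
  have cntv : (R.filter (· < v)).card + (T.filter (· < v)).card + 1 = (v : ℕ) := by
    rw [← Finset.card_union_of_disjoint, ← Finset.filter_union,
      ← Finset.card_insert_of_notMem (a := u), ← Fin.card_Iio v]
    · congr 1
      ext p
      simp only [Finset.mem_insert, Finset.mem_filter, Finset.mem_union, memR, Finset.mem_Iio]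
      constructor
      · rintro (rfl | h)
        · exact huv
        · exact h.2
      · intro h
        by_cases hpu : p = u
        · exact Or.inl hpu
        refine Or.inr ⟨?_, h⟩
        by_cases hp : p ∈ T
        · exact Or.inr hp
        · exact Or.inl ⟨hpu, h.ne, hp⟩
    · simp [huR, hu]
    · exact (Finset.disjoint_left.2 fun p hp => ((memR p).1 hp).2.2).mono
        (Finset.filter_subset _ _) (Finset.filter_subset _ _)
  rw [Finset.sum_pair huv.ne, ← hF, ← hF, ← hG, ← hG,
    alternating_cons_orderEmbOfFin _ x hRr hcu, alternating_cons_orderEmbOfFin _ x hRr hcv,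
    alternating_cons_orderEmbOfFin _ w hT hc1, alternating_cons_orderEmbOfFin _ w hT hc2] at h1
  refine ⟨_, _, hx _ hcu, hx _ hcv, ?_⟩
  generalize (Matrix.detRowAlternating fun a => w ((insert u T).orderEmbOfFin hc1 a)) = A at *
  generalize (Matrix.detRowAlternating fun a => w ((insert v T).orderEmbOfFin hc2 a)) = B at *
  generalize (Matrix.detRowAlternating fun a => x ((insert u R).orderEmbOfFin hcu a)) = C at *
  generalize (Matrix.detRowAlternating fun a => x ((insert v R).orderEmbOfFin hcv a)) = D at *
  have e1 : (-1 : ℝ) ^ (u : ℕ) * (-1) ^ (R.filter (· < u)).card * (-1) ^ (T.filter (· < u)).card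
      = 1 := by
    rw [mul_assoc, ← pow_add, cntu, neg_one_pow_mul_self]
  have e2 : (-1 : ℝ) ^ (v : ℕ) * (-1) ^ (R.filter (· < v)).card * (-1) ^ (T.filter (· < v)).card
      = -1 := by
    rw [mul_assoc, ← pow_add, ← cntv, pow_succ]
    linear_combination -neg_one_pow_mul_self
      ((R.filter (· < v)).card + (T.filter (· < v)).card)
  linear_combination h1 - C * A * e1 - D * B * e2

/-- One element of `J` at a time is exchanged for an element of `J'`. The exchange relation
preserves the sign of the minor. -/
theorem dual_minor_mul_pos (hrs : r + s = n)
    (hx : ∀ (J : Finset (Fin n)) (hJ : J.card = r),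
      0 < Matrix.detRowAlternating fun a => x (J.orderEmbOfFin hJ a))
    (horth : ∀ i c, ∑ p : Fin n, (-1 : ℝ) ^ (p : ℕ) * (x p i * w p c) = 0)
    (hw : ∀ μ : Fin s → ℝ, (∀ p, w p ⬝ᵥ μ = 0) → μ = 0) {J J' : Finset (Fin n)}
    (hJ : J.card = s) (hJ' : J'.card = s) :
    0 < (Matrix.detRowAlternating fun a => w (J.orderEmbOfFin hJ a)) *
      Matrix.detRowAlternating fun a => w (J'.orderEmbOfFin hJ' a) := by
  obtain ⟨N, hN⟩ : ∃ N, (J \ J').card = N := ⟨_, rfl⟩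
  induction N generalizing J with
  | zero =>
    have hsub : J ⊆ J' := Finset.sdiff_eq_empty_iff_subset.1 (Finset.card_eq_zero.1 hN)
    obtain rfl := Finset.eq_of_subset_of_card_le hsub (by omega)
    exact mul_self_pos.2 (dual_minor_ne_zero hrs hx horth hw J hJ)
  | succ N ih =>
    obtain ⟨u, hu⟩ : (J \ J').Nonempty := Finset.card_pos.1 (by omega)
    have hcard : (J' \ J).card = (J \ J').card := by
      have h1 := Finset.card_sdiff_add_card_inter J J'
      have h2 := Finset.card_sdiff_add_card_inter J' J
      rw [Finset.inter_comm] at h2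
      omega
    obtain ⟨v, hv⟩ : (J' \ J).Nonempty := Finset.card_pos.1 (by omega)
    rw [Finset.mem_sdiff] at hu hv
    obtain ⟨T, hT, huT⟩ : ∃ T, insert u T = J ∧ u ∉ T :=
      ⟨J.erase u, Finset.insert_erase hu.1, Finset.notMem_erase u J⟩
    subst hT
    have hvT : v ∉ T := fun h => hv.2 (Finset.mem_insert_of_mem h)
    have hc2 : (insert v T).card = s := by
      rw [Finset.card_insert_of_notMem hvT, ← hJ, Finset.card_insert_of_notMem huT]
    have huv : u ≠ v := fun h => hu.2 (h ▸ hv.1)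
    have hN' : (insert v T \ J').card = N := by
      rw [Finset.insert_sdiff_of_mem _ hv.1]
      rw [Finset.insert_sdiff_of_notMem _ hu.2, Finset.card_insert_of_notMem] at hN
      · omega
      · exact fun h => huT (Finset.mem_sdiff.1 h).1
    have h1 := ih hc2 hN'
    obtain ⟨α, β, hα, hβ, h⟩ : ∃ α β : ℝ, 0 < α ∧ 0 < β ∧
        α * (Matrix.detRowAlternating fun a => w ((insert u T).orderEmbOfFin hJ a)) =
        β * Matrix.detRowAlternating fun a => w ((insert v T).orderEmbOfFin hc2 a) := by
      rcases huv.lt_or_gt with huv | huv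
      · exact dual_minor_exchange hrs hx horth huT hvT huv hJ hc2
      · obtain ⟨α, β, hα, hβ, h⟩ := dual_minor_exchange hrs hx horth hvT huT huv hc2 hJ
        exact ⟨β, α, hβ, hα, h.symm⟩
    have h2 := mul_pos hβ h1
    rw [← mul_assoc, ← h, mul_assoc] at h2
    exact (mul_pos_iff_of_pos_left hα).1 h2

end Duality

/-! ### Applying the band matrix to a totally nonnegative sequence -/

theorem det_pos_of_triangular {r : ℕ} {M : Matrix (Fin r) (Fin r) ℝ}
    (h0 : ∀ a b : Fin r, b < a → M a b = 0) (hd : ∀ a, 0 < M a a) : 0 < M.det := by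
  rw [Matrix.det_of_isUpperTriangular fun a b h => h0 a b h]
  exact Finset.prod_pos fun a _ => hd a

theorem sum_period {M : Type*} [AddCommMonoid M] {n : ℕ} {f : ℤ → M} (hf : ∀ p, f (p + n) = f p)
    (c : ℤ) : ∑ p : Fin n, f (c + (p : ℕ)) = ∑ p : Fin n, f (p : ℕ) := by
  have step : ∀ c : ℤ, ∑ p : Fin n, f (c + 1 + (p : ℕ)) = ∑ p : Fin n, f (c + (p : ℕ)) := by
    intro c
    rw [Fin.sum_univ_eq_sum_range fun p : ℕ => f (c + 1 + p),
      Fin.sum_univ_eq_sum_range fun p : ℕ => f (c + p)]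
    cases n with
    | zero => simp
    | succ n =>
      rw [Finset.sum_range_succ, Finset.sum_range_succ' (fun p : ℕ => f (c + p))]
      congr 1
      · exact Finset.sum_congr rfl fun p _ => by congr 1; push_cast; ring
      · rw [← hf (c + ((0 : ℕ) : ℤ))]; congr 1; push_cast; ring
  induction c using Int.induction_on with
  | zero => simp
  | succ c ih => rw [step, ih]
  | pred c ih => rw [← ih, ← step]; simp

theorem QuasiPeriodic.dotProduct_add {n r r' : ℕ} {s : ℝ} (hs : s * s = 1) {X : ℤ → Fin r → ℝ}
    {Y : ℤ → Fin r' → ℝ} (hX : QuasiPeriodic n s X) (hY : QuasiPeriodic n s Y)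
    (μ : Fin r → ℝ) (p : ℤ) : (μ ⬝ᵥ X (p + n)) • Y (p + n) = (μ ⬝ᵥ X p) • Y p := by
  rw [hX, hY, dotProduct_smul, smul_smul, smul_eq_mul, mul_comm s, mul_assoc, hs, mul_one]

/-- The sequence `j ↦ ∑ p, (lam Z j ⬝ᵥ Z p) • V p`, the sum being over one period. -/
noncomputable def bandSum (n : ℕ) {d k : ℕ} (Z : ℤ → Fin d → ℝ) (V : ℤ → Fin k → ℝ) (j : ℤ) :
    Fin k → ℝ :=
  ∑ p : Fin n, (lam Z j ⬝ᵥ Z ((p : ℕ) : ℤ)) • V ((p : ℕ) : ℤ)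

section BandSum

variable {n k d : ℕ} {Z : ℤ → Fin d → ℝ} {V : ℤ → Fin k → ℝ}

theorem neg_one_pow_eq_of_even (hdk : Even (d + k)) : (-1 : ℝ) ^ (d + 1) = (-1) ^ (k + 1) := by
  have h : (-1 : ℝ) ^ d * (-1) ^ k = 1 := by rw [← pow_add, hdk.neg_one_pow]
  have := neg_one_pow_mul_self k
  rw [pow_succ, pow_succ]
  linear_combination (-(-1 : ℝ) ^ k) * h + (-1) ^ d * this

theorem bandSum_shift (hdk : Even (d + k)) (hZ : QuasiPeriodic n ((-1) ^ (d + 1)) Z)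
    (hV : QuasiPeriodic n ((-1) ^ (k + 1)) V) (c j : ℤ) :
    bandSum n Z V j = ∑ p : Fin n, (lam Z j ⬝ᵥ Z (c + (p : ℕ))) • V (c + (p : ℕ)) := by
  rw [neg_one_pow_eq_of_even hdk] at hZ
  exact (sum_period (f := fun p => (lam Z j ⬝ᵥ Z p) • V p)
    (fun p => hZ.dotProduct_add (neg_one_pow_mul_self _) hV _ p) c).symm

theorem bandSum_quasiPeriodic (hdk : Even (d + k)) (hZ : QuasiPeriodic n ((-1) ^ (d + 1)) Z) :
    QuasiPeriodic n ((-1) ^ (k + 1)) (bandSum n Z V) := by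
  intro j
  simp only [bandSum, lam_quasiPeriodic hZ, ← neg_one_pow_eq_of_even hdk, smul_dotProduct,
    Finset.smul_sum, smul_smul, smul_eq_mul]

theorem bandMinor_nonneg_of_le (hdn : d ≤ n) (hk : k ≤ d) (hdk : Even (d + k))
    (hZ : QuasiPeriodic n ((-1) ^ (d + 1)) Z) (hZP : SeqTP n Z)
    {j p : Fin k → ℤ} (hj : CycInc n j) (hp : CycInc n p) : 0 ≤ bandMinor Z j p := by
  obtain ⟨e, rfl⟩ := Nat.exists_eq_add_of_le hdn
  exact bandMinor_nonneg hk hdk e hZ hZP hj hp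

theorem cycInc_add_fin {c : ℤ} {s : Fin k → Fin n} (hs : StrictMono s) :
    CycInc n fun a => c + ((s a : ℕ) : ℤ) := by
  refine CycInc.of_mem_Ico (c := c) (fun a b h => ?_) (fun a => ?_)
  · have : s a < s b := hs h
    have : (s a : ℕ) < s b := this
    omega
  · have := (s a).2; omega

theorem bandSum_det_nonneg (hdn : d ≤ n) (hk : k ≤ d) (hdk : Even (d + k))
    (hZ : QuasiPeriodic n ((-1) ^ (d + 1)) Z) (hZP : SeqTP n Z) (hVN : SeqTNN n V)
    {q : Fin k → ℤ} (hq : CycInc n q) (c : ℤ) {s : Fin k → Fin n} (hs : StrictMono s) :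
    0 ≤ Matrix.det (Matrix.of fun a b : Fin k => lam Z (q a) ⬝ᵥ Z (c + ((s b : ℕ) : ℤ))) *
      Matrix.detRowAlternating fun a => V (c + ((s a : ℕ) : ℤ)) :=
  mul_nonneg (bandMinor_nonneg_of_le hdn hk hdk hZ hZP hq (cycInc_add_fin hs))
    (hVN _ (cycInc_add_fin hs))

theorem bandSum_seqTNN (hdn : d ≤ n) (hk : k ≤ d) (hdk : Even (d + k))
    (hZ : QuasiPeriodic n ((-1) ^ (d + 1)) Z) (hZP : SeqTP n Z)
    (hV : QuasiPeriodic n ((-1) ^ (k + 1)) V) (hVN : SeqTNN n V) :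
    SeqTNN n (bandSum n Z V) := by
  intro q hq
  simp only [seqMinor, bandSum_shift hdk hZ hV 0]
  exact det_sum_nonneg _ _ fun s hs => bandSum_det_nonneg hdn hk hdk hZ hZP hVN hq 0 hs

/-- A dependency among the rows gives a covector `μ` that vanishes on the vectors `Z (I b)`. With `d
= k + m`, the `k` consecutive covectors have the `m` common zeros `Z (j + k), …, Z (j + d - 1)`, so
`μ` vanishes on their translates by `n` too. Together these are `d` vectors inside one period, hence
`μ = 0`. The columns `j + d, …, j + d + k - 1` of the band matrix are triangular against the `k`
rows, so the dependency is trivial. -/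
theorem bandMinor_consecutive_ne_zero (hd : 0 < d) (hdn : d ≤ n) (hk : k ≤ d)
    (hZ : QuasiPeriodic n ((-1) ^ (d + 1)) Z) (hZP : SeqTP n Z) {j : ℤ} {I : Fin k → ℤ}
    (hI : StrictMono I) (hI1 : ∀ a, j + d ≤ I a) (hI2 : ∀ a, I a < j + n + k) :
    bandMinor Z (fun a : Fin k => j + (a : ℕ)) I ≠ 0 := by
  intro h0
  obtain ⟨c, hc, hc0⟩ := Matrix.exists_vecMul_eq_zero_iff.2
    (show (Matrix.of fun a b : Fin k => lam Z (j + (a : ℕ)) ⬝ᵥ Z (I b)).det = 0 from h0)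
  obtain ⟨m, rfl⟩ := Nat.exists_eq_add_of_le hk
  set μ : Fin (k + m) → ℝ := ∑ a : Fin k, c a • lam Z (j + (a : ℕ)) with hμ
  have hμdot : ∀ x, μ ⬝ᵥ x = ∑ a : Fin k, c a * (lam Z (j + (a : ℕ)) ⬝ᵥ x) := by
    intro x
    simp only [hμ, sum_dotProduct, smul_dotProduct, smul_eq_mul]
  have hμ1 : ∀ b, μ ⬝ᵥ Z (I b) = 0 := fun b => by
    rw [hμdot]; exact congrFun hc0 b
  have hμ2 : ∀ p : ℤ, j + k ≤ p → p < j + k + m → μ ⬝ᵥ Z p = 0 := by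
    intro p h1 h2
    rw [hμdot]
    refine Finset.sum_eq_zero fun a _ => ?_
    have := a.2
    rw [band_eq_zero (by omega) (by push_cast; omega), mul_zero]
  have hμ3 : ∀ p : ℤ, j + n + k ≤ p → p < j + n + k + m → μ ⬝ᵥ Z p = 0 := by
    intro p h1 h2
    rw [show p = (p - n) + n by ring, hZ, dotProduct_smul, hμ2 _ (by omega) (by omega), smul_zero]
  set q : Fin (k + m) → ℤ := Fin.addCases I fun b : Fin m => j + n + k + (b : ℕ) with hq
  have hqc : CycInc n q := by
    refine CycInc.of_mem_Ico (c := j + (k + m : ℕ)) ?_ ?_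
    · intro a b hab
      induction a using Fin.addCases with
      | left a =>
        induction b using Fin.addCases with
        | left b => simpa [hq] using hI (show (a : ℕ) < b from hab)
        | right b => have := hI2 a; simp [hq]; omega
      | right a =>
        induction b using Fin.addCases with
        | left b =>
          have : k + (a : ℕ) < b := hab
          have := b.2; omega
        | right b =>
          have : k + (a : ℕ) < k + b := hab
          simp [hq]; omega
    · intro a
      induction a using Fin.addCases with
      | left a => have := hI1 a; have := hI2 a; simp [hq]; push_cast at *; omega
      | right a => have := a.2; simp [hq]; omega
  have hμ0 : μ = 0 := by
    refine eq_zero_of_dotProduct_seq (hZP q hqc).ne' fun a => ?_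
    induction a using Fin.addCases with
    | left a => simpa [hq] using hμ1 a
    | right a => have := a.2; simpa [hq] using hμ3 _ (by omega) (by omega)
  have hT : 0 < (Matrix.of fun b a : Fin k =>
      lam Z (j + (a : ℕ)) ⬝ᵥ Z (j + (k + m : ℕ) + (b : ℕ)))ᵀ.det := by
    refine det_pos_of_triangular (fun a b hab => ?_) (fun a => ?_)
    · have : (b : ℕ) < a := hab
      have := a.2
      exact band_eq_zero (by push_cast; omega) (by push_cast; omega)
    · have := a.2
      exact band_pos hd hdn hZP (by omega) (by omega)
  refine hc (Matrix.eq_zero_of_vecMul_eq_zero hT.ne' ?_)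
  funext b
  have := hμdot (Z (j + (k + m : ℕ) + (b : ℕ)))
  rw [hμ0, zero_dotProduct] at this
  exact this.symm

/-- Cauchy–Binet is applied over the period that starts at `j + d`. The window hypothesis provides a
nonzero minor of `V` there, and the band minor that multiplies it does not vanish by
`bandMinor_consecutive_ne_zero`. So the consecutive minors are nonzero and `SeqTNN.seqTP` applies.
-/
theorem bandSum_seqTP {ℓ : ℕ} (hd : 0 < d) (hdn : d + ℓ = n) (hk : k ≤ d) (hdk : Even (d + k))
    (hZ : QuasiPeriodic n ((-1) ^ (d + 1)) Z) (hZP : SeqTP n Z)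
    (hV : QuasiPeriodic n ((-1) ^ (k + 1)) V) (hVN : SeqTNN n V)
    (hVw : ∀ j : ℤ, ∃ I : Fin k → ℤ, StrictMono I ∧ (∀ a, j ≤ I a ∧ I a < j + k + ℓ) ∧
      seqMinor V I ≠ 0) :
    SeqTP n (bandSum n Z V) := by
  have hdn' : d ≤ n := by omega
  refine (bandSum_seqTNN hdn' hk hdk hZ hZP hV hVN).seqTP (by omega)
    (bandSum_quasiPeriodic hdk hZ) fun j => ?_
  obtain ⟨I, hI, hIw, hI0⟩ := hVw (j + d)
  have hcons : CycInc n fun a : Fin k => j + (a : ℕ) :=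
    CycInc.of_mem_Ico (c := j) (fun a b h => by have : (a : ℕ) < b := h; omega)
      fun a => by have := a.2; omega
  have hIn : ∀ a, ∃ b : Fin n, I a = j + d + (b : ℕ) := fun a => by
    obtain ⟨i, hi⟩ := Int.eq_ofNat_of_zero_le (show 0 ≤ I a - (j + d) by have := hIw a; omega)
    exact ⟨⟨i, by have := hIw a; omega⟩, by simp; omega⟩
  choose s hs using hIn
  have hsm : StrictMono s := fun a b h => by
    have h1 := hI h
    rw [hs a, hs b] at h1
    exact Fin.lt_def.2 (by omega)
  have hIc : CycInc n I := by
    rw [show I = _ from funext hs]; exact cycInc_add_fin hsm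
  simp only [seqMinor, bandSum_shift hdk hZ hV (j + d)]
  refine (det_sum_pos _ _
    (fun s hs => bandSum_det_nonneg hdn' hk hdk hZ hZP hVN hcons _ hs) s ?_).ne'
  simp only [← hs]
  refine mul_pos (lt_of_le_of_ne (bandMinor_nonneg_of_le hdn' hk hdk hZ hZP hcons hIc) (Ne.symm ?_))
    (lt_of_le_of_ne (hVN I hIc) (Ne.symm hI0))
  exact bandMinor_consecutive_ne_zero hd hdn' hk hZ hZP hI (fun a => (hIw a).1)
    fun a => by have := (hIw a).2; omega

end BandSum

/-- Band minors of order `d` factor as a minor of the covectors times a minor of `X`, so positivity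
passes to the covectors. -/
theorem lam_seqTP {n d : ℕ} (hd : 0 < d) (hdn : d ≤ n) {X : ℤ → Fin d → ℝ}
    (hX : QuasiPeriodic n ((-1) ^ (d + 1)) X) (hXP : SeqTP n X) : SeqTP n (lam X) := by
  have key : ∀ j p : Fin d → ℤ, bandMinor X j p = seqMinor (lam X) j * seqMinor X p := by
    intro j p
    have : (Matrix.of fun a b : Fin d => lam X (j a) ⬝ᵥ X (p b)) =
        (Matrix.of fun a => lam X (j a)) * (Matrix.of fun b => X (p b))ᵀ := by
      ext a b; rfl
    have h := congrArg Matrix.det this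
    rw [Matrix.det_mul, Matrix.det_transpose] at h
    exact h
  refine SeqTNN.seqTP hdn (lam_quasiPeriodic hX) (fun q hq => ?_) fun j => ?_
  · have := bandMinor_nonneg_of_le hdn le_rfl ⟨d, rfl⟩ hX hXP hq hq
    rw [key] at this
    exact nonneg_of_mul_nonneg_left this (hXP q hq)
  · have : bandMinor X (fun a : Fin d => j + (a : ℕ)) (fun a : Fin d => j + d + (a : ℕ)) ≠ 0 :=
      bandMinor_consecutive_ne_zero hd hdn le_rfl hX hXP
        (fun a b h => by have : (a : ℕ) < b := h; omega) (fun a => by omega)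
        fun a => by have := a.2; omega
    rw [key] at this
    exact left_ne_zero_of_mul this

/-! ### Alternating signs and positivity up to a global sign -/

/-- The sequence with alternating signs. -/
noncomputable def altSeq {r : ℕ} (X : ℤ → Fin r → ℝ) (j : ℤ) : Fin r → ℝ := (-1 : ℝ) ^ j • X j

/-- All cyclically increasing minors are nonzero of the same sign. -/
def SeqSignTP (n : ℕ) {r : ℕ} (X : ℤ → Fin r → ℝ) : Prop :=
  ∀ q q', CycInc n q → CycInc n q' → 0 < seqMinor X q * seqMinor X q'

theorem SeqTP.signTP {n r : ℕ} {X : ℤ → Fin r → ℝ} (hX : SeqTP n X) : SeqSignTP n X :=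
  fun q q' hq hq' => mul_pos (hX q hq) (hX q' hq')

theorem neg_one_zpow_mul_self (j : ℤ) : (-1 : ℝ) ^ j * (-1) ^ j = 1 := by
  rw [← zpow_add₀ (by norm_num), Even.neg_one_zpow ⟨j, rfl⟩]

theorem QuasiPeriodic.altSeq {n r : ℕ} {s : ℝ} {X : ℤ → Fin r → ℝ} (hX : QuasiPeriodic n s X) :
    QuasiPeriodic n ((-1) ^ n * s) (altSeq X) := by
  intro j
  simp only [_root_.altSeq, hX j, smul_smul]
  rw [zpow_add₀ (by norm_num), zpow_natCast]
  congr 1; ring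

/-- Rescaling by a sequence of scalars of constant sign. -/
theorem SeqSignTP.smul {n r : ℕ} {X : ℤ → Fin r → ℝ} (hX : SeqSignTP n X) {g : ℤ → ℝ} {ε : ℝ}
    (hg : ∀ j, 0 < ε * g j) : SeqSignTP n fun j => g j • X j := by
  have key : ∀ q : Fin r → ℤ, ε ^ r * seqMinor (fun j => g j • X j) q =
      (∏ a, ε * g (q a)) * seqMinor X q := by
    intro q
    rw [seqMinor, AlternatingMap.map_smul_univ, Finset.prod_mul_distrib, Finset.prod_const,
      Finset.card_univ, Fintype.card_fin, smul_eq_mul]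
    simp only [seqMinor]; ring
  have hε : ε ≠ 0 := fun h => by simpa [h] using hg 0
  intro q q' hq hq'
  have h1 : 0 < ∏ a, ε * g (q a) := Finset.prod_pos fun a _ => hg _
  have h2 : 0 < ∏ a, ε * g (q' a) := Finset.prod_pos fun a _ => hg _
  have h3 := mul_pos (mul_pos h1 h2) (hX q q' hq hq')
  have h4 : 0 < ε ^ r * ε ^ r := by rw [← mul_pow]; exact pow_pos (mul_self_pos.2 hε) r
  refine (mul_pos_iff_of_pos_left h4).1 ?_
  calc _ < _ := h3
    _ = (ε ^ r * seqMinor (fun j => g j • X j) q) * (ε ^ r * seqMinor (fun j => g j • X j) q') := by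
      rw [key, key]; ring
    _ = _ := by ring

theorem SeqSignTP.comp_add {n r : ℕ} {X : ℤ → Fin r → ℝ} (hX : SeqSignTP n X) (c : ℤ) :
    SeqSignTP n fun j => X (j + c) := by
  intro q q' hq hq'
  have h : ∀ q : Fin r → ℤ, CycInc n q → CycInc n fun a => q a + c := fun q hq =>
    ⟨fun a b hab => add_lt_add_left (hq.1 hab) c, fun a b => by
      have := hq.2 a b
      show q a + c < q b + c + n
      omega⟩
  exact hX _ _ (h q hq) (h q' hq')

/-! ### Positivity of the first block of the twist -/

section LeftDual

variable {n k ℓ d : ℕ} {Z : ℤ → Fin d → ℝ} {V : ℤ → Fin k → ℝ} {W : ℤ → Fin ℓ → ℝ}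

theorem orth_shift (hZ : QuasiPeriodic n ((-1) ^ (d + 1)) Z)
    (hW : QuasiPeriodic n ((-1) ^ (d + 1)) W)
    (horth : ∀ i c, ∑ p : Fin n, Z ((p : ℕ) : ℤ) i * W ((p : ℕ) : ℤ) c = 0) (ζ : Fin d → ℝ)
    (c : ℤ) : ∑ p : Fin n, (ζ ⬝ᵥ Z (c + (p : ℕ))) • W (c + (p : ℕ)) = 0 := by
  rw [sum_period (f := fun p => (ζ ⬝ᵥ Z p) • W p)
    (fun p => hZ.dotProduct_add (neg_one_pow_mul_self _) hW _ p) c]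
  funext b
  simp only [Finset.sum_apply, Pi.smul_apply, smul_eq_mul, dotProduct, Finset.sum_mul, Pi.zero_apply]
  rw [Finset.sum_comm]
  refine Finset.sum_eq_zero fun i _ => ?_
  simp only [mul_assoc]
  rw [← Finset.mul_sum, horth, mul_zero]

/-- The rows of the band matrix are combinations of the rows of `Z`, hence orthogonal to `W`, so a
multiple of zero can be added to introduce `y`. In the period that starts at `i + d`, all entries
after the first `ℓ + 1` are translates of the zero entries of the band. -/
theorem dotProduct_bandSum (hd : 0 < d) (hdn : d + ℓ = n) (hdk : Even (d + k))
    (hZ : QuasiPeriodic n ((-1) ^ (d + 1)) Z) (hV : QuasiPeriodic n ((-1) ^ (k + 1)) V)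
    (hW : QuasiPeriodic n ((-1) ^ (k + 1)) W)
    (horth : ∀ i c, ∑ p : Fin n, Z ((p : ℕ) : ℤ) i * W ((p : ℕ) : ℤ) c = 0)
    (x : Fin k → ℝ) (y : Fin ℓ → ℝ) (i : ℤ) :
    x ⬝ᵥ bandSum n Z V i = ∑ t ∈ Finset.range (ℓ + 1), (lam Z i ⬝ᵥ Z (i + d + (t : ℕ))) *
      (x ⬝ᵥ V (i + d + (t : ℕ)) + y ⬝ᵥ W (i + d + (t : ℕ))) := by
  rw [← neg_one_pow_eq_of_even hdk] at hW
  have h1 := congrArg (fun v => y ⬝ᵥ v) (orth_shift hZ hW horth (lam Z i) (i + d))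
  simp only [dotProduct_sum, dotProduct_smul, dotProduct_zero, smul_eq_mul] at h1
  rw [bandSum_shift hdk hZ hV (i + d), dotProduct_sum]
  simp only [dotProduct_smul, smul_eq_mul]
  rw [← add_zero (∑ p : Fin n, _), ← h1, ← Finset.sum_add_distrib]
  simp only [← mul_add]
  rw [Fin.sum_univ_eq_sum_range fun t : ℕ => (lam Z i ⬝ᵥ Z (i + d + (t : ℕ))) *
      (x ⬝ᵥ V (i + d + (t : ℕ)) + y ⬝ᵥ W (i + d + (t : ℕ)))]
  refine (Finset.sum_subset (Finset.range_subset_range.2 (by omega)) fun t ht ht' => ?_).symm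
  rw [Finset.mem_range] at ht ht'
  rw [show i + d + (t : ℕ) = (i + d + t - n) + n by ring, hZ, dotProduct_smul,
    band_eq_zero (by omega) (by omega), smul_zero, zero_mul]

/-- The hypotheses on a totally nonnegative sequence `V` (with sufficiently large windows) and the
orthogonal complement `W` of a totally positive sequence `Z`. -/
structure TwistData (n k ℓ d : ℕ) (Z : ℤ → Fin d → ℝ) (V : ℤ → Fin k → ℝ) (W : ℤ → Fin ℓ → ℝ) :
    Prop where
  card : d + ℓ = n
  le : k ≤ d
  even : Even (d + k)
  qpZ : QuasiPeriodic n ((-1) ^ (d + 1)) Z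
  qpV : QuasiPeriodic n ((-1) ^ (k + 1)) V
  qpW : QuasiPeriodic n ((-1) ^ (k + 1)) W
  posZ : SeqTP n Z
  nonnegV : SeqTNN n V
  window : ∀ j : ℤ, ∃ I : Fin k → ℤ, StrictMono I ∧ (∀ a, j ≤ I a ∧ I a < j + k + ℓ) ∧
      seqMinor V I ≠ 0
  orth : ∀ i c, ∑ p : Fin n, Z ((p : ℕ) : ℤ) i * W ((p : ℕ) : ℤ) c = 0
  spanW : ∀ y : Fin ℓ → ℝ, (∀ p : ℤ, 0 ≤ p → p < n → y ⬝ᵥ W p = 0) → y = 0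

/-- The defining equations of the twist, up to positive rescaling and a global sign `ε`. -/
structure IsDual (k ℓ : ℕ) (ε : ℝ) (V : ℤ → Fin k → ℝ) (W : ℤ → Fin ℓ → ℝ) (A : ℤ → Fin k → ℝ)
    (B : ℤ → Fin ℓ → ℝ) : Prop where
  eq_zero : ∀ j i : ℤ, j - ℓ < i → i < j + k → A j ⬝ᵥ V i + B j ⬝ᵥ W i = 0
  pos : ∀ j : ℤ, 0 < ε * (-1) ^ j * (A j ⬝ᵥ V (j - ℓ) + B j ⬝ᵥ W (j - ℓ))

namespace TwistData

variable (H : TwistData n k ℓ d Z V W)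
include H

theorem bandSum_seqTP (hk : 0 < k) : SeqTP n (bandSum n Z V) :=
  _root_.bandSum_seqTP (by have := H.le; omega) H.card H.le H.even H.qpZ H.posZ H.qpV H.nonnegV
    H.window

theorem dot_bandSum (hk : 0 < k) (x : Fin k → ℝ) (y : Fin ℓ → ℝ) (i : ℤ) :
    x ⬝ᵥ bandSum n Z V i = ∑ t ∈ Finset.range (ℓ + 1), (lam Z i ⬝ᵥ Z (i + d + (t : ℕ))) *
      (x ⬝ᵥ V (i + d + (t : ℕ)) + y ⬝ᵥ W (i + d + (t : ℕ))) :=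
  dotProduct_bandSum (by have := H.le; omega) H.card H.even H.qpZ H.qpV H.qpW H.orth x y i

/-- By `dot_bandSum`, `x` is orthogonal to `k` consecutive vectors of the totally positive band sum.
Each of these `k` identities involves `ℓ + 1` indices, and together they cover exactly the window
`[j - ℓ, j + k)`. -/
theorem left_eq_zero {x : Fin k → ℝ} {y : Fin ℓ → ℝ} {j : ℤ}
    (h : ∀ p : ℤ, j - ℓ ≤ p → p < j + k → x ⬝ᵥ V p + y ⬝ᵥ W p = 0) : x = 0 := by
  rcases Nat.eq_zero_or_pos k with rfl | hk
  · exact Subsingleton.elim _ _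
  have hcard := H.card
  refine eq_zero_of_dotProduct_seq (X := bandSum n Z V) (q := fun a : Fin k => j - n + (a : ℕ))
    (H.bandSum_seqTP hk _ ?_).ne' fun a => ?_
  · refine CycInc.of_mem_Ico (c := j - n) (fun a b h => ?_) fun a => ?_
    · have : (a : ℕ) < b := h
      omega
    · have := a.2; have := H.le; omega
  · rw [H.dot_bandSum hk x y]
    refine Finset.sum_eq_zero fun t ht => ?_
    rw [Finset.mem_range] at ht
    have := a.2
    rw [h _ (by omega) (by omega), mul_zero]

/-- Once `x = 0`, the numbers `y ⬝ᵥ W p` vanish for `j - ℓ ≤ p < j`. Orthogonality with `Z` then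
becomes a relation among the other `d` vectors of `Z` in the period, which are consecutive and
independent. So `y` is orthogonal to a full period of `W`. -/
theorem right_eq_zero {x : Fin k → ℝ} {y : Fin ℓ → ℝ} {j : ℤ}
    (h : ∀ p : ℤ, j - ℓ ≤ p → p < j + k → x ⬝ᵥ V p + y ⬝ᵥ W p = 0) : y = 0 := by
  have hx := H.left_eq_zero h
  have hy : ∀ p : ℤ, j - ℓ ≤ p → p < j + k → y ⬝ᵥ W p = 0 := fun p h1 h2 => by
    simpa [hx] using h p h1 h2
  have hcard := H.card
  have hW := H.qpW
  rw [← neg_one_pow_eq_of_even H.even] at hW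
  have hq : CycInc n fun a : Fin d => j + (a : ℕ) := by
    refine CycInc.of_mem_Ico (c := j) (fun a b h => ?_) fun a => ?_
    · have : (a : ℕ) < b := h
      omega
    · have := a.2; omega
  have hdet := (H.posZ _ hq).ne'
  have hsum : (fun a : Fin d => y ⬝ᵥ W (j + (a : ℕ))) ᵥ* (Matrix.of fun a : Fin d => Z (j + (a : ℕ)))
      = 0 := by
    funext i
    have h0 := orth_shift H.qpZ hW H.orth (Pi.single i 1) (j - ℓ)
    have h1 := congrArg (fun v => y ⬝ᵥ v) h0
    simp only [dotProduct_sum, dotProduct_smul, dotProduct_zero, smul_eq_mul,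
      single_one_dotProduct] at h1
    rw [Fin.sum_univ_eq_sum_range fun t : ℕ => Z (j - ℓ + (t : ℕ)) i *
      (y ⬝ᵥ W (j - ℓ + (t : ℕ))), ← hcard, add_comm d, Finset.sum_range_add] at h1
    have h2 : ∑ t ∈ Finset.range ℓ, Z (j - ℓ + (t : ℕ)) i * (y ⬝ᵥ W (j - ℓ + (t : ℕ))) = 0 :=
      Finset.sum_eq_zero fun t ht => by
        rw [Finset.mem_range] at ht
        rw [hy _ (by omega) (by omega), mul_zero]
    rw [h2, zero_add] at h1
    rw [Pi.zero_apply, ← h1, Matrix.vecMul, dotProduct,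
      ← Fin.sum_univ_eq_sum_range fun t : ℕ => Z (j - ℓ + ((ℓ + t : ℕ))) i *
      (y ⬝ᵥ W (j - ℓ + (ℓ + t : ℕ)))]
    refine Finset.sum_congr rfl fun a _ => ?_
    rw [show j - ℓ + ((ℓ + (a : ℕ) : ℕ) : ℤ) = j + (a : ℕ) by push_cast; ring, mul_comm]
    rfl
  have hz := Matrix.eq_zero_of_vecMul_eq_zero (M := Matrix.of fun a : Fin d => Z (j + (a : ℕ)))
    hdet hsum
  have hall : ∀ p : ℤ, j - ℓ ≤ p → p < j - ℓ + n → y ⬝ᵥ W p = 0 := by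
    intro p h1 h2
    by_cases hp : p < j
    · exact hy p h1 (by omega)
    · obtain ⟨i, hi⟩ := Int.eq_ofNat_of_zero_le (show 0 ≤ p - j by omega)
      have := congrFun hz ⟨i, by omega⟩
      rw [show p = j + (i : ℕ) by omega]
      exact this
  refine H.spanW y fun p h1 h2 => ?_
  have hn : (0 : ℤ) < n := by omega
  have h3 := (p - (j - ℓ)).emod_nonneg hn.ne'
  have h4 := (p - (j - ℓ)).emod_lt_of_pos hn
  have h5 := Int.emod_add_mul_ediv (p - (j - ℓ)) n
  have h6 := hW.add_mul (neg_one_pow_ne_zero _) ((j - ℓ) + (p - (j - ℓ)) % n) ((p - (j - ℓ)) / n)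
  rw [show (j - ℓ) + (p - (j - ℓ)) % n + n * ((p - (j - ℓ)) / n) = p by linarith] at h6
  rw [h6, dotProduct_smul, hall _ (by omega) (by omega), smul_zero]

variable {ε : ℝ} {A : ℤ → Fin k → ℝ} {B : ℤ → Fin ℓ → ℝ} (hD : IsDual k ℓ ε V W A B)
include hD

/-- `A j` is orthogonal to the band sum at `j - n + 1, …, j - n + k - 1`, and this determines a
covector up to a scalar. The scalar is found at index `j - n`, where only the term at the left end
of the window survives. The band entry is known to be positive one period later, which accounts for
the factor `(-1) ^ (k + 1)`. -/
theorem exists_eq_smul_lam (hk : 0 < k) : ∃ c : ℤ → ℝ,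
    (∀ j, A j = c j • lam (bandSum n Z V) (j - n)) ∧ ∀ j, 0 < (-1) ^ (k + 1) * ε * ((-1) ^ j * c j) := by
  have hcard := H.card
  have hle := H.le
  have hTP := H.bandSum_seqTP hk
  have hqp := bandSum_quasiPeriodic (V := V) H.even H.qpZ
  have hpos : ∀ j : ℤ, 0 < (-1) ^ (k + 1) * (lam (bandSum n Z V) (j - n) ⬝ᵥ bandSum n Z V (j - n)) := by
    intro j
    have h := band_pos (j := j - n) (p := j) hk (by omega) hTP (by omega) (by omega)
    have h1 := hqp (j - n)
    rw [sub_add_cancel] at h1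
    rwa [h1, dotProduct_smul, smul_eq_mul] at h
  have hne : ∀ j : ℤ, lam (bandSum n Z V) (j - n) ⬝ᵥ bandSum n Z V (j - n) ≠ 0 := fun j h => by
    have := hpos j; simp [h] at this
  refine ⟨fun j => (A j ⬝ᵥ bandSum n Z V (j - n)) /
    (lam (bandSum n Z V) (j - n) ⬝ᵥ bandSum n Z V (j - n)), fun j => ?_, fun j => ?_⟩
  · rw [← sub_eq_zero]
    refine eq_zero_of_dotProduct_seq (X := bandSum n Z V)
      (q := fun a : Fin k => j - n + (a : ℕ)) (hTP _ ?_).ne' fun a => ?_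
    · refine CycInc.of_mem_Ico (c := j - n) (fun a b h => ?_) fun a => ?_
      · have : (a : ℕ) < b := h
        omega
      · have := a.2; omega
    · rw [sub_dotProduct, smul_dotProduct, smul_eq_mul]
      have := a.2
      rcases Nat.eq_zero_or_pos (a : ℕ) with ha | ha
      · simp only [ha, Nat.cast_zero, add_zero]
        rw [div_mul_cancel₀ _ (hne j), sub_self]
      · rw [band_eq_zero (X := bandSum n Z V) (by omega) (by omega), mul_zero, sub_zero,
          H.dot_bandSum hk _ (B j)]
        refine Finset.sum_eq_zero fun t ht => ?_
        rw [Finset.mem_range] at ht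
        rw [hD.eq_zero j _ (by omega) (by omega), mul_zero]
  · have h1 : A j ⬝ᵥ bandSum n Z V (j - n) = (lam Z (j - n) ⬝ᵥ Z (j - ℓ)) *
        (A j ⬝ᵥ V (j - ℓ) + B j ⬝ᵥ W (j - ℓ)) := by
      rw [H.dot_bandSum hk _ (B j), Finset.sum_eq_single 0]
      · rw [show j - n + d + ((0 : ℕ) : ℤ) = j - ℓ by omega]
      · intro t ht ht0
        rw [Finset.mem_range] at ht
        rw [hD.eq_zero j _ (by omega) (by omega), mul_zero]
      · simp
    have h2 := band_pos (j := j - n) (p := j - ℓ) (by omega) (by omega) H.posZ (by omega) (by omega)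
    have h3 := mul_pos h2 (hD.pos j)
    have h4 := div_pos h3 (hpos j)
    refine h4.trans_eq ?_
    dsimp only
    rw [h1]
    have := hne j
    have h5 := neg_one_pow_mul_self (k + 1)
    field_simp
    linear_combination (-(ε * (A j ⬝ᵥ V (j - ℓ) + B j ⬝ᵥ W (j - ℓ)))) * h5

theorem altSeq_left_signTP : SeqSignTP n (altSeq A) := by
  rcases Nat.eq_zero_or_pos k with rfl | hk
  · intro q q' _ _
    have : ∀ q : Fin 0 → ℤ, seqMinor (altSeq A) q = 1 := fun q => Matrix.det_isEmpty
    rw [this, this]; norm_num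
  obtain ⟨c, hc, hcpos⟩ := H.exists_eq_smul_lam hD hk
  have h1 := (lam_seqTP hk (by have := H.card; have := H.le; omega)
    (bandSum_quasiPeriodic (V := V) H.even H.qpZ) (H.bandSum_seqTP hk)).signTP
  have h2 := (h1.comp_add (-n)).smul (g := fun j => (-1) ^ j * c j) (ε := (-1) ^ (k + 1) * ε) hcpos
  convert h2 using 2 with j
  rw [altSeq, hc, smul_smul, sub_eq_add_neg]

/-- At index `j - n + k` only the term just beyond the right end of the window survives. Its sign is
that of the scalar found in `exists_eq_smul_lam`. These pairings are the numbers by which the twist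
has to be rescaled when it is inverted. -/
theorem dual_right_pos (hk : 0 < k) (j : ℤ) :
    0 < (-1) ^ (k + 1) * ε * ((-1) ^ j * (A j ⬝ᵥ V (j + k) + B j ⬝ᵥ W (j + k))) := by
  obtain ⟨c, hc, hcpos⟩ := H.exists_eq_smul_lam hD hk
  have hcard := H.card
  have hle := H.le
  have h1 : A j ⬝ᵥ bandSum n Z V (j - n + k) = (lam Z (j - n + k) ⬝ᵥ Z (j + k)) *
      (A j ⬝ᵥ V (j + k) + B j ⬝ᵥ W (j + k)) := by
    rw [H.dot_bandSum hk _ (B j), Finset.sum_eq_single ℓ]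
    · rw [show j - n + k + d + (ℓ : ℤ) = j + k by omega]
    · intro t ht ht0
      rw [Finset.mem_range] at ht
      rw [hD.eq_zero j _ (by omega) (by omega), mul_zero]
    · simp
  have h2 := band_pos (j := j - n + k) (p := j + k) (by omega) (by omega) H.posZ (by omega) (by omega)
  have h3 := band_pos (j := j - n) (p := j - n + k) hk (by omega) (H.bandSum_seqTP hk) (by omega)
    (by omega)
  have h4 : A j ⬝ᵥ bandSum n Z V (j - n + k) =
      c j * (lam (bandSum n Z V) (j - n) ⬝ᵥ bandSum n Z V (j - n + k)) := by
    rw [hc, smul_dotProduct, smul_eq_mul]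
  rw [h4] at h1
  refine (mul_pos_iff_of_pos_left h2).1 ((mul_pos (hcpos j) h3).trans_eq ?_)
  linear_combination (-1 : ℝ) ^ (k + 1) * ε * (-1) ^ j * h1

end TwistData

end LeftDual

/-! ### Normalizing signs and totally positive complements -/

theorem seqMinor_mulVec {r : ℕ} (g : Matrix (Fin r) (Fin r) ℝ) (X : ℤ → Fin r → ℝ)
    (q : Fin r → ℤ) : seqMinor (fun j => g *ᵥ X j) q = g.det * seqMinor X q := by
  have : (Matrix.of fun a => g *ᵥ X (q a)) = (Matrix.of fun a => X (q a)) * gᵀ := by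
    ext a b
    simp [Matrix.mul_apply, Matrix.mulVec, dotProduct, mul_comm]
  have h := congrArg Matrix.det this
  rw [Matrix.det_mul, Matrix.det_transpose, mul_comm] at h
  exact h

theorem SeqSignTP.mulVec {n r : ℕ} {X : ℤ → Fin r → ℝ} (hX : SeqSignTP n X)
    {g : Matrix (Fin r) (Fin r) ℝ} (hg : g.det ≠ 0) : SeqSignTP n fun j => g *ᵥ X j := by
  intro q q' hq hq'
  rw [seqMinor_mulVec, seqMinor_mulVec]
  have := mul_pos (mul_self_pos.2 hg) (hX q q' hq hq')
  linarith

theorem QuasiPeriodic.mulVec {n r r' : ℕ} {s : ℝ} {X : ℤ → Fin r → ℝ} (hX : QuasiPeriodic n s X)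
    (g : Matrix (Fin r') (Fin r) ℝ) : QuasiPeriodic n s fun j => g *ᵥ X j := by
  intro j
  simp only [hX j, Matrix.mulVec_smul]

theorem cycInc_consecutive {n r : ℕ} (hrn : r ≤ n) (j : ℤ) :
    CycInc n fun a : Fin r => j + (a : ℕ) := by
  refine CycInc.of_mem_Ico (c := j) (fun a b h => ?_) fun a => ?_
  · have : (a : ℕ) < b := h
    omega
  · have := a.2; omega

/-- Scaling one coordinate by the value of a single minor makes the common sign positive. The empty
minor is already `1`. -/
theorem SeqSignTP.exists_seqTP {n r : ℕ} (hrn : r ≤ n) {X : ℤ → Fin r → ℝ} (hX : SeqSignTP n X) :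
    ∃ g : Matrix (Fin r) (Fin r) ℝ, g.det ≠ 0 ∧ SeqTP n fun j => g *ᵥ X j := by
  have h0 := hX _ _ (cycInc_consecutive hrn 0) (cycInc_consecutive hrn 0)
  cases r with
  | zero =>
    refine ⟨1, by simp, fun q _ => ?_⟩
    have : seqMinor (fun j => (1 : Matrix (Fin 0) (Fin 0) ℝ) *ᵥ X j) q = 1 := Matrix.det_isEmpty
    rw [this]; norm_num
  | succ r =>
    set c := seqMinor X fun a : Fin (r + 1) => 0 + (a : ℕ) with hc
    have hdet : (Matrix.diagonal (Function.update 1 0 c) : Matrix (Fin (r + 1)) (Fin (r + 1)) ℝ).det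
        = c := by
      rw [Matrix.det_diagonal, Fin.prod_univ_succ]
      simp
    refine ⟨Matrix.diagonal (Function.update 1 0 c), ?_, fun q hq => ?_⟩
    · rw [hdet]; exact (mul_self_pos.1 h0)
    · rw [seqMinor_mulVec, hdet]
      exact hX _ _ (cycInc_consecutive hrn 0) hq

theorem altSeq_coe {r : ℕ} (X : ℤ → Fin r → ℝ) (j : ℕ) : altSeq X j = (-1 : ℝ) ^ j • X j := by
  rw [altSeq, zpow_natCast]

theorem neg_one_pow_add_one_eq {n r s : ℕ} (h : r + s = n) :
    (-1 : ℝ) ^ n * (-1) ^ (r + 1) = (-1) ^ (s + 1) := by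
  rw [← h, pow_add, pow_succ, pow_succ]
  linear_combination (-(-1 : ℝ) ^ s) * neg_one_pow_mul_self r

/-- The orthogonal complement of a totally positive sequence, with alternating signs, is totally
positive up to a sign. -/
theorem SeqTP.dual {n r s : ℕ} (hrs : r + s = n) {X : ℤ → Fin r → ℝ} {Y : ℤ → Fin s → ℝ}
    (hXP : SeqTP n X) (hY : QuasiPeriodic n ((-1) ^ (r + 1)) Y)
    (horth : ∀ i c, ∑ p : Fin n, X ((p : ℕ) : ℤ) i * Y ((p : ℕ) : ℤ) c = 0)
    (hspan : ∀ y : Fin s → ℝ, (∀ p : ℤ, 0 ≤ p → p < n → y ⬝ᵥ Y p = 0) → y = 0) :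
    SeqSignTP n (altSeq Y) := by
  have hqp := hY.altSeq
  rw [neg_one_pow_add_one_eq hrs] at hqp
  intro q q' hq hq'
  obtain ⟨J, hJ, -, h1⟩ := hq.exists_finset
  obtain ⟨J', hJ', -, h2⟩ := hq'.exists_finset
  rw [h1 _ hqp, h2 _ hqp]
  refine dual_minor_mul_pos (x := fun p => X ((p : ℕ) : ℤ)) (w := fun p => altSeq Y ((p : ℕ) : ℤ))
    hrs (fun J hJ => hXP _ (cycInc_orderEmbOfFin hJ)) (fun i c => ?_) (fun μ hμ => ?_) hJ hJ'
  · rw [← horth i c]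
    refine Finset.sum_congr rfl fun p _ => ?_
    rw [altSeq_coe, Pi.smul_apply, smul_eq_mul]
    linear_combination (X ((p : ℕ) : ℤ) i * Y ((p : ℕ) : ℤ) c) * neg_one_pow_mul_self (p : ℕ)
  · refine hspan μ fun p h0 hp => ?_
    obtain ⟨i, rfl⟩ := Int.eq_ofNat_of_zero_le h0
    have := hμ ⟨i, by omega⟩
    dsimp only at this
    rw [altSeq_coe, smul_dotProduct, smul_eq_mul, dotProduct_comm] at this
    exact (mul_eq_zero.1 this).resolve_left (neg_one_pow_ne_zero _)

theorem SeqTP.span {n r : ℕ} (hrn : r ≤ n) {X : ℤ → Fin r → ℝ} (hXP : SeqTP n X) {y : Fin r → ℝ}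
    (h : ∀ p : ℤ, 0 ≤ p → p < n → y ⬝ᵥ X p = 0) : y = 0 :=
  eq_zero_of_dotProduct_seq (hXP _ (cycInc_consecutive hrn 0)).ne' fun a =>
    h _ (by omega) (by have := a.2; omega)

/-- A family of vectors spanning `ℝʳ` has a spanning orthogonal family. -/
theorem exists_orth_family {n r s : ℕ} (hrs : r + s = n) (x : Fin n → Fin r → ℝ)
    (hx : ∀ y : Fin r → ℝ, (∀ p, y ⬝ᵥ x p = 0) → y = 0) :
    ∃ w : Fin n → Fin s → ℝ, (∀ i c, ∑ p, x p i * w p c = 0) ∧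
      ∀ y : Fin s → ℝ, (∀ p, y ⬝ᵥ w p = 0) → y = 0 := by
  set M : Matrix (Fin r) (Fin n) ℝ := Matrix.of fun i p => x p i with hM
  have hli : LinearIndependent ℝ M.row := by
    rw [Fintype.linearIndependent_iff]
    intro g hg
    refine congrFun (hx g fun p => ?_)
    have := congrFun hg p
    simpa [dotProduct, hM] using this
  have hrank : M.rank = r := by rw [hli.rank_matrix, Fintype.card_fin]
  have hker : Module.finrank ℝ (LinearMap.ker M.mulVecLin) = s := by
    have := LinearMap.finrank_range_add_finrank_ker M.mulVecLin
    rw [Module.finrank_fin_fun] at this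
    have h2 : Module.finrank ℝ (LinearMap.range M.mulVecLin) = r := hrank
    omega
  let b := Module.finBasisOfFinrankEq ℝ (LinearMap.ker M.mulVecLin) hker
  refine ⟨fun p c => (b c : Fin n → ℝ) p, fun i c => ?_, fun y hy => ?_⟩
  · have := congrFun (LinearMap.mem_ker.1 (b c).2) i
    rw [Matrix.mulVecLin_apply] at this
    exact this
  · have h1 : ∑ c, y c • b c = 0 := by
      apply Subtype.ext
      funext p
      simpa [dotProduct] using hy p
    exact funext (Fintype.linearIndependent_iff.1 b.linearIndependent y h1)

/-- The complement is totally positive up to sign after alternating signs, and a change of basis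
fixes the sign. Alternating once more returns a basis of the complement. -/
theorem SeqTP.exists_dual {n r s : ℕ} [NeZero n] (hrs : r + s = n) {X : ℤ → Fin r → ℝ}
    (hXP : SeqTP n X) : ∃ Y : ℤ → Fin s → ℝ, QuasiPeriodic n ((-1) ^ (s + 1)) Y ∧ SeqTP n Y ∧
      ∀ i c, ∑ p : Fin n, X ((p : ℕ) : ℤ) i * altSeq Y ((p : ℕ) : ℤ) c = 0 := by
  obtain ⟨w, hw1, hw2⟩ := exists_orth_family hrs (fun p : Fin n => X ((p : ℕ) : ℤ)) fun y hy =>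
    hXP.span (by omega) fun p h0 hp => by
      obtain ⟨i, rfl⟩ := Int.eq_ofNat_of_zero_le h0
      exact hy ⟨i, by omega⟩
  set Y := extCol r (Matrix.of fun c p => w p c) with hY
  have hYw : ∀ p : Fin n, Y ((p : ℕ) : ℤ) = w p := fun p => by rw [hY, extCol_coe]; rfl
  have hYq : QuasiPeriodic n ((-1) ^ (r + 1)) Y := extCol_quasiPeriodic _ _
  have hs := hXP.dual hrs hYq (fun i c => by simpa [hYw] using hw1 i c) fun y hy =>
    hw2 y fun p => by rw [← hYw]; exact hy _ (by positivity) (by exact_mod_cast p.2)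
  obtain ⟨g, hg, hgP⟩ := hs.exists_seqTP (by omega)
  have hqp := hYq.altSeq
  rw [neg_one_pow_add_one_eq hrs] at hqp
  refine ⟨_, hqp.mulVec g, hgP, fun i c => ?_⟩
  have : ∀ p : Fin n, altSeq (fun j => g *ᵥ altSeq Y j) ((p : ℕ) : ℤ) = g *ᵥ w p := by
    intro p
    rw [altSeq_coe, altSeq_coe, Matrix.mulVec_smul, smul_smul, neg_one_pow_mul_self, one_smul, hYw]
  simp only [this, Matrix.mulVec, dotProduct, Finset.mul_sum]
  rw [Finset.sum_comm]
  refine Finset.sum_eq_zero fun b _ => ?_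
  rw [← mul_zero (g c b), ← hw1 i b, Finset.mul_sum]
  exact Finset.sum_congr rfl fun p _ => by ring

/-! ### Exchanging the two blocks when `V` is totally positive -/

section RightDual

variable {n k ℓ d : ℕ} {Z : ℤ → Fin d → ℝ} {V : ℤ → Fin k → ℝ} {W : ℤ → Fin ℓ → ℝ}

theorem TwistData.altSeq_signTP (H : TwistData n k ℓ d Z V W) : SeqSignTP n (altSeq W) := by
  have hW := H.qpW
  rw [← neg_one_pow_eq_of_even H.even] at hW
  exact H.posZ.dual H.card hW H.orth H.spanW

/-- The data with the roles of `V` and `W` exchanged. -/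
theorem TwistData.exists_swap [NeZero n] (H : TwistData n k ℓ d Z V W) (hVP : SeqTP n V) :
    ∃ (d' : ℕ) (g : Matrix (Fin ℓ) (Fin ℓ) ℝ) (Z' : ℤ → Fin d' → ℝ), g.det ≠ 0 ∧
      TwistData n ℓ k d' Z' (fun j => g *ᵥ altSeq W j) (altSeq V) := by
  have hle := H.le
  have hcard := H.card
  have heven := H.even
  obtain ⟨g, hg, hgP⟩ := H.altSeq_signTP.exists_seqTP (by omega)
  -- The new totally positive sequence is the sign-alternated complement of `V`, so it is orthogonal
  -- to `altSeq V`, which takes the place of `W`.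
  obtain ⟨d', hd'⟩ : ∃ d', k + d' = n := ⟨n - k, by omega⟩
  obtain ⟨Z', hZq, hZP, horth⟩ := hVP.exists_dual hd'
  have hqW := H.qpW.altSeq
  have hqV := H.qpV.altSeq
  have hd : Even (d' + ℓ) := by
    have : d' + ℓ + 2 * k = d + k + 2 * ℓ := by omega
    rw [Nat.even_iff] at *; omega
  rw [neg_one_pow_add_one_eq hd', neg_one_pow_eq_of_even hd] at hqW hqV
  refine ⟨d', g, Z', hg, by omega, by omega, hd, hZq, hqW.mulVec g, hqV, hZP,
    fun q hq => (hgP q hq).le, fun j => ?_, fun i c => ?_, fun y hy => ?_⟩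
  · refine ⟨fun a => j + (a : ℕ), fun a b h => ?_, fun a => ?_,
      (hgP _ (cycInc_consecutive (by omega) j)).ne'⟩
    · have : (a : ℕ) < b := h
      dsimp only; omega
    · have := a.2; dsimp only; omega
  · rw [← horth c i]
    refine Finset.sum_congr rfl fun p _ => ?_
    rw [altSeq_coe, altSeq_coe, Pi.smul_apply, Pi.smul_apply, smul_eq_mul, smul_eq_mul]
    ring
  · refine hVP.span (by omega) fun p h0 h1 => ?_
    have := hy p h0 h1
    rw [altSeq, dotProduct_smul, smul_eq_mul] at this
    exact (mul_eq_zero.1 this).resolve_left (zpow_ne_zero _ (by norm_num))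

variable {ε : ℝ} {A : ℤ → Fin k → ℝ} {B : ℤ → Fin ℓ → ℝ}

theorem IsDual.pairing_swap {g : Matrix (Fin ℓ) (Fin ℓ) ℝ} (hg : g.det ≠ 0) (j i : ℤ) :
    ((g⁻¹)ᵀ *ᵥ altSeq (fun j => B (j + ℓ - k)) j) ⬝ᵥ (g *ᵥ altSeq W i) +
      altSeq (fun j => A (j + ℓ - k)) j ⬝ᵥ altSeq V i =
      (-1) ^ j * (-1) ^ i * (A (j + ℓ - k) ⬝ᵥ V i + B (j + ℓ - k) ⬝ᵥ W i) := by
  have h1 : ∀ b w : Fin ℓ → ℝ, ((g⁻¹)ᵀ *ᵥ b) ⬝ᵥ (g *ᵥ w) = b ⬝ᵥ w := by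
    intro b w
    rw [Matrix.mulVec_transpose, ← Matrix.dotProduct_mulVec, Matrix.mulVec_mulVec,
      Matrix.nonsing_inv_mul _ (isUnit_iff_ne_zero.2 hg), Matrix.one_mulVec]
  rw [h1]
  simp only [altSeq, smul_dotProduct, dotProduct_smul, smul_eq_mul]
  ring

/-- Reindexing by `ℓ - k` turns the window `[j - ℓ, j + k)` into `[j - k, j + ℓ)`. It also changes
the alternating sign, which accounts for the factor `(-1) ^ ℓ`. -/
theorem IsDual.swap {g : Matrix (Fin ℓ) (Fin ℓ) ℝ} (hg : g.det ≠ 0)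
    (hD : IsDual k ℓ ε V W A B) :
    IsDual ℓ k (ε * (-1) ^ ℓ) (fun j => g *ᵥ altSeq W j) (altSeq V)
      (fun j => (g⁻¹)ᵀ *ᵥ altSeq (fun j => B (j + ℓ - k)) j) (altSeq fun j => A (j + ℓ - k)) where
  eq_zero j i h1 h2 := by
    rw [IsDual.pairing_swap hg, hD.eq_zero _ _ (by omega) (by omega), mul_zero]
  pos j := by
    rw [IsDual.pairing_swap hg]
    have h := hD.pos (j + ℓ - k)
    rw [show j + ℓ - k - ℓ = j - (k : ℤ) by ring] at h
    refine h.trans_eq ?_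
    have e1 : (-1 : ℝ) ^ (j + ℓ - k) = (-1) ^ (j - (k : ℤ)) * (-1) ^ ℓ := by
      rw [show j + ℓ - k = (j - k) + (ℓ : ℤ) by ring, zpow_add₀ (by norm_num), zpow_natCast]
    rw [e1]
    linear_combination (-(ε * (-1) ^ ℓ * (-1) ^ (j - (k : ℤ)) *
      (A (j + ℓ - k) ⬝ᵥ V (j - k) + B (j + ℓ - k) ⬝ᵥ W (j - k)))) * neg_one_zpow_mul_self j

variable [NeZero n] (H : TwistData n k ℓ d Z V W) (hD : IsDual k ℓ ε V W A B) (hVP : SeqTP n V)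
include H hD hVP

/-- After the exchange, `B` is the first block and `altSeq_left_signTP` applies. The two
alternations cancel, so `B` satisfies the sign condition without further alternation. -/
theorem TwistData.right_signTP : SeqSignTP n B := by
  obtain ⟨d', g, Z', hg, H'⟩ := H.exists_swap hVP
  have h1 := H'.altSeq_left_signTP (hD.swap hg)
  have h2 := (h1.mulVec (g := gᵀ) (by rwa [Matrix.det_transpose])).comp_add (k - ℓ)
  convert h2 using 2 with j
  simp only [altSeq, Matrix.mulVec_smul, smul_smul, Matrix.mulVec_mulVec]
  rw [← Matrix.transpose_mul, Matrix.nonsing_inv_mul _ (isUnit_iff_ne_zero.2 hg),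
    Matrix.transpose_one, Matrix.one_mulVec, neg_one_zpow_mul_self, one_smul]
  congr 1; ring

theorem TwistData.dual_right_pos' (hℓ : 0 < ℓ) (j : ℤ) :
    0 < (-1) ^ (k + 1) * ε * ((-1) ^ j * (A j ⬝ᵥ V (j + k) + B j ⬝ᵥ W (j + k))) := by
  obtain ⟨d', g, Z', hg, H'⟩ := H.exists_swap hVP
  have h1 := H'.dual_right_pos (hD.swap hg) hℓ (j + k - ℓ)
  rw [IsDual.pairing_swap hg, show j + k - ℓ + ℓ - k = j by ring,
    show j + k - ℓ + ℓ = j + (k : ℤ) by ring] at h1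
  refine h1.trans_eq ?_
  have e1 : (-1 : ℝ) ^ (j + k) = (-1) ^ j * (-1) ^ k := by
    rw [zpow_add₀ (by norm_num), zpow_natCast]
  rw [e1, pow_succ, pow_succ]
  set P := A j ⬝ᵥ V (j + k) + B j ⬝ᵥ W (j + k)
  have e2 := neg_one_zpow_mul_self (j + k - ℓ)
  have e3 := neg_one_pow_mul_self ℓ
  linear_combination (-(ε * (-1) ^ j * (-1) ^ k * P) * (-1) ^ ℓ * (-1) ^ ℓ) * e2 -
    (ε * (-1) ^ j * (-1) ^ k * P) * e3

end RightDual

/-- For `k = 0` the band sum carries no information. All minors of `V` are then empty, so `V` is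
totally positive and the exchanged data can be used. -/
theorem TwistData.pairing_right_pos {n k ℓ d : ℕ} [NeZero n] {Z : ℤ → Fin d → ℝ}
    {V : ℤ → Fin k → ℝ} {W : ℤ → Fin ℓ → ℝ} (H : TwistData n k ℓ d Z V W) {ε : ℝ}
    {A : ℤ → Fin k → ℝ} {B : ℤ → Fin ℓ → ℝ} (hD : IsDual k ℓ ε V W A B) (hkl : 0 < k + ℓ) (j : ℤ) :
    0 < (-1) ^ (k + 1) * ε * ((-1) ^ j * (A j ⬝ᵥ V (j + k) + B j ⬝ᵥ W (j + k))) := by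
  rcases Nat.eq_zero_or_pos k with rfl | hk
  · refine H.dual_right_pos' hD (fun q _ => ?_) (by omega) j
    have : seqMinor V q = 1 := Matrix.det_isEmpty
    rw [this]; norm_num
  · exact H.dual_right_pos hD hk j

/-! ### The twist of sequences and of matrices -/

theorem dotProduct_append {k ℓ : ℕ} (u : Fin (k + ℓ) → ℝ) (x : Fin k → ℝ) (y : Fin ℓ → ℝ) :
    u ⬝ᵥ Fin.append x y = (fun a => u (Fin.castAdd ℓ a)) ⬝ᵥ x + (fun b => u (Fin.natAdd k b)) ⬝ᵥ y := by
  simp [dotProduct, Fin.sum_univ_add]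

theorem extCol_apply {r n : ℕ} [NeZero n] (k : ℕ) (U : Matrix (Fin r) (Fin n) ℝ) (j : ℤ) (a : Fin r) :
    extCol k U j a = ((-1 : ℝ) ^ (k + 1)) ^ (j / (n : ℤ)) * U a (Fin.ofNat n (j % (n : ℤ)).toNat) :=
  rfl

theorem extCol_stackMat {k ℓ n : ℕ} [NeZero n] (c : ℕ) (V : Matrix (Fin k) (Fin n) ℝ)
    (W : Matrix (Fin ℓ) (Fin n) ℝ) (j : ℤ) :
    extCol c (stackMat V W) j = Fin.append (extCol c V j) (extCol c W j) := by
  funext a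
  induction a using Fin.addCases with
  | left a => simp [extCol_apply, stackMat]
  | right a => simp [extCol_apply, stackMat]

theorem extCol_mul {r r' n : ℕ} [NeZero n] (c : ℕ) (g : Matrix (Fin r') (Fin r) ℝ)
    (U : Matrix (Fin r) (Fin n) ℝ) (j : ℤ) : extCol c (g * U) j = g *ᵥ extCol c U j := by
  funext a
  simp only [extCol_apply, Matrix.mulVec, dotProduct, Matrix.mul_apply, Finset.mul_sum]
  exact Finset.sum_congr rfl fun _ _ => by ring

theorem extCol_parity {r n : ℕ} [NeZero n] {c c' : ℕ} (h : Even (c + c'))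
    (U : Matrix (Fin r) (Fin n) ℝ) : extCol c U = extCol c' U := by
  funext j
  simp only [extCol, neg_one_pow_eq_of_even h]

/-- The matrix with columns `X (j - ℓ), …, X (j + k - 1)`. -/
noncomputable def winMat (k ℓ : ℕ) (X : ℤ → Fin (k + ℓ) → ℝ) (j : ℤ) :
    Matrix (Fin (k + ℓ)) (Fin (k + ℓ)) ℝ :=
  Matrix.of fun a i => X (j - ℓ + (i : ℕ)) a

/-- The twist of a sequence. -/
noncomputable def twistSeq (k ℓ : ℕ) (X : ℤ → Fin (k + ℓ) → ℝ) (j : ℤ) : Fin (k + ℓ) → ℝ :=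
  ((winMat k ℓ X j)ᵀ)⁻¹ *ᵥ fun i : Fin (k + ℓ) => if (i : ℕ) = 0 then (-1 : ℝ) ^ (j + 1) else 0

section TwistSeq

variable {k ℓ : ℕ} {X : ℤ → Fin (k + ℓ) → ℝ} {j : ℤ}

theorem winMat_transpose_mulVec (u : Fin (k + ℓ) → ℝ) (i : Fin (k + ℓ)) :
    ((winMat k ℓ X j)ᵀ *ᵥ u) i = u ⬝ᵥ X (j - ℓ + (i : ℕ)) := by
  rw [dotProduct_comm]; rfl

theorem eq_twistSeq_iff (h : (winMat k ℓ X j).det ≠ 0) (u : Fin (k + ℓ) → ℝ) :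
    u = twistSeq k ℓ X j ↔ ∀ i : Fin (k + ℓ), u ⬝ᵥ X (j - ℓ + (i : ℕ)) =
      if (i : ℕ) = 0 then (-1 : ℝ) ^ (j + 1) else 0 := by
  have hu : IsUnit ((winMat k ℓ X j)ᵀ).det := by
    rw [Matrix.det_transpose]; exact isUnit_iff_ne_zero.2 h
  constructor
  · rintro rfl i
    rw [← winMat_transpose_mulVec, twistSeq, Matrix.mulVec_mulVec, Matrix.mul_nonsing_inv _ hu,
      Matrix.one_mulVec]
  · intro h
    rw [twistSeq, ← funext h, ← funext (winMat_transpose_mulVec (X := X) (j := j) u),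
      Matrix.mulVec_mulVec, Matrix.nonsing_inv_mul _ hu, Matrix.one_mulVec]

theorem winMat_det_ne_zero_of_dotProduct
    (h : ∀ u : Fin (k + ℓ) → ℝ, (∀ p : ℤ, j - ℓ ≤ p → p < j + k → u ⬝ᵥ X p = 0) → u = 0) :
    (winMat k ℓ X j).det ≠ 0 := by
  intro h0
  obtain ⟨u, hu, hu0⟩ := Matrix.exists_vecMul_eq_zero_iff.2 h0
  refine hu (h u fun p h1 h2 => ?_)
  obtain ⟨i, hi⟩ := Int.eq_ofNat_of_zero_le (show 0 ≤ p - (j - ℓ) by omega)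
  have := congrFun hu0 ⟨i, by omega⟩
  rw [show p = j - ℓ + (i : ℕ) by omega]
  exact this

theorem dotProduct_eq_zero_of_winMat (h : (winMat k ℓ X j).det ≠ 0) {u : Fin (k + ℓ) → ℝ}
    (hu : ∀ p : ℤ, j - ℓ ≤ p → p < j + k → u ⬝ᵥ X p = 0) : u = 0 :=
  Matrix.eq_zero_of_vecMul_eq_zero h <| funext fun i =>
    hu (j - ℓ + (i : ℕ)) (by omega) (by have := i.2; omega)

theorem twistSeq_dotProduct_eq_zero (h : (winMat k ℓ X j).det ≠ 0) {i : ℤ} (h1 : j - ℓ < i)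
    (h2 : i < j + k) : twistSeq k ℓ X j ⬝ᵥ X i = 0 := by
  obtain ⟨a, ha⟩ := Int.eq_ofNat_of_zero_le (show 0 ≤ i - (j - ℓ) by omega)
  have := (eq_twistSeq_iff h _).1 rfl ⟨a, by omega⟩
  rw [if_neg (by dsimp only; omega)] at this
  rwa [show i = j - ℓ + (a : ℕ) by omega]

theorem twistSeq_dotProduct_left (h : (winMat k ℓ X j).det ≠ 0) (hkl : 0 < k + ℓ) :
    twistSeq k ℓ X j ⬝ᵥ X (j - ℓ) = (-1) ^ (j + 1) := by
  have := (eq_twistSeq_iff h _).1 rfl ⟨0, hkl⟩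
  simpa using this

theorem twistSeq_unique (h : (winMat k ℓ X j).det ≠ 0) {u : Fin (k + ℓ) → ℝ}
    (h1 : ∀ i : ℤ, j - ℓ < i → i < j + k → u ⬝ᵥ X i = 0)
    (h2 : u ⬝ᵥ X (j - ℓ) = (-1) ^ (j + 1)) : u = twistSeq k ℓ X j := by
  refine (eq_twistSeq_iff h u).2 fun i => ?_
  split_ifs with hi
  · simpa [hi] using h2
  · exact h1 _ (by omega) (by have := i.2; omega)

/-- Translation by `n` changes the defining equations by `(-1) ^ n` and `(-1) ^ (k + 1)` only. For
even `m` these combine to `(-1) ^ (ℓ + 1)`, and the solution is unique. -/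
theorem twistSeq_quasiPeriodic {n m : ℕ} (hn : k + ℓ + m = n) (hm : Even m)
    (hX : QuasiPeriodic n ((-1) ^ (k + 1)) X) (h : ∀ j, (winMat k ℓ X j).det ≠ 0) :
    QuasiPeriodic n ((-1) ^ (ℓ + 1)) (twistSeq k ℓ X) := by
  intro j
  rcases Nat.eq_zero_or_pos (k + ℓ) with h0 | h0
  · exact funext fun a => absurd a.2 (by omega)
  symm
  have hX' : ∀ i, X i = (-1 : ℝ) ^ (k + 1) • X (i - n) := fun i => by rw [← hX]; congr 1; ring
  refine twistSeq_unique (h _) (fun i h1 h2 => ?_) ?_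
  · rw [hX', smul_dotProduct, dotProduct_smul, twistSeq_dotProduct_eq_zero (h j) (by omega)
      (by omega), smul_zero, smul_zero]
  · rw [hX', smul_dotProduct, dotProduct_smul, show j + n - ℓ - n = j - (ℓ : ℤ) by ring,
      twistSeq_dotProduct_left (h j) h0, smul_eq_mul, smul_eq_mul,
      show j + n + 1 = (j + 1) + (n : ℤ) by ring, zpow_add₀ (by norm_num) (j + 1), zpow_natCast,
      ← hn, pow_add (-1 : ℝ) (k + ℓ), hm.neg_one_pow, pow_add, pow_succ, pow_succ]
    ring

end TwistSeq

section Mat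

variable {k ℓ m n : ℕ} [NeZero n]

theorem mem_matCirc_iff {U : Matrix (Fin (k + ℓ)) (Fin n) ℝ} :
    U ∈ matCirc k ℓ n ↔ ∀ j, (winMat k ℓ (extCol k U) j).det ≠ 0 := by
  have key : ∀ j, LinearIndependent ℝ (colWindow k ℓ U j).col ↔
      (winMat k ℓ (extCol k U) j).det ≠ 0 := fun j => by
    rw [Matrix.linearIndependent_cols_iff_isUnit, Matrix.isUnit_iff_isUnit_det, isUnit_iff_ne_zero]
    rfl
  constructor
  · exact fun h j => (key j).1 (h j).1
  · refine fun h j => ⟨(key j).2 (h j), ?_⟩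
    exact ((key j).2 (h j)).span_eq_top_of_card_eq_finrank' (by simp)

theorem extCol_twist (hn : k + ℓ + m = n) (hm : Even m) {U : Matrix (Fin (k + ℓ)) (Fin n) ℝ}
    (h : U ∈ matCirc k ℓ n) : extCol ℓ (twist k ℓ U) = twistSeq k ℓ (extCol k U) := by
  refine extCol_eq_of_quasiPeriodic ℓ _
    (twistSeq_quasiPeriodic hn hm (extCol_quasiPeriodic k U) (mem_matCirc_iff.1 h)) fun j => ?_
  rw [twistSeq]
  have : ∀ i : Fin (k + ℓ), (if (i : ℕ) = 0 then (-1 : ℝ) ^ (((j : ℕ) : ℤ) + 1) else 0) =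
      if (i : ℕ) = 0 then (-1 : ℝ) ^ ((j : ℕ) + 1) else 0 := fun i => by
    rw [← zpow_natCast (-1 : ℝ) ((j : ℕ) + 1)]; rfl
  simp only [this]
  rfl

/-- The stacked twist satisfies the equations that define it. -/
theorem isDual_stackedTwist (hn : k + ℓ + m = n) (hm : Even m) (hkl : 0 < k + ℓ)
    {V : Matrix (Fin k) (Fin n) ℝ} {W : Matrix (Fin ℓ) (Fin n) ℝ}
    (h : stackMat V W ∈ matCirc k ℓ n) :
    IsDual k ℓ (-1) (extCol k V) (extCol k W) (extCol ℓ (stackedTwist V W).1)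
      (extCol ℓ (stackedTwist V W).2) := by
  have key : ∀ j i, extCol ℓ (stackedTwist V W).1 j ⬝ᵥ extCol k V i +
      extCol ℓ (stackedTwist V W).2 j ⬝ᵥ extCol k W i =
      twistSeq k ℓ (extCol k (stackMat V W)) j ⬝ᵥ extCol k (stackMat V W) i := by
    intro j i
    rw [← extCol_twist hn hm h, extCol_stackMat, dotProduct_append]
    rfl
  have hw := mem_matCirc_iff.1 h
  constructor
  · intro j i h1 h2
    rw [key, twistSeq_dotProduct_eq_zero (hw j) h1 h2]
  · intro j
    rw [key, twistSeq_dotProduct_left (hw j) hkl, zpow_add_one₀ (by norm_num)]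
    have := neg_one_zpow_mul_self j
    linarith

/-- The twist is determined by the equations. -/
theorem twist_eq_of_dual {U T : Matrix (Fin (k + ℓ)) (Fin n) ℝ}
    (h : U ∈ matCirc k ℓ n)
    (h0 : ∀ j i : ℤ, j - ℓ < i → i < j + k → extCol ℓ T j ⬝ᵥ extCol k U i = 0)
    (h1 : ∀ j : ℤ, extCol ℓ T j ⬝ᵥ extCol k U (j - ℓ) = (-1) ^ (j + 1)) : twist k ℓ U = T := by
  ext a j
  have := (twist_col_iff k ℓ U h j (T.col j)).2 fun i => by
    rw [← extCol_coe ℓ T j]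
    split_ifs with hi
    · rw [hi, Nat.cast_zero, add_zero, h1, ← zpow_natCast]; rfl
    · exact h0 _ _ (by omega) (by have := i.2; omega)
  exact (congrFun this a).symm

theorem matCirc_mul {U : Matrix (Fin (k + ℓ)) (Fin n) ℝ} (h : U ∈ matCirc k ℓ n)
    {g : Matrix (Fin (k + ℓ)) (Fin (k + ℓ)) ℝ} (hg : g.det ≠ 0) : g * U ∈ matCirc k ℓ n := by
  rw [mem_matCirc_iff] at *
  intro j
  have : winMat k ℓ (extCol k (g * U)) j = g * winMat k ℓ (extCol k U) j := by
    ext a i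
    simp only [winMat, extCol_mul]
    rfl
  rw [this, Matrix.det_mul]
  exact mul_ne_zero hg (h j)

/-- The equations involve only pairings of the twist with the columns of `U`, so the twist
transforms contragrediently. -/
theorem twist_mul {U : Matrix (Fin (k + ℓ)) (Fin n) ℝ} (h : U ∈ matCirc k ℓ n)
    {g : Matrix (Fin (k + ℓ)) (Fin (k + ℓ)) ℝ} (hg : g.det ≠ 0) :
    twist k ℓ (g * U) = (g⁻¹)ᵀ * twist k ℓ U := by
  ext a j
  have := (twist_col_iff k ℓ _ (matCirc_mul h hg) j ((g⁻¹)ᵀ *ᵥ (twist k ℓ U).col j)).2 fun i => by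
    rw [extCol_mul, Matrix.mulVec_transpose, ← Matrix.dotProduct_mulVec, Matrix.mulVec_mulVec,
      Matrix.nonsing_inv_mul _ (isUnit_iff_ne_zero.2 hg), Matrix.one_mulVec]
    exact (twist_col_iff k ℓ U h j _).1 rfl i
  exact (congrFun this a).symm

end Mat

/-! ### A totally positive kernel near the identity -/

/-- Positivity of the Cauchy determinant. -/
theorem cauchy_det_pos : ∀ {r : ℕ} {x y : Fin r → ℝ}, (∀ i, 0 < x i) → (∀ i, 0 < y i) →
    StrictAnti x → StrictAnti y → 0 < (Matrix.of fun i j => 1 / (x i + y j)).det := by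
  intro r
  induction r with
  | zero => intro x y _ _ _ _; simp
  | succ r ih =>
    intro x y hx hy hxa hya
    have hxy : ∀ i j, x i + y j ≠ 0 := fun i j => (add_pos (hx i) (hy j)).ne'
    -- These multiples of the first row clear the first column. What remains is a smaller Cauchy
    -- matrix with positive row and column factors.
    set c : Fin (r + 1) → ℝ := Fin.cons 0 fun i => (x 0 + y 0) / (x i.succ + y 0) with hc
    have h1 := Matrix.det_eq_of_forall_row_eq_smul_add_const
      (A := Matrix.of fun i j => 1 / (x i + y j))
      (B := Matrix.of fun i j => 1 / (x i + y j) - c i * (1 / (x 0 + y j))) c 0 rfl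
      (fun i j => by simp [hc])
    rw [h1, Matrix.det_succ_column_zero, Fin.sum_univ_succ, Finset.sum_eq_zero, add_zero]
    · have h2 : (Matrix.of fun i j => 1 / (x i + y j) - c i * (1 / (x 0 + y j))).submatrix
          (Fin.succAbove 0) Fin.succ = Matrix.of fun i j : Fin r =>
          ((x 0 - x i.succ) / (x i.succ + y 0)) * (Matrix.of fun i j : Fin r =>
          ((y 0 - y j.succ) / (x 0 + y j.succ)) *
            (Matrix.of fun i j : Fin r => 1 / (x i.succ + y j.succ)) i j) i j := by
        ext i j
        have e1 := hxy i.succ j.succ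
        have e2 := hxy 0 j.succ
        have e3 := hxy i.succ 0
        simp only [hc, Matrix.submatrix_apply, Matrix.of_apply, Fin.succAbove_zero, Fin.cons_succ]
        field_simp
        ring
      rw [h2, Matrix.det_mul_column, Matrix.det_mul_row]
      have hpos := ih (x := fun i => x i.succ) (y := fun i => y i.succ) (fun i => hx _)
        (fun i => hy _) (fun i j h => hxa (Fin.succ_lt_succ_iff.2 h))
        (fun i j h => hya (Fin.succ_lt_succ_iff.2 h))
      refine mul_pos ?_ (mul_pos ?_ (mul_pos ?_ hpos))
      · have := add_pos (hx 0) (hy 0)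
        simpa [hc] using this
      · exact Finset.prod_pos fun i _ => div_pos (sub_pos.2 (hxa (Fin.succ_pos i)))
          (add_pos (hx _) (hy _))
      · exact Finset.prod_pos fun i _ => div_pos (sub_pos.2 (hya (Fin.succ_pos i)))
          (add_pos (hx _) (hy _))
    · intro i _
      have : (Matrix.of fun i j => 1 / (x i + y j) - c i * (1 / (x 0 + y j))) i.succ 0 = 0 := by
        have e1 := hxy i.succ 0
        have e2 := hxy 0 0
        simp only [hc, Matrix.of_apply, Fin.cons_succ]
        field_simp
        ring
      rw [this, mul_zero, zero_mul]

/-- A totally positive matrix that tends to the identity as `s → 0`. -/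
noncomputable def posKernel (n : ℕ) (s : ℝ) : Matrix (Fin n) (Fin n) ℝ :=
  Matrix.of fun i j => 2 * s ^ (i : ℕ) * s ^ (j : ℕ) / (s ^ (2 * (i : ℕ)) + s ^ (2 * (j : ℕ)))

theorem posKernel_det_pos {n r : ℕ} {s : ℝ} (h0 : 0 < s) (h1 : s < 1) {p q : Fin r → Fin n}
    (hp : StrictMono p) (hq : StrictMono q) :
    0 < (Matrix.of fun a b => posKernel n s (p b) (q a)).det := by
  have hanti : ∀ {p : Fin r → Fin n}, StrictMono p → StrictAnti fun a => s ^ (2 * (p a : ℕ)) := by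
    intro p hp a b hab
    have : (p a : ℕ) < p b := hp hab
    exact pow_lt_pow_right_of_lt_one₀ h0 h1 (by omega)
  have h : (Matrix.of fun a b => posKernel n s (p b) (q a)) = Matrix.of fun a b =>
      (s ^ (q a : ℕ)) * (Matrix.of fun a b => (2 * s ^ (p b : ℕ)) * (Matrix.of fun a b =>
        1 / (s ^ (2 * (q a : ℕ)) + s ^ (2 * (p b : ℕ)))) a b) a b := by
    ext a b
    simp only [posKernel, Matrix.of_apply]
    rw [add_comm]
    ring
  rw [h, Matrix.det_mul_column, Matrix.det_mul_row]
  refine mul_pos (Finset.prod_pos fun _ _ => pow_pos h0 _) (mul_pos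
    (Finset.prod_pos fun _ _ => mul_pos two_pos (pow_pos h0 _)) ?_)
  exact cauchy_det_pos (fun _ => pow_pos h0 _) (fun _ => pow_pos h0 _) (hanti hq) (hanti hp)

-- For `0 < s < 1` the diagonal entries are `1`, and the others lie between `0` and `2 * s`.
open Filter Topology in
theorem posKernel_tendsto (n : ℕ) : Tendsto (posKernel n) (𝓝[>] 0) (𝓝 1) := by
  have hev : ∀ᶠ s : ℝ in 𝓝[>] 0, 0 < s ∧ s < 1 := Ioo_mem_nhdsGT one_pos
  have hlim : Tendsto (fun s : ℝ => 2 * s) (𝓝[>] 0) (𝓝 0) := by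
    have : Tendsto (fun s : ℝ => 2 * s) (𝓝 0) (𝓝 (2 * 0)) := tendsto_id.const_mul 2
    rw [mul_zero] at this
    exact this.mono_left nhdsWithin_le_nhds
  have bound : ∀ (i j : Fin n), i < j → ∀ s : ℝ, 0 < s → s < 1 →
      0 ≤ posKernel n s i j ∧ posKernel n s i j ≤ 2 * s := by
    intro i j hij s h0 h1
    have hij' : (i : ℕ) < j := hij
    obtain ⟨e, he⟩ := Nat.exists_eq_add_of_lt hij'
    have p1 := pow_pos h0 (2 * (i : ℕ))
    have p2 := pow_pos h0 (2 * (j : ℕ))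
    have p3 := pow_pos h0 (i : ℕ)
    have p4 := pow_pos h0 (j : ℕ)
    simp only [posKernel, Matrix.of_apply]
    refine ⟨by positivity, ?_⟩
    rw [div_le_iff₀ (by positivity)]
    have h2 : s ^ (i : ℕ) * s ^ (j : ℕ) ≤ s * s ^ (2 * (i : ℕ)) := by
      rw [← pow_add, ← pow_succ']
      exact pow_le_pow_of_le_one h0.le h1.le (by omega)
    nlinarith [mul_pos h0 p2]
  have symm : ∀ i j s, posKernel n s i j = posKernel n s j i := by
    intro i j s
    simp only [posKernel, Matrix.of_apply]
    rw [add_comm]; ring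
  have off : ∀ i j : Fin n, i < j → Tendsto (fun s => posKernel n s i j) (𝓝[>] 0) (𝓝 0) := by
    intro i j hij
    refine squeeze_zero' ?_ ?_ hlim
    · filter_upwards [hev] with s hs using (bound i j hij s hs.1 hs.2).1
    · filter_upwards [hev] with s hs using (bound i j hij s hs.1 hs.2).2
  refine tendsto_pi_nhds.2 fun i => tendsto_pi_nhds.2 fun j => ?_
  rcases lt_trichotomy i j with h | h | h
  · rw [Matrix.one_apply_ne h.ne]; exact off i j h
  · subst h
    rw [Matrix.one_apply_eq]
    refine tendsto_const_nhds.congr' ?_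
    filter_upwards [hev] with s hs
    have := pow_pos hs.1 (i : ℕ)
    simp only [posKernel, Matrix.of_apply]
    rw [two_mul (i : ℕ), pow_add]
    field_simp
    norm_num
  · rw [Matrix.one_apply_ne h.ne']
    simp only [symm i j]
    exact off j i h

/-- By Cauchy–Binet every minor of the product is a sum of nonnegative terms, and the nonzero minor
of `V` meets a positive minor of the kernel. -/
theorem seqTP_mul_posKernel {n k : ℕ} [NeZero n] {V : Matrix (Fin k) (Fin n) ℝ}
    (hV : SeqTNN n (extCol k V)) {I : Fin k → ℤ} (hI : CycInc n I)
    (hI0 : seqMinor (extCol k V) I ≠ 0) {s : ℝ} (h0 : 0 < s) (h1 : s < 1) :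
    SeqTP n (extCol k (V * posKernel n s)) := by
  intro q hq
  obtain ⟨J, hJ, -, hJX⟩ := hq.exists_finset
  obtain ⟨I', hI', -, hIX⟩ := hI.exists_finset
  rw [hJX _ (extCol_quasiPeriodic _ _)]
  rw [hIX _ (extCol_quasiPeriodic _ _)] at hI0
  have hcol : ∀ p : Fin n, extCol k (V * posKernel n s) ((p : ℕ) : ℤ) =
      ∑ i, posKernel n s i p • extCol k V ((i : ℕ) : ℤ) := by
    intro p
    simp only [extCol_coe]
    funext a
    simp only [Finset.sum_apply, Pi.smul_apply, smul_eq_mul, Matrix.col_apply, Matrix.mul_apply]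
    exact Finset.sum_congr rfl fun _ _ => mul_comm _ _
  have hVs : ∀ {g : Fin k → Fin n}, StrictMono g →
      0 ≤ Matrix.detRowAlternating fun a => extCol k V ((g a : ℕ) : ℤ) := by
    intro g hg
    have := hV _ (cycInc_add_fin (c := 0) hg)
    simpa only [seqMinor, zero_add] using this
  simp only [hcol]
  refine det_sum_pos _ _ (fun g hg => mul_nonneg (posKernel_det_pos h0 h1 hg
    (J.orderEmbOfFin hJ).strictMono).le (hVs hg)) (I'.orderEmbOfFin hI') (mul_pos
      (posKernel_det_pos h0 h1 (I'.orderEmbOfFin hI').strictMono (J.orderEmbOfFin hJ).strictMono)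
      (lt_of_le_of_ne (hVs (I'.orderEmbOfFin hI').strictMono) (Ne.symm hI0)))

/-! ### Continuity of the twist and weak positivity of the second block -/

section Continuity

variable {k ℓ n : ℕ} [NeZero n]

theorem continuous_extCol {r : ℕ} (c : ℕ) (j : ℤ) :
    Continuous fun U : Matrix (Fin r) (Fin n) ℝ => extCol c U j := by
  refine continuous_pi fun a => ?_
  simp only [extCol_apply]
  fun_prop

theorem continuousAt_twist {U : Matrix (Fin (k + ℓ)) (Fin n) ℝ} (h : U ∈ matCirc k ℓ n) :
    ContinuousAt (twist k ℓ) U := by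
  have hc : ∀ j : ℤ, Continuous fun U : Matrix (Fin (k + ℓ)) (Fin n) ℝ => (colWindow k ℓ U j)ᵀ :=
    fun j => continuous_pi fun a => continuous_pi fun i =>
      (continuous_apply i).comp (continuous_extCol k _)
  refine continuousAt_pi.2 fun a => continuousAt_pi.2 fun j => ?_
  have hd : (colWindow k ℓ U (j : ℕ))ᵀ.det ≠ 0 := by
    rw [Matrix.det_transpose]; exact mem_matCirc_iff.1 h _
  have h1 : ContinuousAt (fun U : Matrix (Fin (k + ℓ)) (Fin n) ℝ =>
      ((colWindow k ℓ U (j : ℕ))ᵀ)⁻¹) U := by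
    refine ContinuousAt.comp (g := Inv.inv) (continuousAt_matrix_inv _ ?_) (hc _).continuousAt
    rw [Ring.inverse_eq_inv']
    exact continuousAt_inv₀ hd
  simp only [twist, Matrix.of_apply, Matrix.mulVec, dotProduct]
  refine tendsto_finsetSum _ fun i _ => ?_
  refine Filter.Tendsto.mul_const _ ?_
  exact ((continuous_apply i).comp (continuous_apply a)).continuousAt.comp h1

omit [NeZero n] in
theorem continuous_stackMat {ι : Type*} [TopologicalSpace ι] {f : ι → Matrix (Fin k) (Fin n) ℝ}
    {g : ι → Matrix (Fin ℓ) (Fin n) ℝ} {x : ι} (hf : ContinuousAt f x) (hg : ContinuousAt g x) :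
    ContinuousAt (fun t => stackMat (f t) (g t)) x := by
  refine continuousAt_pi.2 fun a => ?_
  induction a using Fin.addCases with
  | left a =>
    have : (fun t => stackMat (f t) (g t) (Fin.castAdd ℓ a)) = fun t => f t a := by
      funext t j; simp [stackMat]
    rw [this]
    exact (continuous_apply a).continuousAt.comp hf
  | right a =>
    have : (fun t => stackMat (f t) (g t) (Fin.natAdd k a)) = fun t => g t a := by
      funext t j; simp [stackMat]
    rw [this]
    exact (continuous_apply a).continuousAt.comp hg

end Continuity

theorem TwistData.mem_matCirc {n k ℓ d : ℕ} [NeZero n] {Z : ℤ → Fin d → ℝ}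
    {V : Matrix (Fin k) (Fin n) ℝ} {W : Matrix (Fin ℓ) (Fin n) ℝ}
    (H : TwistData n k ℓ d Z (extCol k V) (extCol k W)) : stackMat V W ∈ matCirc k ℓ n := by
  refine mem_matCirc_iff.2 fun j => winMat_det_ne_zero_of_dotProduct fun u hu => ?_
  simp only [extCol_stackMat, dotProduct_append] at hu
  have h1 := H.left_eq_zero hu
  have h2 := H.right_eq_zero hu
  funext a
  induction a using Fin.addCases with
  | left a => exact congrFun h1 a
  | right a => exact congrFun h2 a

/-- All cyclically increasing minors have the same weak sign. -/
def SeqSignTNN (n : ℕ) {r : ℕ} (X : ℤ → Fin r → ℝ) : Prop :=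
  ∀ q q', CycInc n q → CycInc n q' → 0 ≤ seqMinor X q * seqMinor X q'

-- For the perturbed matrices `V * posKernel n s` the second block has strictly constant sign by
-- `right_signTP`. As `s → 0` the twists converge, since the windows of the limit are bases, and the
-- products of two minors stay nonnegative.
open Filter Topology in
theorem TwistData.right_signTNN {n k ℓ d m : ℕ} [NeZero n] {Z : ℤ → Fin d → ℝ}
    {V : Matrix (Fin k) (Fin n) ℝ} {W : Matrix (Fin ℓ) (Fin n) ℝ}
    (H : TwistData n k ℓ d Z (extCol k V) (extCol k W)) (hn : k + ℓ + m = n) (hm : Even m)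
    (hkl : 0 < k + ℓ) : SeqSignTNN n (extCol ℓ (stackedTwist V W).2) := by
  intro q q' hq hq'
  have hev : ∀ᶠ s : ℝ in 𝓝[>] 0, 0 < s ∧ s < 1 := Ioo_mem_nhdsGT one_pos
  have hle := H.le
  have hcard := H.card
  obtain ⟨I, hI, hIw, hI0⟩ := H.window 0
  have hIc : CycInc n I := CycInc.of_mem_Ico (c := 0) hI fun a => by have := hIw a; omega
  have hTP := fun s (hs : 0 < s ∧ s < 1) => seqTP_mul_posKernel H.nonnegV hIc hI0 hs.1 hs.2
  have hlim : Tendsto (fun s => stackMat (V * posKernel n s) W) (𝓝[>] 0) (𝓝 (stackMat V W)) := by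
    have h1 : ContinuousAt (fun G : Matrix (Fin n) (Fin n) ℝ => stackMat (V * G) W) 1 :=
      continuous_stackMat (continuous_const.matrix_mul continuous_id).continuousAt
        continuousAt_const
    have h2 := h1.tendsto.comp (posKernel_tendsto n)
    rwa [Matrix.mul_one] at h2
  have hlim2 := (continuousAt_twist H.mem_matCirc).tendsto.comp hlim
  have hcont : ∀ q : Fin ℓ → ℤ, Continuous fun T : Matrix (Fin (k + ℓ)) (Fin n) ℝ =>
      seqMinor (extCol ℓ (T.submatrix (Fin.natAdd k) id)) q := by
    intro q
    refine Continuous.matrix_det (A := fun T : Matrix (Fin (k + ℓ)) (Fin n) ℝ =>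
      Matrix.of fun a => extCol ℓ (T.submatrix (Fin.natAdd k) id) (q a)) ?_
    refine continuous_pi fun a => (continuous_extCol ℓ _).comp ?_
    exact continuous_pi fun b => continuous_pi fun j => (continuous_apply j).comp
      (continuous_apply (Fin.natAdd k b))
  have hlim3 := (((hcont q).mul (hcont q')).tendsto _).comp hlim2
  refine ge_of_tendsto hlim3 ?_
  filter_upwards [hev] with s hs
  have H' : TwistData n k ℓ d Z (extCol k (V * posKernel n s)) (extCol k W) :=
    { H with
      qpV := extCol_quasiPeriodic _ _
      nonnegV := fun q hq => (hTP s hs q hq).le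
      window := fun j => ⟨fun a => j + (a : ℕ), fun a b h => by
        have : (a : ℕ) < b := h
        dsimp only; omega, fun a => by have := a.2; dsimp only; omega,
        (hTP s hs _ (cycInc_consecutive (by omega) j)).ne'⟩ }
  exact (H'.right_signTP (isDual_stackedTwist hn hm hkl H'.mem_matCirc) (hTP s hs) q q' hq hq').le

/-! ### Box counts of affine permutations and the Grassmann necklace -/

theorem sum_Ico_eq_sum_fin {M : Type*} [AddCommMonoid M] (n : ℕ) (c : ℤ) (F : ℤ → M) :
    ∑ j ∈ Finset.Ico c (c + n), F j = ∑ p : Fin n, F (c + (p : ℕ)) := by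
  symm
  refine Finset.sum_bij (fun p _ => c + ((p : ℕ) : ℤ)) (fun p _ => ?_) (fun p _ q _ h => ?_)
    (fun j hj => ?_) fun _ _ => rfl
  · have := p.2
    rw [Finset.mem_Ico]; omega
  · exact Fin.ext (by omega)
  · rw [Finset.mem_Ico] at hj
    obtain ⟨i, hi⟩ := Int.eq_ofNat_of_zero_le (show 0 ≤ j - c by omega)
    exact ⟨⟨i, by omega⟩, Finset.mem_univ _, by simp only; omega⟩

/-- The number of `j ∈ [p, q)` with `g j ∈ [u, v)`. -/
noncomputable def box (g : ℤ → ℤ) (p q u v : ℤ) : ℕ :=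
  ((Finset.Ico p q).filter fun j => u ≤ g j ∧ g j < v).card

section Box

variable {g : ℤ → ℤ} {p q r u v w : ℤ}

theorem box_congr {p' q' u' v' : ℤ} (h : ∀ j, (p ≤ j ∧ j < q ∧ u ≤ g j ∧ g j < v) ↔
    (p' ≤ j ∧ j < q' ∧ u' ≤ g j ∧ g j < v')) : box g p q u v = box g p' q' u' v' := by
  unfold box
  congr 1
  ext j
  simp only [Finset.mem_filter, Finset.mem_Ico, and_assoc]
  exact h j

theorem box_mono {p' q' u' v' : ℤ} (h : ∀ j, (p ≤ j ∧ j < q ∧ u ≤ g j ∧ g j < v) →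
    (p' ≤ j ∧ j < q' ∧ u' ≤ g j ∧ g j < v')) : box g p q u v ≤ box g p' q' u' v' := by
  refine Finset.card_le_card fun j => ?_
  simp only [Finset.mem_filter, Finset.mem_Ico, and_assoc]
  exact h j

theorem box_add_left (h1 : p ≤ r) (h2 : r ≤ q) : box g p r u v + box g r q u v = box g p q u v := by
  unfold box
  rw [← Finset.card_union_of_disjoint]
  · congr 1
    ext j
    simp only [Finset.mem_union, Finset.mem_filter, Finset.mem_Ico]
    omega
  · rw [Finset.disjoint_left]
    intro j
    simp only [Finset.mem_filter, Finset.mem_Ico]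
    omega

theorem box_add_right (h1 : u ≤ w) (h2 : w ≤ v) : box g p q u w + box g p q w v = box g p q u v := by
  unfold box
  rw [← Finset.card_union_of_disjoint]
  · congr 1
    ext j
    simp only [Finset.mem_union, Finset.mem_filter, Finset.mem_Ico]
    omega
  · rw [Finset.disjoint_left]
    intro j
    simp only [Finset.mem_filter, Finset.mem_Ico]
    omega

theorem box_shift {n : ℤ} (hg : ∀ j, g (j + n) = g j + n) :
    box g (p + n) (q + n) (u + n) (v + n) = box g p q u v := by
  unfold box
  symm
  refine Finset.card_bij (fun j _ => j + n) (fun j hj => ?_) (fun j _ j' _ h => by omega)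
    fun j hj => ⟨j - n, ?_, by ring⟩
  · simp only [Finset.mem_filter, Finset.mem_Ico] at hj ⊢
    rw [hg]; omega
  · simp only [Finset.mem_filter, Finset.mem_Ico] at hj ⊢
    have := hg (j - n)
    rw [sub_add_cancel] at this
    omega

end Box

theorem Equiv.Perm.add_mul_of_periodic {n : ℕ} {f : Equiv.Perm ℤ} (hf : ∀ i, f (i + n) = f i + n)
    (i t : ℤ) : f (i + n * t) = f i + n * t := by
  induction t using Int.induction_on with
  | zero => simp
  | succ t ih => rw [mul_add, ← add_assoc, mul_one, hf, ih]; ring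
  | pred t ih =>
    have := hf (i + n * (-t - 1))
    rw [show i + n * (-t - 1) + n = i + n * (-t : ℤ) by ring, ih] at this
    linarith

theorem periodic_add_mul {n : ℕ} {M : Type*} {φ : ℤ → M} (hφ : ∀ j, φ (j + n) = φ j) (i t : ℤ) :
    φ (i + n * t) = φ i := by
  induction t using Int.induction_on with
  | zero => simp
  | succ t ih => rw [mul_add, ← add_assoc, mul_one, hφ, ih]
  | pred t ih => rw [← ih, ← hφ]; congr 1; ring

/-- A periodic function has the same sum over a period and over its image under an affine
permutation. -/
theorem sum_periodic_comp_perm {n : ℕ} [NeZero n] {M : Type*} [AddCommMonoid M] {φ : ℤ → M}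
    (hφ : ∀ j, φ (j + n) = φ j) {f : Equiv.Perm ℤ} (hf : ∀ i, f (i + n) = f i + n) :
    ∑ j : Fin n, φ (f (j : ℕ)) = ∑ j : Fin n, φ (j : ℕ) := by
  have hn : (0 : ℤ) < n := by exact_mod_cast NeZero.pos n
  have hlt : ∀ x : ℤ, (x % n).toNat < n := fun x => by
    have := x.emod_nonneg hn.ne'; have := x.emod_lt_of_pos hn; omega
  have hcast : ∀ x : ℤ, ((x % n).toNat : ℤ) = x % n := fun x =>
    Int.toNat_of_nonneg (x.emod_nonneg hn.ne')
  set ρ : Fin n → Fin n := fun j => ⟨(f (j : ℕ) % n).toNat, hlt _⟩ with hρ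
  have hinj : Function.Injective ρ := by
    intro i j hij
    have h1 : f (i : ℕ) % n = f (j : ℕ) % n := by
      have := congrArg (fun x : Fin n => ((x : ℕ) : ℤ)) hij
      simpa only [hρ, hcast] using this
    have h2 := Int.emod_add_mul_ediv (f (i : ℕ)) n
    have h3 := Int.emod_add_mul_ediv (f (j : ℕ)) n
    have h4 : f (i : ℕ) = f ((j : ℕ) + n * (f (i : ℕ) / n - f (j : ℕ) / n)) := by
      rw [Equiv.Perm.add_mul_of_periodic hf]; linarith
    have h5 := f.injective h4
    have h6 := congrArg (· % (n : ℤ)) h5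
    simp only [Int.add_mul_emod_self_left] at h6
    rw [Int.emod_eq_of_lt (by positivity) (by have := i.2; omega),
      Int.emod_eq_of_lt (by positivity) (by have := j.2; omega)] at h6
    exact Fin.ext (by omega)
  rw [← (Finite.injective_iff_bijective.1 hinj).sum_comp fun j : Fin n => φ ((j : ℕ) : ℤ)]
  refine Finset.sum_congr rfl fun j _ => ?_
  simp only [hρ, hcast]
  conv_lhs => rw [← Int.emod_add_mul_ediv (f (j : ℕ)) n]
  rw [periodic_add_mul hφ]

section AffPerm

variable {n k : ℕ} [NeZero n] {b : ℤ} {f : Equiv.Perm ℤ}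

omit [NeZero n] in
theorem affPerm_sum_eq (hf : f ∈ affPerm n k b) (c : ℤ) :
    ∑ p : Fin n, (f (c + (p : ℕ)) - (c + (p : ℕ))) = 0 := by
  rw [sum_period (f := fun j => f j - j) (fun j => by rw [hf.1]; ring) c, ← hf.2.1,
    Finset.sum_range]

omit [NeZero n] in
theorem affPerm_bound (hf : f ∈ affPerm n k b) (hb : k + b ≤ n) (j : ℤ) :
    j ≤ f j + k ∧ f j + k ≤ j + n := by
  have := hf.2.2 j
  omega

/-- Reduce values modulo `n` into `[i, i + n)`. Over the period `[i - n, i)` the values `f j + k`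
lie in `[i, i + n)`, and are unchanged, or below `i`, and are raised by `n`. Their reductions have
the same sum as the reductions of the integers of that period. As the displacements of `f` sum to
zero, comparing the sums gives `n` times the count on one side and `n * k` on the other. -/
theorem affPerm_box_total (hf : f ∈ affPerm n k b) (hb : k + b ≤ n) (i : ℤ) :
    box (fun j => f j + k) (i - n) i i (i + n) = k := by
  have hn : (0 : ℤ) < n := by exact_mod_cast NeZero.pos n
  set φ : ℤ → ℤ := fun x => i + (x - i) % n with hφ
  have hφp : ∀ x, φ (x + n) = φ x := fun x => by
    simp only [hφ]; rw [show x + n - i = x - i + n by ring, Int.add_emod_right]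
  have hcomp : ∀ x, φ (f x + k + n) = φ (f x + k) := fun x => hφp _
  have h1 : ∑ j : Fin n, φ (f ((j : ℕ) : ℤ) + k) = ∑ j : Fin n, φ ((j : ℕ) : ℤ) := by
    rw [sum_periodic_comp_perm (φ := fun x => φ (x + k)) (fun x => by
      rw [← hφp (x + k)]; congr 1; ring) hf.1]
    have := sum_period (n := n) (f := φ) hφp k
    rw [← this]
    exact Finset.sum_congr rfl fun j _ => by rw [add_comm]
  rw [← sum_period (f := fun j => φ (f j + k)) (fun j => by
    rw [hf.1, ← hφp (f j + k)]; congr 1; ring) (i - n), ← sum_period hφp (i - n)] at h1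
  have h2 : ∀ p : Fin n, φ (i - n + (p : ℕ)) = i - n + (p : ℕ) + n := fun p => by
    have := p.2
    simp only [hφ]
    rw [show i - n + ((p : ℕ) : ℤ) - i = (p : ℕ) - n by ring, Int.sub_emod_right,
      Int.emod_eq_of_lt (by omega) (by omega)]
    ring
  have h3 : ∀ p : Fin n, φ (f (i - n + (p : ℕ)) + k) = f (i - n + (p : ℕ)) + k + n -
      n * (if i ≤ f (i - n + (p : ℕ)) + k ∧ f (i - n + (p : ℕ)) + k < i + n then 1 else 0) := by
    intro p
    have := p.2
    have hbd := affPerm_bound hf hb (i - n + (p : ℕ))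
    simp only [hφ]
    split_ifs with h
    · rw [Int.emod_eq_of_lt (by omega) (by omega)]; ring
    · rw [← Int.add_emod_right, Int.emod_eq_of_lt (by omega) (by omega)]; ring
  simp only [h2, h3] at h1
  rw [Finset.sum_sub_distrib, ← Finset.mul_sum] at h1
  have h4 : (box (fun j => f j + k) (i - n) i i (i + n) : ℤ) = ∑ p : Fin n,
      if i ≤ f (i - n + (p : ℕ)) + k ∧ f (i - n + (p : ℕ)) + k < i + n then (1 : ℤ) else 0 := by
    rw [box, Finset.card_filter]
    push_cast
    rw [← sum_Ico_eq_sum_fin n (i - n) fun j =>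
      if i ≤ f j + k ∧ f j + k < i + n then (1 : ℤ) else 0, sub_add_cancel]
  rw [← h4] at h1
  have h5 := affPerm_sum_eq hf (i - n)
  simp only [Finset.sum_add_distrib, Finset.sum_sub_distrib, Finset.sum_const, Finset.card_univ,
    Fintype.card_fin, nsmul_eq_mul] at h1 h5
  have h6 : (n : ℤ) * (box (fun j => f j + k) (i - n) i i (i + n) : ℤ) = n * k := by linarith
  exact_mod_cast mul_left_cancel₀ hn.ne' h6

/-- The elements of the necklace that lie in a given part of the period. -/
theorem card_necklace_filter (hf : f ∈ affPerm n k b) (hb : k + b ≤ n) (a : Fin n) {u v : ℤ}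
    (hu : (a : ℕ) ≤ u) (hv : v ≤ (a : ℕ) + n) :
    ((grNecklace k f a).filter fun x : Fin n => u ≤ (a : ℕ) + ((x : ℕ) - (a : ℕ) : ℤ) % n ∧
      (a : ℕ) + ((x : ℕ) - (a : ℕ) : ℤ) % n < v).card =
      box (fun j => f j + k) ((a : ℕ) - n) (a : ℕ) u v := by
  have hn : (0 : ℤ) < n := by exact_mod_cast NeZero.pos n
  have hlt : ∀ x : ℤ, (x % n).toNat < n := fun x => by
    have := x.emod_nonneg hn.ne'; have := x.emod_lt_of_pos hn; omega
  have hcast : ∀ x : ℤ, ((x % n).toNat : ℤ) = x % n := fun x =>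
    Int.toNat_of_nonneg (x.emod_nonneg hn.ne')
  have hpos : ∀ (x : Fin n) (y : ℤ), (x : ℤ) ≡ y [ZMOD n] → (a : ℕ) ≤ y → y < (a : ℕ) + n →
      (a : ℕ) + ((x : ℕ) - (a : ℕ) : ℤ) % n = y := by
    intro x y hxy h1 h2
    have := hxy.sub_right ((a : ℕ) : ℤ)
    rw [this, Int.emod_eq_of_lt (by omega) (by omega)]; ring
  have hmod : ∀ y : ℤ, (((⟨(y % n).toNat, hlt y⟩ : Fin n) : ℕ) : ℤ) ≡ y [ZMOD n] := fun y => by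
    simp only [hcast]; exact Int.mod_modEq _ _
  symm
  refine Finset.card_bij (fun j _ => (⟨((f j + k) % n).toNat, hlt _⟩ : Fin n)) (fun j hj => ?_)
    (fun j hj j' hj' h => ?_) fun x hx => ?_
  · simp only [Finset.mem_filter, Finset.mem_Ico] at hj
    have hp := hpos _ _ (hmod (f j + k)) (by omega) (by omega)
    rw [Finset.mem_filter, hp]
    refine ⟨?_, by omega, by omega⟩
    simp only [grNecklace, Finset.mem_filter, Finset.mem_univ, true_and]
    exact ⟨j, by omega, by omega, hmod _⟩
  · simp only [Finset.mem_filter, Finset.mem_Ico] at hj hj'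
    have hp := hpos _ _ (hmod (f j + k)) (by omega) (by omega)
    have hp' := hpos _ _ (hmod (f j' + k)) (by omega) (by omega)
    rw [h] at hp
    exact f.injective (by omega)
  · simp only [grNecklace, Finset.mem_filter, Finset.mem_univ, true_and] at hx
    obtain ⟨⟨j, hj1, hj2, hj3⟩, hx2⟩ := hx
    have hbd := affPerm_bound hf hb j
    rw [hpos _ _ hj3 hj2 (by omega)] at hx2
    refine ⟨j, ?_, ?_⟩
    · simp only [Finset.mem_filter, Finset.mem_Ico]; omega
    · apply Fin.ext
      have : (f j + k) % n = (x : ℤ) % n := hj3.symm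
      simp only [this]
      rw [Int.emod_eq_of_lt (by positivity) (by have := x.2; omega)]
      simp

theorem card_necklace_inter_cyc (hf : f ∈ affPerm n k b) (hb : k + b ≤ n) (i : Fin n) {t : ℕ}
    (ht : t ≤ n) : (grNecklace k f i ∩ cyc i t).card =
      box (fun j => f j + k) ((i : ℕ) - n) (i : ℕ) (i : ℕ) ((i : ℕ) + t) := by
  have hn : (0 : ℤ) < n := by exact_mod_cast NeZero.pos n
  rw [← card_necklace_filter hf hb i le_rfl (by omega)]
  congr 1
  ext x
  have := (((x : ℕ) : ℤ) - (i : ℕ)).emod_nonneg hn.ne'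
  simp only [Finset.mem_inter, Finset.mem_filter, cyc, Finset.mem_univ, true_and]
  refine and_congr_right fun _ => ?_
  omega

theorem cyc_self_eq_univ (i : Fin n) : cyc i n = Finset.univ := by
  have hn : (0 : ℤ) < n := by exact_mod_cast NeZero.pos n
  ext x
  simp only [cyc, Finset.mem_filter, Finset.mem_univ, true_and, iff_true]
  exact Int.emod_lt_of_pos _ hn

theorem card_necklace (hf : f ∈ affPerm n k b) (hb : k + b ≤ n) (i : Fin n) :
    (grNecklace k f i).card = k := by
  have h := card_necklace_inter_cyc hf hb i le_rfl
  rwa [cyc_self_eq_univ, Finset.inter_univ, affPerm_box_total hf hb] at h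

/-- The totals for the cuts at `i` and at `a + n` both equal `k`. Besides the two boxes compared
here they consist of boxes that agree by periodicity or by the range of `f`. -/
theorem box_crossing (hf : f ∈ affPerm n k b) (hb : k + b ≤ n) {a i : ℤ} (h1 : a ≤ i)
    (h2 : i < a + n) : box (fun j => f j + k) i (a + n) (a + n) (i + n) =
      box (fun j => f j + k) a i i (a + n) := by
  have hbd := affPerm_bound hf hb
  have t1 := affPerm_box_total hf hb i
  have t2 := affPerm_box_total hf hb (a + n)
  rw [← box_add_right (w := a + n) (by omega) (by omega),
    ← box_add_left (v := a + n) (r := a) (by omega) (by omega)] at t1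
  rw [← box_add_left (r := i) (by omega) (by omega), ← box_add_right (p := i) (w := i + n)
    (by omega) (by omega)] at t2
  have e1 : box (fun j => f j + k) i (a + n) (i + n) (a + n + n) =
      box (fun j => f j + k) (i - n) a i (a + n) := by
    rw [← box_shift (p := i - n) (q := a) (u := i) (v := a + n) (n := n)
      fun j => by rw [hf.1]; ring]
    exact box_congr fun j => by omega
  have e2 : box (fun j => f j + k) (a + n - n) i (a + n) (a + n + n) =
      box (fun j => f j + k) (i - n) i (a + n) (i + n) :=
    box_congr fun j => by have := hbd j; omega
  omega

/-- This is the compatibility of the necklace terms that makes each of them a member of the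
positroid. The interval is moved to begin in `[a, a + n)`. If it extends beyond `a + n` it is cut
there, and the part that wraps around is converted with `box_crossing`. -/
theorem card_necklace_inter_cyc_le (hf : f ∈ affPerm n k b) (hb : k + b ≤ n) (a i : Fin n) {t : ℕ}
    (ht : t ≤ n) : (grNecklace k f a ∩ cyc i t).card ≤
      box (fun j => f j + k) ((i : ℕ) - n) (i : ℕ) (i : ℕ) ((i : ℕ) + t) := by
  have hn : (0 : ℤ) < n := by exact_mod_cast NeZero.pos n
  have hbd := affPerm_bound hf hb
  have ha := a.2
  have hi := i.2
  obtain ⟨i', h1, h2, hmod, hbox⟩ : ∃ i' : ℤ, (a : ℕ) ≤ i' ∧ i' < (a : ℕ) + n ∧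
      (∀ x : ℤ, (x - (i : ℕ)) % n = (x - i') % n) ∧
      box (fun j => f j + k) ((i : ℕ) - n) (i : ℕ) (i : ℕ) ((i : ℕ) + t) =
      box (fun j => f j + k) (i' - n) i' i' (i' + t) := by
    by_cases h : (a : ℕ) ≤ (i : ℕ)
    · exact ⟨(i : ℕ), by omega, by omega, fun _ => rfl, rfl⟩
    · refine ⟨(i : ℕ) + n, by omega, by omega, fun x => ?_, ?_⟩
      · rw [← sub_sub, Int.sub_emod_right]
      · rw [← box_shift (n := n) fun j => by rw [hf.1]; ring]
        congr 1 <;> ring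
  rw [hbox]
  have hsub : grNecklace k f a ∩ cyc i t ⊆
      ((grNecklace k f a).filter fun x : Fin n => i' ≤ (a : ℕ) + ((x : ℕ) - (a : ℕ) : ℤ) % n ∧
        (a : ℕ) + ((x : ℕ) - (a : ℕ) : ℤ) % n < min (i' + t) ((a : ℕ) + n)) ∪
      ((grNecklace k f a).filter fun x : Fin n => (a : ℕ) ≤ (a : ℕ) + ((x : ℕ) - (a : ℕ) : ℤ) % n ∧
        (a : ℕ) + ((x : ℕ) - (a : ℕ) : ℤ) % n < i' + t - n) := by
    intro x hx
    simp only [Finset.mem_inter, cyc, Finset.mem_filter, Finset.mem_univ, true_and,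
      Finset.mem_union] at hx ⊢
    obtain ⟨hx1, hx2⟩ := hx
    have hx3 := hmod (x : ℕ)
    have m1 := (((x : ℕ) : ℤ) - (a : ℕ)).emod_nonneg hn.ne'
    have m2 := (((x : ℕ) : ℤ) - (a : ℕ)).emod_lt_of_pos hn
    have m3 : (((x : ℕ) : ℤ) - i') % n = ((a : ℕ) + (((x : ℕ) : ℤ) - (a : ℕ)) % n - i') % n := by
      rw [add_sub_right_comm, Int.add_emod_emod]; congr 1; ring
    simp only [hx1, true_and]
    by_cases hc : i' ≤ (a : ℕ) + (((x : ℕ) : ℤ) - (a : ℕ)) % n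
    · have m4 := Int.emod_eq_of_lt
        (a := (a : ℕ) + (((x : ℕ) : ℤ) - (a : ℕ)) % n - i') (b := n) (by omega) (by omega)
      left; omega
    · have m4 := Int.emod_eq_of_lt
        (a := (a : ℕ) + (((x : ℕ) : ℤ) - (a : ℕ)) % n - i' + n) (b := n) (by omega) (by omega)
      rw [Int.add_emod_right] at m4
      right; omega
  refine (Finset.card_le_card hsub).trans ((Finset.card_union_le _ _).trans ?_)
  rw [card_necklace_filter hf hb a h1 (min_le_right _ _),
    card_necklace_filter hf hb a le_rfl (by omega)]
  rcases le_or_gt (i' + t) ((a : ℕ) + n) with hc | hc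
  · have e1 : box (fun j => f j + k) ((a : ℕ) - n) (a : ℕ) (a : ℕ) (i' + t - n) = 0 := by
      rw [box, Finset.card_eq_zero, Finset.filter_eq_empty_iff]
      intro j _; omega
    rw [e1, add_zero]
    exact box_mono fun j => by have := hbd j; omega
  · rw [min_eq_right hc.le]
    have e1 : box (fun j => f j + k) ((a : ℕ) - n) (a : ℕ) (a : ℕ) (i' + t - n) =
        box (fun j => f j + k) (a : ℕ) ((a : ℕ) + n) ((a : ℕ) + n) (i' + t) := by
      rw [← box_shift (n := n) fun j => by rw [hf.1]; ring]
      congr 1 <;> ring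
    have e2 : box (fun j => f j + k) ((a : ℕ) - n) (a : ℕ) i' ((a : ℕ) + n) =
        box (fun j => f j + k) (i' - n) (a : ℕ) i' ((a : ℕ) + n) :=
      box_congr fun j => by have := hbd j; omega
    have e3 := box_crossing hf hb h1 h2
    have e4 : box (fun j => f j + k) i' ((a : ℕ) + n) ((a : ℕ) + n) (i' + t) ≤
        box (fun j => f j + k) i' ((a : ℕ) + n) ((a : ℕ) + n) (i' + n) :=
      box_mono fun j => by omega
    have e5 := box_add_left (g := fun j => f j + k) (p := (a : ℕ)) (q := (a : ℕ) + n) (r := i')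
      (u := (a : ℕ) + n) (v := i' + t) h1 h2.le
    have e6 := box_add_right (g := fun j => f j + k) (p := i' - n) (q := i') (w := (a : ℕ) + n)
      (u := i') (v := i' + t) h2.le hc.le
    have e7 := box_add_left (g := fun j => f j + k) (p := i' - n) (q := i') (r := (a : ℕ))
      (u := i') (v := (a : ℕ) + n) (by omega) h1
    have e8 : box (fun j => f j + k) (i' - n) i' ((a : ℕ) + n) (i' + t) =
        box (fun j => f j + k) (a : ℕ) i' ((a : ℕ) + n) (i' + t) :=
      box_congr fun j => by have := hbd j; omega
    omega

end AffPerm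

/-! ### Box counts of the inverse permutation -/

theorem perm_apply_inv {α : Type*} (f : Equiv.Perm α) (a : α) : f (f⁻¹ a) = a :=
  f.apply_symm_apply a

theorem perm_inv_apply {α : Type*} (f : Equiv.Perm α) (a : α) : f⁻¹ (f a) = a :=
  f.symm_apply_apply a

section Inverse

variable {n k ℓ : ℕ} [NeZero n] {f : Equiv.Perm ℤ}

theorem inv_mem_affPerm (hf : f ∈ affPerm n k ℓ) : f⁻¹ ∈ affPerm n ℓ k := by
  have hper : ∀ i, f⁻¹ (i + n) = f⁻¹ i + n := fun i => by
    rw [Equiv.Perm.inv_eq_iff_eq, hf.1, perm_apply_inv]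
  refine ⟨hper, ?_, fun i => ?_⟩
  · have h1 := sum_periodic_comp_perm (φ := fun i => f⁻¹ i - i) (fun j => by rw [hper]; ring) hf.1
    rw [Finset.sum_range fun i : ℕ => f⁻¹ (i : ℤ) - (i : ℤ), ← h1]
    simp only [perm_inv_apply]
    have := hf.2.1
    rw [Finset.sum_range fun i : ℕ => f (i : ℤ) - (i : ℤ)] at this
    rw [← neg_eq_zero, ← this, ← Finset.sum_neg_distrib]
    exact Finset.sum_congr rfl fun _ _ => by ring
  · have := hf.2.2 (f⁻¹ i)
    rw [perm_apply_inv] at this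
    omega

/-- Reflecting the graph turns a box of `f⁻¹` into a box of `f`. The positions `[a - ℓ, a + t - ℓ)`
carry `t` points, and the cut at `a + t - ℓ` carries `k` points in total. Removing from both the
points with shifted value at least `a + k`, which are the same, gives the identity. It is the
combinatorial counterpart of `IsDual.famRank_right`. -/
theorem box_inv (hf : f ∈ affPerm n k ℓ) (hkl : k + ℓ ≤ n) (a : ℤ) {t : ℕ} (ht : t ≤ k + ℓ) :
    box (fun j => f⁻¹ j + ℓ) (a - n) a a (a + t) + k =
      t + box (fun j => f j + k) (a + t - ℓ - n) (a + t - ℓ) (a + t - ℓ) (a + k) := by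
  have hb : (k : ℤ) + ℓ ≤ n := by omega
  have hbd := affPerm_bound hf hb
  have e1 : box (fun j => f⁻¹ j + ℓ) (a - n) a a (a + t) =
      box (fun j => f j + k) (a - ℓ) (a + t - ℓ) (a - n + k) (a + k) := by
    unfold box
    refine Finset.card_bij (fun j _ => f⁻¹ j) (fun j hj => ?_)
      (fun j _ j' _ h => f⁻¹.injective h) fun j hj => ⟨f j, ?_, by simp⟩
    · simp only [Finset.mem_filter, Finset.mem_Ico, perm_apply_inv] at hj ⊢
      omega
    · simp only [Finset.mem_filter, Finset.mem_Ico, perm_inv_apply] at hj ⊢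
      omega
  have e2 : box (fun j => f j + k) (a - ℓ) (a + t - ℓ) (a - n + k) (a + t - ℓ + n) = t := by
    unfold box
    rw [Finset.filter_true_of_mem]
    · simp
    · intro j hj
      have := hbd j
      rw [Finset.mem_Ico] at hj
      dsimp only
      omega
  have e3 := affPerm_box_total hf hb (a + t - ℓ)
  have e4 := box_add_right (g := fun j => f j + k) (p := a - ℓ) (q := a + t - ℓ) (u := a - n + k)
    (w := a + k) (v := a + t - ℓ + n) (by omega) (by omega)
  have e5 := box_add_right (g := fun j => f j + k) (p := a + t - ℓ - n) (q := a + t - ℓ)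
    (u := a + t - ℓ) (w := a + k) (v := a + t - ℓ + n) (by omega) (by omega)
  have e6 : box (fun j => f j + k) (a - ℓ) (a + t - ℓ) (a + k) (a + t - ℓ + n) =
      box (fun j => f j + k) (a + t - ℓ - n) (a + t - ℓ) (a + k) (a + t - ℓ + n) :=
    box_congr fun j => by have := hf.2.2 j; omega
  omega

/-- As `f j ≤ j + ℓ`, all `k` points of the cut at `i` have shifted value below `i + k + ℓ`. This
yields the full rank of all windows of length `k + ℓ`. -/
theorem box_window (hf : f ∈ affPerm n k ℓ) (hkl : k + ℓ ≤ n) (i : ℤ) {t : ℤ} (ht : k + ℓ ≤ t) :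
    box (fun j => f j + k) (i - n) i i (i + t) = k := by
  refine (box_congr fun j => ?_).trans (affPerm_box_total hf (by omega) i)
  have := hf.2.2 j
  omega

end Inverse

/-! ### The Gale order in terms of cardinalities -/

theorem card_filter_lt_eq {r : ℕ} {S : Finset ℤ} (hS : S.card = r) (t : ℤ) :
    (S.filter (· < t)).card = (Finset.univ.filter fun a => S.orderEmbOfFin hS a < t).card := by
  conv_lhs => rw [← Finset.map_orderEmbOfFin_univ S hS, Finset.filter_map, Finset.card_map]
  rfl

theorem forall₂_sort_iff {r : ℕ} {S T : Finset ℤ} (hS : S.card = r) (hT : T.card = r) :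
    List.Forall₂ (· ≤ ·) (S.sort (· ≤ ·)) (T.sort (· ≤ ·)) ↔
      ∀ a, S.orderEmbOfFin hS a ≤ T.orderEmbOfFin hT a := by
  rw [List.forall₂_iff_get]
  constructor
  · rintro ⟨-, h⟩ a
    exact h a (by simp [hS]) (by simp [hT])
  · refine fun h => ⟨by simp [hS, hT], fun i h1 h2 => ?_⟩
    exact h ⟨i, by simpa [hS] using h1⟩

/-- Thresholds in `S` suffice. If the element of `T` at position `a` were smaller than that of `S`,
then `T` would have at least `a + 1` elements below the latter and `S` only `a`. -/
theorem orderEmb_le_iff {r : ℕ} {S T : Finset ℤ} (hS : S.card = r) (hT : T.card = r) :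
    (∀ a, S.orderEmbOfFin hS a ≤ T.orderEmbOfFin hT a) ↔
      ∀ t ∈ S, (T.filter (· < t)).card ≤ (S.filter (· < t)).card := by
  simp only [card_filter_lt_eq hS, card_filter_lt_eq hT]
  constructor
  · intro h t _
    refine Finset.card_le_card fun a ha => ?_
    rw [Finset.mem_filter] at ha ⊢
    exact ⟨ha.1, (h a).trans_lt ha.2⟩
  · intro h a
    by_contra! hlt
    have h1 := h _ (Finset.orderEmbOfFin_mem S hS a)
    simp only [OrderEmbedding.lt_iff_lt] at h1
    have h2 : (Finset.univ.filter fun b => b < a).card = (a : ℕ) := by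
      rw [← Fin.card_Iio a]; congr 1; ext; simp
    have h3 : (a : ℕ) + 1 ≤
        (Finset.univ.filter fun b => T.orderEmbOfFin hT b < S.orderEmbOfFin hS a).card := by
      rw [← Fin.card_Iic a]
      refine Finset.card_le_card fun b hb => ?_
      rw [Finset.mem_Iic] at hb
      rw [Finset.mem_filter]
      exact ⟨Finset.mem_univ _, ((T.orderEmbOfFin hT).monotone hb).trans_lt hlt⟩
    omega

section GaleOrder

variable {n r : ℕ}

theorem cycPos_injective (i : Fin n) :
    Function.Injective fun a : Fin n => ((a : ℤ) - (i : ℤ)) % (n : ℤ) := by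
  intro a b h
  have ha := a.2
  have hb := b.2
  have h1 : ((a : ℕ) : ℤ) ≡ (b : ℕ) [ZMOD n] := by
    have := Int.ModEq.add_right (i : ℤ) (show ((a : ℤ) - i) ≡ (b : ℤ) - i [ZMOD n] from h)
    simpa using this
  rw [Int.ModEq, Int.emod_eq_of_lt (by omega) (by omega),
    Int.emod_eq_of_lt (by omega) (by omega)] at h1
  exact Fin.ext (by omega)

theorem card_cycPos_filter (i : Fin n) (S : Finset (Fin n)) (t : ℕ) :
    ((S.image fun a : Fin n => ((a : ℤ) - (i : ℤ)) % (n : ℤ)).filter (· < (t : ℤ))).card =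
      (S ∩ cyc i t).card := by
  rw [Finset.filter_image, Finset.card_image_of_injective _ (cycPos_injective i)]
  congr 1
  ext a
  simp [mem_cyc]

theorem galeLE_iff {i : Fin n} {S T : Finset (Fin n)} (hS : S.card = r) (hT : T.card = r) :
    galeLE i S T ↔ ∀ t : ℕ, t ≤ n → (T ∩ cyc i t).card ≤ (S ∩ cyc i t).card := by
  have hn : (0 : ℤ) < n := by have := i.2; omega
  have hS' : (S.image fun a : Fin n => ((a : ℤ) - (i : ℤ)) % (n : ℤ)).card = r := by
    rw [Finset.card_image_of_injective _ (cycPos_injective i), hS]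
  have hT' : (T.image fun a : Fin n => ((a : ℤ) - (i : ℤ)) % (n : ℤ)).card = r := by
    rw [Finset.card_image_of_injective _ (cycPos_injective i), hT]
  rw [galeLE, cyclicPositions, cyclicPositions, forall₂_sort_iff hS' hT']
  constructor
  · intro h t _
    rw [← card_cycPos_filter, ← card_cycPos_filter, card_filter_lt_eq hS', card_filter_lt_eq hT']
    refine Finset.card_le_card fun a ha => ?_
    rw [Finset.mem_filter] at ha ⊢
    exact ⟨ha.1, (h a).trans_lt ha.2⟩
  · intro h
    rw [orderEmb_le_iff hS' hT']
    intro t ht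
    obtain ⟨a, -, rfl⟩ := Finset.mem_image.1 ht
    have h0 := ((a : ℤ) - (i : ℤ)).emod_nonneg hn.ne'
    have h1 := ((a : ℤ) - (i : ℤ)).emod_lt_of_pos hn
    obtain ⟨t, ht⟩ := Int.eq_ofNat_of_zero_le h0
    rw [ht]
    change ((T.image fun a : Fin n => ((a : ℤ) - (i : ℤ)) % (n : ℤ)).filter (· < (t : ℤ))).card ≤
      ((S.image fun a : Fin n => ((a : ℤ) - (i : ℤ)) % (n : ℤ)).filter (· < (t : ℤ))).card
    rw [card_cycPos_filter, card_cycPos_filter]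
    exact h t (by omega)

end GaleOrder

/-! ### Matrix representatives of points of the Grassmannian -/

section Representatives

variable {r r' n : ℕ}

theorem exists_mul_of_rowSpan_le {M : Matrix (Fin r) (Fin n) ℝ} {M' : Matrix (Fin r') (Fin n) ℝ}
    (h : rowSpan M ≤ rowSpan M') : ∃ g : Matrix (Fin r) (Fin r') ℝ, M = g * M' := by
  have h1 : ∀ a, ∃ c : Fin r' → ℝ, c ᵥ* M' = M a := by
    intro a
    have h2 : M.row a ∈ rowSpan M' := h (Submodule.subset_span ⟨a, rfl⟩)
    obtain ⟨c, hc⟩ := (Submodule.mem_span_range_iff_exists_fun ℝ).1 h2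
    refine ⟨c, ?_⟩
    rw [Matrix.vecMul_eq_sum]
    exact hc
  choose g hg using h1
  refine ⟨Matrix.of g, ?_⟩
  ext a j
  exact (congrFun (hg a) j).symm

theorem rowSpan_mul_le (g : Matrix (Fin r) (Fin r') ℝ) (M : Matrix (Fin r') (Fin n) ℝ) :
    rowSpan (g * M) ≤ rowSpan M := by
  rw [rowSpan, Submodule.span_le]
  rintro _ ⟨a, rfl⟩
  refine (Submodule.mem_span_range_iff_exists_fun ℝ).2 ⟨g a, ?_⟩
  have : (g * M).row a = g a ᵥ* M := by ext j; simp [Matrix.mul_apply_eq_vecMul, Matrix.row]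
  rw [this, Matrix.vecMul_eq_sum]
  rfl

theorem rowSpan_mul {g : Matrix (Fin r) (Fin r) ℝ} (hg : g.det ≠ 0) (M : Matrix (Fin r) (Fin n) ℝ) :
    rowSpan (g * M) = rowSpan M := by
  refine le_antisymm (rowSpan_mul_le g M) ?_
  have := rowSpan_mul_le g⁻¹ (g * M)
  rwa [← Matrix.mul_assoc, Matrix.nonsing_inv_mul _ (isUnit_iff_ne_zero.2 hg), Matrix.one_mul] at this

theorem row_linearIndependent_iff {M : Matrix (Fin r) (Fin n) ℝ} :
    LinearIndependent ℝ M.row ↔ ∀ y : Fin r → ℝ, (∀ p, y ⬝ᵥ M.col p = 0) → y = 0 := by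
  rw [Fintype.linearIndependent_iff]
  have key : ∀ y : Fin r → ℝ, ∑ a, y a • M.row a = 0 ↔ ∀ p, y ⬝ᵥ M.col p = 0 := fun y => by
    rw [funext_iff]
    refine forall_congr' fun p => ?_
    simp [dotProduct, Matrix.row, Matrix.col]
  constructor
  · exact fun h y hy => funext (h y ((key y).2 hy))
  · exact fun h y hy => congrFun (h y ((key y).1 hy))

theorem linearIndependent_row_mul {g : Matrix (Fin r) (Fin r) ℝ} (hg : g.det ≠ 0)
    {M : Matrix (Fin r) (Fin n) ℝ} (hM : LinearIndependent ℝ M.row) :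
    LinearIndependent ℝ (g * M).row := by
  rw [row_linearIndependent_iff] at *
  intro y hy
  refine Matrix.eq_zero_of_vecMul_eq_zero hg (hM _ fun p => ?_)
  rw [← Matrix.dotProduct_mulVec]
  exact hy p

theorem exists_det_mul_of_rowSpan_eq {M M' : Matrix (Fin r) (Fin n) ℝ}
    (hM : LinearIndependent ℝ M.row) (h : rowSpan M = rowSpan M') :
    ∃ g : Matrix (Fin r) (Fin r) ℝ, g.det ≠ 0 ∧ M = g * M' := by
  obtain ⟨g, hg⟩ := exists_mul_of_rowSpan_le h.le
  refine ⟨g, fun h0 => ?_, hg⟩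
  obtain ⟨y, hy, hy0⟩ := Matrix.exists_vecMul_eq_zero_iff.2 h0
  refine hy (row_linearIndependent_iff.1 hM y fun p => ?_)
  have : y ᵥ* M = 0 := by rw [hg, ← Matrix.vecMul_vecMul, hy0, Matrix.zero_vecMul]
  exact congrFun this p

/-- Multiplication of a full rank matrix by an invertible matrix. -/
def FullRankMat.mulLeft (M : FullRankMat r n) (g : Matrix (Fin r) (Fin r) ℝ) (hg : g.det ≠ 0) :
    FullRankMat r n :=
  ⟨g * M.1, linearIndependent_row_mul hg M.2⟩

theorem FullRankMat.toGr_mulLeft (M : FullRankMat r n) {g : Matrix (Fin r) (Fin r) ℝ}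
    (hg : g.det ≠ 0) : (M.mulLeft g hg).toGr = M.toGr :=
  Subtype.ext (rowSpan_mul hg M.1)

theorem FullRankMat.exists_mul_of_toGr_eq {M M' : FullRankMat r n} (h : M.toGr = M'.toGr) :
    ∃ g : Matrix (Fin r) (Fin r) ℝ, g.det ≠ 0 ∧ M.1 = g * M'.1 :=
  exists_det_mul_of_rowSpan_eq M.2 (congrArg Subtype.val h)

theorem Gr.exists_rep (X : Gr r n) : ∃ M : FullRankMat r n, M.toGr = X := by
  let b := Module.finBasisOfFinrankEq ℝ X.1 X.2
  have hli : LinearIndependent ℝ fun a => (b a : Fin n → ℝ) :=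
    b.linearIndependent.map' X.1.subtype (Submodule.ker_subtype _)
  refine ⟨⟨Matrix.of fun a => (b a : Fin n → ℝ), hli⟩, Subtype.ext ?_⟩
  have h1 : Set.range (fun a => (b a : Fin n → ℝ)) = X.1.subtype '' Set.range b := by
    rw [← Set.range_comp]; rfl
  change Submodule.span ℝ (Set.range fun a => (b a : Fin n → ℝ)) = X.1
  rw [h1, Submodule.span_image, b.span_eq, Submodule.map_subtype_top]

theorem FullRankMat.span_col (M : FullRankMat r n) : Submodule.span ℝ (Set.range M.1.col) = ⊤ := by
  refine Submodule.eq_top_of_finrank_eq ?_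
  rw [← Matrix.rank_eq_finrank_span_cols, M.2.rank_matrix]
  simp

end Representatives

/-! ### Positroid cells in terms of signs and interval ranks -/

theorem famRank_mulVec_le {ι : Type*} {r r' : ℕ} (g : Matrix (Fin r') (Fin r) ℝ)
    (v : ι → Fin r → ℝ) (I : Finset ι) : famRank (fun p => g *ᵥ v p) I ≤ famRank v I := by
  have h : (fun p => g *ᵥ v p) '' (I : Set ι) = Matrix.toLin' g '' (v '' I) := by
    rw [← Set.image_comp]; rfl
  rw [famRank, h, Submodule.span_image]
  exact Submodule.finrank_map_le _ _

theorem famRank_mulVec {ι : Type*} {r : ℕ} {g : Matrix (Fin r) (Fin r) ℝ} (hg : g.det ≠ 0)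
    (v : ι → Fin r → ℝ) (I : Finset ι) : famRank (fun p => g *ᵥ v p) I = famRank v I := by
  refine le_antisymm (famRank_mulVec_le g v I) ?_
  have := famRank_mulVec_le g⁻¹ (fun p => g *ᵥ v p) I
  simpa only [Matrix.mulVec_mulVec, Matrix.nonsing_inv_mul _ (isUnit_iff_ne_zero.2 hg),
    Matrix.one_mulVec] using this

/-- Rescaling to nonnegative minors. -/
theorem SeqSignTNN.exists_seqTNN {n r : ℕ} {X : ℤ → Fin r → ℝ} (hX : SeqSignTNN n X) :
    ∃ g : Matrix (Fin r) (Fin r) ℝ, g.det ≠ 0 ∧ SeqTNN n fun j => g *ᵥ X j := by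
  by_cases h : ∃ q, CycInc n q ∧ seqMinor X q ≠ 0
  · obtain ⟨q, hq, hq0⟩ := h
    cases r with
    | zero =>
      refine ⟨1, by simp, fun q _ => ?_⟩
      have : seqMinor (fun j => (1 : Matrix (Fin 0) (Fin 0) ℝ) *ᵥ X j) q = 1 := Matrix.det_isEmpty
      rw [this]; norm_num
    | succ r =>
      set c := seqMinor X q with hc
      have hdet : (Matrix.diagonal (Function.update 1 0 c) :
          Matrix (Fin (r + 1)) (Fin (r + 1)) ℝ).det = c := by
        rw [Matrix.det_diagonal, Fin.prod_univ_succ]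
        simp
      refine ⟨Matrix.diagonal (Function.update 1 0 c), by rwa [hdet], fun q' hq' => ?_⟩
      rw [seqMinor_mulVec, hdet]
      exact hX _ _ hq hq'
  · push Not at h
    refine ⟨1, by simp, fun q hq => ?_⟩
    rw [seqMinor_mulVec, h q hq, mul_zero]

theorem SeqSignTNN.mulVec {n r : ℕ} {X : ℤ → Fin r → ℝ} (hX : SeqSignTNN n X)
    (g : Matrix (Fin r) (Fin r) ℝ) : SeqSignTNN n fun j => g *ᵥ X j := by
  intro q q' hq hq'
  rw [seqMinor_mulVec, seqMinor_mulVec]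
  have := mul_nonneg (mul_self_nonneg g.det) (hX q q' hq hq')
  linarith

theorem SeqTNN.signTNN {n r : ℕ} {X : ℤ → Fin r → ℝ} (hX : SeqTNN n X) : SeqSignTNN n X :=
  fun q q' hq hq' => mul_nonneg (hX q hq) (hX q' hq')

theorem maxMinor_eq_seqMinor {n r : ℕ} [NeZero n] (c : ℕ) (M : Matrix (Fin r) (Fin n) ℝ)
    (J : Finset (Fin n)) (hJ : J.card = r) : maxMinor M J hJ =
      seqMinor (extCol c M) fun a => ((J.orderEmbOfFin hJ a : Fin n) : ℕ) := by
  rw [maxMinor_eq, seqMinor]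
  simp only [extCol_coe]

theorem seqTNN_extCol_iff {n r : ℕ} [NeZero n] {M : Matrix (Fin r) (Fin n) ℝ} :
    SeqTNN n (extCol r M) ↔ ∀ J hJ, 0 ≤ maxMinor M J hJ := by
  constructor
  · intro h J hJ
    rw [maxMinor_eq_seqMinor r]
    exact h _ (cycInc_orderEmbOfFin hJ)
  · intro h q hq
    obtain ⟨J, hJ, -, h1⟩ := hq.exists_finset
    rw [h1 _ (extCol_quasiPeriodic _ _)]
    have := h J hJ
    rw [maxMinor_eq_seqMinor r] at this
    exact this

theorem seqTP_extCol_iff {n r : ℕ} [NeZero n] {M : Matrix (Fin r) (Fin n) ℝ} :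
    SeqTP n (extCol r M) ↔ ∀ J hJ, 0 < maxMinor M J hJ := by
  constructor
  · intro h J hJ
    rw [maxMinor_eq_seqMinor r]
    exact h _ (cycInc_orderEmbOfFin hJ)
  · intro h q hq
    obtain ⟨J, hJ, -, h1⟩ := hq.exists_finset
    rw [h1 _ (extCol_quasiPeriodic _ _)]
    have := h J hJ
    rw [maxMinor_eq_seqMinor r] at this
    exact this

section PosCell

variable {n k : ℕ} [NeZero n] {b : ℤ} {f : Equiv.Perm ℤ}

theorem mem_positroid_iff (hf : f ∈ affPerm n k b) (hb : k + b ≤ n) {J : Finset (Fin n)} :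
    J ∈ positroid k n f ↔ J.card = k ∧ ∀ (i : Fin n) (t : ℕ), t ≤ n → (J ∩ cyc i t).card ≤
      box (fun j => f j + k) ((i : ℕ) - n) (i : ℕ) (i : ℕ) ((i : ℕ) + t) := by
  refine and_congr_right fun hJ => forall_congr' fun i => ?_
  rw [galeLE_iff (card_necklace hf hb i) hJ]
  refine forall_congr' fun t => forall_congr' fun ht => ?_
  rw [card_necklace_inter_cyc hf hb i ht]

theorem necklace_mem_positroid (hf : f ∈ affPerm n k b) (hb : k + b ≤ n) (a : Fin n) :
    grNecklace k f a ∈ positroid k n f :=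
  (mem_positroid_iff hf hb).2 ⟨card_necklace hf hb a,
    fun i _ ht => card_necklace_inter_cyc_le hf hb a i ht⟩

omit [NeZero n] in
theorem maxMinor_ne_zero_iff {M : Matrix (Fin k) (Fin n) ℝ} {J : Finset (Fin n)} (hJ : J.card = k) :
    maxMinor M J hJ ≠ 0 ↔ LinearIndepOn ℝ M.col (J : Set (Fin n)) := by
  rw [maxMinor_eq]
  exact detRow_orderEmb_ne_zero_iff (v := M.col) hJ

theorem famRank_extCol (c : ℕ) (M : Matrix (Fin k) (Fin n) ℝ) (i : Fin n) (t : ℕ) :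
    famRank M.col (cyc i t) = famRank (extCol c M) (Finset.Ico ((i : ℕ) : ℤ) ((i : ℕ) + t)) := by
  rw [← famRank_cyc (neg_one_pow_ne_zero _) (extCol_quasiPeriodic c M)]
  simp only [extCol_coe]

/-- A point lies in the cell of `f` if and only if it is totally nonnegative and the ranks of all
cyclic intervals of columns are the ones determined by `f`. -/
theorem mem_posCell_iff (hf : f ∈ affPerm n k b) (hb : k + b ≤ n) (M : FullRankMat k n) :
    M.toGr ∈ posCell k n f ↔ SeqSignTNN n (extCol k M.1) ∧
      ∀ (i : Fin n) (t : ℕ), t ≤ n → famRank M.1.col (cyc i t) =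
        box (fun j => f j + k) ((i : ℕ) - n) (i : ℕ) (i : ℕ) ((i : ℕ) + t) := by
  constructor
  · rintro ⟨M', hM', h⟩
    obtain ⟨g, hg, hgM⟩ := FullRankMat.exists_mul_of_toGr_eq hM'.symm
    have hext : extCol k M.1 = fun j => g *ᵥ extCol k M'.1 j := by
      rw [hgM]; exact funext (extCol_mul k g M'.1)
    have hcol : M.1.col = fun p => g *ᵥ M'.1.col p := by
      funext p
      rw [← extCol_coe k M.1, hext, ← extCol_coe k M'.1]
    constructor
    · rw [hext]
      refine SeqSignTNN.mulVec (SeqTNN.signTNN (seqTNN_extCol_iff.2 fun J hJ => ?_)) g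
      by_cases hJp : J ∈ positroid k n f
      · exact ((h J hJ).1 hJp).le
      · exact ((h J hJ).2 hJp).ge
    · intro i t ht
      rw [hcol, famRank_mulVec hg]
      apply le_antisymm
      -- Upper bound: a maximal independent subset of the interval extends to a basis, whose nonzero
      -- minor puts it into the positroid.
      · obtain ⟨K, hK, hKi, hKc, -⟩ := exists_linearIndepOn_card_eq (v := M'.1.col) (cyc i t)
        obtain ⟨B, -, hKB, hB, hBi⟩ := exists_linearIndepOn_extension hKi (Set.subset_univ _)
        rw [Set.image_univ] at hB
        obtain ⟨J, rfl⟩ : ∃ J : Finset (Fin n), (J : Set (Fin n)) = B :=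
          ⟨B.toFinite.toFinset, by simp⟩
        have hspan : Submodule.span ℝ (M'.1.col '' J) = ⊤ := by
          rw [eq_top_iff, ← M'.span_col]; exact Submodule.span_le.2 hB
        have hJ : J.card = k := by
          rw [← famRank_eq_card hBi, famRank, hspan, finrank_top]; simp
        have hJp : J ∈ positroid k n f := by
          by_contra hcon
          exact (maxMinor_ne_zero_iff hJ).2 hBi ((h J hJ).2 hcon)
        rw [← hKc]
        exact (Finset.card_le_card (Finset.subset_inter (by exact_mod_cast hKB) hK)).trans
          (((mem_positroid_iff hf hb).1 hJp).2 i t ht)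
      -- Lower bound: the necklace term at `i` is itself a basis and meets the interval in the
      -- required number of elements.
      · have hc := card_necklace hf hb i
        have hi := (maxMinor_ne_zero_iff hc).1 ((h _ hc).1 (necklace_mem_positroid hf hb i)).ne'
        have hi2 : LinearIndepOn ℝ M'.1.col ((grNecklace k f i ∩ cyc i t : Finset (Fin n)) :
            Set (Fin n)) := hi.mono (by exact_mod_cast Finset.inter_subset_left)
        rw [← card_necklace_inter_cyc hf hb i ht, ← famRank_eq_card hi2]
        exact famRank_mono _ Finset.inter_subset_right
  · rintro ⟨h1, h2⟩
    obtain ⟨g, hg, hgP⟩ := h1.exists_seqTNN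
    rw [← FullRankMat.toGr_mulLeft M hg]
    have hext : extCol k (M.mulLeft g hg).1 = fun j => g *ᵥ extCol k M.1 j :=
      funext (extCol_mul k g M.1)
    have hcol : (M.mulLeft g hg).1.col = fun p => g *ᵥ M.1.col p := by
      funext p
      rw [← extCol_coe k (M.mulLeft g hg).1, hext, ← extCol_coe k M.1]
    have hnn : ∀ J hJ, 0 ≤ maxMinor (M.mulLeft g hg).1 J hJ :=
      seqTNN_extCol_iff.1 (by rw [hext]; exact hgP)
    have hrank : ∀ (i : Fin n) (t : ℕ), t ≤ n → famRank (M.mulLeft g hg).1.col (cyc i t) =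
        box (fun j => f j + k) ((i : ℕ) - n) (i : ℕ) (i : ℕ) ((i : ℕ) + t) := by
      intro i t ht
      rw [hcol, famRank_mulVec hg, h2 i t ht]
    refine ⟨M.mulLeft g hg, rfl, fun J hJ => ⟨fun hJp => ?_, fun hJp => ?_⟩⟩
    · refine lt_of_le_of_ne (hnn J hJ) fun h0 => ?_
      have hdep : ¬ LinearIndepOn ℝ (M.mulLeft g hg).1.col (J : Set (Fin n)) := by
        rw [← maxMinor_ne_zero_iff hJ, not_not]; exact h0.symm
      -- A zero minor at `J` would give a cyclic interval that contains more elements of `J` than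
      -- its rank, against membership in the positroid.
      obtain ⟨i, t, ht, hlt⟩ := exists_cyc_famRank_lt
        (fun J hJ => by have := hnn J hJ; rwa [maxMinor_eq] at this)
        (M.mulLeft g hg).span_col hJ hdep
      rw [hrank i t ht] at hlt
      exact absurd (((mem_positroid_iff hf hb).1 hJp).2 i t ht) (not_le.2 hlt)
    · by_contra h0
      refine hJp ((mem_positroid_iff hf hb).2 ⟨hJ, fun i t ht => ?_⟩)
      have hi := (maxMinor_ne_zero_iff hJ).1 h0
      have hi2 : LinearIndepOn ℝ (M.mulLeft g hg).1.col ((J ∩ cyc i t : Finset (Fin n)) :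
          Set (Fin n)) := hi.mono (by exact_mod_cast Finset.inter_subset_left)
      rw [← hrank i t ht, ← famRank_eq_card hi2]
      exact famRank_mono _ Finset.inter_subset_right

end PosCell

/-! ### Interval ranks under the twist -/

theorem famRank_Ico_eq_rank {r : ℕ} (X : ℤ → Fin r → ℝ) (a : ℤ) (t : ℕ) :
    famRank X (Finset.Ico a (a + t)) = (Matrix.of fun s : Fin t => X (a + (s : ℕ))).rank := by
  rw [Matrix.rank_eq_finrank_span_row, famRank]
  have h : X '' ((Finset.Ico a (a + t) : Finset ℤ) : Set ℤ) =
      Set.range (Matrix.of fun s : Fin t => X (a + (s : ℕ))).row := by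
    ext y
    simp only [Set.mem_image, Set.mem_range, Finset.coe_Ico, Set.mem_Ico]
    constructor
    · rintro ⟨p, hp, rfl⟩
      obtain ⟨i, hi⟩ := Int.eq_ofNat_of_zero_le (show 0 ≤ p - a by omega)
      refine ⟨⟨i, by omega⟩, ?_⟩
      change X (a + (i : ℕ)) = X p
      congr 1; omega
    · rintro ⟨s, rfl⟩
      exact ⟨a + (s : ℕ), by have := s.2; omega, rfl⟩
  rw [h]

section RankDuality

variable {k ℓ : ℕ} {ε : ℝ} {V : ℤ → Fin k → ℝ} {W : ℤ → Fin ℓ → ℝ} {A : ℤ → Fin k → ℝ}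
  {B : ℤ → Fin ℓ → ℝ}

/-- Ranks of intervals of the second part of the twist are determined by ranks of intervals of
`V`. -/
theorem IsDual.famRank_right (hD : IsDual k ℓ ε V W A B)
    (hind : ∀ (j : ℤ) (x : Fin k → ℝ) (y : Fin ℓ → ℝ),
      (∀ p : ℤ, j - ℓ ≤ p → p < j + k → x ⬝ᵥ V p + y ⬝ᵥ W p = 0) → x = 0 ∧ y = 0)
    (a : ℤ) {t : ℕ} (ht : t ≤ k + ℓ) :
    famRank B (Finset.Ico a (a + t)) + k =
      t + famRank V (Finset.Ico (a + t - ℓ) (a + k)) := by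
  obtain ⟨t', ht'⟩ := Nat.exists_eq_add_of_le ht
  rw [show a + (k : ℤ) = a + t - ℓ + (t' : ℕ) by omega, famRank_Ico_eq_rank, famRank_Ico_eq_rank]
  set AM : Matrix (Fin t) (Fin k) ℝ := Matrix.of fun s : Fin t => A (a + (s : ℕ)) with hAM
  set BM : Matrix (Fin t) (Fin ℓ) ℝ := Matrix.of fun s : Fin t => B (a + (s : ℕ)) with hBM
  set VM : Matrix (Fin t') (Fin k) ℝ :=
    Matrix.of fun s : Fin t' => V (a + t - ℓ + (s : ℕ)) with hVM
  have hpair : ∀ (c : Fin t → ℝ) (i : ℤ), (c ᵥ* AM) ⬝ᵥ V i + (c ᵥ* BM) ⬝ᵥ W i =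
      ∑ s : Fin t, c s * (A (a + (s : ℕ)) ⬝ᵥ V i + B (a + (s : ℕ)) ⬝ᵥ W i) := by
    intro c i
    rw [← Matrix.dotProduct_mulVec, ← Matrix.dotProduct_mulVec, ← dotProduct_add]
    rfl
  -- The pairings of `t` consecutive twist vectors with the left ends of their windows form a
  -- triangular matrix with nonzero diagonal.
  set D : Matrix (Fin t) (Fin t) ℝ := Matrix.of fun s s' : Fin t =>
    A (a + (s : ℕ)) ⬝ᵥ V (a + (s' : ℕ) - ℓ) + B (a + (s : ℕ)) ⬝ᵥ W (a + (s' : ℕ) - ℓ) with hDdef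
  have hDdet : D.det ≠ 0 := by
    rw [Matrix.det_of_isLowerTriangular]
    · refine Finset.prod_ne_zero_iff.2 fun s _ h0 => ?_
      have := hD.pos (a + (s : ℕ))
      simp only [hDdef, Matrix.of_apply] at h0
      rw [h0, mul_zero] at this
      exact lt_irrefl _ this
    · intro s s' hs
      have hs' : (s : ℕ) < s' := hs
      have := s'.2
      exact hD.eq_zero _ _ (by omega) (by omega)
  have hvan : ∀ (s : Fin t) (i : ℤ), a + t - ℓ ≤ i → i < a + k →
      A (a + (s : ℕ)) ⬝ᵥ V i + B (a + (s : ℕ)) ⬝ᵥ W i = 0 := fun s i h1 h2 =>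
    hD.eq_zero _ _ (by have := s.2; omega) (by omega)
  have hmem : ∀ c : LinearMap.ker BM.vecMulLinear,
      AM.vecMulLinear c.1 ∈ LinearMap.ker VM.mulVecLin := by
    rintro ⟨c, hc⟩
    have hc' : c ᵥ* BM = 0 := hc
    rw [LinearMap.mem_ker]
    funext s
    have h1 := hpair c (a + t - ℓ + (s : ℕ))
    rw [hc', zero_dotProduct, add_zero] at h1
    have h2 : (VM.mulVecLin (AM.vecMulLinear c)) s = (c ᵥ* AM) ⬝ᵥ V (a + t - ℓ + (s : ℕ)) :=
      dotProduct_comm (V (a + t - ℓ + (s : ℕ))) (c ᵥ* AM)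
    rw [h2, h1]
    exact Finset.sum_eq_zero fun s' _ => by
      rw [hvan s' _ (by omega) (by have := s.2; omega), mul_zero]
  -- A relation among the `t` vectors of `B` produces a combination of the vectors of `A` orthogonal
  -- to `V` on the last `k + ℓ - t` indices of the window. `D` recovers the relation, so the map is
  -- injective. It is surjective because `D` lets one match the values on the first `t` indices, and
  -- the window determines both components. The two kernels have dimensions `t - rank B` and `k -
  -- rank V`.
  set ψ : LinearMap.ker BM.vecMulLinear →ₗ[ℝ] LinearMap.ker VM.mulVecLin :=
    LinearMap.codRestrict _ (AM.vecMulLinear.comp (LinearMap.ker BM.vecMulLinear).subtype) hmem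
    with hψ
  have hbij : Function.Bijective ψ := by
    constructor
    · rw [← LinearMap.ker_eq_bot, LinearMap.ker_eq_bot']
      rintro ⟨c, hc⟩ h0
      have hc' : c ᵥ* BM = 0 := hc
      have h0' : c ᵥ* AM = 0 := congrArg Subtype.val h0
      apply Subtype.ext
      refine Matrix.eq_zero_of_vecMul_eq_zero hDdet (funext fun s => ?_)
      have h1 := hpair c (a + (s : ℕ) - ℓ)
      rw [hc', h0', zero_dotProduct, zero_dotProduct, add_zero] at h1
      exact h1.symm
    · rintro ⟨x, hx⟩
      have hx' : ∀ s : Fin t', x ⬝ᵥ V (a + t - ℓ + (s : ℕ)) = 0 := fun s => by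
        rw [dotProduct_comm]; exact congrFun hx s
      set c : Fin t → ℝ := (fun s : Fin t => x ⬝ᵥ V (a + (s : ℕ) - ℓ)) ᵥ* D⁻¹ with hc
      have hcD : c ᵥ* D = fun s : Fin t => x ⬝ᵥ V (a + (s : ℕ) - ℓ) := by
        rw [hc, Matrix.vecMul_vecMul, Matrix.nonsing_inv_mul _ (isUnit_iff_ne_zero.2 hDdet),
          Matrix.vecMul_one]
      have hz := hind a (x - c ᵥ* AM) (-(c ᵥ* BM)) fun p h1 h2 => by
        have h3 : (x - c ᵥ* AM) ⬝ᵥ V p + (-(c ᵥ* BM)) ⬝ᵥ W p =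
            x ⬝ᵥ V p - ((c ᵥ* AM) ⬝ᵥ V p + (c ᵥ* BM) ⬝ᵥ W p) := by
          rw [sub_dotProduct, neg_dotProduct]; ring
        rw [h3, hpair]
        by_cases hp : p < a + t - ℓ
        · obtain ⟨i, hi⟩ := Int.eq_ofNat_of_zero_le (show 0 ≤ p - (a - ℓ) by omega)
          have h4 := congrFun hcD ⟨i, by omega⟩
          rw [show p = a + (i : ℕ) - ℓ by omega, sub_eq_zero]
          exact h4.symm
        · obtain ⟨i, hi⟩ := Int.eq_ofNat_of_zero_le (show 0 ≤ p - (a + t - ℓ) by omega)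
          have h4 := hx' ⟨i, by omega⟩
          rw [show a + t - ℓ + (((⟨i, by omega⟩ : Fin t') : ℕ) : ℤ) = p by simp only; omega] at h4
          rw [h4, zero_sub, neg_eq_zero]
          exact Finset.sum_eq_zero fun s _ => by rw [hvan s p (by omega) h2, mul_zero]
      refine ⟨⟨c, neg_eq_zero.1 hz.2⟩, Subtype.ext (sub_eq_zero.1 hz.1).symm⟩
  have h1 := (LinearEquiv.ofBijective ψ hbij).finrank_eq
  have h2 := LinearMap.finrank_range_add_finrank_ker BM.vecMulLinear
  have h3 := LinearMap.finrank_range_add_finrank_ker VM.mulVecLin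
  rw [Module.finrank_fin_fun] at h2 h3
  rw [range_vecMulLinear, ← Matrix.rank_eq_finrank_span_row] at h2
  change VM.rank + _ = k at h3
  omega

end RankDuality

/-! ### The cell of the second block -/

section Cells

variable {n k ℓ m : ℕ} [NeZero n] {f : Equiv.Perm ℤ}

theorem famRank_Ico_eq_box {b : ℤ} (hf : f ∈ affPerm n k b) (hb : k + b ≤ n) {M : FullRankMat k n}
    (hM : M.toGr ∈ posCell k n f) (c : ℕ) (a : ℤ) {t : ℕ} (ht : t ≤ n) :
    famRank (extCol c M.1) (Finset.Ico a (a + t)) =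
      box (fun j => f j + k) (a - n) a a (a + t) := by
  have hn : (0 : ℤ) < n := by exact_mod_cast NeZero.pos n
  have h0 := a.emod_nonneg hn.ne'
  have h1 := a.emod_lt_of_pos hn
  have h2 := Int.emod_add_mul_ediv a n
  obtain ⟨i, hi⟩ := Int.eq_ofNat_of_zero_le h0
  have h3 := ((mem_posCell_iff hf hb M).1 hM).2 ⟨i, by omega⟩ t ht
  rw [famRank_extCol c] at h3
  have h4 := famRank_Ico_add_mul (neg_one_pow_ne_zero _) (extCol_quasiPeriodic c M.1) (i : ℤ)
    ((i : ℤ) + t) (a / n)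
  have h5 := periodic_add_mul (n := n) (φ := fun a => box (fun j => f j + k) (a - n) a a (a + t))
    (fun a => by
      rw [← box_shift (n := n) (p := a - n) (q := a) (u := a) fun j => by rw [hf.1]; ring]
      congr 1 <;> ring) (i : ℤ) (a / n)
  rw [show (i : ℤ) + t + n * (a / n) = a + t by omega,
    show (i : ℤ) + n * (a / n) = a by omega] at h4
  rw [show (i : ℤ) + n * (a / n) = a by omega] at h5
  rw [h4, h5]
  exact h3

theorem exists_window_of_posCell (hn : k + ℓ + m = n) (hf : f ∈ affPerm n k ℓ) {M : FullRankMat k n}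
    (hM : M.toGr ∈ posCell k n f) (c : ℕ) (j : ℤ) :
    ∃ I : Fin k → ℤ, StrictMono I ∧ (∀ a, j ≤ I a ∧ I a < j + k + ℓ) ∧
      seqMinor (extCol c M.1) I ≠ 0 := by
  have h1 := famRank_Ico_eq_box hf (by omega) hM c j (t := k + ℓ) (by omega)
  rw [box_window hf (by omega) j (by push_cast; omega)] at h1
  obtain ⟨K, hK, hKi, hKc, -⟩ := exists_linearIndepOn_card_eq (v := extCol c M.1)
    (Finset.Ico j (j + (k + ℓ : ℕ)))
  rw [h1] at hKc
  refine ⟨K.orderEmbOfFin hKc, (K.orderEmbOfFin hKc).strictMono, fun a => ?_, ?_⟩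
  · have := Finset.mem_Ico.1 (hK (Finset.orderEmbOfFin_mem K hKc a))
    push_cast at this
    omega
  · exact (detRow_ne_zero_iff _).2 (LinearIndependent.comp hKi (K.orderIsoOfFin hKc)
      (K.orderIsoOfFin hKc).injective)

/-- For lengths up to `k + ℓ`, `famRank_right` and `box_inv` express ranks and counts through the
same quantity for `f`. Longer intervals have the maximal rank `ℓ` on both sides. Full rank over one
period also makes the rows independent. -/
theorem mem_posCell_of_dual (hn : k + ℓ + m = n) (hf : f ∈ affPerm n k ℓ) {M : FullRankMat k n}
    (hM : M.toGr ∈ posCell k n f) {c : ℕ} {ε : ℝ} {W : ℤ → Fin ℓ → ℝ} {A : ℤ → Fin k → ℝ}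
    {N : Matrix (Fin ℓ) (Fin n) ℝ} (hD : IsDual k ℓ ε (extCol c M.1) W A (extCol ℓ N))
    (hind : ∀ (j : ℤ) (x : Fin k → ℝ) (y : Fin ℓ → ℝ),
      (∀ p : ℤ, j - ℓ ≤ p → p < j + k → x ⬝ᵥ extCol c M.1 p + y ⬝ᵥ W p = 0) → x = 0 ∧ y = 0)
    (hN : SeqSignTNN n (extCol ℓ N)) :
    ∃ h : LinearIndependent ℝ N.row,
      FullRankMat.toGr (⟨N, h⟩ : FullRankMat ℓ n) ∈ posCell ℓ n f⁻¹ := by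
  have hb : (k : ℤ) + ℓ ≤ n := by omega
  have hf' := inv_mem_affPerm hf
  have hrank : ∀ (a : ℤ) (t : ℕ), t ≤ k + ℓ → famRank (extCol ℓ N) (Finset.Ico a (a + t)) =
      box (fun j => f⁻¹ j + ℓ) (a - n) a a (a + t) := by
    intro a t ht
    have h1 := hD.famRank_right hind a ht
    have h2 := box_inv hf (by omega) a ht
    have h3 := famRank_Ico_eq_box hf hb hM c (a + t - ℓ) (t := k + ℓ - t) (by omega)
    rw [show a + t - ℓ + ((k + ℓ - t : ℕ) : ℤ) = a + k by omega] at h3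
    omega
  have hfull : ∀ (a : ℤ) (t : ℕ), k + ℓ ≤ t → famRank (extCol ℓ N) (Finset.Ico a (a + t)) = ℓ := by
    intro a t ht
    have h1 := hrank a (k + ℓ) le_rfl
    rw [box_window hf' (by omega) a (by push_cast; omega)] at h1
    apply le_antisymm
    · refine (Submodule.finrank_le _).trans ?_
      simp
    · exact h1.symm.trans_le (famRank_mono _ (Finset.Ico_subset_Ico_right (by omega)))
  have hli : LinearIndependent ℝ N.row := by
    have h1 := hfull 0 n (by omega)
    rw [famRank_Ico_eq_rank] at h1
    rw [row_linearIndependent_iff]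
    intro y hy
    have h2 : (Matrix.of fun s : Fin n => extCol ℓ N (0 + ((s : ℕ) : ℤ))) = Nᵀ := by
      ext s b
      simp only [Matrix.of_apply, zero_add, extCol_coe]
      rfl
    rw [h2] at h1
    have h3 := LinearMap.finrank_range_add_finrank_ker (Nᵀ).mulVecLin
    rw [Module.finrank_fin_fun] at h3
    change (Nᵀ).rank + _ = ℓ at h3
    have h4 : LinearMap.ker (Nᵀ).mulVecLin = ⊥ := Submodule.finrank_eq_zero.1 (by omega)
    refine LinearMap.ker_eq_bot'.1 h4 y (funext fun p => ?_)
    exact (dotProduct_comm _ _).trans (hy p)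
  refine ⟨hli, (mem_posCell_iff hf' (by omega) _).2 ⟨hN, fun i t ht => ?_⟩⟩
  rw [famRank_extCol ℓ]
  by_cases htk : t ≤ k + ℓ
  · exact hrank _ t htk
  · have := hfull (i : ℕ) t (by omega)
    rw [this, box_window hf' (by omega) _ (by omega)]

end Cells

/-! ### Complements of totally positive spaces -/

section Perp

variable {n r d : ℕ}

theorem mem_rowSpan_iff_of_orth (hn : d + r = n) {Z : Matrix (Fin d) (Fin n) ℝ}
    {W : Matrix (Fin r) (Fin n) ℝ} (hZ : LinearIndependent ℝ Z.row) (hW : LinearIndependent ℝ W.row)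
    (h : ∀ i c, ∑ p, Z i p * W c p = 0) (w : Fin n → ℝ) :
    w ∈ rowSpan W ↔ ∀ z ∈ rowSpan Z, z ⬝ᵥ w = 0 := by
  have hrk : Z.rank = d := by rw [hZ.rank_matrix, Fintype.card_fin]
  have hker : Module.finrank ℝ Z.mulVecLin.ker = r := by
    have := Z.mulVecLin.finrank_range_add_finrank_ker
    rw [Module.finrank_fin_fun] at this
    have h2 : Module.finrank ℝ Z.mulVecLin.range = d := hrk
    omega
  have hfin : Module.finrank ℝ (rowSpan W) = r := by
    have := finrank_span_eq_card hW
    rwa [Fintype.card_fin] at this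
  have heq : rowSpan W = Z.mulVecLin.ker := by
    refine Submodule.eq_of_le_of_finrank_eq (Submodule.span_le.2 ?_) (hfin.trans hker.symm)
    rintro _ ⟨c, rfl⟩
    rw [SetLike.mem_coe, LinearMap.mem_ker, Matrix.mulVecLin_apply]
    exact funext fun i => h i c
  rw [heq, LinearMap.mem_ker, Matrix.mulVecLin_apply]
  constructor
  · intro hw z hz
    induction hz using Submodule.span_induction with
    | mem x hx => obtain ⟨i, rfl⟩ := hx; exact congrFun hw i
    | zero => exact zero_dotProduct _
    | add x y _ _ hx hy => rw [add_dotProduct, hx, hy, add_zero]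
    | smul a x _ hx => rw [smul_dotProduct, hx, smul_zero]
  · intro hw
    exact funext fun i => hw _ (Submodule.subset_span ⟨i, rfl⟩)

variable [NeZero n]

theorem extCol_span {M : Matrix (Fin r) (Fin n) ℝ} (hM : LinearIndependent ℝ M.row) (c : ℕ)
    (y : Fin r → ℝ) (h : ∀ p : ℤ, 0 ≤ p → p < n → y ⬝ᵥ extCol c M p = 0) : y = 0 :=
  row_linearIndependent_iff.1 hM y fun p => by
    have := h p (by omega) (by omega)
    rwa [extCol_coe] at this

theorem mem_grPosPerp_iff (hn : d + r = n) (W : FullRankMat r n) :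
    W.toGr ∈ grPosPerp d r n ↔ ∃ Z : FullRankMat d n, SeqTP n (extCol d Z.1) ∧
      ∀ i c, ∑ p : Fin n, extCol d Z.1 ((p : ℕ) : ℤ) i * extCol d W.1 ((p : ℕ) : ℤ) c = 0 := by
  constructor
  · rintro ⟨_, ⟨Z, rfl, hZ⟩, h⟩
    refine ⟨Z, seqTP_extCol_iff.2 hZ, fun i c => ?_⟩
    simp only [extCol_coe]
    exact (h (W.1.row c)).1 (Submodule.subset_span ⟨c, rfl⟩) (Z.1.row i)
      (Submodule.subset_span ⟨i, rfl⟩)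
  · rintro ⟨Z, hZ, h⟩
    refine ⟨Z.toGr, ⟨Z, rfl, seqTP_extCol_iff.1 hZ⟩, mem_rowSpan_iff_of_orth hn Z.2 W.2 ?_⟩
    intro i c
    have := h i c
    simp only [extCol_coe] at this
    exact this

/-- One direction is `SeqTP.dual`. Conversely, the alternated sequence is normalized to a totally
positive one, and its dual `Y` is orthogonal to it after an alternation. The two alternations cancel
in the pairing and leave `Y` orthogonal to `W`. -/
theorem mem_grPosPerp_iff_signTP (hn : d + r = n) {c : ℕ} (hc : Even (d + c)) (W : FullRankMat r n) :
    W.toGr ∈ grPosPerp d r n ↔ SeqSignTP n (altSeq (extCol c W.1)) := by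
  rw [← extCol_parity hc, mem_grPosPerp_iff hn]
  constructor
  · rintro ⟨Z, hZ, h⟩
    exact hZ.dual hn (extCol_quasiPeriodic d W.1) h (extCol_span W.2 d)
  · intro h
    obtain ⟨g, hg, hgP⟩ := h.exists_seqTP (by omega)
    obtain ⟨Y, hYq, hYP, hY⟩ := hgP.exists_dual (s := d) (by omega)
    set Z : Matrix (Fin d) (Fin n) ℝ := Matrix.of fun i p => Y ((p : ℕ) : ℤ) i with hZdef
    have hZ : extCol d Z = Y := extCol_eq_of_quasiPeriodic d Z hYq fun p => rfl
    have hZr : LinearIndependent ℝ Z.row := row_linearIndependent_iff.2 fun y hy =>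
      hYP.span (by omega) fun p h0 h1 => by
        have := hy ⟨p.toNat, by omega⟩
        rw [← extCol_coe d, hZ] at this
        simpa [Int.toNat_of_nonneg h0] using this
    refine ⟨⟨Z, hZr⟩, by rwa [hZ], fun i c => ?_⟩
    rw [hZ]
    have h1 : g *ᵥ (∑ p : Fin n, Y ((p : ℕ) : ℤ) i • extCol d W.1 ((p : ℕ) : ℤ)) = 0 := by
      funext b
      rw [Pi.zero_apply, ← hY b i, Matrix.mulVec_sum, Finset.sum_apply]
      refine Finset.sum_congr rfl fun p _ => ?_
      rw [altSeq_coe, altSeq_coe, Matrix.mulVec_smul, Matrix.mulVec_smul]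
      simp only [Pi.smul_apply, smul_eq_mul]
      have := neg_one_pow_mul_self (p : ℕ)
      linear_combination (-(g *ᵥ extCol d W.1 ((p : ℕ) : ℤ)) b * Y ((p : ℕ) : ℤ) i) * this
    have h2 := Matrix.eq_zero_of_mulVec_eq_zero hg h1
    have := congrFun h2 c
    rw [Finset.sum_apply] at this
    exact this

end Perp

/-! ### Block triangular changes of basis -/

section Flag

variable {k ℓ n : ℕ}

/-- The block matrix that sends `stackMat V W` to `stackMat (g * V + c * W) (g' * W)`. -/
def blockUpper (g : Matrix (Fin k) (Fin k) ℝ) (c : Matrix (Fin k) (Fin ℓ) ℝ)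
    (g' : Matrix (Fin ℓ) (Fin ℓ) ℝ) : Matrix (Fin (k + ℓ)) (Fin (k + ℓ)) ℝ :=
  (Matrix.fromBlocks g c 0 g').reindex finSumFinEquiv finSumFinEquiv

variable {g : Matrix (Fin k) (Fin k) ℝ} {c : Matrix (Fin k) (Fin ℓ) ℝ}
  {g' : Matrix (Fin ℓ) (Fin ℓ) ℝ}

theorem det_blockUpper : (blockUpper g c g').det = g.det * g'.det := by
  rw [blockUpper, Matrix.det_reindex_self, Matrix.det_fromBlocks_zero₂₁]

theorem det_blockUpper_ne_zero (hg : g.det ≠ 0) (hg' : g'.det ≠ 0) :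
    (blockUpper g c g').det ≠ 0 := by
  rw [det_blockUpper]
  exact mul_ne_zero hg hg'

theorem stackMat_castAdd (V : Matrix (Fin k) (Fin n) ℝ) (W : Matrix (Fin ℓ) (Fin n) ℝ) (a : Fin k)
    (p : Fin n) : stackMat V W (Fin.castAdd ℓ a) p = V a p :=
  congrFun (Fin.append_left V.row W.row a) p

theorem stackMat_natAdd (V : Matrix (Fin k) (Fin n) ℝ) (W : Matrix (Fin ℓ) (Fin n) ℝ) (a : Fin ℓ)
    (p : Fin n) : stackMat V W (Fin.natAdd k a) p = W a p :=
  congrFun (Fin.append_right V.row W.row a) p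

theorem stackMat_submatrix (U : Matrix (Fin (k + ℓ)) (Fin n) ℝ) :
    stackMat (U.submatrix (Fin.castAdd ℓ) id) (U.submatrix (Fin.natAdd k) id) = U := by
  ext i p
  induction i using Fin.addCases with
  | left a => rw [stackMat_castAdd]; rfl
  | right b => rw [stackMat_natAdd]; rfl

theorem blockUpper_mul_stackMat (V : Matrix (Fin k) (Fin n) ℝ) (W : Matrix (Fin ℓ) (Fin n) ℝ) :
    blockUpper g c g' * stackMat V W = stackMat (g * V + c * W) (g' * W) := by
  ext i p
  induction i using Fin.addCases with
  | left a =>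
    rw [stackMat_castAdd, Matrix.mul_apply, Fin.sum_univ_add]
    simp only [stackMat_castAdd, stackMat_natAdd, blockUpper, Matrix.reindex_apply,
      Matrix.submatrix_apply, finSumFinEquiv_symm_apply_castAdd, finSumFinEquiv_symm_apply_natAdd,
      Matrix.fromBlocks_apply₁₁, Matrix.fromBlocks_apply₁₂]
    rfl
  | right b =>
    rw [stackMat_natAdd, Matrix.mul_apply, Fin.sum_univ_add]
    simp only [stackMat_castAdd, stackMat_natAdd, blockUpper, Matrix.reindex_apply,
      Matrix.submatrix_apply, finSumFinEquiv_symm_apply_castAdd, finSumFinEquiv_symm_apply_natAdd,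
      Matrix.fromBlocks_apply₂₁, Matrix.fromBlocks_apply₂₂, Matrix.zero_apply, zero_mul,
      Finset.sum_const_zero, zero_add]
    rfl

theorem blockUpper_transpose_mul (T : Matrix (Fin (k + ℓ)) (Fin n) ℝ) :
    (blockUpper g c g')ᵀ * T = stackMat (gᵀ * T.submatrix (Fin.castAdd ℓ) id)
      (cᵀ * T.submatrix (Fin.castAdd ℓ) id + g'ᵀ * T.submatrix (Fin.natAdd k) id) := by
  ext i p
  induction i using Fin.addCases with
  | left a =>
    rw [stackMat_castAdd, Matrix.mul_apply, Fin.sum_univ_add]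
    simp only [blockUpper, Matrix.reindex_apply, Matrix.transpose_apply,
      Matrix.submatrix_apply, finSumFinEquiv_symm_apply_castAdd, finSumFinEquiv_symm_apply_natAdd,
      Matrix.fromBlocks_apply₁₁, Matrix.fromBlocks_apply₂₁, Matrix.zero_apply, zero_mul,
      Finset.sum_const_zero, add_zero]
    rfl
  | right b =>
    rw [stackMat_natAdd, Matrix.mul_apply, Fin.sum_univ_add]
    simp only [blockUpper, Matrix.reindex_apply, Matrix.transpose_apply,
      Matrix.submatrix_apply, finSumFinEquiv_symm_apply_castAdd, finSumFinEquiv_symm_apply_natAdd,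
      Matrix.fromBlocks_apply₁₂, Matrix.fromBlocks_apply₂₂]
    rfl

theorem stackMat_injective {V V' : Matrix (Fin k) (Fin n) ℝ} {W W' : Matrix (Fin ℓ) (Fin n) ℝ}
    (h : stackMat V W = stackMat V' W') : V = V' ∧ W = W' := by
  constructor
  · ext a p
    have := congrFun₂ h (Fin.castAdd ℓ a) p
    rwa [stackMat_castAdd, stackMat_castAdd] at this
  · ext a p
    have := congrFun₂ h (Fin.natAdd k a) p
    rwa [stackMat_natAdd, stackMat_natAdd] at this

theorem rowSpan_stackMat (V : Matrix (Fin k) (Fin n) ℝ) (W : Matrix (Fin ℓ) (Fin n) ℝ) :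
    rowSpan (stackMat V W) = rowSpan V ⊔ rowSpan W := by
  rw [rowSpan, rowSpan, rowSpan, ← Submodule.span_union]
  congr 1
  ext x
  constructor
  · rintro ⟨i, rfl⟩
    induction i using Fin.addCases with
    | left a => exact Or.inl ⟨a, funext fun p => (stackMat_castAdd V W a p).symm⟩
    | right b => exact Or.inr ⟨b, funext fun p => (stackMat_natAdd V W b p).symm⟩
  · rintro (⟨a, rfl⟩ | ⟨b, rfl⟩)
    · exact ⟨Fin.castAdd ℓ a, funext fun p => stackMat_castAdd V W a p⟩
    · exact ⟨Fin.natAdd k b, funext fun p => stackMat_natAdd V W b p⟩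

theorem rowSpan_stackMat_swap (V : Matrix (Fin k) (Fin n) ℝ) (W : Matrix (Fin ℓ) (Fin n) ℝ) :
    rowSpan (stackMat W V) = rowSpan (stackMat V W) := by
  rw [rowSpan_stackMat, rowSpan_stackMat, sup_comm]

variable [NeZero n]

theorem linearIndependent_of_mem_matCirc {U : Matrix (Fin (k + ℓ)) (Fin n) ℝ}
    (h : U ∈ matCirc k ℓ n) : LinearIndependent ℝ U.row := by
  rw [row_linearIndependent_iff]
  intro y hy
  refine dotProduct_eq_zero_of_winMat (mem_matCirc_iff.1 h 0) fun p _ _ => ?_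
  rw [extCol, dotProduct_smul, hy, smul_zero]

/-- A change of basis of the flag acts on the stacked twist by a change of basis. -/
theorem stackedTwist_block {V : Matrix (Fin k) (Fin n) ℝ} {W : Matrix (Fin ℓ) (Fin n) ℝ}
    (h : stackMat V W ∈ matCirc k ℓ n) (hg : g.det ≠ 0) (hg' : g'.det ≠ 0) :
    stackMat (g * V + c * W) (g' * W) ∈ matCirc k ℓ n ∧
      (stackedTwist V W).1 = gᵀ * (stackedTwist (g * V + c * W) (g' * W)).1 ∧
      (stackedTwist V W).2 = cᵀ * (stackedTwist (g * V + c * W) (g' * W)).1 +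
        g'ᵀ * (stackedTwist (g * V + c * W) (g' * W)).2 := by
  have hdet := det_blockUpper_ne_zero (c := c) hg hg'
  have h1 := matCirc_mul h hdet
  have h2 := twist_mul h hdet
  rw [blockUpper_mul_stackMat] at h1 h2
  refine ⟨h1, stackMat_injective ?_⟩
  have h3 : (blockUpper g c g')ᵀ * twist k ℓ (stackMat (g * V + c * W) (g' * W)) =
      twist k ℓ (stackMat V W) := by
    rw [h2, ← Matrix.mul_assoc, ← Matrix.transpose_mul, Matrix.nonsing_inv_mul _ hdet.isUnit,
      Matrix.transpose_one, Matrix.one_mul]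
  rw [blockUpper_transpose_mul] at h3
  rw [stackedTwist, stackMat_submatrix, ← h3]
  rfl

end Flag

/-! ### The stacked twist on representatives -/

section Source

variable {k ℓ m n : ℕ} [NeZero n] {f : Equiv.Perm ℤ}

theorem linearIndependent_of_altSeq_signTP {r c : ℕ} (hr : r ≤ n) {M : Matrix (Fin r) (Fin n) ℝ}
    (h : SeqSignTP n (altSeq (extCol c M))) : LinearIndependent ℝ M.row := by
  rw [row_linearIndependent_iff]
  intro y hy
  have hq := cycInc_consecutive (r := r) hr 0
  have hne : (Matrix.of fun a : Fin r => altSeq (extCol c M) (0 + (a : ℕ))).det ≠ 0 :=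
    left_ne_zero_of_mul (h _ _ hq hq).ne'
  refine Matrix.eq_zero_of_mulVec_eq_zero hne (funext fun a => ?_)
  rw [Matrix.mulVec, dotProduct_comm]
  simp only [Matrix.of_apply, altSeq, extCol, dotProduct_smul, hy, smul_zero, Pi.zero_apply]

/-- The matrix `g` is needed because an arbitrary representative of a point of a cell has minors of
constant weak sign, not necessarily nonnegative ones. -/
theorem exists_twistData (hn : k + ℓ + m = n) (hm : Even m) (hf : f ∈ affPerm n k ℓ)
    {V : FullRankMat k n} {W : FullRankMat ℓ n} (hV : V.toGr ∈ posCell k n f)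
    (hW : W.toGr ∈ grPosPerp (k + m) ℓ n) :
    ∃ (g : Matrix (Fin k) (Fin k) ℝ) (_ : g.det ≠ 0) (Z : FullRankMat (k + m) n),
      TwistData n k ℓ (k + m) (extCol (k + m) Z.1) (extCol k (g * V.1)) (extCol k W.1) := by
  obtain ⟨g, hg, hgV⟩ := ((mem_posCell_iff hf (by omega) V).1 hV).1.exists_seqTNN
  obtain ⟨Z, hZ, horth⟩ := (mem_grPosPerp_iff (by omega) W).1 hW
  have he : Even (k + m + k) := by
    rw [add_right_comm]
    exact (Even.add_self k).add hm
  have hgV' : SeqTNN n (extCol k (g * V.1)) := by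
    rwa [funext fun j => extCol_mul k g V.1 j]
  refine ⟨g, hg, Z, ⟨by omega, by omega, he, extCol_quasiPeriodic _ _, extCol_quasiPeriodic _ _,
    extCol_quasiPeriodic _ _, hZ, hgV', fun j => ?_, ?_, extCol_span W.2 k⟩⟩
  · exact exists_window_of_posCell hn hf (M := V.mulLeft g hg)
      (by rwa [FullRankMat.toGr_mulLeft]) k j
  · rwa [← extCol_parity he W.1]

theorem eq_one_of_mem_affPerm_zero {n : ℕ} {f : Equiv.Perm ℤ} (hf : f ∈ affPerm n 0 0) : f = 1 := by
  ext i
  have := hf.2.2 i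
  simp only [Equiv.Perm.coe_one, id_eq]
  omega

/-- The stacked twist of representatives of a point of a positroid cell and of a point of
`grPosPerp (k + m) ℓ n`. -/
theorem stackedTwist_mem (hn : k + ℓ + m = n) (hm : Even m) (hf : f ∈ affPerm n k ℓ)
    (V : FullRankMat k n) (W : FullRankMat ℓ n) (hV : V.toGr ∈ posCell k n f)
    (hW : W.toGr ∈ grPosPerp (k + m) ℓ n) :
    stackMat V.1 W.1 ∈ matCirc k ℓ n ∧
      (∃ h : LinearIndependent ℝ (stackedTwist V.1 W.1).1.row,
        FullRankMat.toGr ⟨_, h⟩ ∈ grPosPerp (ℓ + m) k n) ∧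
      ∃ h : LinearIndependent ℝ (stackedTwist V.1 W.1).2.row,
        FullRankMat.toGr ⟨_, h⟩ ∈ posCell ℓ n f⁻¹ := by
  -- For `k + ℓ = 0` all pairings are zero and the strict sign in `IsDual` is impossible, so this
  -- case is treated directly.
  rcases Nat.eq_zero_or_pos (k + ℓ) with h0 | hkl
  · obtain ⟨rfl, rfl⟩ : k = 0 ∧ ℓ = 0 := by omega
    obtain rfl := eq_one_of_mem_affPerm_zero hf
    have hsub (M N : FullRankMat 0 n) : M = N := Subsingleton.elim M N
    refine ⟨mem_matCirc_iff.2 fun j => ?_, ⟨linearIndependent_empty_type, ?_⟩,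
      ⟨linearIndependent_empty_type, ?_⟩⟩
    · have : IsEmpty (Fin (0 + 0)) := inferInstanceAs (IsEmpty (Fin 0))
      rw [Matrix.det_isEmpty]
      exact one_ne_zero
    · rwa [hsub ⟨_, _⟩ W]
    · rwa [hsub ⟨_, _⟩ V, inv_one]
  obtain ⟨g, hg, Z, H⟩ := exists_twistData hn hm hf hV hW
  have hM := H.mem_matCirc
  have hD := isDual_stackedTwist hn hm hkl hM
  -- The data concern `g * V`. Undoing `g` changes the first block of the twist by an invertible
  -- factor and leaves the second block as it is.
  obtain ⟨hM', h1, h2⟩ := stackedTwist_block (c := 0) hM (g := g⁻¹) (g' := 1)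
    (Matrix.isUnit_nonsing_inv_det _ hg.isUnit).ne_zero (by simp)
  have hgV : g⁻¹ * (g * V.1) = V.1 := by
    rw [← Matrix.mul_assoc, Matrix.nonsing_inv_mul _ hg.isUnit, Matrix.one_mul]
  simp only [hgV, Matrix.zero_mul, add_zero, Matrix.one_mul, Matrix.transpose_zero, zero_add,
    Matrix.transpose_one] at hM' h1 h2
  refine ⟨hM', ?_, ?_⟩
  · have hdet : (gᵀ).det ≠ 0 := by rwa [Matrix.det_transpose]
    have h3 : (stackedTwist V.1 W.1).1 = gᵀ * (stackedTwist (g * V.1) W.1).1 := by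
      rw [h1, ← Matrix.mul_assoc, ← Matrix.transpose_mul, Matrix.nonsing_inv_mul _ hg.isUnit,
        Matrix.transpose_one, Matrix.one_mul]
    have hS := H.altSeq_left_signTP hD
    have hS' : SeqSignTP n (altSeq (extCol ℓ (stackedTwist V.1 W.1).1)) := by
      have h4 : altSeq (extCol ℓ (stackedTwist V.1 W.1).1) =
          fun j => gᵀ *ᵥ altSeq (extCol ℓ (stackedTwist (g * V.1) W.1).1) j := by
        funext j
        rw [h3, altSeq, altSeq, extCol_mul, Matrix.mulVec_smul]
      rw [h4]
      exact hS.mulVec hdet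
    have hli : LinearIndependent ℝ (stackedTwist V.1 W.1).1.row := 
      linearIndependent_of_altSeq_signTP (by omega) hS'
    exact ⟨hli, (mem_grPosPerp_iff_signTP (by omega) (by
      rw [add_right_comm]; exact (Even.add_self ℓ).add hm) _).2 hS'⟩
  · rw [← h2]
    exact mem_posCell_of_dual hn hf (M := V.mulLeft g hg) (c := k)
      (by rwa [FullRankMat.toGr_mulLeft]) hD
      (fun j x y h => ⟨H.left_eq_zero h, H.right_eq_zero h⟩) (H.right_signTNN hn hm hkl)

end Source

/-! ### Inverting the twist -/

section Untwist

variable {k ℓ : ℕ}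

/-- Any `k + ℓ` consecutive vectors of the twist form a basis. -/
theorem twistSeq_window {X : ℤ → Fin (k + ℓ) → ℝ} (h : ∀ j, (winMat k ℓ X j).det ≠ 0) (b : ℤ) :
    (Matrix.of fun a : Fin (k + ℓ) => twistSeq k ℓ X (b + (a : ℕ))).det ≠ 0 := by
  set A : Matrix (Fin (k + ℓ)) (Fin (k + ℓ)) ℝ :=
    Matrix.of fun a => twistSeq k ℓ X (b + (a : ℕ))
  set B : Matrix (Fin (k + ℓ)) (Fin (k + ℓ)) ℝ :=
    Matrix.of fun i a => X (b + (a : ℕ) - ℓ) i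
  have hAB (a a' : Fin (k + ℓ)) : (A * B) a a' =
      twistSeq k ℓ X (b + (a : ℕ)) ⬝ᵥ X (b + (a' : ℕ) - ℓ) := rfl
  -- Pairing with the left ends of the windows gives a triangular matrix with diagonal entries `±1`.
  have htri : (A * B).BlockTriangular OrderDual.toDual := fun a a' haa' => by
    have : (a : ℕ) < a' := haa'
    rw [hAB]
    exact twistSeq_dotProduct_eq_zero (h _) (by omega) (by omega)
  have hdet : (A * B).det ≠ 0 := by
    rw [Matrix.det_of_isLowerTriangular _ htri, Finset.prod_ne_zero_iff]
    intro a _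
    rw [hAB, twistSeq_dotProduct_left (h _) (Fin.pos a)]
    exact zpow_ne_zero _ (by norm_num)
  rw [Matrix.det_mul] at hdet
  exact left_ne_zero_of_mul hdet

theorem eq_zero_of_twistSeq_dotProduct {X : ℤ → Fin (k + ℓ) → ℝ}
    (h : ∀ j, (winMat k ℓ X j).det ≠ 0) (b : ℤ) {u : Fin (k + ℓ) → ℝ}
    (hu : ∀ p : ℤ, b ≤ p → p < b + k + ℓ → twistSeq k ℓ X p ⬝ᵥ u = 0) : u = 0 :=
  Matrix.eq_zero_of_mulVec_eq_zero (twistSeq_window h b)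
    (funext fun a => hu (b + (a : ℕ)) (by omega) (by omega))

variable {m n : ℕ} [NeZero n]

theorem extCol_dotProduct_stackMat (c c' : ℕ) (X V : Matrix (Fin k) (Fin n) ℝ)
    (Y W : Matrix (Fin ℓ) (Fin n) ℝ) (i j : ℤ) :
    extCol c (stackMat X Y) j ⬝ᵥ extCol c' (stackMat V W) i =
      extCol c X j ⬝ᵥ extCol c' V i + extCol c Y j ⬝ᵥ extCol c' W i := by
  rw [extCol_stackMat, extCol_stackMat, dotProduct_append]
  simp only [Fin.append_left, Fin.append_right]

/-- The vector at index `p` has prescribed pairings with the `k + ℓ` consecutive twist vectors whose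
windows contain `p`, and these form a basis. -/
theorem twist_injOn (hn : k + ℓ + m = n) (hm : Even m) {U U' : Matrix (Fin (k + ℓ)) (Fin n) ℝ}
    (h : U ∈ matCirc k ℓ n) (h' : U' ∈ matCirc k ℓ n) (heq : twist k ℓ U = twist k ℓ U') :
    U = U' := by
  have hT := extCol_twist hn hm h
  have hT' := extCol_twist hn hm h'
  rw [← heq, hT] at hT'
  have hw := mem_matCirc_iff.1 h
  have hw' := mem_matCirc_iff.1 h'
  ext a p
  have key : extCol k U (p : ℕ) - extCol k U' (p : ℕ) = 0 := by
    refine eq_zero_of_twistSeq_dotProduct hw ((p : ℕ) - k + 1) fun j h1 h2 => ?_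
    rw [dotProduct_sub, sub_eq_zero]
    rcases eq_or_lt_of_le (show j ≤ (p : ℕ) + ℓ by omega) with hj | hj
    · have hp : ((p : ℕ) : ℤ) = j - ℓ := by omega
      rw [hp, twistSeq_dotProduct_left (hw j) (Fin.pos a), hT',
        twistSeq_dotProduct_left (hw' j) (Fin.pos a)]
    · rw [twistSeq_dotProduct_eq_zero (hw j) (by omega) (by omega), hT',
        twistSeq_dotProduct_eq_zero (hw' j) (by omega) (by omega)]
  rw [extCol_coe, extCol_coe, sub_eq_zero] at key
  exact congrFun key a

theorem linearIndependent_twist (hn : k + ℓ + m = n) (hm : Even m)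
    {U : Matrix (Fin (k + ℓ)) (Fin n) ℝ} (h : U ∈ matCirc k ℓ n) :
    LinearIndependent ℝ (twist k ℓ U).row := by
  rw [row_linearIndependent_iff]
  intro y hy
  refine eq_zero_of_twistSeq_dotProduct (mem_matCirc_iff.1 h) 0 fun p _ _ => ?_
  rw [← extCol_twist hn hm h, extCol, smul_dotProduct, dotProduct_comm, hy, smul_zero]

theorem extCol_mul_diagonal {r : ℕ} (c : ℕ) (M : Matrix (Fin r) (Fin n) ℝ) {d : ℤ → ℝ}
    (hd : ∀ j, d (j + n) = d j) :
    extCol c (M * Matrix.diagonal fun p : Fin n => d (p : ℕ)) = fun j => d j • extCol c M j := by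
  refine extCol_eq_of_quasiPeriodic c _ (fun j => ?_) fun p => ?_
  · rw [hd, extCol_quasiPeriodic c M j, smul_comm]
  · funext a
    simp only [extCol_coe, Pi.smul_apply, smul_eq_mul, Matrix.col_apply, Matrix.mul_diagonal]
    exact mul_comm _ _

/-- The pairings of the vectors of the stacked twist with the first vectors to the right of their
windows. -/
noncomputable def rightPairing (V : Matrix (Fin k) (Fin n) ℝ) (W : Matrix (Fin ℓ) (Fin n) ℝ)
    (j : ℤ) : ℝ :=
  (-1) ^ (j + k) * (extCol ℓ (stackedTwist V W).1 j ⬝ᵥ extCol k V (j + k) +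
    extCol ℓ (stackedTwist V W).2 j ⬝ᵥ extCol k W (j + k))

theorem rightPairing_add (hn : k + ℓ + m = n) (hm : Even m) (V : Matrix (Fin k) (Fin n) ℝ)
    (W : Matrix (Fin ℓ) (Fin n) ℝ) (j : ℤ) : rightPairing V W (j + n) = rightPairing V W j := by
  have h1 : (-1 : ℝ) ^ (j + n + k) = (-1) ^ (j + k) * (-1) ^ n := by
    rw [add_right_comm, zpow_add₀ (by norm_num), zpow_natCast]
  have h2 : (-1 : ℝ) ^ n * ((-1) ^ (ℓ + 1) * (-1) ^ (k + 1)) = 1 := by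
    rw [← pow_add, ← pow_add]
    exact Even.neg_one_pow (by
      obtain ⟨a, rfl⟩ := hm
      exact ⟨k + ℓ + a + 1, by omega⟩)
  rw [rightPairing, rightPairing, h1, add_right_comm j n k, extCol_quasiPeriodic,
    extCol_quasiPeriodic, extCol_quasiPeriodic, extCol_quasiPeriodic]
  simp only [smul_dotProduct, dotProduct_smul, smul_eq_mul]
  linear_combination ((-1) ^ (j + k) * (extCol ℓ (stackedTwist V W).1 j ⬝ᵥ extCol k V (j + k) +
    extCol ℓ (stackedTwist V W).2 j ⬝ᵥ extCol k W (j + k))) * h2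

/-- The stacked twist with its blocks exchanged and its columns rescaled: the inverse of the stacked
twist up to sign. -/
noncomputable def untwist (V : Matrix (Fin k) (Fin n) ℝ) (W : Matrix (Fin ℓ) (Fin n) ℝ) :
    Matrix (Fin ℓ) (Fin n) ℝ × Matrix (Fin k) (Fin n) ℝ :=
  ((stackedTwist V W).2 * Matrix.diagonal fun p : Fin n => (rightPairing V W (p : ℕ))⁻¹,
    (stackedTwist V W).1 * Matrix.diagonal fun p : Fin n => (rightPairing V W (p : ℕ))⁻¹)

/-- The twist vector at `i` is orthogonal to the column at `j` for `i - ℓ < j < i + k`, that is, for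
`j - k < i < j + ℓ`. Read with `j` fixed, this is the defining window of the twist with `k` and `ℓ`
exchanged. The normalization at its left end concerns the pairing of the twist vector at `j - k`
with the column at `j`. Division by `rightPairing` turns this pairing into a sign, and what remains
is the factor `-1` on both blocks. -/
theorem untwist_spec (hn : k + ℓ + m = n) (hm : Even m) {V : Matrix (Fin k) (Fin n) ℝ}
    {W : Matrix (Fin ℓ) (Fin n) ℝ} (h : stackMat V W ∈ matCirc k ℓ n)
    (h0 : ∀ p : Fin n, rightPairing V W (p : ℕ) ≠ 0) :
    stackMat (untwist V W).1 (untwist V W).2 ∈ matCirc ℓ k n ∧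
      stackedTwist (untwist V W).1 (untwist V W).2 = (-W, -V) := by
  have hper := rightPairing_add hn hm V W
  have hne (j : ℤ) : rightPairing V W j ≠ 0 := by
    have hr : ∀ q : ℤ, ∀ i, rightPairing V W (i + q * n) = rightPairing V W i := by
      intro q i
      have := Function.Periodic.int_mul (f := rightPairing V W) (c := (n : ℤ)) hper q
      exact this i
    have hn0 : (0 : ℤ) < n := by exact_mod_cast NeZero.pos n
    have h1 := Int.emod_nonneg j hn0.ne'
    have h2 := Int.emod_lt_of_pos j hn0
    have h3 := h0 ⟨(j % n).toNat, by omega⟩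
    rw [Int.toNat_of_nonneg h1] at h3
    rwa [← hr (j / n), Int.emod_add_ediv_mul] at h3
  have hper' (j : ℤ) : (rightPairing V W (j + n))⁻¹ = (rightPairing V W j)⁻¹ := by rw [hper]
  have e1 : extCol ℓ (untwist V W).1 =
      fun j => (rightPairing V W j)⁻¹ • extCol ℓ (stackedTwist V W).2 j :=
    extCol_mul_diagonal ℓ _ (d := fun j => (rightPairing V W j)⁻¹) hper'
  have e2 : extCol ℓ (untwist V W).2 =
      fun j => (rightPairing V W j)⁻¹ • extCol ℓ (stackedTwist V W).1 j :=
    extCol_mul_diagonal ℓ _ (d := fun j => (rightPairing V W j)⁻¹) hper'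
  have hT := extCol_twist hn hm h
  have hTs (j : ℤ) : twistSeq k ℓ (extCol k (stackMat V W)) j =
      Fin.append (extCol ℓ (stackedTwist V W).1 j) (extCol ℓ (stackedTwist V W).2 j) := by
    rw [← extCol_stackMat, stackedTwist, stackMat_submatrix, hT]
  have hmem : stackMat (untwist V W).1 (untwist V W).2 ∈ matCirc ℓ k n := by
    rw [mem_matCirc_iff]
    intro j
    refine winMat_det_ne_zero_of_dotProduct fun u hu => ?_
    have key : Fin.append (fun b : Fin k => u (Fin.natAdd ℓ b)) (fun a => u (Fin.castAdd k a)) = 0 := by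
      refine eq_zero_of_twistSeq_dotProduct (mem_matCirc_iff.1 h) (j - k) fun p h1 h2 => ?_
      have h3 := hu p h1 (by omega)
      rw [extCol_stackMat, e1, e2, dotProduct_append, dotProduct_smul, dotProduct_smul,
        ← smul_add, smul_eq_zero] at h3
      have h4 := h3.resolve_left (inv_ne_zero (hne p))
      rw [hTs, dotProduct_comm, dotProduct_append]
      simp only [Fin.append_left, Fin.append_right]
      rwa [add_comm]
    funext a
    induction a using Fin.addCases with
    | left a => exact (Fin.append_right _ _ a).symm.trans (congrFun key (Fin.natAdd k a))
    | right b => exact (Fin.append_left _ _ b).symm.trans (congrFun key (Fin.castAdd ℓ b))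
  refine ⟨hmem, ?_⟩
  have hpair (i j : ℤ) : twistSeq k ℓ (extCol k (stackMat V W)) i ⬝ᵥ extCol k (stackMat V W) j =
      extCol ℓ (stackedTwist V W).1 i ⬝ᵥ extCol k V j +
        extCol ℓ (stackedTwist V W).2 i ⬝ᵥ extCol k W j := by
    rw [hTs, extCol_stackMat, dotProduct_append]
    simp only [Fin.append_left, Fin.append_right]
  have hcalc (i j : ℤ) : extCol k (stackMat (-W) (-V)) j ⬝ᵥ
      extCol ℓ (stackMat (untwist V W).1 (untwist V W).2) i = -(rightPairing V W i)⁻¹ *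
        (twistSeq k ℓ (extCol k (stackMat V W)) i ⬝ᵥ extCol k (stackMat V W) j) := by
    have hneg {r : ℕ} (M : Matrix (Fin r) (Fin n) ℝ) : extCol k (-M) j = -extCol k M j := by
      funext a
      simp only [extCol_apply, Matrix.neg_apply, Pi.neg_apply, mul_neg]
    rw [extCol_dotProduct_stackMat, e1, e2, hpair, hneg, hneg, dotProduct_smul, dotProduct_smul,
      neg_dotProduct, neg_dotProduct, dotProduct_comm (extCol k V j),
      dotProduct_comm (extCol k W j), smul_eq_mul, smul_eq_mul]
    ring
  have htw : twist ℓ k (stackMat (untwist V W).1 (untwist V W).2) = stackMat (-W) (-V) := by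
    refine twist_eq_of_dual hmem (fun j i h1 h2 => ?_) fun j => ?_
    · rw [hcalc, twistSeq_dotProduct_eq_zero (mem_matCirc_iff.1 h i) (by omega) (by omega),
        mul_zero]
    · have h1 : rightPairing V W (j - k) = (-1) ^ j *
          (twistSeq k ℓ (extCol k (stackMat V W)) (j - k) ⬝ᵥ extCol k (stackMat V W) j) := by
        rw [hpair, rightPairing, sub_add_cancel]
      have h2 := hne (j - k)
      rw [hcalc]
      rw [h1] at h2 ⊢
      have h3 := right_ne_zero_of_mul h2
      rw [mul_inv, neg_mul, mul_assoc, inv_mul_cancel₀ h3, mul_one,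
        inv_eq_of_mul_eq_one_left (neg_one_zpow_mul_self j), zpow_add_one₀ (by norm_num)]
      ring
  refine Prod.ext ?_ ?_
  · ext a p
    exact (congrFun₂ htw (Fin.castAdd k a) p).trans (stackMat_castAdd _ _ a p)
  · ext a p
    exact (congrFun₂ htw (Fin.natAdd ℓ a) p).trans (stackMat_natAdd _ _ a p)

end Untwist

/-! ### The relation between flags induced by the twist -/

section FlagRep

variable {k ℓ m n : ℕ}

theorem linearIndependent_of_finrank_rowSpan {r : ℕ} {M : Matrix (Fin r) (Fin n) ℝ}
    (h : Module.finrank ℝ (rowSpan M) = r) : LinearIndependent ℝ M.row := by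
  rw [linearIndependent_iff_card_eq_finrank_span, Fintype.card_fin]
  exact h.symm

theorem finrank_rowSpan {r : ℕ} {M : Matrix (Fin r) (Fin n) ℝ} (h : LinearIndependent ℝ M.row) :
    Module.finrank ℝ (rowSpan M) = r :=
  (FullRankMat.toGr ⟨M, h⟩).2

theorem det_ne_zero_of_eq_mul {r : ℕ} {M M' : Matrix (Fin r) (Fin n) ℝ}
    {B : Matrix (Fin r) (Fin r) ℝ} (hM : LinearIndependent ℝ M.row) (h : M = B * M') :
    B.det ≠ 0 := by
  intro h0
  obtain ⟨v, hv, hvB⟩ := Matrix.exists_vecMul_eq_zero_iff.2 h0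
  refine hv (row_linearIndependent_iff.1 hM v fun p => ?_)
  have : v ᵥ* M = 0 := by rw [h, ← Matrix.vecMul_vecMul, hvB, Matrix.zero_vecMul]
  exact congrFun this p

theorem mul_left_cancel_of_det_ne_zero {r : ℕ} {B : Matrix (Fin r) (Fin r) ℝ} (hB : B.det ≠ 0)
    {M M' : Matrix (Fin r) (Fin n) ℝ} (h : B * M = B * M') : M = M' := by
  have := congrArg (B⁻¹ * ·) h
  simpa only [← Matrix.mul_assoc, Matrix.nonsing_inv_mul _ hB.isUnit, Matrix.one_mul] using this

/-- The rows of `W` span the smaller subspace of a flag, and the rows of `V` and `W` together span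
the larger one. -/
def Fl.IsRep (F : Fl ℓ (k + ℓ) n) (V : Matrix (Fin k) (Fin n) ℝ) (W : Matrix (Fin ℓ) (Fin n) ℝ) :
    Prop :=
  rowSpan W = F.small.1 ∧ rowSpan (stackMat V W) = F.large.1

namespace Fl.IsRep

variable {F F' : Fl ℓ (k + ℓ) n} {V V' : Matrix (Fin k) (Fin n) ℝ} {W W' : Matrix (Fin ℓ) (Fin n) ℝ}

theorem linearIndependent_right (h : F.IsRep V W) : LinearIndependent ℝ W.row :=
  linearIndependent_of_finrank_rowSpan (by rw [h.1]; exact F.small.2)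

theorem linearIndependent_stack (h : F.IsRep V W) : LinearIndependent ℝ (stackMat V W).row :=
  linearIndependent_of_finrank_rowSpan (by rw [h.2]; exact F.large.2)

theorem eq (h : F.IsRep V W) (h' : F'.IsRep V W) : F = F' :=
  Subtype.ext (Prod.ext (Subtype.ext (h.1.symm.trans h'.1)) (Subtype.ext (h.2.symm.trans h'.2)))

theorem exists_of_linearIndependent (h : LinearIndependent ℝ (stackMat V W).row)
    (hW : LinearIndependent ℝ W.row) : ∃ F : Fl ℓ (k + ℓ) n, F.IsRep V W :=
  ⟨⟨(FullRankMat.toGr ⟨W, hW⟩, FullRankMat.toGr ⟨_, h⟩),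
    (le_sup_right.trans (rowSpan_stackMat V W).ge : rowSpan W ≤ rowSpan (stackMat V W))⟩, rfl, rfl⟩

/-- The rows of `W'` involve only those of `W`, while the rows of `V'` may involve both blocks.
Independence of the stacked rows makes the diagonal blocks invertible. -/
theorem exists_block (h : F.IsRep V W) (h' : F.IsRep V' W') :
    ∃ (g : Matrix (Fin k) (Fin k) ℝ) (c : Matrix (Fin k) (Fin ℓ) ℝ) (g' : Matrix (Fin ℓ) (Fin ℓ) ℝ),
      g.det ≠ 0 ∧ g'.det ≠ 0 ∧ V' = g * V + c * W ∧ W' = g' * W := by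
  obtain ⟨g', hg', hW⟩ := exists_det_mul_of_rowSpan_eq h'.linearIndependent_right (h'.1.trans h.1.symm)
  obtain ⟨q, hq⟩ := exists_mul_of_rowSpan_le (M := V') (M' := stackMat V W) (by
    rw [h.2, ← h'.2, rowSpan_stackMat]
    exact le_sup_left)
  set g : Matrix (Fin k) (Fin k) ℝ := q.submatrix id (Fin.castAdd ℓ) with hg
  set c : Matrix (Fin k) (Fin ℓ) ℝ := q.submatrix id (Fin.natAdd k) with hc
  have hV : V' = g * V + c * W := by
    rw [hq]
    ext a p
    rw [Matrix.mul_apply, Fin.sum_univ_add]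
    simp only [stackMat_castAdd, stackMat_natAdd]
    rfl
  have hB : stackMat V' W' = blockUpper g c g' * stackMat V W := by
    rw [blockUpper_mul_stackMat, ← hV, ← hW]
  have hdet := det_ne_zero_of_eq_mul h'.linearIndependent_stack hB
  rw [det_blockUpper] at hdet
  exact ⟨g, c, g', left_ne_zero_of_mul hdet, hg', hV, hW⟩

theorem block (h : F.IsRep V W) {g : Matrix (Fin k) (Fin k) ℝ} (hg : g.det ≠ 0)
    (c : Matrix (Fin k) (Fin ℓ) ℝ) {g' : Matrix (Fin ℓ) (Fin ℓ) ℝ} (hg' : g'.det ≠ 0) :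
    F.IsRep (g * V + c * W) (g' * W) := by
  rw [Fl.IsRep, ← blockUpper_mul_stackMat, rowSpan_mul hg', rowSpan_mul (det_blockUpper_ne_zero hg hg')]
  exact h

variable [NeZero n]

theorem mem_matCirc (h : F.IsRep V W) (h' : F.IsRep V' W') (hm : stackMat V W ∈ matCirc k ℓ n) :
    stackMat V' W' ∈ matCirc k ℓ n := by
  obtain ⟨B, hB, hBe⟩ := exists_det_mul_of_rowSpan_eq h'.linearIndependent_stack
    (h'.2.trans h.2.symm)
  rw [hBe]
  exact matCirc_mul hm hB

end Fl.IsRep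

variable [NeZero n] {F F' : Fl ℓ (k + ℓ) n} {G : Fl k (ℓ + k) n}
  {V V' : Matrix (Fin k) (Fin n) ℝ} {W W' : Matrix (Fin ℓ) (Fin n) ℝ}

/-- The relation between flags that is induced by the stacked twist. -/
def TwistRel (F : Fl ℓ (k + ℓ) n) (G : Fl k (ℓ + k) n) : Prop :=
  ∃ V W, F.IsRep V W ∧ stackMat V W ∈ matCirc k ℓ n ∧
    G.IsRep (stackedTwist V W).2 (stackedTwist V W).1

/-- Block triangular changes of `(V, W)` act on the twist by block triangular matrices for the
opposite order of the blocks, so the resulting flag does not depend on the representative. -/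
theorem TwistRel.isRep_right (h : TwistRel F G) (hF : F.IsRep V W) :
    G.IsRep (stackedTwist V W).2 (stackedTwist V W).1 := by
  obtain ⟨V₀, W₀, h₀, hmem, hG⟩ := h
  obtain ⟨g, c, g', hg, hg', rfl, rfl⟩ := hF.exists_block h₀
  have hmem' := h₀.mem_matCirc hF hmem
  obtain ⟨-, h1, h2⟩ := stackedTwist_block (c := c) hmem' hg hg'
  rw [h1, h2, add_comm]
  exact hG.block (by rwa [Matrix.det_transpose]) _ (by rwa [Matrix.det_transpose])

/-- The representatives of `G` differ by a block triangular matrix. Transposed and applied to `(V₀,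
W₀)`, it gives a pair with the same twist as `(V, W)`, and the twist is injective. -/
theorem TwistRel.isRep_left (hn : k + ℓ + m = n) (hm : Even m) (h : TwistRel F G)
    (hmem : stackMat V W ∈ matCirc k ℓ n)
    (hG : G.IsRep (stackedTwist V W).2 (stackedTwist V W).1) : F.IsRep V W := by
  obtain ⟨V₀, W₀, h₀, hmem₀, hG₀⟩ := h
  obtain ⟨δ, κ, γ, hδ, hγ, hY, hX⟩ := hG.exists_block hG₀
  have hγ' : (γᵀ).det ≠ 0 := by rwa [Matrix.det_transpose]
  have hδ' : (δᵀ).det ≠ 0 := by rwa [Matrix.det_transpose]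
  obtain ⟨h1, h2, h3⟩ := stackedTwist_block (g := γᵀ) (c := κᵀ) (g' := δᵀ) hmem₀ hγ' hδ'
  rw [Matrix.transpose_transpose, hX] at h2
  have e1 := mul_left_cancel_of_det_ne_zero hγ h2
  rw [Matrix.transpose_transpose, Matrix.transpose_transpose, hY, ← e1, add_comm] at h3
  have e2 := mul_left_cancel_of_det_ne_zero hδ (add_left_cancel h3)
  have e3 : twist k ℓ (stackMat V W) = twist k ℓ (stackMat (γᵀ * V₀ + κᵀ * W₀) (δᵀ * W₀)) := by
    rw [← stackMat_submatrix (twist k ℓ (stackMat V W)),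
      ← stackMat_submatrix (twist k ℓ (stackMat (γᵀ * V₀ + κᵀ * W₀) (δᵀ * W₀)))]
    exact congrArg₂ stackMat e1 e2
  obtain ⟨rfl, rfl⟩ := stackMat_injective (twist_injOn hn hm hmem h1 e3)
  exact h₀.block hγ' _ hδ'

theorem TwistRel.right_unique {G' : Fl k (ℓ + k) n} (h : TwistRel F G) (h' : TwistRel F G') :
    G = G' := by
  obtain ⟨V, W, hF, -, hG⟩ := h
  exact hG.eq (h'.isRep_right hF)

theorem TwistRel.left_unique (hn : k + ℓ + m = n) (hm : Even m) (h : TwistRel F G)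
    (h' : TwistRel F' G) : F = F' := by
  obtain ⟨V, W, hF, hmem, hG⟩ := h
  exact hF.eq (h'.isRep_left hn hm hmem hG)

end FlagRep

/-! ### Flags over positroid cells -/

section Cells

variable {k ℓ m n : ℕ} {f : Equiv.Perm ℤ}

theorem mem_univAmpCell_iff {F : Fl ℓ (k + ℓ) n} : F ∈ univAmpCell k ℓ m n f ↔
    ∃ (V : FullRankMat k n) (W : FullRankMat ℓ n), V.toGr ∈ posCell k n f ∧
      W.toGr ∈ grPosPerp (k + m) ℓ n ∧ F.IsRep V.1 W.1 := by
  constructor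
  · rintro ⟨hW, X, hX, hF⟩
    obtain ⟨V, rfl⟩ := X.exists_rep
    obtain ⟨W, hW'⟩ := F.small.exists_rep
    have hWs : rowSpan W.1 = F.small.1 := congrArg Subtype.val hW'
    refine ⟨V, W, hX, by rwa [hW'], hWs, ?_⟩
    rw [rowSpan_stackMat, hWs]
    exact hF
  · rintro ⟨V, W, hV, hW, h1, h2⟩
    have hWs : W.toGr = F.small := Subtype.ext h1
    refine ⟨by rwa [← hWs], V.toGr, hV, ?_⟩
    rw [← h2, rowSpan_stackMat, ← h1]
    rfl

theorem mem_univAmpGe_iff (hn : k + ℓ + m = n) {F : Fl ℓ (k + ℓ) n} :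
    F ∈ univAmpGe k ℓ m n ↔ ∃ f ∈ affPerm n k ℓ, F ∈ univAmpCell k ℓ m n f := by
  have h : (n : ℤ) - k - m = ℓ := by omega
  simp only [univAmpGe, flagImage, grGe, h, univAmpCell, Set.mem_ofPred_eq, Set.mem_iUnion]
  constructor
  · rintro ⟨hW, V, ⟨f, hf, hV⟩, hF⟩
    exact ⟨f, hf, hW, V, hV, hF⟩
  · rintro ⟨f, hf, hW, V, hV, hF⟩
    exact ⟨hW, V, ⟨f, hf, hV⟩, hF⟩

theorem univAmpCell_subset (hn : k + ℓ + m = n) (hf : f ∈ affPerm n k ℓ) :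
    univAmpCell k ℓ m n f ⊆ univAmpGe k ℓ m n :=
  fun _ hF => (mem_univAmpGe_iff hn).2 ⟨f, hf, hF⟩

variable [NeZero n]

theorem Fl.IsRep.mem_matCirc_of_univAmpGe (hn : k + ℓ + m = n) (hm : Even m) {F : Fl ℓ (k + ℓ) n}
    (hF : F ∈ univAmpGe k ℓ m n) {V : Matrix (Fin k) (Fin n) ℝ} {W : Matrix (Fin ℓ) (Fin n) ℝ}
    (h : F.IsRep V W) : stackMat V W ∈ matCirc k ℓ n := by
  obtain ⟨f, hf, hF⟩ := (mem_univAmpGe_iff hn).1 hF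
  obtain ⟨V₀, W₀, hV₀, hW₀, h₀⟩ := mem_univAmpCell_iff.1 hF
  exact h₀.mem_matCirc h (stackedTwist_mem hn hm hf V₀ W₀ hV₀ hW₀).1

theorem linearIndependent_stackedTwist (hn : k + ℓ + m = n) (hm : Even m)
    {V : Matrix (Fin k) (Fin n) ℝ} {W : Matrix (Fin ℓ) (Fin n) ℝ}
    (h : stackMat V W ∈ matCirc k ℓ n) :
    LinearIndependent ℝ (stackMat (stackedTwist V W).2 (stackedTwist V W).1).row := by
  refine linearIndependent_of_finrank_rowSpan ?_
  have h1 : stackMat (stackedTwist V W).1 (stackedTwist V W).2 = twist k ℓ (stackMat V W) :=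
    stackMat_submatrix _
  rw [rowSpan_stackMat_swap, h1, finrank_rowSpan (linearIndependent_twist hn hm h), add_comm]

theorem exists_twistRel_right (hn : k + ℓ + m = n) (hm : Even m) (hf : f ∈ affPerm n k ℓ)
    {F : Fl ℓ (k + ℓ) n} (hF : F ∈ univAmpCell k ℓ m n f) :
    ∃ G ∈ univAmpCell ℓ k m n f⁻¹, TwistRel F G := by
  obtain ⟨V, W, hV, hW, h⟩ := mem_univAmpCell_iff.1 hF
  obtain ⟨hmem, ⟨h1, hX⟩, h2, hY⟩ := stackedTwist_mem hn hm hf V W hV hW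
  obtain ⟨G, hG⟩ := Fl.IsRep.exists_of_linearIndependent
    (linearIndependent_stackedTwist hn hm hmem) h1
  exact ⟨G, mem_univAmpCell_iff.2 ⟨_, _, hY, hX, hG⟩, V.1, W.1, h, hmem, hG⟩

end Cells

/-! ### Positive column scaling -/

section ColumnScaling

variable {k n : ℕ}

theorem linearIndependent_mul_diagonal {M : Matrix (Fin k) (Fin n) ℝ} {d : Fin n → ℝ}
    (hd : ∀ p, 0 < d p) (hM : LinearIndependent ℝ M.row) :
    LinearIndependent ℝ (M * Matrix.diagonal d).row := by
  rw [row_linearIndependent_iff] at hM ⊢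
  intro y hy
  refine hM y fun p => ?_
  have h : (M * Matrix.diagonal d).col p = d p • M.col p := by
    funext a
    rw [Matrix.col_apply, Matrix.mul_diagonal, Pi.smul_apply, smul_eq_mul, mul_comm,
      Matrix.col_apply]
  have := hy p
  rw [h, dotProduct_smul, smul_eq_mul] at this
  exact (mul_eq_zero.1 this).resolve_left (hd p).ne'

theorem posCell_mul_diagonal {f : Equiv.Perm ℤ} {M : FullRankMat k n} {d : Fin n → ℝ}
    (hd : ∀ p, 0 < d p) (hM : M.toGr ∈ posCell k n f) :
    FullRankMat.toGr ⟨M.1 * Matrix.diagonal d, linearIndependent_mul_diagonal hd M.2⟩ ∈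
      posCell k n f := by
  obtain ⟨M', hM', hminor⟩ := hM
  obtain ⟨g, hg, hgM⟩ := FullRankMat.exists_mul_of_toGr_eq hM'
  refine ⟨⟨M'.1 * Matrix.diagonal d, linearIndependent_mul_diagonal hd M'.2⟩, ?_, fun J hJ => ?_⟩
  · refine Subtype.ext ?_
    change rowSpan (M'.1 * Matrix.diagonal d) = rowSpan (M.1 * Matrix.diagonal d)
    rw [hgM, Matrix.mul_assoc, rowSpan_mul hg]
  · have hpos : 0 < ∏ a, d (J.orderEmbOfFin hJ a) := Finset.prod_pos fun a _ => hd _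
    have hdet : maxMinor (M'.1 * Matrix.diagonal d) J hJ =
        maxMinor M'.1 J hJ * ∏ a, d (J.orderEmbOfFin hJ a) := by
      rw [maxMinor, maxMinor, ← Matrix.det_diagonal, ← Matrix.det_mul]
      congr 1
      ext a b
      simp only [Matrix.submatrix_apply, Matrix.mul_diagonal, id_eq]
    rw [hdet]
    exact ⟨fun h => mul_pos ((hminor J hJ).1 h) hpos, fun h => by rw [(hminor J hJ).2 h, zero_mul]⟩

theorem grPosPerp_mul_diagonal [NeZero n] {r d : ℕ} (hn : d + r = n) {M : FullRankMat r n}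
    {δ : ℤ → ℝ} (hδ : ∀ j, 0 < δ j) (hper : ∀ j, δ (j + n) = δ j) (hM : M.toGr ∈ grPosPerp d r n) :
    FullRankMat.toGr ⟨M.1 * Matrix.diagonal fun p : Fin n => δ (p : ℕ),
      linearIndependent_mul_diagonal (fun _ => hδ _) M.2⟩ ∈ grPosPerp d r n := by
  rw [mem_grPosPerp_iff_signTP hn (Even.add_self d)] at hM ⊢
  have h : altSeq (extCol d (M.1 * Matrix.diagonal fun p : Fin n => δ (p : ℕ))) =
      fun j => δ j • altSeq (extCol d M.1) j := by
    rw [extCol_mul_diagonal d M.1 hper]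
    funext j
    rw [altSeq, altSeq, smul_comm]
  rw [h]
  exact hM.smul (ε := 1) fun j => by rw [one_mul]; exact hδ j

end ColumnScaling

/-! ### Every flag over a cell has a partner -/

section Inverse

variable {k ℓ m n : ℕ} [NeZero n] {f : Equiv.Perm ℤ}

/-- Replacing `V` by `g * V` does not alter the pairings, because the first block of the twist
changes contragrediently. So `pairing_right_pos` applies, with `ε = -1` for the stacked twist. -/
theorem rightPairing_pos (hn : k + ℓ + m = n) (hm : Even m) (hkl : 0 < k + ℓ)
    (hf : f ∈ affPerm n k ℓ) {V : FullRankMat k n} {W : FullRankMat ℓ n}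
    (hV : V.toGr ∈ posCell k n f) (hW : W.toGr ∈ grPosPerp (k + m) ℓ n) (j : ℤ) :
    0 < rightPairing V.1 W.1 j := by
  obtain ⟨g, hg, Z, H⟩ := exists_twistData hn hm hf hV hW
  have hpos := H.pairing_right_pos (isDual_stackedTwist hn hm hkl H.mem_matCirc) hkl j
  obtain ⟨-, h1, h2⟩ := stackedTwist_block (c := 0) (g := g) (g' := 1)
    (stackedTwist_mem hn hm hf V W hV hW).1 hg (by simp)
  simp only [Matrix.zero_mul, add_zero, Matrix.one_mul, Matrix.transpose_zero, zero_add,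
    Matrix.transpose_one] at h1 h2
  rw [extCol_mul, dotProduct_mulVec, ← Matrix.mulVec_transpose, ← extCol_mul, ← h1, ← h2] at hpos
  rw [rightPairing, zpow_add₀ (by norm_num), zpow_natCast]
  convert hpos using 1
  ring

omit [NeZero n] in
theorem Fl.IsRep.neg {F : Fl ℓ (k + ℓ) n} {V : Matrix (Fin k) (Fin n) ℝ}
    {W : Matrix (Fin ℓ) (Fin n) ℝ} (h : F.IsRep V W) : F.IsRep (-V) (-W) := by
  have hdet (r : ℕ) : (-1 : Matrix (Fin r) (Fin r) ℝ).det ≠ 0 := by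
    rw [Matrix.det_neg, Matrix.det_one, mul_one]
    exact pow_ne_zero _ (by norm_num)
  have := h.block (hdet k) 0 (hdet ℓ)
  simpa only [Matrix.neg_mul, Matrix.one_mul, Matrix.zero_mul, add_zero] using this

theorem twistRel_of_untwist (hn : k + ℓ + m = n) (hm : Even m) {F : Fl k (ℓ + k) n}
    {G : Fl ℓ (k + ℓ) n} {V : Matrix (Fin k) (Fin n) ℝ} {W : Matrix (Fin ℓ) (Fin n) ℝ}
    (h : stackMat V W ∈ matCirc k ℓ n) (h0 : ∀ p : Fin n, rightPairing V W (p : ℕ) ≠ 0)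
    (hG : G.IsRep V W) (hF : F.IsRep (untwist V W).1 (untwist V W).2) : TwistRel F G := by
  obtain ⟨hmem, hst⟩ := untwist_spec hn hm h h0
  refine ⟨_, _, hF, hmem, ?_⟩
  rw [hst]
  exact hG.neg

/-- The blocks of the twist lie over `f⁻¹` by `stackedTwist_mem`. Dividing the columns by positive
periodic numbers keeps them there, and the untwisted pair is a partner by `untwist_spec`. -/
theorem exists_twistRel_left (hn : k + ℓ + m = n) (hm : Even m) (hkl : 0 < k + ℓ)
    (hf : f ∈ affPerm n k ℓ) {G : Fl ℓ (k + ℓ) n} (hG : G ∈ univAmpCell k ℓ m n f) :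
    ∃ F ∈ univAmpCell ℓ k m n f⁻¹, TwistRel F G := by
  obtain ⟨V, W, hV, hW, h⟩ := mem_univAmpCell_iff.1 hG
  obtain ⟨hmem, ⟨h1, hX⟩, h2, hY⟩ := stackedTwist_mem hn hm hf V W hV hW
  have hpos (j : ℤ) : 0 < (rightPairing V.1 W.1 j)⁻¹ :=
    inv_pos.2 (rightPairing_pos hn hm hkl hf hV hW j)
  have h0 (p : Fin n) : rightPairing V.1 W.1 (p : ℕ) ≠ 0 :=
    (rightPairing_pos hn hm hkl hf hV hW _).ne'
  have hper (j : ℤ) : (rightPairing V.1 W.1 (j + n))⁻¹ = (rightPairing V.1 W.1 j)⁻¹ := by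
    rw [rightPairing_add hn hm]
  have hY' := posCell_mul_diagonal (d := fun p : Fin n => (rightPairing V.1 W.1 (p : ℕ))⁻¹)
    (fun p => hpos _) hY
  have hX' := grPosPerp_mul_diagonal (d := ℓ + m) (by omega) hpos hper hX
  obtain ⟨hmem', -⟩ := untwist_spec hn hm hmem h0
  obtain ⟨F, hF⟩ := Fl.IsRep.exists_of_linearIndependent
    (linearIndependent_of_mem_matCirc hmem')
    (linearIndependent_mul_diagonal (fun p => hpos _) h1)
  exact ⟨F, mem_univAmpCell_iff.2 ⟨_, _, hY', hX', hF⟩, twistRel_of_untwist hn hm hmem h0 h hF⟩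

end Inverse

/-! ### Grassmannian topology through orthogonal projections -/

open scoped Topology

open Filter

section Topology

variable {r n : ℕ}

theorem det_mul_transpose_ne_zero {M : Matrix (Fin r) (Fin n) ℝ} (hM : LinearIndependent ℝ M.row) :
    (M * Mᵀ).det ≠ 0 := by
  intro h0
  obtain ⟨v, hv, hvM⟩ := Matrix.exists_vecMul_eq_zero_iff.2 h0
  refine hv (row_linearIndependent_iff.1 hM v fun p => ?_)
  have h1 : (v ᵥ* M) ⬝ᵥ (v ᵥ* M) = 0 := by
    rw [← Matrix.vecMul_vecMul] at hvM
    nth_rewrite 2 [← Matrix.mulVec_transpose]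
    rw [dotProduct_mulVec, hvM, zero_dotProduct]
  exact congrFun (dotProduct_self_eq_zero.1 h1) p

/-- The matrix of the orthogonal projection to the row span. -/
noncomputable def projMat (M : Matrix (Fin r) (Fin n) ℝ) : Matrix (Fin n) (Fin n) ℝ :=
  Mᵀ * (M * Mᵀ)⁻¹ * M

theorem projMat_mul {g : Matrix (Fin r) (Fin r) ℝ} (hg : g.det ≠ 0) (M : Matrix (Fin r) (Fin n) ℝ) :
    projMat (g * M) = projMat M := by
  have hg' : (gᵀ).det ≠ 0 := by rwa [Matrix.det_transpose]
  have h : g * M * (g * M)ᵀ = g * (M * Mᵀ) * gᵀ := by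
    rw [Matrix.transpose_mul]
    simp only [Matrix.mul_assoc]
  have h1 : gᵀ * (gᵀ)⁻¹ = 1 := Matrix.mul_nonsing_inv _ hg'.isUnit
  have h2 : g⁻¹ * g = 1 := Matrix.nonsing_inv_mul _ hg.isUnit
  rw [projMat, projMat, h, Matrix.mul_inv_rev, Matrix.mul_inv_rev, Matrix.transpose_mul]
  calc Mᵀ * gᵀ * ((gᵀ)⁻¹ * ((M * Mᵀ)⁻¹ * g⁻¹)) * (g * M)
      = Mᵀ * (gᵀ * (gᵀ)⁻¹) * (M * Mᵀ)⁻¹ * (g⁻¹ * g) * M := by simp only [Matrix.mul_assoc]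
    _ = _ := by rw [h1, h2, Matrix.mul_one, Matrix.mul_one]

theorem rowSpan_mul_projMat_le {s : ℕ} (A : Matrix (Fin s) (Fin n) ℝ) (M : Matrix (Fin r) (Fin n) ℝ) :
    rowSpan (A * projMat M) ≤ rowSpan M := by
  rw [projMat, ← Matrix.mul_assoc]
  exact rowSpan_mul_le _ M

theorem mul_projMat {s : ℕ} {A : Matrix (Fin s) (Fin n) ℝ} {M : Matrix (Fin r) (Fin n) ℝ}
    (hM : LinearIndependent ℝ M.row) (h : rowSpan A ≤ rowSpan M) : A * projMat M = A := by
  obtain ⟨g, rfl⟩ := exists_mul_of_rowSpan_le h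
  have h1 : M * Mᵀ * (M * Mᵀ)⁻¹ = 1 :=
    Matrix.mul_nonsing_inv _ (det_mul_transpose_ne_zero hM).isUnit
  calc g * M * projMat M = g * (M * Mᵀ * (M * Mᵀ)⁻¹) * M := by
        simp only [projMat, Matrix.mul_assoc]
    _ = g * M := by rw [h1, Matrix.mul_one]

theorem continuousAt_matrix_mul {S : Type*} [TopologicalSpace S] {a b c : ℕ}
    {A : S → Matrix (Fin a) (Fin b) ℝ} {B : S → Matrix (Fin b) (Fin c) ℝ} {x : S}
    (hA : ContinuousAt A x) (hB : ContinuousAt B x) : ContinuousAt (fun y => A y * B y) x := by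
  refine continuousAt_pi.2 fun i => continuousAt_pi.2 fun j => ?_
  simp only [Matrix.mul_apply]
  exact tendsto_finsetSum _ fun l _ => ((continuous_apply_apply i l).continuousAt.comp hA).mul
    ((continuous_apply_apply l j).continuousAt.comp hB)

theorem continuousAt_projMat {M : Matrix (Fin r) (Fin n) ℝ} (hM : LinearIndependent ℝ M.row) :
    ContinuousAt projMat M := by
  have h2 : Continuous fun M : Matrix (Fin r) (Fin n) ℝ => M * Mᵀ :=
    continuous_id.matrix_mul continuous_id.matrix_transpose
  have h3 : ContinuousAt (fun M : Matrix (Fin r) (Fin n) ℝ => (M * Mᵀ)⁻¹) M := by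
    have h0 : ContinuousAt Inv.inv (M * Mᵀ) := by
      refine continuousAt_matrix_inv _ ?_
      rw [Ring.inverse_eq_inv']
      exact continuousAt_inv₀ (det_mul_transpose_ne_zero hM)
    exact ContinuousAt.comp (f := fun M : Matrix (Fin r) (Fin n) ℝ => M * Mᵀ) h0 h2.continuousAt
  exact continuousAt_matrix_mul
    (continuousAt_matrix_mul continuous_id.matrix_transpose.continuousAt h3) continuousAt_id

namespace Gr

/-- The matrix of the orthogonal projection to a point of the Grassmannian. -/
noncomputable def proj (X : Gr r n) : Matrix (Fin n) (Fin n) ℝ :=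
  projMat X.exists_rep.choose.1

theorem proj_toGr (M : FullRankMat r n) : M.toGr.proj = projMat M.1 := by
  obtain ⟨g, hg, h⟩ := FullRankMat.exists_mul_of_toGr_eq M.toGr.exists_rep.choose_spec
  rw [proj, h, projMat_mul hg]

theorem rowSpan_mul_proj_le {s : ℕ} (A : Matrix (Fin s) (Fin n) ℝ) (X : Gr r n) :
    rowSpan (A * X.proj) ≤ X.1 := by
  obtain ⟨M, rfl⟩ := X.exists_rep
  rw [proj_toGr]
  exact rowSpan_mul_projMat_le A M.1

theorem mul_proj {s : ℕ} {A : Matrix (Fin s) (Fin n) ℝ} {X : Gr r n} (h : rowSpan A ≤ X.1) :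
    A * X.proj = A := by
  obtain ⟨M, rfl⟩ := X.exists_rep
  rw [proj_toGr]
  exact mul_projMat M.2 h

/-- The projection depends only on the row span, so continuity can be checked on full rank matrices,
where it is a rational expression with nonvanishing denominator. -/
theorem continuous_proj : Continuous (proj : Gr r n → Matrix (Fin n) (Fin n) ℝ) := by
  rw [continuous_coinduced_dom]
  have h : (proj : Gr r n → Matrix (Fin n) (Fin n) ℝ) ∘ FullRankMat.toGr =
      fun M : FullRankMat r n => projMat M.1 := funext proj_toGr
  rw [h]
  exact continuous_iff_continuousAt.2 fun M =>
    (continuousAt_projMat M.2).comp continuous_subtype_val.continuousAt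

/-- A map to the Grassmannian is continuous where it has a continuous local lift to matrices. -/
theorem continuousAt_of_lift {S : Type*} [TopologicalSpace S] {X : S → Gr r n} {x : S}
    {M : S → Matrix (Fin r) (Fin n) ℝ} (hM : ContinuousAt M x)
    (h : ∀ᶠ y in 𝓝 x, rowSpan (M y) = (X y).1) : ContinuousAt X x := by
  have hli (y : S) (hy : rowSpan (M y) = (X y).1) : LinearIndependent ℝ (M y).row :=
    linearIndependent_of_finrank_rowSpan (by rw [hy]; exact (X y).2)
  have hx := h.self_of_nhds
  intro U hU
  obtain ⟨O, hOU, hO, hxO⟩ := mem_nhds_iff.1 hU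
  have hO' : IsOpen ((FullRankMat.toGr (r := r) (n := n)) ⁻¹' O) := isOpen_coinduced.1 hO
  obtain ⟨O', hO'o, hO'e⟩ := isOpen_induced_iff.1 hO'
  have heq (y : S) (hy : rowSpan (M y) = (X y).1) : M y ∈ O' ↔ X y ∈ O := by
    have h1 : FullRankMat.toGr ⟨M y, hli y hy⟩ = X y := Subtype.ext hy
    rw [← h1]
    exact Set.ext_iff.1 hO'e ⟨M y, hli y hy⟩
  change ∀ᶠ y in 𝓝 x, X y ∈ U
  filter_upwards [hM (hO'o.mem_nhds ((heq x hx).2 hxO)), h] with y hy1 hy2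
  exact hOU ((heq y hy2).1 hy1)

end Gr

theorem eventually_linearIndependent {S : Type*} [TopologicalSpace S] {x : S}
    {M : S → Matrix (Fin r) (Fin n) ℝ} (hM : ContinuousAt M x) (h : LinearIndependent ℝ (M x).row) :
    ∀ᶠ y in 𝓝 x, LinearIndependent ℝ (M y).row := by
  have hc : ContinuousAt (fun y => (M y * (M y)ᵀ).det) x :=
    (continuous_id.matrix_mul continuous_id.matrix_transpose).matrix_det.continuousAt.comp hM
  filter_upwards [hc.eventually_ne (det_mul_transpose_ne_zero h)] with y hy
  rw [row_linearIndependent_iff]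
  intro v hv
  by_contra hv0
  refine hy (Matrix.exists_vecMul_eq_zero_iff.1 ⟨v, hv0, ?_⟩)
  have h1 : v ᵥ* M y = 0 := funext hv
  rw [← Matrix.vecMul_vecMul, h1, Matrix.zero_vecMul]

end Topology

/-! ### Continuous local representatives of flags -/

section FlagTopology

variable {k ℓ n : ℕ} {S : Type*} [TopologicalSpace S] {F : S → Fl ℓ (k + ℓ) n} {x : S}

theorem Fl.continuous_small : Continuous (Fl.small : Fl ℓ (k + ℓ) n → Gr ℓ n) :=
  continuous_fst.comp continuous_subtype_val

theorem Fl.continuous_large : Continuous (Fl.large : Fl ℓ (k + ℓ) n → Gr (k + ℓ) n) :=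
  continuous_snd.comp continuous_subtype_val

/-- A continuous family of flags has continuous local representatives with prescribed value. -/
theorem Fl.exists_lift (hF : ContinuousAt F x) {V : Matrix (Fin k) (Fin n) ℝ}
    {W : Matrix (Fin ℓ) (Fin n) ℝ} (h : (F x).IsRep V W) :
    ∃ (V' : S → Matrix (Fin k) (Fin n) ℝ) (W' : S → Matrix (Fin ℓ) (Fin n) ℝ), V' x = V ∧ W' x = W ∧
      ContinuousAt V' x ∧ ContinuousAt W' x ∧ ∀ᶠ y in 𝓝 x, (F y).IsRep (V' y) (W' y) := by
  -- The given representatives are projected to the nearby subspaces. At `x` this changes nothing,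
  -- and independence of rows persists nearby, so the projected rows span by dimension.
  have hV0 : V * (F x).large.proj = V :=
    Gr.mul_proj (by rw [← h.2, rowSpan_stackMat]; exact le_sup_left)
  have hW0 : W * (F x).small.proj = W := Gr.mul_proj h.1.le
  have hV : ContinuousAt (fun y => V * (F y).large.proj) x :=
    (continuous_const.matrix_mul (Gr.continuous_proj.comp Fl.continuous_large)).continuousAt.comp hF
  have hW : ContinuousAt (fun y => W * (F y).small.proj) x :=
    (continuous_const.matrix_mul (Gr.continuous_proj.comp Fl.continuous_small)).continuousAt.comp hF
  refine ⟨_, _, hV0, hW0, hV, hW, ?_⟩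
  have h1 := eventually_linearIndependent hW (by
    rw [hW0]
    exact h.linearIndependent_right)
  have h2 := eventually_linearIndependent (continuous_stackMat hV hW) (by
    rw [hV0, hW0]
    exact h.linearIndependent_stack)
  filter_upwards [h1, h2] with y hy1 hy2
  have e1 : rowSpan (W * (F y).small.proj) = (F y).small.1 :=
    Submodule.eq_of_le_of_finrank_eq (Gr.rowSpan_mul_proj_le _ _)
      ((finrank_rowSpan hy1).trans (F y).small.2.symm)
  refine ⟨e1, Submodule.eq_of_le_of_finrank_eq ?_ ((finrank_rowSpan hy2).trans (F y).large.2.symm)⟩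
  rw [rowSpan_stackMat, e1]
  exact sup_le (Gr.rowSpan_mul_proj_le _ _) (F y).2

theorem Fl.continuousAt_of_lift {V : S → Matrix (Fin k) (Fin n) ℝ} {W : S → Matrix (Fin ℓ) (Fin n) ℝ}
    (hV : ContinuousAt V x) (hW : ContinuousAt W x) (h : ∀ᶠ y in 𝓝 x, (F y).IsRep (V y) (W y)) :
    ContinuousAt F x := by
  have h1 : ContinuousAt (fun y => (F y).small) x :=
    Gr.continuousAt_of_lift hW (h.mono fun y hy => hy.1)
  have h2 : ContinuousAt (fun y => (F y).large) x :=
    Gr.continuousAt_of_lift (continuous_stackMat hV hW) (h.mono fun y hy => hy.2)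
  exact Topology.IsInducing.subtypeVal.continuousAt_iff.2 (h1.prodMk h2)

end FlagTopology

/-! ### The homeomorphism and its restriction to cells -/

section Homeo

variable {k ℓ m n : ℕ}

theorem Fl.subsingleton_of_eq_zero (hk : k = 0) (hℓ : ℓ = 0) (F F' : Fl ℓ (k + ℓ) n) : F = F' := by
  subst hk hℓ
  have h {r : ℕ} (hr : r = 0) (X Y : Gr r n) : X = Y :=
    Subtype.ext ((Submodule.finrank_eq_zero.1 (X.2.trans hr)).trans
      (Submodule.finrank_eq_zero.1 (Y.2.trans hr)).symm)
  exact Subtype.ext (Prod.ext (h rfl _ _) (h rfl _ _))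

variable [NeZero n] {f : Equiv.Perm ℤ}

/-- For `k + ℓ = 0` there is only one flag, so its partner on the other side is the flag itself. -/
theorem exists_twistRel (hn : k + ℓ + m = n) (hm : Even m) (hf : f ∈ affPerm n k ℓ)
    {G : Fl ℓ (k + ℓ) n} (hG : G ∈ univAmpCell k ℓ m n f) :
    ∃ F ∈ univAmpCell ℓ k m n f⁻¹, TwistRel F G := by
  rcases Nat.eq_zero_or_pos (k + ℓ) with h0 | hkl
  · obtain ⟨rfl, rfl⟩ : k = 0 ∧ ℓ = 0 := by omega
    obtain rfl := eq_one_of_mem_affPerm_zero hf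
    obtain ⟨G', hG', h⟩ := exists_twistRel_right hn hm hf hG
    obtain rfl := Fl.subsingleton_of_eq_zero rfl rfl G G'
    exact ⟨G, hG', h⟩
  · exact exists_twistRel_left hn hm hkl hf hG

theorem continuousAt_stackedTwist {S : Type*} [TopologicalSpace S]
    {V : S → Matrix (Fin k) (Fin n) ℝ} {W : S → Matrix (Fin ℓ) (Fin n) ℝ} {x : S}
    (hV : ContinuousAt V x) (hW : ContinuousAt W x) (h : stackMat (V x) (W x) ∈ matCirc k ℓ n) :
    ContinuousAt (fun y => (stackedTwist (V y) (W y)).1) x ∧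
      ContinuousAt (fun y => (stackedTwist (V y) (W y)).2) x := by
  have h1 : ContinuousAt (fun y => twist k ℓ (stackMat (V y) (W y))) x :=
    ContinuousAt.comp (f := fun y => stackMat (V y) (W y)) (continuousAt_twist h)
      (continuous_stackMat hV hW)
  exact ⟨(continuous_id.matrix_submatrix (Fin.castAdd ℓ) id).continuousAt.comp h1,
    (continuous_id.matrix_submatrix (Fin.natAdd k) id).continuousAt.comp h1⟩

theorem continuousAt_rightPairing {S : Type*} [TopologicalSpace S]
    {V : S → Matrix (Fin k) (Fin n) ℝ} {W : S → Matrix (Fin ℓ) (Fin n) ℝ} {x : S}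
    (hV : ContinuousAt V x) (hW : ContinuousAt W x) (h : stackMat (V x) (W x) ∈ matCirc k ℓ n)
    (j : ℤ) : ContinuousAt (fun y => rightPairing (V y) (W y) j) x := by
  obtain ⟨h1, h2⟩ := continuousAt_stackedTwist hV hW h
  have hdot {r : ℕ} {A B : S → Fin r → ℝ} (hA : ContinuousAt A x) (hB : ContinuousAt B x) :
      ContinuousAt (fun y => A y ⬝ᵥ B y) x :=
    (continuous_fst.dotProduct continuous_snd).continuousAt.comp (hA.prodMk hB)
  exact continuousAt_const.mul
    ((hdot ((continuous_extCol ℓ j).continuousAt.comp h1)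
      ((continuous_extCol k (j + k)).continuousAt.comp hV)).add
    (hdot ((continuous_extCol ℓ j).continuousAt.comp h2)
      ((continuous_extCol k (j + k)).continuousAt.comp hW)))

theorem continuousAt_untwist {S : Type*} [TopologicalSpace S]
    {V : S → Matrix (Fin k) (Fin n) ℝ} {W : S → Matrix (Fin ℓ) (Fin n) ℝ} {x : S}
    (hV : ContinuousAt V x) (hW : ContinuousAt W x) (h : stackMat (V x) (W x) ∈ matCirc k ℓ n)
    (h0 : ∀ p : Fin n, rightPairing (V x) (W x) (p : ℕ) ≠ 0) :
    ContinuousAt (fun y => (untwist (V y) (W y)).1) x ∧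
      ContinuousAt (fun y => (untwist (V y) (W y)).2) x := by
  obtain ⟨h1, h2⟩ := continuousAt_stackedTwist hV hW h
  have h3 : ContinuousAt (fun y => Matrix.diagonal fun p : Fin n =>
      (rightPairing (V y) (W y) (p : ℕ))⁻¹) x :=
    (continuous_id.matrix_diagonal).continuousAt.comp (continuousAt_pi.2 fun p =>
      (continuousAt_rightPairing hV hW h _).inv₀ (h0 p))
  exact ⟨continuousAt_matrix_mul h2 h3, continuousAt_matrix_mul h1 h3⟩

theorem exists_rep_of_mem_univAmpGe (hn : k + ℓ + m = n) (hm : Even m) (hkl : 0 < k + ℓ)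
    {F : Fl ℓ (k + ℓ) n} (hF : F ∈ univAmpGe k ℓ m n) :
    ∃ V W, F.IsRep V W ∧ ∀ j, rightPairing V W j ≠ 0 := by
  obtain ⟨f, hf, hF⟩ := (mem_univAmpGe_iff hn).1 hF
  obtain ⟨V, W, hV, hW, h⟩ := mem_univAmpCell_iff.1 hF
  exact ⟨_, _, h, fun j => (rightPairing_pos hn hm hkl hf hV hW j).ne'⟩

theorem continuous_of_twistRel
    {φ : univAmpGe k ℓ m n → univAmpGe ℓ k m n} (hφ : ∀ F, TwistRel F.1 (φ F).1) :
    Continuous φ := by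
  refine continuous_iff_continuousAt.2 fun x => ?_
  obtain ⟨V, W, hrep, hmem, -⟩ := hφ x
  obtain ⟨V', W', rfl, rfl, hV, hW, hev⟩ := Fl.exists_lift continuous_subtype_val.continuousAt hrep
  obtain ⟨h1, h2⟩ := continuousAt_stackedTwist hV hW hmem
  refine Topology.IsInducing.subtypeVal.continuousAt_iff.2 (Fl.continuousAt_of_lift h2 h1 ?_)
  filter_upwards [hev] with y hy using (hφ y).isRep_right hy

/-- Near `x` the map is represented by `untwist` of a continuous lift. The lift need not consist of
representatives from cells, so nonvanishing of its right pairings is obtained from their continuity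
and their values at `x`. -/
theorem continuous_of_twistRel_inv (hn : k + ℓ + m = n) (hm : Even m)
    {ψ : univAmpGe k ℓ m n → univAmpGe ℓ k m n} (hψ : ∀ G, TwistRel (ψ G).1 G.1) :
    Continuous ψ := by
  refine continuous_iff_continuousAt.2 fun x => ?_
  rcases Nat.eq_zero_or_pos (k + ℓ) with h0 | hkl
  · have h : ψ = fun _ => ψ x := funext fun y =>
      Subtype.ext (Fl.subsingleton_of_eq_zero (by omega) (by omega) _ _)
    rw [h]
    exact continuousAt_const
  obtain ⟨V, W, hrep, hne⟩ := exists_rep_of_mem_univAmpGe hn hm hkl x.2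
  obtain ⟨V', W', rfl, rfl, hV, hW, hev⟩ := Fl.exists_lift continuous_subtype_val.continuousAt hrep
  have hmem := hrep.mem_matCirc_of_univAmpGe hn hm x.2
  obtain ⟨h1, h2⟩ := continuousAt_untwist hV hW hmem fun p => hne _
  refine Topology.IsInducing.subtypeVal.continuousAt_iff.2 (Fl.continuousAt_of_lift h1 h2 ?_)
  have hev' : ∀ᶠ y in 𝓝 x, ∀ p : Fin n, rightPairing (V' y) (W' y) (p : ℕ) ≠ 0 :=
    eventually_all.2 fun p => (continuousAt_rightPairing hV hW hmem _).eventually_ne (hne _)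
  filter_upwards [hev, hev'] with y hy hy'
  obtain ⟨hmem', hst⟩ := untwist_spec hn hm (hy.mem_matCirc_of_univAmpGe hn hm y.2) hy'
  refine (hψ y).isRep_left (m := m) (by omega) hm hmem' ?_
  rw [hst]
  exact hy.neg

/-- The homeomorphism between universal amplituhedra that is induced by the stacked twist. -/
theorem exists_twist_homeomorph (hn : k + ℓ + m = n) (hm : Even m) :
    ∃ Θ : univAmpGe k ℓ m n ≃ₜ univAmpGe ℓ k m n, ∀ F, TwistRel F.1 (Θ F).1 := by
  have hn' : ℓ + k + m = n := by omega
  have hex (F : univAmpGe k ℓ m n) : ∃ G : univAmpGe ℓ k m n, TwistRel F.1 G.1 := by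
    obtain ⟨f, hf, hF⟩ := (mem_univAmpGe_iff hn).1 F.2
    obtain ⟨G, hG, h⟩ := exists_twistRel_right hn hm hf hF
    exact ⟨⟨G, univAmpCell_subset hn' (inv_mem_affPerm hf) hG⟩, h⟩
  have hex' (G : univAmpGe ℓ k m n) : ∃ F : univAmpGe k ℓ m n, TwistRel F.1 G.1 := by
    obtain ⟨f, hf, hG⟩ := (mem_univAmpGe_iff hn').1 G.2
    obtain ⟨F, hF, h⟩ := exists_twistRel hn' hm hf hG
    exact ⟨⟨F, univAmpCell_subset hn (inv_mem_affPerm hf) hF⟩, h⟩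
  choose φ hφ using hex
  choose ψ hψ using hex'
  exact ⟨{ toFun := φ
           invFun := ψ
           left_inv := fun F => Subtype.ext ((hψ (φ F)).left_unique hn hm (hφ F))
           right_inv := fun G => Subtype.ext ((hφ (ψ G)).right_unique (hψ G))
           continuous_toFun := continuous_of_twistRel hφ
           continuous_invFun := continuous_of_twistRel_inv hn' hm hψ }, hφ⟩

omit [NeZero n] in
theorem mem_grGe_iff (hn : k + ℓ + m = n) {X : Gr k n} :
    X ∈ grGe m k n ↔ ∃ f ∈ affPerm n k ℓ, X ∈ posCell k n f := by
  have h : (n : ℤ) - k - m = ℓ := by omega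
  simp only [grGe, h, Set.mem_iUnion, exists_prop]

theorem exists_flag (hn : k + ℓ + m = n) (hm : Even m) {X : Gr k n} {Y : Gr ℓ n}
    (hX : X ∈ grGe m k n) (hY : Y ∈ grPosPerp (k + m) ℓ n) :
    ∃ F ∈ univAmpGe k ℓ m n, F.small = Y ∧ F.large.1 = X.1 ⊔ Y.1 := by
  obtain ⟨f, hf, hX⟩ := (mem_grGe_iff hn).1 hX
  obtain ⟨V, rfl⟩ := X.exists_rep
  obtain ⟨W, rfl⟩ := Y.exists_rep
  obtain ⟨hmem, -⟩ := stackedTwist_mem hn hm hf V W hX hY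
  obtain ⟨F, hF⟩ := Fl.IsRep.exists_of_linearIndependent
    (linearIndependent_of_mem_matCirc hmem) W.2
  exact ⟨F, univAmpCell_subset hn hf (mem_univAmpCell_iff.2 ⟨V, W, hX, hY, hF⟩),
    Subtype.ext hF.1.symm, hF.2.symm.trans (rowSpan_stackMat _ _)⟩

theorem exists_stackedTwist_map (hn : k + ℓ + m = n) (hm : Even m) {X : Gr k n} {Y : Gr ℓ n}
    (hX : X ∈ grGe m k n) (hY : Y ∈ grPosPerp (k + m) ℓ n) :
    ∃ q : ↥(grPosPerp (ℓ + m) k n) × ↥(grGe m ℓ n), ∀ (V : FullRankMat k n) (W : FullRankMat ℓ n),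
      V.toGr = X → W.toGr = Y → stackMat V.1 W.1 ∈ matCirc k ℓ n ∧
        rowSpan (stackedTwist V.1 W.1).1 = q.1.1.1 ∧ rowSpan (stackedTwist V.1 W.1).2 = q.2.1.1 := by
  obtain ⟨f, hf, hX⟩ := (mem_grGe_iff hn).1 hX
  obtain ⟨V, rfl⟩ := X.exists_rep
  obtain ⟨W, rfl⟩ := Y.exists_rep
  obtain ⟨hmem, ⟨h1, hX'⟩, h2, hY'⟩ := stackedTwist_mem hn hm hf V W hX hY
  refine ⟨⟨⟨_, hX'⟩, ⟨_, (mem_grGe_iff (show ℓ + k + m = n by omega)).2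
    ⟨_, inv_mem_affPerm hf, hY'⟩⟩⟩, fun V' W' hV hW => ?_⟩
  obtain ⟨g, hg, hgV⟩ := FullRankMat.exists_mul_of_toGr_eq hV
  obtain ⟨g', hg', hgW⟩ := FullRankMat.exists_mul_of_toGr_eq hW
  obtain ⟨hmem', e1, e2⟩ := stackedTwist_block (c := 0) hmem hg hg'
  simp only [Matrix.zero_mul, add_zero, Matrix.transpose_zero, zero_add, ← hgV, ← hgW]
    at hmem' e1 e2
  refine ⟨hmem', ?_, ?_⟩
  · change _ = rowSpan (stackedTwist V.1 W.1).1
    rw [e1, rowSpan_mul (by rwa [Matrix.det_transpose])]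
  · change _ = rowSpan (stackedTwist V.1 W.1).2
    rw [e2, rowSpan_mul (by rwa [Matrix.det_transpose])]

/-- Partners inside the corresponding cells exist in both directions, and partners are unique. -/
theorem TwistRel.mem_univAmpCell_iff (hn : k + ℓ + m = n) (hm : Even m) (hf : f ∈ affPerm n k ℓ)
    {F : Fl ℓ (k + ℓ) n} {G : Fl k (ℓ + k) n} (h : TwistRel F G) :
    F ∈ univAmpCell k ℓ m n f ↔ G ∈ univAmpCell ℓ k m n f⁻¹ := by
  constructor
  · intro hF
    obtain ⟨G', hG', h'⟩ := exists_twistRel_right hn hm hf hF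
    rwa [h.right_unique h']
  · intro hG
    obtain ⟨F', hF', h'⟩ := exists_twistRel (by omega) hm (inv_mem_affPerm hf) hG
    rw [inv_inv] at hF'
    rwa [h.left_unique hn hm h']

end Homeo

theorem mainTheorem6 (k ℓ m n : ℕ) [NeZero n] (hn : 2 ≤ n) (hm : Even m) (hsum : k + ℓ + m = n) :
    ∃ (θ : ↥(grGe m k n) × ↥(grPosPerp (k + m) ℓ n) →
          ↥(grPosPerp (ℓ + m) k n) × ↥(grGe m ℓ n))
      (𝒵 : ↥(grGe m k n) × ↥(grPosPerp (k + m) ℓ n) → ↥(univAmpGe k ℓ m n))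
      (𝒵op : ↥(grPosPerp (ℓ + m) k n) × ↥(grGe m ℓ n) → ↥(univAmpGe ℓ k m n))
      (θt : ↥(univAmpGe k ℓ m n) ≃ₜ ↥(univAmpGe ℓ k m n)),
      -- `θ` is the stacked twist map, computed on arbitrary matrix representatives
      (∀ (p : ↥(grGe m k n) × ↥(grPosPerp (k + m) ℓ n)) (V : FullRankMat k n)
          (W : FullRankMat ℓ n), V.toGr = p.1.1 → W.toGr = p.2.1 →
          stackMat V.1 W.1 ∈ matCirc k ℓ n ∧
          rowSpan (stackedTwist V.1 W.1).1 = (θ p).1.1.1 ∧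
          rowSpan (stackedTwist V.1 W.1).2 = (θ p).2.1.1) ∧
      -- `𝒵 (V, W) = (W, span (V, W))` and `𝒵op (W', V') = (W', span (W', V'))`
      (∀ p, (𝒵 p).1.small = p.2.1 ∧ (𝒵 p).1.large.1 = p.1.1.1 ⊔ p.2.1.1) ∧
      (∀ q, (𝒵op q).1.small = q.1.1 ∧ (𝒵op q).1.large.1 = q.1.1.1 ⊔ q.2.1.1) ∧
      -- the square commutes
      (∀ p, θt (𝒵 p) = 𝒵op (θ p)) ∧
      -- restriction to the images of the positroid cells
      ∀ f ∈ affPerm n k ℓ,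
        univAmpCell k ℓ m n f ⊆ univAmpGe k ℓ m n ∧
        univAmpCell ℓ k m n f⁻¹ ⊆ univAmpGe ℓ k m n ∧
        ∃ g : ↥(univAmpCell k ℓ m n f) ≃ₜ ↥(univAmpCell ℓ k m n f⁻¹),
          ∀ (x : ↥(univAmpGe k ℓ m n)) (hx : x.1 ∈ univAmpCell k ℓ m n f),
            (g ⟨x.1, hx⟩).1 = (θt x).1 := by
  have hsum' : ℓ + k + m = n := by omega
  choose θ hθ using fun p : ↥(grGe m k n) × ↥(grPosPerp (k + m) ℓ n) =>
    exists_stackedTwist_map hsum hm p.1.2 p.2.2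
  choose 𝒵 h𝒵 h𝒵s h𝒵l using fun p : ↥(grGe m k n) × ↥(grPosPerp (k + m) ℓ n) =>
    exists_flag hsum hm p.1.2 p.2.2
  choose 𝒵op h𝒵op h𝒵ops h𝒵opl using fun q : ↥(grPosPerp (ℓ + m) k n) × ↥(grGe m ℓ n) =>
    exists_flag hsum' hm q.2.2 q.1.2
  obtain ⟨Θ, hΘ⟩ := exists_twist_homeomorph hsum hm
  refine ⟨θ, fun p => ⟨𝒵 p, h𝒵 p⟩, fun q => ⟨𝒵op q, h𝒵op q⟩, Θ, hθ,
    fun p => ⟨h𝒵s p, h𝒵l p⟩, fun q => ⟨h𝒵ops q, by rw [sup_comm]; exact h𝒵opl q⟩,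
    fun p => ?_, fun f hf => ?_⟩
  -- Both sides of the square are represented by the twist of the same pair `(V, W)`, with its
  -- blocks in the order of the target flag.
  · obtain ⟨V, hV⟩ := p.1.1.exists_rep
    obtain ⟨W, hW⟩ := p.2.1.exists_rep
    obtain ⟨-, h1, h2⟩ := hθ p V W hV hW
    have hVs : rowSpan V.1 = p.1.1.1 := congrArg Subtype.val hV
    have hWs : rowSpan W.1 = p.2.1.1 := congrArg Subtype.val hW
    have hrep : (𝒵 p).IsRep V.1 W.1 :=
      ⟨by rw [h𝒵s, hWs], by rw [h𝒵l, rowSpan_stackMat, hVs, hWs]⟩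
    have hrep' : (𝒵op (θ p)).IsRep (stackedTwist V.1 W.1).2 (stackedTwist V.1 W.1).1 :=
      ⟨by rw [h𝒵ops, h1], by rw [h𝒵opl, rowSpan_stackMat, h1, h2]⟩
    exact Subtype.ext (((hΘ ⟨𝒵 p, h𝒵 p⟩).isRep_right hrep).eq hrep')
  · have hsub := univAmpCell_subset hsum hf
    have hsub' := univAmpCell_subset hsum' (inv_mem_affPerm hf)
    have hmem (x : ↥(univAmpGe k ℓ m n)) := (hΘ x).mem_univAmpCell_iff hsum hm hf
    refine ⟨hsub, hsub', ⟨⟨fun x => ⟨(Θ ⟨x.1, hsub x.2⟩).1, (hmem _).1 x.2⟩,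
      fun y => ⟨(Θ.symm ⟨y.1, hsub' y.2⟩).1, (hmem _).2 (by
        rw [Homeomorph.apply_symm_apply]; exact y.2)⟩, fun x => ?_, fun y => ?_⟩, ?_, ?_⟩,
      fun x hx => rfl⟩
    · have h := congrArg Subtype.val (Θ.symm_apply_apply ⟨x.1, hsub x.2⟩)
      exact Subtype.ext h
    · have h := congrArg Subtype.val (Θ.apply_symm_apply ⟨y.1, hsub' y.2⟩)
      exact Subtype.ext h
    · exact (continuous_subtype_val.comp (Θ.continuous.comp
        (continuous_subtype_val.subtype_mk _))).subtype_mk _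
    · exact (continuous_subtype_val.comp (Θ.symm.continuous.comp
        (continuous_subtype_val.subtype_mk _))).subtype_mk _
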